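/- Let $d\ge 1$ be an integer and $s>d$ real. Let $\Omega\subset\mathbb{R}^d$ be closed, of positive Lebesgue measure, with $C^1$ boundary, and let $V:\Omega\to[0,\infty)$ be continuous; if $\Omega$ is unbounded, assume moreover that $V(x)\to+\infty$ as $|x|\to\infty$ and that $\int_\Omega e^{-MV(x)}\,dx<\infty$ for some $M>0$. For $\vec X_N=(x_1,\dots,x_N)\in\Omega^N$ put $$\mathcal H_N(\vec X_N)=\sum_{i\neq j}\frac1{|x_i-x_j|^{s}}+N^{s/d}\sum_{i=1}^N V(x_i).$$ **Notation.** $K_R$ is the cube of centre $0$ and sidelength $R$. $\mathrm{Config}$ is the space of locally finite point configurations in $\mathbb{R}^d$ (points counted with multiplicity), with the vague topology; $\theta_x$ is translation by $-x$. For $\mathcal C\in\mathrm{Config}$ let $$\mathrm{Int}_R(\mathcal C)=\sum_{p\ne q\in\mathcal C\cap K_R}|p-q|^{-s},\qquad \mathrm{Dens}(\mathcal C)=\liminf_{R\to\infty}\frac{|\mathcal C\cap K_R|}{R^d},\qquad \mathcal W_s(\mathcal C)=\liminf_{R\to\infty}\frac{\mathrm{Int}_R(\mathcal C)}{R^d},$$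 where two points at the same site are distinct points, so that $\mathrm{Int}_R(\mathcal C)=+\infty$ if $\mathcal C$ has a multiple point in $K_R$. $\mathrm{Config}_m$ is the set of configurations with $\mathrm{Dens}=m$. For a probability measure $P$ on $\mathrm{Config}$ let $\mathrm{Intens}(P)=\mathbf E_P[\mathrm{Dens}]$ and $\mathbb W_s(P)=\liminf_{R\to\infty}R^{-d}\,\mathbf E_P[\mathrm{Int}_R]$. A tagged process is a measure $\bar P$ on $\Omega\times\mathrm{Config}$ of the form $\bar P(dx,d\mathcal C)=dx\,\bar P^x(d\mathcal C)$ with $\bar P^x$ probability measures; it is stationary if $\bar P^x$ is translation invariant for a.e. $x\in\Omega$. Its intensity measure is $\mathrm{Intens}(\bar P^x)\,dx$ on $\Omega$, and $$\overline{\mathbb W}_s(\bar P)=\int_\Omega\mathbb W_s(\bar P^x)\,dx,\qquad \overline{\mathbb V}(\bar P)=\int_\Omega V(x)\,\mathrm{Intens}(\bar P^x)\,dx.$$ $\overline{\mathcal M}_{stat,1}$ is the set of stationary tagged processes with $\int_\Omega\mathrm{Intens}(\bar P^x)\,dx=1$. The tagged empirical process of $\vec X_N$ is $\overline{\mathrm{Emp}}_N(\vec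 X_N)=\int_\Omega\delta_{(x,\ \theta_{N^{1/d}x}\cdot\sum_i\delta_{N^{1/d}x_i})}\,dx$. Weak convergence of such measures is tested against bounded continuous functions on $\Omega\times\mathrm{Config}$ that vanish for $x$ outside a bounded set. Finally $C_{s,d}=\lim_{N\to\infty}N^{-1-s/d}\inf_{x\in K_1^N}\sum_{i\ne j}|x_i-x_j|^{-s}$. **Statement.** For every $N\ge1$ let $\vec X_N$ be a minimizer of $\mathcal H_N$ over $\Omega^N$. The functional $$\rho\mapsto C_{s,d}\int_\Omega\rho^{1+s/d}\,dx+\int_\Omega V\rho\,dx$$ has a unique minimizer $\mu_{V,\infty}$ (up to a.e. equality) among probability densities on $\Omega$, and there is a tagged process $\bar P\in\overline{\mathcal M}_{stat,1}$ such that: 1. along a subsequence, $\overline{\mathrm{Emp}}_N(\vec X_N)$ converges weakly to $\bar P$, and $\bar P$ minimizes $\overline{\mathbb W}_s+\overline{\mathbb V}$ over $\overline{\mathcal M}_{stat,1}$; 2. the intensity measure of $\bar P$ is $\mu_{V,\infty}(x)\,dx$; 3. for $\bar P$-almost every $(x,\mathcal C)$, $\mathcal C\in\mathrm{Config}_{\mu_{V,\infty}(x)}$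 and $\mathcal W_s(\mathcal C)\le\mathcal W_s(\mathcal C')$ for all $\mathcal C'\in\mathrm{Config}_{\mu_{V,\infty}(x)}$. -/

import Mathlib

open Set Filter Topology MeasureTheory ProbabilityTheory
open scoped ENNReal NNReal BoundedContinuousFunction

noncomputable section

namespace HyperRiesz

/-- Euclidean space of dimension `d`. -/
abbrev E (d : ℕ) : Type := EuclideanSpace ℝ (Fin d)

/-- Lebesgue measure on a subset `Ω` of `ℝᵈ`. -/
def leb {d : ℕ} (Ω : Set (E d)) : Measure Ω := (volume : Measure (E d)).comap Subtype.val

/-- The closed hypercube of centre `0` and sidelength `R`. -/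
def cube (d : ℕ) (R : ℝ) : Set (E d) := {x | ∀ i, |x i| ≤ R / 2}

/-- The Riesz kernel `|x - y|⁻ˢ`, equal to `+∞` when `x = y` (for `s > 0`). -/
def rieszKernel {d : ℕ} (s : ℝ) (x y : E d) : ℝ≥0∞ := edist x y ^ (-s)

/-! ### Point configurations -/

/-- A locally finite point configuration in `ℝᵈ`, given by the number of points (with
multiplicity) that it has at each site. -/
@[ext]
structure Config (d : ℕ) where
  mult : E d → ℕ
  locallyFinite : ∀ R : ℝ, (Metric.closedBall (0 : E d) R ∩ Function.support mult).Finite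

namespace Config

variable {d : ℕ}

/-- The Radon measure `∑_{p ∈ C} δ_p` attached to a configuration. -/
def toMeasure (C : Config d) : Measure (E d) :=
  Measure.sum fun p : E d => (C.mult p : ℝ≥0∞) • Measure.dirac p

/-- The vague topology: the coarsest one for which `C ↦ ∫ f dC` is continuous for every
continuous compactly supported `f`. -/
instance : TopologicalSpace (Config d) :=
  ⨅ f : {f : E d → ℝ // Continuous f ∧ HasCompactSupport f},
    TopologicalSpace.induced (fun C : Config d => ∫ p, f.1 p ∂C.toMeasure) inferInstance

/-- The Borel σ-algebra of the vague topology. -/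
instance : MeasurableSpace (Config d) := borel (Config d)

instance : BorelSpace (Config d) := ⟨rfl⟩

/-- The configuration `θ_x · C = ∑_{p ∈ C} δ_{p - x}`, that is, `C` translated by `-x`. -/
def translate (x : E d) (C : Config d) : Config d where
  mult q := C.mult (q + x)
  locallyFinite R := by
    refine ((C.locallyFinite (R + ‖x‖)).preimage
      (add_left_injective x).injOn).subset ?_
    rintro q ⟨hq, hm⟩
    refine ⟨?_, hm⟩
    rw [mem_closedBall_zero_iff] at hq ⊢
    exact (norm_add_le q x).trans (by linarith)

open Classical in
/-- The finite configuration `∑_i δ_{y i}` of an `N`-tuple of points. -/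
def ofTuple {N : ℕ} (y : Fin N → E d) : Config d where
  mult q := (Finset.univ.filter fun i => y i = q).card
  locallyFinite R := by
    refine (Set.finite_range y).subset ?_
    rintro q ⟨-, hq⟩
    obtain ⟨i, hi⟩ := Finset.card_pos.1 (Nat.pos_of_ne_zero hq)
    exact ⟨i, (Finset.mem_filter.1 hi).2⟩

/-- The density `liminf_{R → ∞} |C ∩ K_R| / Rᵈ`, points being counted with multiplicity. -/
def dens (C : Config d) : ℝ≥0∞ :=
  liminf (fun R : ℝ => C.toMeasure (cube d R) / ENNReal.ofReal (R ^ d)) atTop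

open Classical in
/-- The number of ordered pairs of distinct points of `C`, the first at the site `p`, the second
at the site `q`; two points sitting at the same site are distinct points. -/
def pairs (C : Config d) (p q : E d) : ℕ :=
  if p = q then C.mult p * (C.mult p - 1) else C.mult p * C.mult q

/-- The Riesz interaction `Int[A, A](C)` of the points of `C` that lie in `A`: the sum of
`|p - q|⁻ˢ` over ordered pairs of distinct points. A multiple point in `A` makes it infinite. -/
def interaction (s : ℝ) (A : Set (E d)) (C : Config d) : ℝ≥0∞ :=
  ∑' p : A, ∑' q : A, (C.pairs p q : ℝ≥0∞) * rieszKernel s (p : E d) q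

/-- The Riesz energy `𝒲_s(C) = liminf_{R → ∞} R⁻ᵈ Int[K_R, K_R](C)`. -/
def energy (s : ℝ) (C : Config d) : ℝ≥0∞ :=
  liminf (fun R : ℝ => C.interaction s (cube d R) / ENNReal.ofReal (R ^ d)) atTop

end Config

/-! ### Random point configurations -/

/-- A law on configurations is stationary if it is invariant under all translations. -/
def IsStationary {d : ℕ} (P : Measure (Config d)) : Prop :=
  ∀ x : E d, P.map (Config.translate x) = P

/-- The intensity `E_P[Dens]`. -/
def intensity {d : ℕ} (P : Measure (Config d)) : ℝ≥0∞ := ∫⁻ C, C.dens ∂P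

/-- The Riesz energy `𝕎_s(P) = liminf_{R → ∞} R⁻ᵈ E_P[Int[K_R, K_R]]`. -/
def processEnergy {d : ℕ} (s : ℝ) (P : Measure (Config d)) : ℝ≥0∞ :=
  liminf (fun R : ℝ =>
    (∫⁻ C, C.interaction s (cube d R) ∂P) / ENNReal.ofReal (R ^ d)) atTop

/-! ### Random tagged point configurations -/

/-- A random tagged point configuration with tags in `Ω`, given by its disintegration
`x ↦ P̄ˣ` with respect to Lebesgue measure on `Ω`: a measurable family of probability measures on
configurations. -/
structure TaggedProcess {d : ℕ} (Ω : Set (E d)) where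
  fiber : Kernel Ω (Config d)
  isMarkov : IsMarkovKernel fiber

namespace TaggedProcess

variable {d : ℕ} {Ω : Set (E d)}

/-- The measure `P̄(dx, dC) = dx P̄ˣ(dC)` on `Ω × Config`. -/
def toMeasure (P : TaggedProcess Ω) : Measure (Ω × Config d) :=
  leb Ω ⊗ₘ P.fiber

/-- Stationarity: almost every fibre is stationary. -/
def Stationary (P : TaggedProcess Ω) : Prop :=
  ∀ᵐ x ∂leb Ω, IsStationary (P.fiber x)

/-- The intensity measure, with density `x ↦ Intens(P̄ˣ)` on `Ω`. -/
def intensityMeasure (P : TaggedProcess Ω) : Measure Ω :=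
  (leb Ω).withDensity fun x => intensity (P.fiber x)

/-- The class of stationary tagged processes whose intensity integrates to `1`. -/
def StationaryUnit (P : TaggedProcess Ω) : Prop :=
  P.Stationary ∧ ∫⁻ x, intensity (P.fiber x) ∂leb Ω = 1

/-- `W̄_s(P̄) = ∫_Ω 𝕎_s(P̄ˣ) dx`. -/
def energy (s : ℝ) (P : TaggedProcess Ω) : ℝ≥0∞ :=
  ∫⁻ x, processEnergy s (P.fiber x) ∂leb Ω

/-- `V̄(P̄)`, the integral of `V` against the intensity measure. -/
def potentialEnergy (V : Ω → ℝ) (P : TaggedProcess Ω) : ℝ≥0∞ :=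
  ∫⁻ x, ENNReal.ofReal (V x) ∂P.intensityMeasure

end TaggedProcess

/-! ### Finite systems -/

/-- The Riesz energy `∑_{i ≠ j} |x_i - x_j|⁻ˢ` of an `N`-tuple. -/
def rieszEnergy {d N : ℕ} (s : ℝ) (x : Fin N → E d) : ℝ≥0∞ :=
  ∑ i, ∑ j ∈ Finset.univ.erase i, rieszKernel s (x i) (x j)

/-- The minimal Riesz energy of `N` points in `A`. -/
def minRieszEnergy {d : ℕ} (s : ℝ) (A : Set (E d)) (N : ℕ) : ℝ≥0∞ :=
  ⨅ x : Fin N → A, rieszEnergy s fun i => (x i : E d)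

/-- The constant `C_{s,d}`, the limit of `E_s(K_1, N) / N^{1 + s/d}` as `N → ∞`. It is known that
the limit exists; it is written here as a `liminf`. -/
def rieszConstant (s : ℝ) (d : ℕ) : ℝ≥0∞ :=
  liminf (fun N : ℕ => minRieszEnergy s (cube d 1) N / (N : ℝ≥0∞) ^ (1 + s / d)) atTop

/-- `H_N(x) = ∑_{i ≠ j} |x_i - x_j|⁻ˢ + N^{s/d} ∑_i V(x_i)` for `x ∈ Ω^N`. -/
def hamiltonian {d N : ℕ} {Ω : Set (E d)} (s : ℝ) (V : Ω → ℝ) (x : Fin N → Ω) : ℝ≥0∞ :=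
  rieszEnergy s (fun i => (x i : E d)) +
    ENNReal.ofReal ((N : ℝ) ^ (s / d) * ∑ i, V (x i))

/-- The tagged empirical process `∫_Ω δ_{(x, θ_{N^{1/d} x} · X_N')} dx`, where
`X_N' = ∑_i δ_{N^{1/d} x_i}`. -/
def taggedEmpirical {d N : ℕ} {Ω : Set (E d)} (X : Fin N → Ω) : Measure (Ω × Config d) :=
  (leb Ω).map fun x : Ω =>
    (x, Config.translate (((N : ℝ) ^ (1 / d : ℝ)) • (x : E d))
      (Config.ofTuple fun i => ((N : ℝ) ^ (1 / d : ℝ)) • (X i : E d)))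

/-- Weak convergence of measures on `Ω × Config` whose first marginal is Lebesgue measure on `Ω`
(hence of possibly infinite mass): convergence against bounded continuous functions of `(x, C)`
that vanish for `x` outside a bounded set. -/
def TendstoWeakly {d : ℕ} {Ω : Set (E d)} (μ : ℕ → Measure (Ω × Config d))
    (ν : Measure (Ω × Config d)) : Prop :=
  ∀ F : (Ω × Config d) →ᵇ ℝ,
    (∃ R : ℝ, ∀ (x : Ω) (C : Config d), R < ‖(x : E d)‖ → F (x, C) = 0) →
    Tendsto (fun n => ∫ z, F z ∂μ n) atTop (𝓝 (∫ z, F z ∂ν))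

/-! ### The macroscopic problem and the standing assumptions -/

/-- `ρ` is a probability density on `Ω`. -/
def IsProbDensity {d : ℕ} {Ω : Set (E d)} (ρ : Ω → ℝ≥0∞) : Prop :=
  Measurable ρ ∧ ∫⁻ x, ρ x ∂leb Ω = 1

/-- `C_{s,d} ∫_Ω ρ^{1 + s/d} + ∫_Ω V ρ`. -/
def macroEnergy {d : ℕ} {Ω : Set (E d)} (s : ℝ) (V : Ω → ℝ) (ρ : Ω → ℝ≥0∞) : ℝ≥0∞ :=
  rieszConstant s d * (∫⁻ x, ρ x ^ (1 + s / d) ∂leb Ω) +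
    ∫⁻ x, ENNReal.ofReal (V x) * ρ x ∂leb Ω

/-- `ρ` minimizes the macroscopic energy among probability densities on `Ω`. -/
def IsMacroMinimizer {d : ℕ} {Ω : Set (E d)} (s : ℝ) (V : Ω → ℝ) (ρ : Ω → ℝ≥0∞) : Prop :=
  IsProbDensity ρ ∧ ∀ ρ' : Ω → ℝ≥0∞, IsProbDensity ρ' → macroEnergy s V ρ ≤ macroEnergy s V ρ'

/-- The boundary of `Ω` is a `C¹` hypersurface: near each of its points it is the zero set of a
`C¹` function whose differential does not vanish at that point. -/
def HasC1Boundary {d : ℕ} (Ω : Set (E d)) : Prop :=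
  ∀ p ∈ frontier Ω, ∃ U ∈ 𝓝 p, ∃ φ : E d → ℝ,
    ContDiff ℝ 1 φ ∧ fderiv ℝ φ p ≠ 0 ∧ frontier Ω ∩ U = {x | φ x = 0} ∩ U

/-- The confinement assumption on `V`, made only when `Ω` is unbounded: `V(x) → +∞` as
`|x| → ∞` in `Ω`, and `∫_Ω exp(-M V) < ∞` for some `M > 0`. -/
def Confining {d : ℕ} {Ω : Set (E d)} (V : Ω → ℝ) : Prop :=
  ¬ Bornology.IsBounded Ω →
    Tendsto V (comap (fun x : Ω => ‖(x : E d)‖) atTop) atTop ∧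
    ∃ M : ℝ, 0 < M ∧ ∫⁻ x, ENNReal.ofReal (Real.exp (-M * V x)) ∂leb Ω < ⊤

end HyperRiesz

end

open HyperRiesz

/-!
# Minimizers of hypersingular Riesz energies under a microscope

Write `p = 1 + s / d` and `C = C_{s,d}`. Since `s > d`, the interaction is short ranged: two groups
of `N` points at macroscopic distance interact by `N ^ 2`, which is negligible with respect to the
total energy, of the order `N ^ p`. Energies are therefore local, and both the macroscopic and the
microscopic problems reduce to the convex function `t ↦ C t ^ p`.

**Upper bound.** Subdividing cubes shows that the minimal energies of `n` points in the unit cube,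
divided by `n ^ p`, converge to a constant `C ∈ (0, ∞)` (`eventually_minRieszEnergy_le`,
`rieszConstant_pos`, `rieszConstant_lt_top`). Filling the cells of a fine grid with near minimizers
gives systems with energy per particle close to `C ∫ ρ ^ p + ∫ V ρ` for every density `ρ` of bounded
support (`eventually_exists_hamiltonian_le`). The minimizer of this macroscopic functional is
explicit, and unique by strict convexity (`exists_macroMinimizer`).

**Compactness.** Configurations are encoded by sequences of points of a compactification of `ℝᵈ`
(`Enum`), the sites at infinity standing for absent points. The blown-up systems seen from `x ∈ Ω`,
their points being listed by increasing norm, become maps from `Ω` to the compact metrizable space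
`Enum d`. A subsequence has a Young measure `κ` as a limit (`exists_youngMeasure`): integrals of lower
semicontinuous functions of `x` and of the enumeration are lower semicontinuous. The map
`Enum.toConfig` back to configurations is continuous on the sets `Enum.Tame T`, where only the first
`T k` points may lie in the ball of radius `k`. When points are listed by norm, a point of large
index in a small ball interacts with many others there, so that bounded energy per particle makes
the enumerations tame up to small probabilities (`exists_tame`). Hence the image of `κ` is the weak
limit of the tagged empirical processes (`IsYoungLimit.tendstoWeakly`).

**The limit.** It is stationary, because a microscopic translation is a vanishing displacement of
the tag and the boundary of `Ω` is Lebesgue negligible (`HasC1Boundary.volume_frontier`,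
`TendstoWeakly.ae_isStationary`). Its intensity `m` is a probability density: no mass accumulates at
a point, leaves `Ω` or escapes to infinity (`le_lintegral_meanCount`,
`IsYoungLimit.exists_intensity`). Its energy and its potential energy are at most the lower limits of
the energy and of the potential per particle (`lintegral_processEnergy_le`,
`lintegral_mul_meanCount_le`).

**Lower bound and conclusion.** The points of a configuration in a cube have at least the minimal
energy, so that the energy of a configuration of density `m` is at least `C m ^ p`
(`Config.mul_dens_rpow_le_energy`), and the same holds in the mean for a random configuration
(`mul_intensity_rpow_le_processEnergy`). Therefore the energy of a tagged process is at least the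
macroscopic energy of its intensity, and together with the upper bound all inequalities are
equalities: `m` is the macroscopic minimizer, the limit minimizes the energy among tagged processes,
and almost every fibre is a stationary law of minimal energy at its mean density. The strict
convexity of `t ↦ t ^ p` forces the density in large cubes to be almost constant under such a law; a
maximal inequality for stationary laws (`IsStationary.mul_maximalSet_le`), in place of an ergodic
theorem, transfers this to the asymptotic density of almost every configuration, which is then
itself of density `m` and of minimal energy (`IsStationary.ae_dens_eq_and_energy_eq`).

Measurability of the functionals of configurations is checked on enumerations, by means of the Lusin
separation theorem (`Config.measurable_of_comp_toConfig`).
-/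

noncomputable section

namespace HyperRiesz
variable {d : ℕ}

/-! ### The vague topology -/

namespace Config

lemma lintegral_toMeasure (C : Config d) (f : E d → ℝ≥0∞) :
    ∫⁻ p, f p ∂C.toMeasure = ∑' p, (C.mult p : ℝ≥0∞) * f p := by
  simp [toMeasure, lintegral_sum_measure, lintegral_smul_measure]

lemma toMeasure_singleton (C : Config d) (p : E d) : C.toMeasure {p} = C.mult p := by
  rw [← lintegral_indicator_one (measurableSet_singleton p), lintegral_toMeasure,
    tsum_eq_single p]
  · simp
  · intro q hq; simp [hq]

lemma toMeasure_closedBall_lt_top (C : Config d) (R : ℝ) :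
    C.toMeasure (Metric.closedBall 0 R) < ∞ := by
  rw [← lintegral_indicator_one Metric.isClosed_closedBall.measurableSet, lintegral_toMeasure,
    tsum_eq_sum (s := (C.locallyFinite R).toFinset)]
  · refine ENNReal.sum_lt_top.2 fun p _ => ENNReal.mul_lt_top (by simp) ?_
    exact (indicator_le_self' (by simp) p).trans_lt (by simp)
  · intro p hp
    simp only [Finite.mem_toFinset, mem_inter_iff, Function.mem_support, not_and_or, not_not] at hp
    rcases hp with hp | hp <;> simp [hp]

instance (C : Config d) : IsFiniteMeasureOnCompacts C.toMeasure where
  lt_top_of_isCompact K hK := by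
    obtain ⟨R, hR⟩ := hK.isBounded.subset_closedBall (0 : E d)
    exact (measure_mono hR).trans_lt (C.toMeasure_closedBall_lt_top R)

instance (C : Config d) : SigmaFinite C.toMeasure := inferInstance

lemma toMeasure_injective : Function.Injective (toMeasure : Config d → Measure (E d)) := by
  intro C C' h
  ext p
  have := congrArg (fun μ : Measure (E d) => μ {p}) h
  simpa [toMeasure_singleton] using this

lemma continuous_integral {f : E d → ℝ} (hf : Continuous f) (hc : HasCompactSupport f) :
    Continuous fun C : Config d => ∫ p, f p ∂C.toMeasure :=
  continuous_iff_le_induced.2 (iInf_le _ (⟨f, hf, hc⟩ : {f : E d → ℝ // Continuous f ∧ HasCompactSupport f}))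

/-- A continuous cutoff with values in `[0, 1]`: it equals `1` on the ball of radius `R` and vanishes
outside the ball of radius `R + 1`. -/
def bump (R : ℝ) (x : E d) : ℝ := max 0 (min 1 (R + 1 - ‖x‖))

lemma continuous_bump (R : ℝ) : Continuous (bump R : E d → ℝ) := by unfold bump; fun_prop

lemma bump_nonneg (R : ℝ) (x : E d) : 0 ≤ bump R x := le_max_left _ _

lemma bump_le_one (R : ℝ) (x : E d) : bump R x ≤ 1 := max_le zero_le_one (min_le_left _ _)

lemma bump_eq_one {R : ℝ} {x : E d} (h : ‖x‖ ≤ R) : bump R x = 1 := by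
  unfold bump; rw [min_eq_left (by linarith)]; simp

lemma bump_eq_zero {R : ℝ} {x : E d} (h : R + 1 ≤ ‖x‖) : bump R x = 0 := by
  unfold bump; exact max_eq_left ((min_le_right _ _).trans (by linarith))

lemma hasCompactSupport_bump (R : ℝ) : HasCompactSupport (bump R : E d → ℝ) := by
  refine HasCompactSupport.intro (isCompact_closedBall (0 : E d) (R + 1)) fun x hx => ?_
  exact bump_eq_zero (le_of_lt (by simpa using hx))

lemma abs_integral_sub_le (C : Config d) {f g : E d → ℝ} (hf : Continuous f)
    (hfc : HasCompactSupport f) (hg : Continuous g) (hgc : HasCompactSupport g) {R ε : ℝ}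
    (hε : ∀ x, ‖x‖ ≤ R → |f x - g x| ≤ ε) (hR : ∀ x, R < ‖x‖ → f x - g x = 0) (hε0 : 0 ≤ ε) :
    |∫ p, f p ∂C.toMeasure - ∫ p, g p ∂C.toMeasure| ≤ ε * ∫ p, bump R p ∂C.toMeasure := by
  rw [← integral_sub (hf.integrable_of_hasCompactSupport hfc)
    (hg.integrable_of_hasCompactSupport hgc), ← integral_const_mul]
  have hb : Integrable (bump R) C.toMeasure :=
    (continuous_bump R).integrable_of_hasCompactSupport (hasCompactSupport_bump R)
  rw [← Real.norm_eq_abs]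
  refine norm_integral_le_of_norm_le (hb.const_mul ε) (ae_of_all _ fun x => ?_)
  rcases le_or_gt ‖x‖ R with h | h
  · simpa [bump_eq_one h] using hε x h
  · rw [hR x h]; simpa using mul_nonneg hε0 (bump_nonneg R x)

/-- Uniform separability of the continuous functions supported in a given ball. -/
lemma exists_dense_seq_supported (R : ℝ) : ∃ D : ℕ → E d → ℝ,
    (∀ k, Continuous (D k) ∧ ∀ x, R < ‖x‖ → D k x = 0) ∧
    ∀ f : E d → ℝ, Continuous f → (∀ x, R < ‖x‖ → f x = 0) → ∀ η > 0,
      ∃ k, ∀ x, ‖x‖ ≤ R → |f x - D k x| ≤ η := by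
  let T : Set C(E d, ℝ) := {f | ∀ x, R < ‖x‖ → f x = 0}
  have hT : TopologicalSpace.SeparableSpace T := inferInstance
  have hne : Nonempty T := ⟨⟨0, fun _ _ => rfl⟩⟩
  refine ⟨fun k => (TopologicalSpace.denseSeq T k).1, fun k =>
    ⟨(TopologicalSpace.denseSeq T k).1.continuous, (TopologicalSpace.denseSeq T k).2⟩,
    fun f hf hfR η hη => ?_⟩
  let f' : T := ⟨⟨f, hf⟩, hfR⟩
  have hconv : ∀ᶠ g : T in 𝓝 f', ∀ x ∈ Metric.closedBall (0 : E d) R,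
      dist (f'.1 x) (g.1 x) < η := by
    have h1 : Tendsto (fun g : T => g.1) (𝓝 f') (𝓝 f'.1) := continuous_subtype_val.tendsto _
    rw [ContinuousMap.tendsto_iff_forall_isCompact_tendstoUniformlyOn] at h1
    exact (Metric.tendstoUniformlyOn_iff.1 (h1 _ (isCompact_closedBall (0 : E d) R))) η hη
  obtain ⟨k, hk⟩ := (TopologicalSpace.denseRange_denseSeq T).exists_mem_open
    isOpen_interior ⟨f', mem_interior_iff_mem_nhds.2 hconv⟩
  exact ⟨k, fun x hx => (interior_subset hk x (by simpa using hx)).le⟩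

/-- The vague topology is induced by countably many test functions: on each ball it suffices to
take a sequence that is dense for uniform convergence, together with a bump function, which bounds
the number of points locally uniformly in the configuration. -/
lemma exists_isInducing_integral : ∃ F : ℕ → E d → ℝ,
    (∀ k, Continuous (F k) ∧ HasCompactSupport (F k)) ∧
    IsInducing fun (C : Config d) k => ∫ p, F k p ∂C.toMeasure := by
  choose D hD hDd using fun n : ℕ => exists_dense_seq_supported (d := d) n
  have hcs : ∀ n k, HasCompactSupport (D n k) := fun n k =>
    HasCompactSupport.intro (isCompact_closedBall (0 : E d) n) fun x hx =>
      (hD n k).2 x (by simpa using hx)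
  let G : (ℕ × ℕ) ⊕ ℕ → E d → ℝ := Sum.elim (fun a => D a.1 a.2) (fun n => bump (n : ℝ))
  have hG : ∀ a, Continuous (G a) ∧ HasCompactSupport (G a) := by
    rintro (⟨n, k⟩ | n)
    · exact ⟨(hD n k).1, hcs n k⟩
    · exact ⟨continuous_bump _, hasCompactSupport_bump _⟩
  obtain ⟨e⟩ : Nonempty (ℕ ≃ (ℕ × ℕ) ⊕ ℕ) := ⟨(Denumerable.eqv _).symm⟩
  refine ⟨fun k => G (e k), fun k => hG _, ⟨le_antisymm ?_ ?_⟩⟩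
  · exact continuous_iff_le_induced.1
      (continuous_pi fun k => continuous_integral (hG _).1 (hG _).2)
  · refine le_iInf fun ⟨f, hf, hc⟩ => ?_
    let t : TopologicalSpace (Config d) := TopologicalSpace.induced
      (fun (C : Config d) k => ∫ p, G (e k) p ∂C.toMeasure) inferInstance
    change t ≤ _
    rw [← continuous_iff_le_induced]
    have hGc : ∀ a, Continuous fun C : Config d => ∫ p, G a p ∂C.toMeasure := fun a => by
      have : Continuous fun (C : Config d) k => ∫ p, G (e k) p ∂C.toMeasure :=
        continuous_induced_dom
      simpa [Function.comp_def] using (continuous_apply (e.symm a)).comp this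
    rw [continuous_iff_continuousAt]
    intro C₀
    obtain ⟨R, hR⟩ := hc.isBounded.subset_closedBall (0 : E d)
    obtain ⟨n, hn⟩ := exists_nat_ge R
    have hfn : ∀ x, (n : ℝ) < ‖x‖ → f x = 0 := fun x hx => by
      by_contra h0
      have := hR (subset_tsupport f h0)
      rw [mem_closedBall_zero_iff] at this
      linarith
    rw [ContinuousAt, Metric.tendsto_nhds]
    intro ε hε
    set M := ∫ p, bump (n : ℝ) p ∂C₀.toMeasure with hM
    have hM0 : 0 ≤ M := integral_nonneg fun x => bump_nonneg _ _
    set η := ε / (4 * (M + 1)) with hη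
    have hη0 : 0 < η := by positivity
    have hηM : η * (M + 1) = ε / 4 := by rw [hη]; field_simp
    obtain ⟨k, hk⟩ : ∃ k, ∀ x, ‖x‖ ≤ n → |f x - G (.inl (n, k)) x| ≤ η :=
      hDd n f hf hfn η hη0
    have hz : ∀ x, (n : ℝ) < ‖x‖ → f x - G (.inl (n, k)) x = 0 := fun x hx => by
      rw [hfn x hx]; simp [G, (hD n k).2 x hx]
    have e1 : ∀ᶠ C : Config d in 𝓝 C₀, ∫ p, bump (n : ℝ) p ∂C.toMeasure < M + 1 :=
      ((hGc (.inr n)).tendsto C₀).eventually (gt_mem_nhds (by simp [G, hM]))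
    have e2 : ∀ᶠ C : Config d in 𝓝 C₀, |∫ p, G (.inl (n, k)) p ∂C.toMeasure -
        ∫ p, G (.inl (n, k)) p ∂C₀.toMeasure| < ε / 4 :=
      (Metric.tendsto_nhds.1 ((hGc (.inl (n, k))).tendsto C₀)) (ε / 4) (by positivity)
    filter_upwards [e1, e2] with C h1 h2
    have a1 := C.abs_integral_sub_le hf hc (hG (.inl (n, k))).1 (hG (.inl (n, k))).2 hk hz hη0.le
    have a2 := C₀.abs_integral_sub_le hf hc (hG (.inl (n, k))).1 (hG (.inl (n, k))).2 hk hz hη0.le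
    have b1 : η * ∫ p, bump (n : ℝ) p ∂C.toMeasure ≤ ε / 4 := by rw [← hηM]; gcongr
    have b2 : η * ∫ p, bump (n : ℝ) p ∂C₀.toMeasure ≤ ε / 4 := by
      rw [← hηM, ← hM]; gcongr; linarith
    rw [Real.dist_eq]
    rw [abs_le] at a1 a2
    rw [abs_lt] at h2 ⊢
    constructor <;> linarith

instance : SecondCountableTopology (Config d) := by
  obtain ⟨F, -, hF⟩ := exists_isInducing_integral (d := d)
  exact hF.secondCountableTopology

instance : T2Space (Config d) := by
  refine ⟨fun C C' h => ?_⟩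
  by_contra hn
  refine h (toMeasure_injective (Measure.ext_of_integral_eq_on_compactlySupported fun f => ?_))
  by_contra hne
  exact hn (separated_by_continuous (continuous_integral f.continuous f.hasCompactSupport) hne)

instance : TopologicalSpace.PseudoMetrizableSpace (Config d) := by
  obtain ⟨F, -, hF⟩ := exists_isInducing_integral (d := d)
  exact hF.pseudoMetrizableSpace

/-- Measurability of a map with values in configurations can be tested on compactly supported
continuous functions. -/
lemma measurable_of_integral {α : Type*} [MeasurableSpace α] {g : α → Config d}
    (h : ∀ f : E d → ℝ, Continuous f → HasCompactSupport f →
      Measurable fun a => ∫ p, f p ∂(g a).toMeasure) : Measurable g := by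
  obtain ⟨F, hFc, hF⟩ := exists_isInducing_integral (d := d)
  have h1 : borel (Config d) = MeasurableSpace.comap
      (fun (C : Config d) k => ∫ p, F k p ∂C.toMeasure) (borel (ℕ → ℝ)) :=
    (congrArg (@borel (Config d)) hF.eq_induced).trans borel_comap
  have h2 : Measurable[_, MeasurableSpace.comap
      (fun (C : Config d) k => ∫ p, F k p ∂C.toMeasure) (borel (ℕ → ℝ))] g := by
    rw [measurable_comap_iff, ← BorelSpace.measurable_eq (α := ℕ → ℝ)]
    exact measurable_pi_iff.2 fun k => h _ (hFc k).1 (hFc k).2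
  rw [← h1] at h2
  exact h2

lemma continuous_of_integral {α : Type*} [TopologicalSpace α] {g : α → Config d}
    (h : ∀ f : E d → ℝ, Continuous f → HasCompactSupport f →
      Continuous fun a => ∫ p, f p ∂(g a).toMeasure) : Continuous g :=
  continuous_iInf_rng.2 fun f => continuous_induced_rng.2 (h f.1 f.2.1 f.2.2)

/-! ### Translations -/

lemma toMeasure_translate (x : E d) (C : Config d) :
    (C.translate x).toMeasure = C.toMeasure.map (fun p => p - x) := by
  refine Measure.ext fun s hs => ?_
  rw [Measure.map_apply (by fun_prop) hs, ← lintegral_indicator_one hs,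
    ← lintegral_indicator_one (hs.preimage (by fun_prop)), lintegral_toMeasure,
    lintegral_toMeasure, ← (Equiv.subRight x).tsum_eq]
  simp [translate, indicator]
  rfl

lemma lintegral_translate (x : E d) (C : Config d) (f : E d → ℝ≥0∞) :
    ∫⁻ p, f p ∂(C.translate x).toMeasure = ∫⁻ p, f (p - x) ∂C.toMeasure := by
  rw [lintegral_toMeasure, lintegral_toMeasure, ← (Equiv.subRight x).tsum_eq]
  simp [translate]

lemma integral_translate (x : E d) (C : Config d) (f : E d → ℝ) :
    ∫ p, f p ∂(C.translate x).toMeasure = ∫ p, f (p - x) ∂C.toMeasure := by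
  rw [toMeasure_translate]
  exact integral_map_equiv (MeasurableEquiv.subRight x) f

lemma continuous_translate (x : E d) : Continuous (translate x : Config d → Config d) := by
  refine continuous_of_integral fun f hf hc => ?_
  simp_rw [integral_translate]
  exact continuous_integral (by fun_prop)
    (hc.comp_homeomorph (Homeomorph.subRight x))

lemma continuous_translate_left (C : Config d) : Continuous fun x : E d => C.translate x := by
  refine continuous_of_integral fun f hf hc => ?_
  simp_rw [integral_translate]
  rw [continuous_iff_continuousAt]
  intro x₀
  obtain ⟨R, hR⟩ := hc.isBounded.subset_closedBall (0 : E d)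
  have hK := isCompact_closedBall (0 : E d) (R + ‖x₀‖ + 1)
  have := continuousOn_integral_of_compact_support (μ := C.toMeasure)
    (f := fun x p => f (p - x)) (s := Metric.closedBall x₀ 1) hK
    (by fun_prop) (fun x p hx hp => by
      by_contra h0
      have h1 := hR (subset_tsupport f h0)
      rw [mem_closedBall_iff_norm] at hx
      rw [mem_closedBall_zero_iff] at h1 hp
      refine hp ?_
      calc ‖p‖ = ‖(p - x) + ((x - x₀) + x₀)‖ := by congr 1; abel
        _ ≤ ‖p - x‖ + (‖x - x₀‖ + ‖x₀‖) := (norm_add_le _ _).trans (by gcongr; exact norm_add_le _ _)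
        _ ≤ R + ‖x₀‖ + 1 := by linarith)
  exact this.continuousAt (Metric.closedBall_mem_nhds x₀ one_pos)

lemma translate_translate (x y : E d) (C : Config d) :
    (C.translate x).translate y = C.translate (x + y) := by
  ext q
  simp [translate, add_comm x y, add_assoc]

end Config


/-! ### Extension by zero along an open embedding -/

section Extend

variable {α β : Type*} [TopologicalSpace α] [TopologicalSpace β] {j : α → β}

lemma lowerSemicontinuous_extend_zero (hj : IsOpenEmbedding j) {f : α → ℝ≥0∞}
    (hf : LowerSemicontinuous f) : LowerSemicontinuous (Function.extend j f 0) := by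
  rw [lowerSemicontinuous_iff_isOpen_preimage] at hf ⊢
  intro t
  convert hj.isOpenMap _ (hf t) using 1
  ext b
  simp only [mem_preimage, mem_Ioi, mem_image]
  constructor
  · intro h
    by_cases hb : ∃ a, j a = b
    · obtain ⟨a, rfl⟩ := hb
      rw [hj.injective.extend_apply] at h
      exact ⟨a, h, rfl⟩
    · rw [Function.extend_apply' _ _ _ hb] at h
      simp at h
  · rintro ⟨a, ha, rfl⟩
    rwa [hj.injective.extend_apply]

lemma continuous_extend_zero [T2Space β] (hj : IsOpenEmbedding j) {γ : Type*} [TopologicalSpace γ]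
    [Zero γ] {f : α → γ} (hf : Continuous f) (hc : HasCompactSupport f) :
    Continuous (Function.extend j f 0) := by
  rw [continuous_iff_continuousAt]
  intro b
  by_cases hb : b ∈ range j
  · obtain ⟨a, rfl⟩ := hb
    rw [← hj.continuousAt_iff]
    exact (hf.congr fun a => (hj.injective.extend_apply f 0 a).symm).continuousAt
  · have hcl : IsClosed (j '' tsupport f) := (hc.isCompact.image hj.continuous).isClosed
    have hmem : (j '' tsupport f)ᶜ ∈ 𝓝 b := hcl.isOpen_compl.mem_nhds
      fun ⟨a, _, h⟩ => hb ⟨a, h⟩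
    refine (continuousAt_const (y := (0 : γ))).congr ?_
    filter_upwards [hmem] with c hc'
    by_cases h : ∃ a, j a = c
    · obtain ⟨a, rfl⟩ := h
      rw [hj.injective.extend_apply]
      by_contra h0
      exact hc' ⟨a, subset_tsupport f (fun h => h0 h.symm), rfl⟩
    · rw [Function.extend_apply' _ _ _ h]; rfl

end Extend

/-! ### Enumerations of configurations -/

/-- The compactification of `ℝᵈ` by a sphere at infinity, realized as the closed unit ball. -/
abbrev Site (d : ℕ) : Type := Metric.closedBall (0 : E d) 1

instance : CompactSpace (Site d) := isCompact_iff_compactSpace.1 (isCompact_closedBall _ _)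

/-- The inclusion of `ℝᵈ` in its compactification, `x ↦ x / √(1 + |x|²)`. -/
def site (x : E d) : Site d := Set.inclusion Metric.ball_subset_closedBall (Homeomorph.unitBall x)

lemma isOpenEmbedding_site : IsOpenEmbedding (site : E d → Site d) := by
  refine IsOpenEmbedding.comp (g := Set.inclusion Metric.ball_subset_closedBall) ?_
    Homeomorph.unitBall.isOpenEmbedding
  refine ⟨.inclusion _, ?_⟩
  rw [Set.range_inclusion]
  exact Metric.isOpen_ball.preimage continuous_subtype_val

lemma site_injective : Function.Injective (site : E d → Site d) := isOpenEmbedding_site.injective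

lemma exists_notMem_range_site (hd : 1 ≤ d) : ∃ z : Site d, z ∉ range (site : E d → Site d) := by
  refine ⟨⟨EuclideanSpace.single ⟨0, hd⟩ (1 : ℝ), by simp⟩, ?_⟩
  rintro ⟨x, hx⟩
  have h1 := (Homeomorph.unitBall x).2
  have h2 := congrArg Subtype.val hx
  simp only [site, Set.inclusion] at h2
  rw [h2] at h1
  simp at h1

/-- Sequences of sites, the sites at infinity standing for absent points. They enumerate the
configurations, and they form a compact metrizable space. -/
abbrev Enum (d : ℕ) : Type := ℕ → Site d

/-- A function on `ℝᵈ`, extended by `0` to the sites at infinity. -/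
def ext₁ {γ : Type*} [Zero γ] (f : E d → γ) : Site d → γ := Function.extend site f 0

/-- A function of two points, extended by `0` to the pairs with a site at infinity. -/
def ext₂ (g : E d → E d → ℝ≥0∞) : Site d × Site d → ℝ≥0∞ :=
  Function.extend (Prod.map site site) (Function.uncurry g) 0

lemma ext₁_site {γ : Type*} [Zero γ] (f : E d → γ) (x : E d) : ext₁ f (site x) = f x :=
  site_injective.extend_apply _ _ _

lemma ext₁_of_notMem {γ : Type*} [Zero γ] (f : E d → γ) {z : Site d} (hz : z ∉ range (site (d := d))) :
    ext₁ f z = 0 := Function.extend_apply' _ _ _ hz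

lemma ext₂_site (g : E d → E d → ℝ≥0∞) (x y : E d) : ext₂ g (site x, site y) = g x y :=
  (site_injective.prodMap site_injective).extend_apply _ _ (x, y)

lemma ext₂_of_notMem (g : E d → E d → ℝ≥0∞) {z w : Site d}
    (hz : z ∉ range (site (d := d)) ∨ w ∉ range (site (d := d))) : ext₂ g (z, w) = 0 := by
  refine Function.extend_apply' _ _ _ ?_
  rintro ⟨⟨x, y⟩, h⟩
  simp only [Prod.map_apply, Prod.mk.injEq] at h
  rcases hz with hz | hz
  · exact hz ⟨x, h.1⟩
  · exact hz ⟨y, h.2⟩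

lemma measurable_ext₁ {γ : Type*} [Zero γ] [MeasurableSpace γ] {f : E d → γ} (hf : Measurable f) :
    Measurable (ext₁ f) :=
  isOpenEmbedding_site.measurableEmbedding.measurable_extend hf measurable_const

lemma measurable_ext₂ {g : E d → E d → ℝ≥0∞} (hg : Measurable (Function.uncurry g)) :
    Measurable (ext₂ g) :=
  (isOpenEmbedding_site.prodMap isOpenEmbedding_site).measurableEmbedding.measurable_extend hg
    measurable_const

lemma lowerSemicontinuous_ext₁ {f : E d → ℝ≥0∞} (hf : LowerSemicontinuous f) :
    LowerSemicontinuous (ext₁ f) := lowerSemicontinuous_extend_zero isOpenEmbedding_site hf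

lemma lowerSemicontinuous_ext₂ {g : E d → E d → ℝ≥0∞}
    (hg : LowerSemicontinuous (Function.uncurry g)) : LowerSemicontinuous (ext₂ g) :=
  lowerSemicontinuous_extend_zero (isOpenEmbedding_site.prodMap isOpenEmbedding_site) hg

lemma continuous_ext₁ {γ : Type*} [Zero γ] [TopologicalSpace γ] {f : E d → γ} (hf : Continuous f)
    (hc : HasCompactSupport f) : Continuous (ext₁ f) :=
  continuous_extend_zero isOpenEmbedding_site hf hc

namespace Enum

/-- The sequences with finitely many terms in every bounded region. -/
def LocFin : Set (Enum d) :=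
  {u | ∀ k : ℕ, {i | u i ∈ site '' Metric.closedBall (0 : E d) k}.Finite}

lemma finite_of_mem_locFin {u : Enum d} (hu : u ∈ LocFin) (R : ℝ) :
    {i | u i ∈ site '' Metric.closedBall (0 : E d) R}.Finite := by
  obtain ⟨n, hn⟩ := exists_nat_ge R
  exact (hu n).subset fun i hi => image_mono (Metric.closedBall_subset_closedBall hn) hi

lemma finite_fiber {u : Enum d} (hu : u ∈ LocFin) (p : E d) : {i | u i = site p}.Finite :=
  (finite_of_mem_locFin hu ‖p‖).subset fun i hi => ⟨p, by simp, hi.symm⟩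

open Classical in
/-- The configuration enumerated by a sequence of sites (empty if the sequence is not locally
finite). -/
def toConfig (u : Enum d) : Config d where
  mult p := if u ∈ LocFin then {i | u i = site p}.ncard else 0
  locallyFinite R := by
    by_cases hu : u ∈ LocFin
    · have := ((finite_of_mem_locFin hu R).image u).preimage (site_injective (d := d)).injOn
      refine this.subset ?_
      rintro p ⟨hp, hm⟩
      simp only [Function.mem_support, hu, if_true] at hm
      obtain ⟨i, hi⟩ := Set.nonempty_of_ncard_ne_zero hm
      exact ⟨i, ⟨p, hp, hi.symm⟩, hi⟩
    · simp [hu]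

lemma mult_toConfig {u : Enum d} (hu : u ∈ LocFin) (p : E d) :
    (toConfig u).mult p = {i | u i = site p}.ncard := by simp [toConfig, hu]

open Classical in
lemma mult_toConfig_eq_tsum {u : Enum d} (hu : u ∈ LocFin) (p : E d) :
    ((toConfig u).mult p : ℝ≥0∞) = ∑' i, if u i = site p then 1 else 0 := by
  rw [mult_toConfig hu, tsum_eq_sum (s := (finite_fiber hu p).toFinset) (by simp),
    Set.ncard_eq_toFinset_card _ (finite_fiber hu p), Finset.sum_ite_of_true (by simp)]
  simp

open Classical in
lemma tsum_ite_site (f : E d → ℝ≥0∞) (z : Site d) :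
    ∑' p, (if z = site p then f p else 0) = ext₁ f z := by
  by_cases hz : z ∈ range (site (d := d))
  · obtain ⟨x, rfl⟩ := hz
    rw [tsum_eq_single x, if_pos rfl, ext₁_site]
    intro y hy
    rw [if_neg fun h => hy (site_injective h).symm]
  · rw [ext₁_of_notMem f hz]
    simp only [ENNReal.tsum_eq_zero]
    exact fun p => if_neg fun h => hz ⟨p, h.symm⟩

lemma lintegral_toConfig {u : Enum d} (hu : u ∈ LocFin) (f : E d → ℝ≥0∞) :
    ∫⁻ p, f p ∂(toConfig u).toMeasure = ∑' i, ext₁ f (u i) := by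
  classical
  rw [Config.lintegral_toMeasure]
  simp_rw [mult_toConfig_eq_tsum hu, ← ENNReal.tsum_mul_right, ite_mul, one_mul, zero_mul]
  rw [ENNReal.tsum_comm]
  simp_rw [tsum_ite_site]

open Classical in
lemma pairs_toConfig {u : Enum d} (hu : u ∈ LocFin) (p q : E d) :
    ((toConfig u).pairs p q : ℝ≥0∞) =
      ∑' i, ∑' j, if i ≠ j ∧ u i = site p ∧ u j = site q then 1 else 0 := by
  have key : ∀ i, (∑' j, if i ≠ j ∧ u i = site p ∧ u j = site q then (1 : ℝ≥0∞) else 0) =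
      if u i = site p then ((((finite_fiber hu q).toFinset.erase i).card : ℕ) : ℝ≥0∞) else 0 := by
    intro i
    split_ifs with h
    · rw [tsum_eq_sum (s := (finite_fiber hu q).toFinset.erase i)]
      · rw [Finset.sum_ite_of_true]
        · simp
        · intro j hj; simp at hj; exact ⟨Ne.symm hj.1, h, hj.2⟩
      · intro j hj
        simp only [Finset.mem_erase, Finite.mem_toFinset, mem_ofPred_eq, not_and] at hj
        rw [if_neg]
        rintro ⟨h1, -, h2⟩
        exact hj (Ne.symm h1) h2
    · simp [h]
  simp_rw [key]
  rw [tsum_eq_sum (s := (finite_fiber hu p).toFinset) (by simp +contextual),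
    Finset.sum_ite_of_true (by simp), Config.pairs]
  have hp : (toConfig u).mult p = (finite_fiber hu p).toFinset.card := by
    rw [mult_toConfig hu, Set.ncard_eq_toFinset_card _ (finite_fiber hu p)]
  have hq : (toConfig u).mult q = (finite_fiber hu q).toFinset.card := by
    rw [mult_toConfig hu, Set.ncard_eq_toFinset_card _ (finite_fiber hu q)]
  rw [hp, hq]
  split_ifs with hpq
  · subst hpq
    rw [Finset.sum_congr rfl fun i hi => by rw [Finset.card_erase_of_mem hi], Finset.sum_const]
    simp
  · rw [Finset.sum_congr rfl fun i hi => by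
      rw [Finset.erase_eq_of_notMem (s := (finite_fiber hu q).toFinset) (a := i)
        (by simp at hi ⊢; rw [hi]; exact fun h => hpq (site_injective h))], Finset.sum_const]
    simp

open Classical in
lemma tsum_ite_site₂ (g : E d → E d → ℝ≥0∞) (z w : Site d) :
    ∑' p, ∑' q, (if z = site p ∧ w = site q then g p q else 0) = ext₂ g (z, w) := by
  have h1 : ∀ p, ∑' q, (if z = site p ∧ w = site q then g p q else 0) =
      if z = site p then ext₁ (g p) w else 0 := fun p => by
    split_ifs with h
    · simp only [h, true_and, tsum_ite_site]
    · simp [h]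
  simp_rw [h1]
  rw [tsum_ite_site (fun p => ext₁ (g p) w)]
  by_cases hz : z ∈ range (site (d := d))
  · obtain ⟨x, rfl⟩ := hz
    rw [ext₁_site]
    by_cases hw : w ∈ range (site (d := d))
    · obtain ⟨y, rfl⟩ := hw
      rw [ext₁_site, ext₂_site]
    · rw [ext₁_of_notMem _ hw, ext₂_of_notMem _ (.inr hw)]
  · rw [ext₁_of_notMem _ hz, ext₂_of_notMem _ (.inl hz)]

open Classical in
/-- Sums over ordered pairs of distinct points of an enumerated configuration. -/
lemma tsum_pairs_toConfig {u : Enum d} (hu : u ∈ LocFin) (g : E d → E d → ℝ≥0∞) :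
    ∑' p, ∑' q, ((toConfig u).pairs p q : ℝ≥0∞) * g p q =
      ∑' i, ∑' j, if i = j then 0 else ext₂ g (u i, u j) := by
  simp_rw [pairs_toConfig hu, ← ENNReal.tsum_mul_right]
  have h1 : ∀ p : E d, (∑' (q : E d) (i : ℕ) (j : ℕ),
      (if i ≠ j ∧ u i = site p ∧ u j = site q then (1 : ℝ≥0∞) else 0) * g p q) =
      ∑' (i : ℕ) (j : ℕ) (q : E d),
      (if i ≠ j ∧ u i = site p ∧ u j = site q then (1 : ℝ≥0∞) else 0) * g p q := fun p => by
    rw [ENNReal.tsum_comm]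
    exact tsum_congr fun i => ENNReal.tsum_comm
  simp_rw [h1]
  rw [ENNReal.tsum_comm]
  refine tsum_congr fun i => ?_
  rw [ENNReal.tsum_comm]
  refine tsum_congr fun j => ?_
  split_ifs with hij
  · simp [hij]
  · simp only [ne_eq, hij, not_false_eq_true, true_and, ite_mul, one_mul, zero_mul]
    exact tsum_ite_site₂ g _ _

end Enum

/-- The Riesz kernel restricted to pairs of points of `A`. -/
def cutKernel (s : ℝ) (A : Set (E d)) (p q : E d) : ℝ≥0∞ :=
  (A ×ˢ A).indicator (Function.uncurry (rieszKernel s)) (p, q)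

lemma Config.interaction_eq_tsum (s : ℝ) (A : Set (E d)) (C : Config d) :
    C.interaction s A = ∑' p, ∑' q, (C.pairs p q : ℝ≥0∞) * cutKernel s A p q := by
  unfold Config.interaction
  rw [tsum_subtype A fun p => ∑' q : A, (C.pairs p q : ℝ≥0∞) * rieszKernel s p q]
  refine tsum_congr fun p => ?_
  by_cases hp : p ∈ A
  · rw [indicator_of_mem hp, tsum_subtype A fun q => (C.pairs p q : ℝ≥0∞) * rieszKernel s p q]
    refine tsum_congr fun q => ?_
    by_cases hq : q ∈ A <;> simp [cutKernel, hp, hq]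
  · simp [cutKernel, hp]

open Classical in
lemma Enum.interaction_toConfig {u : Enum d} (hu : u ∈ LocFin) (s : ℝ) (A : Set (E d)) :
    (toConfig u).interaction s A =
      ∑' i, ∑' j, if i = j then 0 else ext₂ (cutKernel s A) (u i, u j) := by
  rw [Config.interaction_eq_tsum, tsum_pairs_toConfig hu]


instance : PolishSpace (Site d) := Metric.isClosed_closedBall.polishSpace

namespace Enum

lemma measurableSet_locFin : MeasurableSet (LocFin : Set (Enum d)) := by
  have : (LocFin : Set (Enum d)) = ⋂ k : ℕ, ⋃ n : ℕ, ⋂ i : ℕ, ⋂ _ : n ≤ i,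
      (fun u : Enum d => u i) ⁻¹' (site '' Metric.closedBall (0 : E d) k)ᶜ := by
    ext u
    simp only [LocFin, mem_ofPred_eq, mem_iInter, mem_iUnion, mem_preimage, mem_compl_iff]
    refine forall_congr' fun k => ⟨fun h => ?_, fun ⟨n, hn⟩ => ?_⟩
    · obtain ⟨n, hn⟩ := h.bddAbove
      exact ⟨n + 1, fun i hi hmem => absurd (hn hmem) (by omega)⟩
    · refine (Set.finite_lt_nat n).subset fun i hi => ?_
      by_contra h
      exact hn i (by simpa using h) hi
  rw [this]
  refine MeasurableSet.iInter fun k => MeasurableSet.iUnion fun n => MeasurableSet.iInter fun i =>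
    MeasurableSet.iInter fun _ => MeasurableSet.preimage ?_ (measurable_pi_apply i)
  exact ((isCompact_closedBall (0 : E d) k).image
    isOpenEmbedding_site.continuous).isClosed.measurableSet.compl

lemma toConfig_of_notMem {u : Enum d} (hu : u ∉ LocFin) (p : E d) : (toConfig u).mult p = 0 := by
  simp [toConfig, hu]

lemma lintegral_toConfig_of_notMem {u : Enum d} (hu : u ∉ LocFin) (f : E d → ℝ≥0∞) :
    ∫⁻ p, f p ∂(toConfig u).toMeasure = 0 := by
  rw [Config.lintegral_toMeasure]; simp [toConfig_of_notMem hu]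

lemma interaction_toConfig_of_notMem {u : Enum d} (hu : u ∉ LocFin) (s : ℝ) (A : Set (E d)) :
    (toConfig u).interaction s A = 0 := by
  simp [Config.interaction, Config.pairs, toConfig_of_notMem hu]

lemma interaction_toConfig_le (u : Enum d) (s : ℝ) (A : Set (E d)) :
    (toConfig u).interaction s A ≤
      ∑' i, ∑' j, if i = j then 0 else ext₂ (cutKernel s A) (u i, u j) := by
  by_cases hu : u ∈ LocFin
  · exact (interaction_toConfig hu s A).le
  · simp [interaction_toConfig_of_notMem hu]

lemma measurable_lintegral_prod_toConfig {α : Type*} [MeasurableSpace α] {f : α → E d → ℝ≥0∞}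
    (hf : Measurable (Function.uncurry f)) :
    Measurable fun a : α × Enum d => ∫⁻ p, f a.1 p ∂(toConfig a.2).toMeasure := by
  classical
  have : (fun a : α × Enum d => ∫⁻ p, f a.1 p ∂(toConfig a.2).toMeasure) =
      (Prod.snd ⁻¹' LocFin).indicator fun a => ∑' i, ext₁ (f a.1) (a.2 i) := by
    ext a
    by_cases hu : a.2 ∈ LocFin
    · rw [indicator_of_mem (by exact hu), lintegral_toConfig hu]
    · rw [indicator_of_notMem (by exact hu), lintegral_toConfig_of_notMem hu]
  rw [this]
  refine (Measurable.tsum fun i => ?_).indicator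
    (measurableSet_locFin.preimage measurable_snd)
  have hj : MeasurableEmbedding (Prod.map id site : α × E d → α × Site d) :=
    MeasurableEmbedding.id.prodMap isOpenEmbedding_site.measurableEmbedding
  have h2 : Measurable (Function.extend (Prod.map id site : α × E d → α × Site d)
    (Function.uncurry f) 0) := hj.measurable_extend hf measurable_const
  have h3 : (fun a : α × Enum d => ext₁ (f a.1) (a.2 i)) = fun a =>
      Function.extend (Prod.map id site : α × E d → α × Site d) (Function.uncurry f) 0
        (a.1, a.2 i) := by
    ext a
    by_cases hz : a.2 i ∈ range (site (d := d))
    · obtain ⟨x, hx⟩ := hz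
      rw [← hx, ext₁_site]
      exact (hj.injective.extend_apply (Function.uncurry f) 0 (a.1, x)).symm
    · rw [ext₁_of_notMem _ hz, Function.extend_apply']
      · rfl
      · rintro ⟨⟨b, x⟩, h⟩
        simp only [Prod.map_apply, Prod.mk.injEq] at h
        exact hz ⟨x, h.2⟩
  rw [h3]
  exact h2.comp (measurable_fst.prodMk ((measurable_pi_apply i).comp measurable_snd))

lemma measurable_lintegral_toConfig {f : E d → ℝ≥0∞} (hf : Measurable f) :
    Measurable fun u : Enum d => ∫⁻ p, f p ∂(toConfig u).toMeasure := by
  have hf' : Measurable (Function.uncurry fun _ : Unit => f) := by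
    rw [Function.uncurry_def]; exact hf.comp measurable_snd
  have m : Measurable fun u : Enum d => ((), u) := measurable_const.prodMk measurable_id
  have h := (measurable_lintegral_prod_toConfig hf').comp m
  rw [Function.comp_def] at h
  exact h

lemma measurable_toConfig : Measurable (toConfig : Enum d → Config d) := by
  refine Config.measurable_of_integral fun f hf hc => ?_
  have : ∀ u : Enum d, ∫ p, f p ∂(toConfig u).toMeasure =
      (∫⁻ p, ENNReal.ofReal (f p) ∂(toConfig u).toMeasure).toReal -
      (∫⁻ p, ENNReal.ofReal (-f p) ∂(toConfig u).toMeasure).toReal := fun u =>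
    integral_eq_lintegral_pos_part_sub_lintegral_neg_part
      (hf.integrable_of_hasCompactSupport hc)
  simp_rw [this]
  exact ((measurable_lintegral_toConfig (by fun_prop)).ennreal_toReal).sub
    ((measurable_lintegral_toConfig (by fun_prop)).ennreal_toReal)

/-- Every configuration is enumerated by some sequence, since its points are countably many. -/
lemma surjective_toConfig (hd : 1 ≤ d) : Function.Surjective (toConfig : Enum d → Config d) := by
  classical
  intro C
  obtain ⟨z, hz⟩ := exists_notMem_range_site hd
  have hsupp : (Function.support C.mult).Countable := by
    have : Function.support C.mult ⊆
        ⋃ n : ℕ, Metric.closedBall (0 : E d) n ∩ Function.support C.mult := fun p hp => by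
      obtain ⟨n, hn⟩ := exists_nat_ge ‖p‖
      exact mem_iUnion.2 ⟨n, by simpa using hn, hp⟩
    exact (countable_iUnion fun n : ℕ => (C.locallyFinite n).countable).mono this
  -- the points of `C`, repeated according to their multiplicity
  let T := Σ p : Function.support C.mult, Fin (C.mult p)
  have : Countable (Function.support C.mult) := hsupp
  obtain ⟨e, he⟩ := exists_injective_nat T
  -- unused indices are sent to a site at infinity
  let u : Enum d := fun n => if h : ∃ t, e t = n then site (h.choose.1 : E d) else z
  have hu1 : ∀ t, u (e t) = site (t.1 : E d) := fun t => by
    have h : ∃ t', e t' = e t := ⟨t, rfl⟩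
    simp only [u, h, dif_pos]
    rw [he h.choose_spec]
  have hu2 : ∀ n x, u n = site x → ∃ t : T, e t = n ∧ (t.1 : E d) = x := fun n x hn => by
    by_cases h : ∃ t, e t = n
    · obtain ⟨t, rfl⟩ := h
      exact ⟨t, rfl, site_injective ((hu1 t).symm.trans hn)⟩
    · simp only [u, h, dif_neg, not_false_eq_true] at hn
      exact absurd ⟨x, hn.symm⟩ hz
  have hLF : u ∈ LocFin := fun k => by
    have hfin : {t : T | (t.1 : E d) ∈ Metric.closedBall (0 : E d) k}.Finite := by
      have h1 : {q : Function.support C.mult | (q : E d) ∈ Metric.closedBall (0 : E d) k}.Finite :=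
        ((C.locallyFinite k).preimage (Subtype.val_injective.injOn)).subset
          fun q hq => ⟨hq, q.2⟩
      refine (h1.biUnion fun q _ => (Set.finite_univ (α := Fin (C.mult q))).image
        (fun i => (⟨q, i⟩ : T))).subset ?_
      rintro ⟨q, i⟩ hq
      exact mem_biUnion (x := q) hq ⟨i, trivial, rfl⟩
    refine (hfin.image e).subset ?_
    rintro n ⟨x, hx, hn⟩
    obtain ⟨t, rfl, rfl⟩ := hu2 n x hn.symm
    exact ⟨t, hx, rfl⟩
  refine ⟨u, Config.ext ?_⟩
  ext p
  rw [mult_toConfig hLF]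
  have hset : {i | u i = site p} = e '' {t : T | (t.1 : E d) = p} := by
    ext n
    constructor
    · intro hn
      obtain ⟨t, rfl, rfl⟩ := hu2 n p hn
      exact ⟨t, rfl, rfl⟩
    · rintro ⟨t, rfl, rfl⟩
      exact hu1 t
  rw [hset, Set.ncard_image_of_injective _ he]
  by_cases hp : C.mult p = 0
  · rw [hp]
    convert Set.ncard_empty T
    ext t
    simp only [mem_ofPred_eq, mem_empty_iff_false, iff_false]
    rintro rfl
    exact t.1.2 hp
  · have : {t : T | (t.1 : E d) = p} = range fun i : Fin (C.mult p) => (⟨⟨p, hp⟩, i⟩ : T) := by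
      ext ⟨⟨q, hq⟩, i⟩
      simp only [mem_ofPred_eq, mem_range]
      constructor
      · rintro rfl
        exact ⟨i, rfl⟩
      · rintro ⟨j, hj⟩
        have := congrArg (fun t : T => (t.1 : E d)) hj
        exact this.symm
    rw [this, ← Set.image_univ, Set.ncard_image_of_injective, Set.ncard_univ, Nat.card_fin]
    intro i j hij
    exact eq_of_heq (Sigma.mk.inj_iff.1 hij).2

end Enum

namespace Config

/-- A function of a configuration is measurable as soon as it is a measurable function of the
enumerations of the configuration, by the Lusin separation theorem. -/
lemma measurable_of_comp_toConfig (hd : 1 ≤ d) {β : Type*} [MeasurableSpace β] {g : Config d → β}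
    (h : Measurable (g ∘ Enum.toConfig)) : Measurable g :=
  (Enum.measurable_toConfig.measurable_comp_iff_of_surjective (Enum.surjective_toConfig hd)).1 h

lemma measurable_lintegral (hd : 1 ≤ d) {f : E d → ℝ≥0∞} (hf : Measurable f) :
    Measurable fun C : Config d => ∫⁻ p, f p ∂C.toMeasure :=
  measurable_of_comp_toConfig hd (Enum.measurable_lintegral_toConfig hf)

lemma measurable_toMeasure_apply (hd : 1 ≤ d) {A : Set (E d)} (hA : MeasurableSet A) :
    Measurable fun C : Config d => C.toMeasure A := by
  simp_rw [← lintegral_indicator_one hA]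
  exact measurable_lintegral hd (measurable_one.indicator hA)

lemma measurable_cutKernel (s : ℝ) {A : Set (E d)} (hA : MeasurableSet A) :
    Measurable (Function.uncurry (cutKernel s A)) := by
  have : Function.uncurry (cutKernel s A) =
      (A ×ˢ A).indicator (Function.uncurry (rieszKernel s)) := by ext ⟨p, q⟩; rfl
  rw [this]
  refine Measurable.indicator ?_ (hA.prod hA)
  unfold rieszKernel
  exact (measurable_edist (α := E d)).pow_const (-s)

lemma measurable_interaction (hd : 1 ≤ d) (s : ℝ) {A : Set (E d)} (hA : MeasurableSet A) :
    Measurable fun C : Config d => C.interaction s A := by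
  classical
  refine measurable_of_comp_toConfig hd ?_
  have : (fun C : Config d => C.interaction s A) ∘ Enum.toConfig =
      Enum.LocFin.indicator fun u => ∑' i, ∑' j, if i = j then 0 else
        ext₂ (cutKernel s A) (u i, u j) := by
    ext u
    by_cases hu : u ∈ Enum.LocFin
    · rw [indicator_of_mem hu, Function.comp_apply, Enum.interaction_toConfig hu]
    · rw [indicator_of_notMem hu, Function.comp_apply, Enum.interaction_toConfig_of_notMem hu]
  rw [this]
  refine (Measurable.tsum fun i => Measurable.tsum fun j => ?_).indicator
    Enum.measurableSet_locFin
  split_ifs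
  · exact measurable_const
  · exact (measurable_ext₂ (measurable_cutKernel s hA)).comp
      ((measurable_pi_apply i).prodMk (measurable_pi_apply j))

end Config

lemma lowerSemicontinuous_cutKernel (s : ℝ) {A : Set (E d)} (hA : IsOpen A) :
    LowerSemicontinuous (Function.uncurry (cutKernel s A)) := by
  have : Function.uncurry (cutKernel s A) =
      (A ×ˢ A).indicator (Function.uncurry (rieszKernel s)) := by ext ⟨p, q⟩; rfl
  rw [this, lowerSemicontinuous_iff_isOpen_preimage]
  have hc : Continuous (Function.uncurry (rieszKernel (d := d) s)) := by
    unfold rieszKernel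
    exact ENNReal.continuous_rpow_const.comp continuous_edist
  intro t
  convert (hA.prod hA).inter ((isOpen_Ioi (a := t)).preimage hc) using 1
  ext z
  by_cases hz : z ∈ A ×ˢ A <;> simp [hz]


/-! ### Riesz energies of finite families -/

/-- The Riesz energy of a family of points indexed by a finite type. -/
def pairEnergy {ι : Type*} [Fintype ι] [DecidableEq ι] (s : ℝ) (x : ι → E d) : ℝ≥0∞ :=
  ∑ i, ∑ j, if i = j then 0 else rieszKernel s (x i) (x j)

lemma rieszEnergy_eq_pairEnergy {N : ℕ} (s : ℝ) (x : Fin N → E d) :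
    rieszEnergy s x = pairEnergy s x := by
  unfold rieszEnergy pairEnergy
  refine Finset.sum_congr rfl fun i _ => ?_
  rw [← Finset.add_sum_erase Finset.univ _ (Finset.mem_univ i), if_pos rfl, zero_add]
  refine Finset.sum_congr rfl fun j hj => ?_
  rw [if_neg (Ne.symm (Finset.ne_of_mem_erase hj))]

lemma pairEnergy_comp_le {ι κ : Type*} [Fintype ι] [DecidableEq ι] [Fintype κ] [DecidableEq κ]
    (s : ℝ) (x : ι → E d) {e : κ → ι} (he : Function.Injective e) :
    pairEnergy s (x ∘ e) ≤ pairEnergy s x := by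
  let F : ι × ι → ℝ≥0∞ := fun z => if z.1 = z.2 then 0 else rieszKernel s (x z.1) (x z.2)
  calc pairEnergy s (x ∘ e) = ∑' z : κ × κ, F (Prod.map e e z) := by
        rw [tsum_fintype, Fintype.sum_prod_type]
        simp [pairEnergy, F, he.eq_iff]
    _ ≤ ∑' z, F z := ENNReal.tsum_comp_le_tsum_of_injective (he.prodMap he) F
    _ = pairEnergy s x := by
        rw [tsum_fintype, Fintype.sum_prod_type]
        simp [pairEnergy, F]

lemma pairEnergy_congr {ι : Type*} [Fintype ι] [DecidableEq ι] {s : ℝ} {x y : ι → E d} {c : ℝ≥0∞}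
    (h : ∀ i j, i ≠ j → rieszKernel s (x i) (x j) = c * rieszKernel s (y i) (y j)) :
    pairEnergy s x = c * pairEnergy s y := by
  unfold pairEnergy
  simp_rw [Finset.mul_sum]
  refine Finset.sum_congr rfl fun i _ => Finset.sum_congr rfl fun j _ => ?_
  split_ifs with hij
  · simp
  · exact h i j hij

lemma rieszKernel_smul_add {s c : ℝ} (hc : 0 < c) (a x y : E d) :
    rieszKernel s (a + c • x) (a + c • y) = ENNReal.ofReal c ^ (-s) * rieszKernel s x y := by
  unfold rieszKernel
  rw [edist_add_left, edist_smul₀, ← ENNReal.mul_rpow_of_ne_top (by simp) (edist_ne_top x y)]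
  congr 1
  rw [ENNReal.smul_def, smul_eq_mul, ← Real.enorm_eq_ofReal hc.le]; rfl

/-- Lower bound for the kernel in terms of the distance. -/
lemma le_rieszKernel {s : ℝ} (hs : 0 ≤ s) {x y : E d} {r : ℝ≥0∞} (h : edist x y ≤ r) :
    r ^ (-s) ≤ rieszKernel s x y := by
  unfold rieszKernel
  rw [ENNReal.rpow_neg, ENNReal.rpow_neg]
  exact ENNReal.inv_le_inv.2 (ENNReal.rpow_le_rpow h hs)

lemma rieszKernel_le {s : ℝ} (hs : 0 ≤ s) {x y : E d} {r : ℝ≥0∞} (h : r ≤ edist x y) :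
    rieszKernel s x y ≤ r ^ (-s) := by
  unfold rieszKernel
  rw [ENNReal.rpow_neg, ENNReal.rpow_neg]
  exact ENNReal.inv_le_inv.2 (ENNReal.rpow_le_rpow h hs)

lemma minRieszEnergy_le (s : ℝ) {A : Set (E d)} {N : ℕ} (x : Fin N → E d) (hx : ∀ i, x i ∈ A) :
    minRieszEnergy s A N ≤ rieszEnergy s x :=
  iInf_le (fun x : Fin N → A => rieszEnergy s fun i => (x i : E d)) fun i => ⟨x i, hx i⟩

lemma exists_rieszEnergy_lt {s : ℝ} {A : Set (E d)} {N : ℕ} {c : ℝ≥0∞}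
    (h : minRieszEnergy s A N < c) : ∃ x : Fin N → E d, (∀ i, x i ∈ A) ∧ rieszEnergy s x < c := by
  obtain ⟨x, hx⟩ := iInf_lt_iff.1 h
  exact ⟨fun i => x i, fun i => (x i).2, hx⟩

lemma minRieszEnergy_mono (s : ℝ) (A : Set (E d)) : Monotone (minRieszEnergy s A) := by
  intro m n hmn
  refine le_iInf fun x => ?_
  refine (minRieszEnergy_le s (fun i : Fin m => (x (Fin.castLE hmn i) : E d))
    fun i => (x _).2).trans ?_
  rw [rieszEnergy_eq_pairEnergy, rieszEnergy_eq_pairEnergy]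
  exact pairEnergy_comp_le s (fun i => (x i : E d)) (Fin.castLE_injective hmn)

lemma minRieszEnergy_card_le {ι : Type*} [Fintype ι] [DecidableEq ι] (s : ℝ) {A : Set (E d)}
    (x : ι → E d) (hx : ∀ i, x i ∈ A) : minRieszEnergy s A (Fintype.card ι) ≤ pairEnergy s x := by
  refine (minRieszEnergy_le s (x ∘ (Fintype.equivFin ι).symm) fun i => hx _).trans ?_
  rw [rieszEnergy_eq_pairEnergy]
  exact pairEnergy_comp_le s x (Equiv.injective _)

/-- The energy of points in a cube of side `R` is at least `R⁻ˢ` times the minimum on the unit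
cube. -/
lemma mul_minRieszEnergy_le {s R : ℝ} (hR : 0 < R) {ι : Type*} [Fintype ι] [DecidableEq ι]
    (x : ι → E d) (hx : ∀ i, x i ∈ cube d R) :
    ENNReal.ofReal R ^ (-s) * minRieszEnergy s (cube d 1) (Fintype.card ι) ≤ pairEnergy s x := by
  have h1 : pairEnergy s x = ENNReal.ofReal R ^ (-s) * pairEnergy s fun i => R⁻¹ • x i := by
    refine pairEnergy_congr fun i j _ => ?_
    have := rieszKernel_smul_add (s := s) hR 0 (R⁻¹ • x i) (R⁻¹ • x j)
    simpa [smul_smul, hR.ne'] using this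
  rw [h1]
  gcongr
  refine minRieszEnergy_card_le s _ fun i j => ?_
  have := hx i j
  simp only [PiLp.smul_apply, smul_eq_mul, abs_mul, abs_inv, abs_of_pos hR]
  rw [inv_mul_le_iff₀ hR]
  linarith

/-! ### Points placed in the cells of a grid -/

/-- The point of coordinates `z` in the cell `q` of the grid of mesh `1 / k`; the cell is the cube
`(q + [0,1]ᵈ) / k`, and points of the unit cube are mapped to its concentric reduction by the
factor `1 - δ`. -/
def gridPoint (k δ : ℝ) (q : Fin d → ℤ) (z : E d) : E d :=
  WithLp.toLp 2 fun j => ((q j : ℝ) + 1 / 2 + (1 - δ) * z j) / k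

lemma gridPoint_apply (k δ : ℝ) (q : Fin d → ℤ) (z : E d) (j : Fin d) :
    gridPoint k δ q z j = ((q j : ℝ) + 1 / 2 + (1 - δ) * z j) / k := rfl

lemma rieszKernel_gridPoint {s k δ : ℝ} (hk : 0 < k) (hδ : δ < 1) (q : Fin d → ℤ) (z z' : E d) :
    rieszKernel s (gridPoint k δ q z) (gridPoint k δ q z') =
      ENNReal.ofReal ((1 - δ) / k) ^ (-s) * rieszKernel s z z' := by
  have h : ∀ z : E d, gridPoint k δ q z = gridPoint k δ q 0 + ((1 - δ) / k) • z := fun z => by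
    ext j
    simp [gridPoint_apply]
    ring
  rw [h z, h z', rieszKernel_smul_add (div_pos (by linarith) hk)]

lemma le_edist_gridPoint {k δ : ℝ} (hk : 0 < k) (hδ : δ < 1) {q q' : Fin d → ℤ}
    (hq : q ≠ q') {z z' : E d} (hz : z ∈ cube d 1) (hz' : z' ∈ cube d 1) :
    ENNReal.ofReal (δ / k * ‖q - q'‖) ≤ edist (gridPoint k δ q z) (gridPoint k δ q' z') := by
  obtain ⟨j₁, hj₁⟩ := Function.ne_iff.1 hq
  have : Nonempty (Fin d) := ⟨j₁⟩
  obtain ⟨j, -, hj⟩ := Finset.exists_max_image Finset.univ (fun j => ‖(q - q') j‖)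
    Finset.univ_nonempty
  have hnorm : ‖q - q'‖ = |(q j : ℝ) - q' j| := by
    refine le_antisymm ((pi_norm_le_iff_of_nonneg (abs_nonneg _)).2 fun i => ?_) ?_
    · refine (hj i (Finset.mem_univ i)).trans_eq ?_
      simp [Int.norm_eq_abs]
    · have := norm_le_pi_norm (q - q') j
      simpa [Int.norm_eq_abs] using this
  have h1 : 1 ≤ |(q j : ℝ) - q' j| := by
    have h2 := hj j₁ (Finset.mem_univ _)
    have h3 : (1 : ℝ) ≤ ‖(q - q') j₁‖ := by
      rw [Int.norm_eq_abs]
      have : (1 : ℤ) ≤ |(q - q') j₁| := Int.one_le_abs (sub_ne_zero.2 hj₁)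
      exact_mod_cast this
    have h4 : ‖(q - q') j‖ = |(q j : ℝ) - q' j| := by simp [Int.norm_eq_abs]
    rw [← h4]; exact h3.trans h2
  rw [edist_dist, hnorm]
  refine ENNReal.ofReal_le_ofReal ?_
  have h5 : |gridPoint k δ q z j - gridPoint k δ q' z' j| ≤
      dist (gridPoint k δ q z) (gridPoint k δ q' z') := by
    rw [dist_eq_norm]
    exact PiLp.norm_apply_le (gridPoint k δ q z - gridPoint k δ q' z') j
  refine le_trans ?_ h5
  rw [gridPoint_apply, gridPoint_apply, ← sub_div, abs_div, abs_of_pos hk, div_mul_eq_mul_div]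
  gcongr
  have e1 : ((q j : ℝ) + 1 / 2 + (1 - δ) * z j) - ((q' j : ℝ) + 1 / 2 + (1 - δ) * z' j) =
      ((q j : ℝ) - q' j) - (1 - δ) * (z' j - z j) := by ring
  rw [e1]
  have h6 : |(1 - δ) * (z' j - z j)| ≤ 1 - δ := by
    rw [abs_mul, abs_of_pos (by linarith : 0 < 1 - δ)]
    have a1 := hz j
    have a2 := hz' j
    rw [abs_le] at a1 a2
    have : |z' j - z j| ≤ 1 := by rw [abs_le]; constructor <;> linarith
    nlinarith
  have h7 := abs_sub_abs_le_abs_sub ((q j : ℝ) - q' j) ((1 - δ) * (z' j - z j))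
  nlinarith

/-- Energy of a system made of copies placed in the cells of a grid: the energies of the copies,
plus an interaction between distinct cells that the gaps between the reduced cells control. -/
lemma pairEnergy_gridPoint_le {s k δ : ℝ} (hs : 0 ≤ s) (hk : 0 < k) (hδ : δ < 1)
    (Q : Finset (Fin d → ℤ)) (n : Q → ℕ) (z : ∀ q : Q, Fin (n q) → E d)
    (hz : ∀ q i, z q i ∈ cube d 1) :
    pairEnergy s (fun a : Σ q : Q, Fin (n q) => gridPoint k δ a.1 (z a.1 a.2)) ≤
      ∑ q, ENNReal.ofReal ((1 - δ) / k) ^ (-s) * rieszEnergy s (z q) +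
      ∑ q, ∑ q', if q = q' then 0 else
        (n q * n q' : ℝ≥0∞) * ENNReal.ofReal (δ / k * ‖(q : Fin d → ℤ) - q'‖) ^ (-s) := by
  classical
  have key : ∀ q q' : Q, (∑ i, ∑ j, if (⟨q, i⟩ : Σ q : Q, Fin (n q)) = ⟨q', j⟩ then 0 else
      rieszKernel s (gridPoint k δ q (z q i)) (gridPoint k δ q' (z q' j))) ≤
      (if q = q' then ENNReal.ofReal ((1 - δ) / k) ^ (-s) * rieszEnergy s (z q) else 0) +
      if q = q' then 0 else
        (n q * n q' : ℝ≥0∞) * ENNReal.ofReal (δ / k * ‖(q : Fin d → ℤ) - q'‖) ^ (-s) := by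
    intro q q'
    split_ifs with h
    · subst h
      rw [add_zero, rieszEnergy_eq_pairEnergy]
      refine le_of_eq ?_
      have e : pairEnergy s (fun i => gridPoint k δ q.1 (z q i)) =
          ENNReal.ofReal ((1 - δ) / k) ^ (-s) * pairEnergy s (z q) := by
        refine pairEnergy_congr fun i j _ => ?_
        exact rieszKernel_gridPoint hk hδ q.1 (z q i) (z q j)
      rw [← e]
      unfold pairEnergy
      refine Finset.sum_congr rfl fun i _ => Finset.sum_congr rfl fun j _ => ?_
      simp only [Sigma.mk.injEq, heq_eq_eq, true_and]
    · rw [zero_add]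
      have hne : (q : Fin d → ℤ) ≠ q' := fun h' => h (Subtype.ext h')
      calc _ ≤ ∑ i : Fin (n q), ∑ j : Fin (n q'),
            ENNReal.ofReal (δ / k * ‖(q : Fin d → ℤ) - q'‖) ^ (-s) := by
            refine Finset.sum_le_sum fun i _ => Finset.sum_le_sum fun j _ => ?_
            split_ifs
            · exact zero_le
            · exact rieszKernel_le hs (le_edist_gridPoint hk hδ hne (hz _ _) (hz _ _))
        _ = _ := by simp [mul_assoc]
  unfold pairEnergy
  rw [Fintype.sum_sigma]
  simp_rw [Fintype.sum_sigma]
  have : ∀ q : Q, (∑ i, ∑ q', ∑ j, if (⟨q, i⟩ : Σ q : Q, Fin (n q)) = ⟨q', j⟩ then 0 else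
      rieszKernel s (gridPoint k δ q (z q i)) (gridPoint k δ q' (z q' j))) =
      ∑ q', ∑ i, ∑ j, if (⟨q, i⟩ : Σ q : Q, Fin (n q)) = ⟨q', j⟩ then 0 else
      rieszKernel s (gridPoint k δ q (z q i)) (gridPoint k δ q' (z q' j)) :=
    fun q => Finset.sum_comm
  simp_rw [this]
  refine (Finset.sum_le_sum fun q _ => Finset.sum_le_sum fun q' _ => key q q').trans ?_
  simp_rw [Finset.sum_add_distrib]
  simp

/-- The lattice sum `∑_{m ≠ 0} |m|⁻ˢ` over `ℤᵈ` converges for `s > d`. -/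
lemma summable_lattice {s : ℝ} (hs : (d : ℝ) < s) :
    Summable fun m : Fin d → ℤ => ‖m‖ ^ (-s) := by
  let b := Pi.basisFun ℝ (Fin d)
  let L : Submodule ℤ (Fin d → ℝ) := Submodule.span ℤ (range b)
  have hfin : Module.finrank ℤ L ≤ d := by
    have := finrank_range_le_card (R := ℤ) (b := b)
    simpa [Set.finrank] using this
  have h1 := ZLattice.summable_norm_rpow L (-s) (by
    have : (Module.finrank ℤ L : ℝ) ≤ d := by exact_mod_cast hfin
    linarith)
  have hmem : ∀ m : Fin d → ℤ, (fun j => (m j : ℝ)) ∈ L := fun m => by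
    have : (fun j => (m j : ℝ)) = ∑ j, m j • b j := by
      ext i
      simp [b, Pi.basisFun_apply, Pi.single_apply]
    rw [this]
    exact Submodule.sum_mem _ fun j _ => Submodule.smul_mem _ _
      (Submodule.subset_span (mem_range_self j))
  let e : (Fin d → ℤ) → L := fun m => ⟨fun j => (m j : ℝ), hmem m⟩
  have he : Function.Injective e := fun m m' h => by
    ext j
    have := congrFun (congrArg Subtype.val h) j
    exact Int.cast_injective (α := ℝ) this
  have h2 := h1.comp_injective he
  refine h2.congr fun m => ?_
  have : ‖e m‖ = ‖m‖ := by
    simp only [e, Submodule.coe_norm, Pi.norm_def]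
    congr 1
  simp only [Function.comp_apply, this]


/-! ### The constant `C_{s,d}` -/

/-- Subdividing the unit cube in `kᵈ` cells and placing in each of them a copy of an `n`-point
system. -/
lemma minRieszEnergy_pow_mul_le {s : ℝ} (hs : (d : ℝ) < s) :
    ∃ κ : ℝ, 0 ≤ κ ∧ ∀ (k n : ℕ) (δ A : ℝ), 1 ≤ k → 0 < δ → δ < 1 → 0 ≤ A →
      minRieszEnergy s (cube d 1) n < ENNReal.ofReal A →
      minRieszEnergy s (cube d 1) (k ^ d * n) ≤
        ENNReal.ofReal ((k : ℝ) ^ (d + s) * ((1 - δ) ^ (-s) * A + (n : ℝ) ^ 2 * κ * δ ^ (-s))) := by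
  classical
  have hs0 : 0 < s := (Nat.cast_nonneg d).trans_lt hs
  have hsum := summable_lattice hs
  refine ⟨∑' m : Fin d → ℤ, ‖m‖ ^ (-s), tsum_nonneg fun m => by positivity, ?_⟩
  set κ := ∑' m : Fin d → ℤ, ‖m‖ ^ (-s) with hκ
  have hκ0 : 0 ≤ κ := tsum_nonneg fun m => by positivity
  intro k n δ A hk hδ0 hδ hA hn
  have hk0 : (0 : ℝ) < k := by exact_mod_cast hk
  obtain ⟨z, hz, hzA⟩ := exists_rieszEnergy_lt hn
  let Q : Finset (Fin d → ℤ) := Fintype.piFinset fun _ => Finset.Ico (0 : ℤ) k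
  have hQcard : Fintype.card Q = k ^ d := by simp [Q]
  let x : (Σ _ : Q, Fin n) → E d := fun a => gridPoint k δ a.1 (z a.2)
  -- the cells fill `[0,1]ᵈ`; `v` recentres this cube at the origin
  let v : E d := WithLp.toLp 2 fun _ => (-(1 / 2) : ℝ)
  have hx : ∀ a, v + (1 : ℝ) • x a ∈ cube d 1 := by
    rintro ⟨⟨q, hq⟩, i⟩ j
    have hqj := Finset.mem_Ico.1 (Fintype.mem_piFinset.1 hq j)
    have h1 : (0 : ℝ) ≤ q j := by exact_mod_cast hqj.1
    have h2 : (q j : ℝ) + 1 ≤ k := by exact_mod_cast hqj.2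
    have h3 := hz i j
    rw [abs_le] at h3
    have h4 : 0 ≤ ((q j : ℝ) + 1 / 2 + (1 - δ) * z i j) / k := by
      apply div_nonneg _ hk0.le; nlinarith
    have h5 : ((q j : ℝ) + 1 / 2 + (1 - δ) * z i j) / k ≤ 1 := by
      rw [div_le_one hk0]; nlinarith
    have h6 : (v + (1 : ℝ) • x ⟨⟨q, hq⟩, i⟩) j =
      -(1 / 2) + ((q j : ℝ) + 1 / 2 + (1 - δ) * z i j) / k := by
      simp [v, x, gridPoint_apply]
    rw [h6, abs_le]; constructor <;> linarith
  have h1 := minRieszEnergy_card_le s (fun a => v + (1 : ℝ) • x a) hx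
  have hcard : Fintype.card (Σ _ : Q, Fin n) = k ^ d * n := by
    rw [Fintype.card_sigma]
    simp only [Fintype.card_fin, Finset.sum_const, Finset.card_univ, hQcard, smul_eq_mul]
  rw [hcard, pairEnergy_congr (y := x) (c := 1) fun i j _ => by
    rw [rieszKernel_smul_add one_pos]; simp, one_mul] at h1
  refine h1.trans ((pairEnergy_gridPoint_le hs0.le hk0 hδ Q (fun _ => n) (fun _ => z)
    (fun _ => hz)).trans ?_)
  -- factor gained by each copy when it is contracted to its reduced cell
  have e1 : ENNReal.ofReal ((1 - δ) / k) ^ (-s) = ENNReal.ofReal ((k : ℝ) ^ s * (1 - δ) ^ (-s)) := by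
    rw [ENNReal.ofReal_rpow_of_pos (div_pos (by linarith) hk0),
      Real.div_rpow (by linarith) hk0.le, Real.rpow_neg hk0.le, div_inv_eq_mul, mul_comm]
  -- the interaction of one copy with all the others is bounded by the whole lattice sum
  have e2 : ∀ q : Q, (∑ q' : Q, if q = q' then (0 : ℝ≥0∞) else
      (n * n : ℝ≥0∞) * ENNReal.ofReal (δ / k * ‖(q : Fin d → ℤ) - q'‖) ^ (-s)) ≤
      ENNReal.ofReal ((k : ℝ) ^ s * ((n : ℝ) ^ 2 * κ * δ ^ (-s))) := by
    intro q
    have hle : ∀ q' : Q, (if q = q' then (0 : ℝ≥0∞) else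
        (n * n : ℝ≥0∞) * ENNReal.ofReal (δ / k * ‖(q : Fin d → ℤ) - q'‖) ^ (-s)) ≤
        ENNReal.ofReal ((k : ℝ) ^ s * ((n : ℝ) ^ 2 * δ ^ (-s)) *
          ‖(q : Fin d → ℤ) - q'‖ ^ (-s)) := by
      intro q'
      split_ifs with h
      · exact zero_le
      · have hpos : 0 < ‖(q : Fin d → ℤ) - q'‖ := norm_pos_iff.2 (sub_ne_zero.2
          fun h' => h (Subtype.ext h'))
        rw [ENNReal.ofReal_rpow_of_pos (by positivity), ← ENNReal.ofReal_natCast n,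
          ← ENNReal.ofReal_mul (by positivity), ← ENNReal.ofReal_mul (by positivity)]
        refine ENNReal.ofReal_le_ofReal (le_of_eq ?_)
        rw [Real.mul_rpow (by positivity) hpos.le, Real.div_rpow hδ0.le hk0.le,
          Real.rpow_neg hk0.le, div_inv_eq_mul]
        ring
    refine (Finset.sum_le_sum fun q' _ => hle q').trans ?_
    rw [← ENNReal.ofReal_sum_of_nonneg fun q' _ => by positivity, ← Finset.mul_sum]
    refine ENNReal.ofReal_le_ofReal ?_
    have h2 : ∑ q' : Q, ‖(q : Fin d → ℤ) - q'‖ ^ (-s) ≤ κ := by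
      have hs2 : Summable fun q' : Fin d → ℤ => ‖(q : Fin d → ℤ) - q'‖ ^ (-s) :=
        (Equiv.subLeft (q : Fin d → ℤ)).summable_iff.2 hsum
      have hs3 : ∑' q' : Fin d → ℤ, ‖(q : Fin d → ℤ) - q'‖ ^ (-s) = κ :=
        (Equiv.subLeft (q : Fin d → ℤ)).tsum_eq fun m : Fin d → ℤ => ‖m‖ ^ (-s)
      rw [Finset.sum_coe_sort Q fun q' => ‖(q : Fin d → ℤ) - q'‖ ^ (-s), ← hs3]
      exact hs2.sum_le_tsum _ fun _ _ => by positivity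
    calc _ ≤ (k : ℝ) ^ s * ((n : ℝ) ^ 2 * δ ^ (-s)) * κ := by gcongr
      _ = _ := by ring
  calc _ ≤ ∑ _q : Q, ENNReal.ofReal ((k : ℝ) ^ s * (1 - δ) ^ (-s)) * ENNReal.ofReal A +
        ∑ _q : Q, ENNReal.ofReal ((k : ℝ) ^ s * ((n : ℝ) ^ 2 * κ * δ ^ (-s))) := by
        rw [e1]
        gcongr with q _ q _
        exact e2 q
    _ = _ := by
        have hδ' : 0 < 1 - δ := by linarith
        rw [← Finset.sum_add_distrib, Finset.sum_const, Finset.card_univ, hQcard, nsmul_eq_mul,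
          ← ENNReal.ofReal_mul (by positivity), ← ENNReal.ofReal_add (by positivity) (by positivity),
          ← ENNReal.ofReal_natCast, ← ENNReal.ofReal_mul (by positivity)]
        congr 1
        rw [Real.rpow_add hk0, Real.rpow_natCast]
        push_cast
        ring

/-- One point in each cell of a grid gives a system with energy of the order `N ^ (1 + s / d)`. -/
lemma rieszConstant_lt_top (hd : 1 ≤ d) {s : ℝ} (hs : (d : ℝ) < s) : rieszConstant s d < ∞ := by
  obtain ⟨κ, hκ, h⟩ := minRieszEnergy_pow_mul_le hs
  set B := (1 - 1 / 2 : ℝ) ^ (-s) * 1 + ((1 : ℕ) : ℝ) ^ 2 * κ * (1 / 2) ^ (-s) with hB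
  have h1 : minRieszEnergy s (cube d 1) 1 < ENNReal.ofReal 1 := by
    refine (minRieszEnergy_le s (fun _ : Fin 1 => (0 : E d)) fun i j => by simp).trans_lt ?_
    simp [rieszEnergy]
  have hd0 : (0 : ℝ) < d := by exact_mod_cast hd
  refine lt_of_le_of_lt (b := ENNReal.ofReal B) ?_ ENNReal.ofReal_lt_top
  refine liminf_le_of_frequently_le' (frequently_atTop.2 fun N => ⟨(N + 1) ^ d, ?_, ?_⟩)
  · exact (Nat.le_succ N).trans (Nat.le_self_pow (by omega) _)
  · have h2 := h (N + 1) 1 (1 / 2) 1 (by omega) (by norm_num) (by norm_num) (by norm_num) h1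
    rw [mul_one] at h2
    have hN : (0 : ℝ) < ((N + 1 : ℕ) : ℝ) := by positivity
    refine ENNReal.div_le_of_le_mul (h2.trans_eq ?_)
    rw [← ENNReal.ofReal_natCast, ENNReal.ofReal_rpow_of_pos (by positivity),
      ← ENNReal.ofReal_mul (by positivity), ← hB, mul_comm B]
    congr 2
    push_cast
    rw [← Real.rpow_natCast, ← Real.rpow_mul (by positivity)]
    congr 1
    field_simp

/-- The minimal energies satisfy `limsup ≤ liminf`, by subdivision: the interaction between
different copies is negligible with respect to the energy of each copy because `s > d`. -/
lemma eventually_minRieszEnergy_le (hd : 1 ≤ d) {s : ℝ} (hs : (d : ℝ) < s) {c : ℝ}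
    (hc : rieszConstant s d < ENNReal.ofReal c) :
    ∀ᶠ n : ℕ in atTop, minRieszEnergy s (cube d 1) n ≤ ENNReal.ofReal (c * (n : ℝ) ^ (1 + s / d)) := by
  obtain ⟨κ, hκ, h⟩ := minRieszEnergy_pow_mul_le hs
  have hd0 : (0 : ℝ) < d := by exact_mod_cast hd
  set p := 1 + s / d with hp
  have hp2 : 2 < p := by
    have : 1 < s / d := (one_lt_div hd0).2 hs
    linarith
  obtain ⟨c₁', hc₁, hc₁'⟩ := exists_between hc
  lift c₁' to ℝ≥0 using hc₁'.ne_top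
  set c₁ : ℝ := (c₁' : ℝ) with hc₁def
  have hcc : c₁ < c := by
    have : ENNReal.ofReal c₁ < ENNReal.ofReal c := by simpa [hc₁def] using hc₁'
    exact (ENNReal.ofReal_lt_ofReal_iff_of_nonneg c₁'.2).1 this
  have hc₁0 : 0 ≤ c₁ := c₁'.2
  -- half of the gap `c - c₁` absorbs the contraction and the cross interactions, the other half
  -- the rounding of the number of cells
  set c₂ := (c₁ + c) / 2 with hc₂
  obtain ⟨δ, hδ, hδ0, hδ1⟩ : ∃ δ : ℝ, (1 - δ) ^ (-s) * c₁ < c₂ ∧ 0 < δ ∧ δ < 1 := by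
    have hcont : ContinuousAt (fun δ : ℝ => (1 - δ) ^ (-s) * c₁) 0 := by
      refine ContinuousAt.mul (ContinuousAt.rpow_const (by fun_prop) (by simp)) continuousAt_const
    have h1 : ∀ᶠ δ : ℝ in 𝓝 0, (1 - δ) ^ (-s) * c₁ < c₂ :=
      hcont.tendsto.eventually (gt_mem_nhds (by simp [hc₂]; linarith))
    have h2 : ∀ᶠ δ : ℝ in 𝓝[>] 0, (1 - δ) ^ (-s) * c₁ < c₂ := h1.filter_mono nhdsWithin_le_nhds
    have h3 : ∀ᶠ δ : ℝ in 𝓝[>] 0, δ < 1 := (gt_mem_nhds one_pos).filter_mono nhdsWithin_le_nhds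
    obtain ⟨δ, h⟩ := (h2.and (h3.and self_mem_nhdsWithin)).exists
    exact ⟨δ, h.1, h.2.2, h.2.1⟩
  -- a near optimal number of points, so large that the cross interactions, of order `m ^ 2`, are
  -- small compared with `m ^ p`; this uses `p > 2`
  obtain ⟨m, hm, hm1, hm2⟩ : ∃ m : ℕ, minRieszEnergy s (cube d 1) m / (m : ℝ≥0∞) ^ p < c₁' ∧
      1 ≤ m ∧ (m : ℝ) ^ 2 * κ * δ ^ (-s) ≤ (c₂ - (1 - δ) ^ (-s) * c₁) * (m : ℝ) ^ p := by
    have h1 : ∃ᶠ m : ℕ in atTop, minRieszEnergy s (cube d 1) m / (m : ℝ≥0∞) ^ p < c₁' :=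
      frequently_lt_of_liminf_lt (by isBoundedDefault) hc₁
    have h2 : Tendsto (fun m : ℕ => κ * δ ^ (-s) * (m : ℝ) ^ (-(p - 2))) atTop (𝓝 (κ * δ ^ (-s) * 0)) :=
      ((tendsto_rpow_neg_atTop (by linarith)).comp tendsto_natCast_atTop_atTop).const_mul _
    rw [mul_zero] at h2
    have h3 := (h2.eventually (gt_mem_nhds (sub_pos.2 hδ))).and (eventually_ge_atTop 1)
    obtain ⟨m, h4, h5, h6⟩ := (h1.and_eventually h3).exists
    refine ⟨m, h4, h6, ?_⟩
    have hm0 : (0 : ℝ) < m := by exact_mod_cast h6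
    have h7 : (m : ℝ) ^ 2 = (m : ℝ) ^ (-(p - 2)) * (m : ℝ) ^ p := by
      rw [← Real.rpow_add hm0, ← Real.rpow_natCast]; congr 1; push_cast; ring
    have h8 : 0 < (m : ℝ) ^ p := by positivity
    rw [h7]
    nlinarith
  have hm0 : (0 : ℝ) < m := by exact_mod_cast hm1
  have hmA : minRieszEnergy s (cube d 1) m < ENNReal.ofReal (c₁ * (m : ℝ) ^ p) := by
    rw [ENNReal.div_lt_iff (.inl (by simp; omega)) (.inl (by
      exact ENNReal.rpow_ne_top_of_nonneg (by linarith) (by simp)))] at hm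
    refine hm.trans_eq ?_
    rw [ENNReal.ofReal_mul hc₁0, ← ENNReal.ofReal_rpow_of_pos hm0]
    simp [hc₁def]
  have hk : ∀ k : ℕ, 1 ≤ k → minRieszEnergy s (cube d 1) (k ^ d * m) ≤
      ENNReal.ofReal (c₂ * ((k : ℝ) ^ d * m) ^ p) := by
    intro k hk
    have hk0 : (0 : ℝ) < k := by exact_mod_cast hk
    refine (h k m δ _ hk hδ0 hδ1 (by positivity) hmA).trans (ENNReal.ofReal_le_ofReal ?_)
    have e1 : ((k : ℝ) ^ d * m) ^ p = (k : ℝ) ^ (d + s) * (m : ℝ) ^ p := by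
      rw [Real.mul_rpow (by positivity) hm0.le, ← Real.rpow_natCast, ← Real.rpow_mul hk0.le]
      congr 2
      rw [hp]; field_simp
    rw [e1]
    have : 0 < (k : ℝ) ^ (d + s) := by positivity
    calc _ ≤ (k : ℝ) ^ (d + s) * (c₂ * (m : ℝ) ^ p) := by
          gcongr
          linarith
      _ = _ := by ring
  have hc₂0 : 0 < c₂ := by linarith
  have hc₂c : c₂ < c := by linarith
  -- for a general `n`, use the least number `k ^ d` of cells such that `n ≤ k ^ d * m`; with `t ^
  -- d = n / m` one has `k ≤ t + 1`
  have ht : Tendsto (fun n : ℕ => ((n : ℝ) / m) ^ (1 / (d : ℝ))) atTop atTop :=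
    (tendsto_rpow_atTop (by positivity)).comp
      (tendsto_natCast_atTop_atTop.atTop_div_const hm0)
  have hlim : Tendsto (fun n : ℕ => c₂ * (1 + (((n : ℝ) / m) ^ (1 / (d : ℝ)))⁻¹) ^ ((d : ℝ) * p)) atTop
      (𝓝 (c₂ * (1 + 0) ^ ((d : ℝ) * p))) :=
    (((tendsto_inv_atTop_zero.comp ht).const_add 1).rpow_const (.inl (by norm_num))).const_mul _
  rw [add_zero, Real.one_rpow, mul_one] at hlim
  filter_upwards [hlim.eventually (gt_mem_nhds hc₂c), eventually_ge_atTop 1] with n hn hn1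
  have hn0 : (0 : ℝ) < n := by exact_mod_cast hn1
  set t := ((n : ℝ) / m) ^ (1 / (d : ℝ)) with htdef
  have ht0 : 0 < t := by positivity
  have htd : t ^ (d : ℝ) = n / m := by
    rw [htdef, ← Real.rpow_mul (by positivity)]
    rw [one_div_mul_cancel hd0.ne', Real.rpow_one]
  set k := ⌈t⌉₊ with hkdef
  have hkt : t ≤ k := Nat.le_ceil t
  have hkt' : (k : ℝ) ≤ t + 1 := (Nat.ceil_lt_add_one ht0.le).le
  have hk1 : 1 ≤ k := Nat.one_le_ceil_iff.2 ht0
  have hnk : n ≤ k ^ d * m := by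
    have : (n : ℝ) ≤ (k : ℝ) ^ d * m := by
      rw [← div_le_iff₀ hm0, ← htd, ← Real.rpow_natCast]
      exact Real.rpow_le_rpow ht0.le hkt hd0.le
    exact_mod_cast this
  refine (minRieszEnergy_mono s _ hnk).trans ((hk k hk1).trans (ENNReal.ofReal_le_ofReal ?_))
  have h1 : (k : ℝ) ^ d * m ≤ (1 + t⁻¹) ^ (d : ℝ) * n := by
    have h2 : (k : ℝ) ≤ (1 + t⁻¹) * t := by
      rw [add_mul, inv_mul_cancel₀ ht0.ne']; linarith
    calc (k : ℝ) ^ d * m = (k : ℝ) ^ (d : ℝ) * m := by rw [Real.rpow_natCast]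
      _ ≤ ((1 + t⁻¹) * t) ^ (d : ℝ) * m := by gcongr
      _ = (1 + t⁻¹) ^ (d : ℝ) * (n / m * m) := by
          rw [Real.mul_rpow (by positivity) ht0.le, htd]; ring
      _ = _ := by rw [div_mul_cancel₀ _ hm0.ne']
  calc c₂ * ((k : ℝ) ^ d * m) ^ p ≤ c₂ * ((1 + t⁻¹) ^ (d : ℝ) * n) ^ p := by
        gcongr
    _ = c₂ * (1 + t⁻¹) ^ ((d : ℝ) * p) * (n : ℝ) ^ p := by
        rw [Real.mul_rpow (by positivity) hn0.le, Real.rpow_mul (by positivity)]; ring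
    _ ≤ c * (n : ℝ) ^ p := by gcongr


lemma edist_le_of_coord {x y : E d} {r : ℝ} (hr : 0 ≤ r) (h : ∀ j, |x j - y j| ≤ r) :
    edist x y ≤ ENNReal.ofReal (√d * r) := by
  rw [edist_dist]
  refine ENNReal.ofReal_le_ofReal ?_
  rw [EuclideanSpace.dist_eq, ← Real.sqrt_sq hr, ← Real.sqrt_mul (Nat.cast_nonneg d)]
  refine Real.sqrt_le_sqrt ?_
  calc ∑ j, dist (x j) (y j) ^ 2 ≤ ∑ _j : Fin d, r ^ 2 := by
        refine Finset.sum_le_sum fun j _ => ?_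
        rw [Real.dist_eq]
        exact pow_le_pow_left₀ (abs_nonneg _) (h j) 2
    _ = d * r ^ 2 := by simp

/-- By the Cauchy–Schwarz inequality, at least `n ^ 2 / M` ordered pairs among `n` objects share
their class in a partition in `M` classes. -/
lemma sq_card_le_mul_card_pairs {ι κ : Type*} [Fintype ι] [DecidableEq κ] (φ : ι → κ)
    (T : Finset κ) (hφ : ∀ i, φ i ∈ T) :
    (Fintype.card ι) ^ 2 ≤ T.card * ∑ i, ∑ j, if φ i = φ j then 1 else 0 := by
  have h1 : Fintype.card ι = ∑ c ∈ T, (Finset.univ.filter fun i => φ i = c).card :=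
    Finset.card_eq_sum_card_fiberwise (fun i _ => hφ i)
  have h2 : ∑ c ∈ T, (Finset.univ.filter fun i => φ i = c).card ^ 2 =
      ∑ i, ∑ j, if φ i = φ j then 1 else 0 := by
    have : ∀ c, (Finset.univ.filter fun i => φ i = c).card ^ 2 =
        ∑ i, ∑ j, if φ i = c ∧ φ j = c then 1 else 0 := fun c => by
      rw [sq, Finset.card_filter, Finset.sum_mul_sum]
      refine Finset.sum_congr rfl fun i _ => Finset.sum_congr rfl fun j _ => ?_
      by_cases h : φ i = c <;> simp [h]
    simp_rw [this]
    rw [Finset.sum_comm]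
    refine Finset.sum_congr rfl fun i _ => ?_
    rw [Finset.sum_comm]
    refine Finset.sum_congr rfl fun j _ => ?_
    rw [Finset.sum_eq_single (φ i)]
    · simp [eq_comm]
    · intro c _ hc; simp [Ne.symm hc]
    · intro h; exact absurd (hφ i) h
  rw [h1, ← h2]
  exact sq_sum_le_card_mul_sum_sq

/-- Lower bound for the energy of `n` points of the unit cube, obtained from the pairs sharing a
cell of a grid with at most `n / 2` cells. -/
lemma exists_le_minRieszEnergy (hd : 1 ≤ d) {s : ℝ} (hs : 0 < s) :
    ∃ c : ℝ, 0 < c ∧ ∀ᶠ n : ℕ in atTop,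
      ENNReal.ofReal (c * (n : ℝ) ^ (1 + s / d)) ≤ minRieszEnergy s (cube d 1) n := by
  have hd0 : (0 : ℝ) < d := by exact_mod_cast hd
  refine ⟨(√d) ^ (-s) * (2 ^ (1 / (d : ℝ)) * 4) ^ (-s), by positivity, ?_⟩
  have ht : Tendsto (fun n : ℕ => ((n : ℝ) / 2) ^ (1 / (d : ℝ))) atTop atTop :=
    (tendsto_rpow_atTop (by positivity)).comp
      (tendsto_natCast_atTop_atTop.atTop_div_const two_pos)
  filter_upwards [ht.eventually_ge_atTop 2, eventually_ge_atTop 1] with n hn hn1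
  have hn0 : (0 : ℝ) < n := by exact_mod_cast hn1
  set t := ((n : ℝ) / 2) ^ (1 / (d : ℝ)) with htdef
  have ht0 : 0 < t := by linarith
  have htd : t ^ (d : ℝ) = n / 2 := by
    rw [htdef, ← Real.rpow_mul (by positivity), one_div_mul_cancel hd0.ne', Real.rpow_one]
  -- the coordinates of the cells take the `k + 1` values `0, …, k`, so `(k + 1) ^ d ≤ n / 2`
  -- cells are used; the constant of the statement comes from `k ≥ t / 4` and the diameter `√d /
  -- k` of a cell
  obtain ⟨k, hk1, hk2, hk3⟩ : ∃ k : ℕ, 1 ≤ k ∧ ((k : ℝ) + 1) ≤ t ∧ t / 4 ≤ k := by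
    have h1 : 2 ≤ ⌊t⌋₊ := Nat.le_floor (by exact_mod_cast hn)
    refine ⟨⌊t⌋₊ - 1, by omega, ?_, ?_⟩
    · rw [Nat.cast_sub (by omega)]; push_cast
      linarith [Nat.floor_le ht0.le]
    · rw [Nat.cast_sub (by omega)]; push_cast
      have := Nat.lt_floor_add_one t
      have h2 : (2 : ℝ) ≤ ⌊t⌋₊ := by exact_mod_cast h1
      linarith
  have hk0 : (0 : ℝ) < k := by exact_mod_cast hk1
  refine le_iInf fun x => ?_
  let y : Fin n → E d := fun i => x i
  change _ ≤ rieszEnergy s y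
  rw [rieszEnergy_eq_pairEnergy]
  let φ : Fin n → Fin d → ℤ := fun i j => ⌊(k : ℝ) * (y i j + 1 / 2)⌋
  let T : Finset (Fin d → ℤ) := Fintype.piFinset fun _ => Finset.Icc (0 : ℤ) k
  have hφ : ∀ i, φ i ∈ T := fun i => Fintype.mem_piFinset.2 fun j => by
    have := (x i).2 j
    rw [abs_le] at this
    rw [Finset.mem_Icc]
    refine ⟨Int.floor_nonneg.2 (mul_nonneg hk0.le (by simp only [y]; linarith)), ?_⟩
    rw [← Int.cast_le (R := ℝ)]
    refine (Int.floor_le _).trans ?_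
    push_cast
    have h1 : y i j + 1 / 2 ≤ 1 := by simp only [y]; linarith
    nlinarith
  have hT : ((T.card : ℕ) : ℝ) ≤ n / 2 := by
    have : T.card = (k + 1) ^ d := by simp [T]
    rw [this, ← htd, Real.rpow_natCast]
    push_cast
    gcongr
  -- by Cauchy–Schwarz; removing the `n` diagonal pairs leaves at least `n` of them
  have hpairs : (2 * n : ℝ) ≤ ∑ i, ∑ j, if φ i = φ j then (1 : ℝ) else 0 := by
    have h1 : (n : ℝ) ^ 2 ≤ T.card * ∑ i, ∑ j, if φ i = φ j then (1 : ℝ) else 0 := by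
      have := sq_card_le_mul_card_pairs φ T hφ
      rw [Fintype.card_fin] at this
      exact_mod_cast this
    have h2 : (0 : ℝ) ≤ ∑ i, ∑ j, if φ i = φ j then (1 : ℝ) else 0 :=
      Finset.sum_nonneg fun i _ => Finset.sum_nonneg fun j _ => by split_ifs <;> norm_num
    nlinarith
  have hpairs' : (n : ℝ) ≤ ∑ i, ∑ j, if i ≠ j ∧ φ i = φ j then (1 : ℝ) else 0 := by
    have h1 : ∀ i : Fin n, (∑ j, if φ i = φ j then (1 : ℝ) else 0) =
        1 + ∑ j, if i ≠ j ∧ φ i = φ j then (1 : ℝ) else 0 := fun i => by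
      rw [← Finset.add_sum_erase Finset.univ _ (Finset.mem_univ i), if_pos rfl,
        ← Finset.add_sum_erase Finset.univ (fun j => if i ≠ j ∧ φ i = φ j then (1 : ℝ) else 0)
        (Finset.mem_univ i)]
      simp only [ne_eq, not_true_eq_false, false_and, if_false, zero_add]
      congr 1
      refine Finset.sum_congr rfl fun j hj => ?_
      simp [Ne.symm (Finset.ne_of_mem_erase hj)]
    simp_rw [h1, Finset.sum_add_distrib] at hpairs
    simp only [Finset.sum_const, Finset.card_univ, Fintype.card_fin, nsmul_eq_mul, mul_one]
      at hpairs
    linarith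
  have hker : ∀ i j, φ i = φ j → ENNReal.ofReal ((√d * (1 / k)) ^ (-s)) ≤
      rieszKernel s (y i) (y j) := fun i j hij => by
    rw [← ENNReal.ofReal_rpow_of_pos (by positivity)]
    refine le_rieszKernel hs.le (edist_le_of_coord (by positivity) fun l => ?_)
    have h1 := congrFun hij l
    have h2 := Int.abs_sub_lt_one_of_floor_eq_floor h1
    rw [← mul_sub, abs_mul, abs_of_pos hk0] at h2
    rw [le_div_iff₀' hk0]
    have h3 : y i l + 1 / 2 - (y j l + 1 / 2) = y i l - y j l := by ring
    rw [h3] at h2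
    exact h2.le
  calc ENNReal.ofReal ((√d) ^ (-s) * (2 ^ (1 / (d : ℝ)) * 4) ^ (-s) * (n : ℝ) ^ (1 + s / d))
      ≤ ENNReal.ofReal ((∑ i, ∑ j, if i ≠ j ∧ φ i = φ j then (1 : ℝ) else 0) *
        (√d * (1 / k)) ^ (-s)) := by
        refine ENNReal.ofReal_le_ofReal ?_
        have e1 : (n : ℝ) ^ (1 + s / d) = n * (2 ^ (1 / (d : ℝ)) * t) ^ s := by
          rw [htdef, ← Real.mul_rpow (by norm_num) (by positivity), mul_div_cancel₀ _ two_ne_zero,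
            ← Real.rpow_mul hn0.le, Real.rpow_add hn0, Real.rpow_one]
          congr 2; ring
        have e2 : (2 ^ (1 / (d : ℝ)) * 4 : ℝ) ^ (-s) * (2 ^ (1 / (d : ℝ)) * t) ^ s =
            (t / 4) ^ s := by
          rw [Real.rpow_neg (by positivity), ← Real.inv_rpow (by positivity),
            ← Real.mul_rpow (by positivity) (by positivity)]
          congr 1
          field_simp
        have e3 : (√d * (1 / k)) ^ (-s) = (√d) ^ (-s) * (k : ℝ) ^ s := by
          rw [Real.mul_rpow (by positivity) (by positivity), one_div, Real.inv_rpow hk0.le,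
            Real.rpow_neg hk0.le, inv_inv]
        rw [e1, e3]
        calc _ = n * ((√d) ^ (-s) * (t / 4) ^ s) := by rw [← e2]; ring
          _ ≤ _ := by gcongr
    _ = ∑ i, ∑ j, if i ≠ j ∧ φ i = φ j then ENNReal.ofReal ((√d * (1 / k)) ^ (-s)) else 0 := by
        rw [Finset.sum_mul, ENNReal.ofReal_sum_of_nonneg]
        · refine Finset.sum_congr rfl fun i _ => ?_
          rw [Finset.sum_mul, ENNReal.ofReal_sum_of_nonneg]
          · refine Finset.sum_congr rfl fun j _ => ?_
            split_ifs <;> simp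
          · intro j _; split_ifs <;> simp; positivity
        · intro i _
          exact mul_nonneg (Finset.sum_nonneg fun j _ => by split_ifs <;> norm_num) (by positivity)
    _ ≤ pairEnergy s y := by
        refine Finset.sum_le_sum fun i _ => Finset.sum_le_sum fun j _ => ?_
        by_cases hij : i = j
        · simp [hij]
        · simp only [ne_eq, hij, not_false_eq_true, true_and, if_false]
          split_ifs with h
          · exact hker i j h
          · exact zero_le

lemma rieszConstant_pos (hd : 1 ≤ d) {s : ℝ} (hs : 0 < s) : 0 < rieszConstant s d := by
  obtain ⟨c, hc, h⟩ := exists_le_minRieszEnergy hd hs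
  refine (ENNReal.ofReal_pos.2 hc).trans_le (le_liminf_of_le (by isBoundedDefault) ?_)
  filter_upwards [h, eventually_ge_atTop 1] with n hn hn1
  have hn0 : (0 : ℝ) < n := by exact_mod_cast hn1
  rw [ENNReal.le_div_iff_mul_le (.inl (by simp; omega)) (.inl (by
    exact ENNReal.rpow_ne_top_of_nonneg (by positivity) (by simp)))]
  refine le_trans (le_of_eq ?_) hn
  rw [ENNReal.ofReal_mul hc.le, ← ENNReal.ofReal_rpow_of_pos hn0, ENNReal.ofReal_natCast]

/-- Minimal energies are bounded below for every number of points, up to a shift of this number. -/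
lemma exists_mul_sub_rpow_le (hd : 1 ≤ d) {s : ℝ} (hs : 0 < s) {c : ℝ≥0∞}
    (hc : c < rieszConstant s d) : ∃ m : ℕ, ∀ n : ℕ,
      c * ((n - m : ℕ) : ℝ≥0∞) ^ (1 + s / d) ≤ minRieszEnergy s (cube d 1) n := by
  obtain ⟨m, hm⟩ := eventually_atTop.1 (eventually_lt_of_lt_liminf hc)
  have hp : 0 < 1 + s / (d : ℝ) := by positivity
  refine ⟨m + 1, fun n => ?_⟩
  -- the truncated subtraction makes the bound trivial for few points
  rcases le_or_gt (m + 1) n with h | h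
  · have h1 := hm n (by omega)
    rw [ENNReal.lt_div_iff_mul_lt (.inl (by simp; omega)) (.inl (by
      exact ENNReal.rpow_ne_top_of_nonneg hp.le (by simp)))] at h1
    refine le_trans ?_ h1.le
    gcongr
    exact_mod_cast Nat.sub_le n (m + 1)
  · rw [Nat.sub_eq_zero_of_le h.le, Nat.cast_zero, ENNReal.zero_rpow_of_pos hp, mul_zero]
    exact zero_le


/-! ### The macroscopic problem -/

lemma lintegral_leb {Ω : Set (E d)} (hΩ : MeasurableSet Ω) (f : E d → ℝ≥0∞) :
    ∫⁻ x, f x ∂leb Ω = ∫⁻ x in Ω, f x := lintegral_subtype_comap hΩ f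

lemma map_leb {Ω : Set (E d)} (hΩ : MeasurableSet Ω) :
    (leb Ω).map Subtype.val = (volume : Measure (E d)).restrict Ω := map_comap_subtype_coe hΩ _

lemma leb_apply {Ω : Set (E d)} (hΩ : MeasurableSet Ω) (A : Set Ω) :
    leb Ω A = volume (Subtype.val '' A) := comap_subtype_coe_apply hΩ _ A

lemma leb_norm_le_lt_top {Ω : Set (E d)} (hΩ : MeasurableSet Ω) (R : ℝ) :
    leb Ω {x | ‖(x : E d)‖ ≤ R} < ∞ := by
  rw [leb_apply hΩ]
  refine (measure_mono (t := Metric.closedBall (0 : E d) R) ?_).trans_lt measure_closedBall_lt_top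
  rintro _ ⟨x, hx, rfl⟩
  simpa using hx

lemma sigmaFinite_leb {Ω : Set (E d)} (hΩ : MeasurableSet Ω) : SigmaFinite (leb Ω) :=
  ⟨⟨{ set := fun n => {x | ‖(x : E d)‖ ≤ n}
      set_mem := fun _ => trivial
      finite := fun n => leb_norm_le_lt_top hΩ n
      spanning := by
        ext x
        simpa using exists_nat_ge ‖(x : E d)‖ }⟩⟩

lemma Confining.exists_le {Ω : Set (E d)} {V : Ω → ℝ} (h : Confining V) (M : ℝ) :
    ∃ k : ℝ, ∀ x : Ω, k < ‖(x : E d)‖ → M ≤ V x := by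
  by_cases hb : Bornology.IsBounded Ω
  · obtain ⟨R, hR⟩ := hb.subset_closedBall (0 : E d)
    exact ⟨R, fun x hx => absurd (hR x.2) (by simpa using hx)⟩
  · have h1 := (h hb).1.eventually_ge_atTop M
    rw [eventually_comap, eventually_atTop] at h1
    obtain ⟨k, hk⟩ := h1
    exact ⟨k, fun x hx => hk _ hx.le x rfl⟩

/-- Strict form of the inequality between the convex function `t ↦ tᵖ` and its tangents. -/
lemma tangent_lt_rpow {p t r : ℝ} (hp : 1 < p) (ht : 0 ≤ t) (hr : 0 ≤ r) (htr : t ≠ r) :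
    p * r ^ (p - 1) * t < t ^ p + (p - 1) * r ^ p := by
  rcases hr.eq_or_lt with rfl | hr
  · have ht' : 0 < t := lt_of_le_of_ne ht (Ne.symm htr)
    rw [Real.zero_rpow (by linarith), Real.zero_rpow (by linarith)]
    simp only [mul_zero, zero_mul, add_zero]
    positivity
  · have h1 := one_add_mul_self_lt_rpow_one_add (s := t / r - 1) (by
      have := div_nonneg ht hr.le; linarith) (by
      intro h; apply htr; rw [sub_eq_zero, div_eq_one_iff_eq hr.ne'] at h; exact h) hp
    rw [add_sub_cancel, Real.div_rpow ht hr.le, lt_div_iff₀ (by positivity)] at h1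
    have h2 : r ^ p = r ^ (p - 1) * r := by rw [← Real.rpow_add_one hr.ne']; congr 1; ring
    have h3 : (1 + p * (t / r - 1)) * r ^ p = p * r ^ (p - 1) * t - (p - 1) * r ^ p := by
      rw [h2]; field_simp; ring
    linarith

lemma tangent_le_rpow {p t r : ℝ} (hp : 1 < p) (ht : 0 ≤ t) (hr : 0 ≤ r) :
    p * r ^ (p - 1) * t ≤ t ^ p + (p - 1) * r ^ p := by
  rcases eq_or_ne t r with rfl | h
  · rcases ht.eq_or_lt with rfl | ht'
    · rw [Real.zero_rpow (by linarith : p ≠ 0)]; simp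
    · have h2 : t ^ p = t ^ (p - 1) * t := by rw [← Real.rpow_add_one ht'.ne']; congr 1; ring
      rw [h2]; apply le_of_eq; ring
  · exact (tangent_lt_rpow hp ht hr h).le

/-- The profile minimizing `t ↦ c tᵖ + (v - l) t` over `t ≥ 0`. -/
def profile (c p l v : ℝ) : ℝ := (max (l - v) 0 / (c * p)) ^ (1 / (p - 1))

lemma profile_nonneg {c p l v : ℝ} (hc : 0 < c) (hp : 1 < p) : 0 ≤ profile c p l v := by
  unfold profile
  exact Real.rpow_nonneg (div_nonneg (le_max_right _ _) (by positivity)) _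

lemma profile_eq_zero {c p l v : ℝ} (hp : 1 < p) (h : l ≤ v) : profile c p l v = 0 := by
  unfold profile
  rw [max_eq_right (by linarith), zero_div, Real.zero_rpow]
  exact (one_div_pos.2 (by linarith)).ne'

lemma mul_profile_rpow {c p l v : ℝ} (hc : 0 < c) (hp : 1 < p) :
    c * p * profile c p l v ^ (p - 1) = max (l - v) 0 := by
  unfold profile
  rw [← Real.rpow_mul (div_nonneg (le_max_right _ _) (by positivity)),
    one_div_mul_cancel (by linarith), Real.rpow_one]
  field_simp

lemma profile_lt {c p l v t : ℝ} (hc : 0 < c) (hp : 1 < p) (ht : 0 ≤ t)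
    (h : t ≠ profile c p l v) :
    c * profile c p l v ^ p + v * profile c p l v + l * t < c * t ^ p + v * t + l * profile c p l v := by
  set r := profile c p l v with hr
  have hr0 : 0 ≤ r := profile_nonneg hc hp
  have h1 := tangent_lt_rpow hp ht hr0 h
  have h2 : c * p * r ^ (p - 1) = max (l - v) 0 := mul_profile_rpow hc hp
  -- the stationarity condition of the minimization problem: either `r = 0`, or `c p r ^ (p - 1) =
  -- l - v`
  have h3 : (l - v) * r = c * p * r ^ p := by
    rcases le_or_gt l v with hlv | hlv
    · rw [hr, profile_eq_zero hp hlv, Real.zero_rpow (by linarith)]; ring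
    · rw [max_eq_left (by linarith)] at h2
      rw [← h2]
      have hr1 : r ≠ 0 := by
        intro h0
        rw [h0, Real.zero_rpow (by linarith)] at h2
        linarith
      have : r ^ p = r ^ (p - 1) * r := by rw [← Real.rpow_add_one hr1]; congr 1; ring
      rw [this]; ring
  have h4 : (l - v) * t ≤ c * p * r ^ (p - 1) * t := by
    rw [h2]; exact mul_le_mul_of_nonneg_right (le_max_left _ _) ht
  nlinarith

/-- The minimality of `profile` and its uniqueness, for extended nonnegative values `τ`. The terms
with `l` are moved so that no subtraction occurs. -/
lemma profile_le_ennreal {c p l v : ℝ} (hc : 0 < c) (hp : 1 < p) (hl : 0 ≤ l) (hv : 0 ≤ v)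
    (τ : ℝ≥0∞) :
    ENNReal.ofReal c * ENNReal.ofReal (profile c p l v) ^ p +
        ENNReal.ofReal v * ENNReal.ofReal (profile c p l v) + ENNReal.ofReal l * τ ≤
      ENNReal.ofReal c * τ ^ p + ENNReal.ofReal v * τ +
        ENNReal.ofReal l * ENNReal.ofReal (profile c p l v) ∧
    (τ ≠ ∞ → ENNReal.ofReal c * ENNReal.ofReal (profile c p l v) ^ p +
        ENNReal.ofReal v * ENNReal.ofReal (profile c p l v) + ENNReal.ofReal l * τ =
      ENNReal.ofReal c * τ ^ p + ENNReal.ofReal v * τ +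
        ENNReal.ofReal l * ENNReal.ofReal (profile c p l v) → τ = ENNReal.ofReal (profile c p l v)) := by
  have hr0 : 0 ≤ profile c p l v := profile_nonneg hc hp
  set r := profile c p l v with hr
  -- if `τ` is infinite then so is the right-hand side; the equality case excludes this value
  by_cases hτ : τ = ∞
  · refine ⟨?_, fun h => absurd hτ h⟩
    have hc' : ENNReal.ofReal c ≠ 0 := (ENNReal.ofReal_pos.2 hc).ne'
    rw [hτ, ENNReal.top_rpow_of_pos (by linarith), ENNReal.mul_top hc']
    simp
  · lift τ to ℝ≥0 using hτ
    have hτ' : ((τ : ℝ≥0) : ℝ≥0∞) = ENNReal.ofReal (τ : ℝ) := by simp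
    have hp0 : 0 ≤ p := by linarith
    have e1 : ∀ a b : ℝ, 0 ≤ a → 0 ≤ b → ENNReal.ofReal c * ENNReal.ofReal a ^ p +
        ENNReal.ofReal v * ENNReal.ofReal a + ENNReal.ofReal l * ENNReal.ofReal b =
        ENNReal.ofReal (c * a ^ p + v * a + l * b) := fun a b ha hb => by
      rw [ENNReal.ofReal_rpow_of_nonneg ha hp0, ← ENNReal.ofReal_mul hc.le,
        ← ENNReal.ofReal_mul hv, ← ENNReal.ofReal_mul hl,
        ← ENNReal.ofReal_add (by positivity) (by positivity),
        ← ENNReal.ofReal_add (by positivity) (by positivity)]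
    rw [hτ', e1 r τ hr0 τ.2, e1 τ r τ.2 hr0]
    constructor
    · refine ENNReal.ofReal_le_ofReal ?_
      rcases eq_or_ne (τ : ℝ) r with h | h
      · rw [h]
      · exact (profile_lt hc hp τ.2 h).le
    · intro _ heq
      by_contra hne
      have hne' : (τ : ℝ) ≠ r := fun h => hne (by rw [h])
      have h1 := profile_lt hc hp τ.2 hne'
      have h2 : 0 ≤ c * (τ : ℝ) ^ p + v * τ + l * r := by positivity
      have h3 : 0 ≤ c * r ^ p + v * r + l * τ := by positivity
      rw [ENNReal.ofReal_eq_ofReal_iff h3 h2] at heq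
      exact h1.ne heq

lemma continuous_profile {c p : ℝ} (hp : 1 < p) :
    Continuous fun a : ℝ × ℝ => profile c p a.1 a.2 := by
  unfold profile
  refine Continuous.rpow_const (by fun_prop) fun _ => .inr ?_
  exact (one_div_pos.2 (by linarith)).le

lemma profile_mono {c p l l' v : ℝ} (hc : 0 < c) (hp : 1 < p) (h : l ≤ l') :
    profile c p l v ≤ profile c p l' v := by
  unfold profile
  refine Real.rpow_le_rpow (div_nonneg (le_max_right _ _) (by positivity)) ?_
    (one_div_pos.2 (by linarith)).le
  gcongr

/-- The multiplier for which the minimizing profile has mass `1`. -/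
lemma exists_lintegral_profile_eq_one {Ω : Set (E d)} (hΩ : MeasurableSet Ω)
    (hΩ_pos : 0 < volume Ω) {V : Ω → ℝ} (hV : Continuous V) (hV0 : ∀ x, 0 ≤ V x)
    (hconf : Confining V) {c p : ℝ} (hc : 0 < c) (hp : 1 < p) :
    ∃ l : ℝ, 0 ≤ l ∧ ∫⁻ x, ENNReal.ofReal (profile c p l (V x)) ∂leb Ω = 1 := by
  set F : ℝ → ℝ≥0∞ := fun l => ∫⁻ x, ENNReal.ofReal (profile c p l (V x)) ∂leb Ω with hF
  have hmeas : ∀ l, Measurable fun x => ENNReal.ofReal (profile c p l (V x)) := fun l =>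
    (((continuous_profile hp).comp (continuous_const.prodMk hV)).measurable).ennreal_ofReal
  -- the profile is bounded and, by confinement, supported in a ball
  have hfin : ∀ l, F l ≠ ∞ := fun l => by
    obtain ⟨k, hk⟩ := hconf.exists_le l
    have hb : ∀ x, ENNReal.ofReal (profile c p l (V x)) ≤
        {x : Ω | ‖(x : E d)‖ ≤ k}.indicator (fun _ => ENNReal.ofReal (profile c p l 0)) x := by
      intro x
      by_cases hx : ‖(x : E d)‖ ≤ k
      · rw [indicator_of_mem (by exact hx)]
        refine ENNReal.ofReal_le_ofReal ?_
        unfold profile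
        refine Real.rpow_le_rpow (div_nonneg (le_max_right _ _) (by positivity)) ?_
          (one_div_pos.2 (by linarith)).le
        have := hV0 x
        gcongr
      · rw [profile_eq_zero hp (hk x (not_le.1 hx))]; simp
    refine ((lintegral_mono hb).trans_lt ?_).ne
    rw [lintegral_indicator_const (by
      exact (isClosed_le (by fun_prop) continuous_const).measurableSet)]
    exact ENNReal.mul_lt_top ENNReal.ofReal_lt_top (leb_norm_le_lt_top hΩ k)
  have hF0 : F 0 = 0 := by
    simp only [hF, profile_eq_zero hp (hV0 _)]
    simp
  -- as `l → ∞` the mass tends to infinity, because it does so on a set `{V ≤ k}` of positive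
  -- volume
  obtain ⟨L, hL0, hL⟩ : ∃ L : ℝ, 0 ≤ L ∧ 1 ≤ F L := by
    obtain ⟨k, hk⟩ : ∃ k : ℕ, leb Ω {x | V x ≤ k} ≠ 0 := by
      by_contra hcon
      push Not at hcon
      have : leb Ω univ = 0 := by
        have hU : (univ : Set Ω) = ⋃ k : ℕ, {x | V x ≤ k} := by
          ext x
          simpa using exists_nat_ge (V x)
        rw [hU]
        exact measure_iUnion_null hcon
      rw [leb_apply hΩ] at this
      simp only [image_univ, Subtype.range_coe_subtype] at this
      exact hΩ_pos.ne' this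
    have hlow : ∀ L : ℝ, ENNReal.ofReal (profile c p L k) * leb Ω {x | V x ≤ k} ≤ F L := by
      intro L
      rw [← lintegral_indicator_const (isClosed_le hV continuous_const).measurableSet]
      refine lintegral_mono fun x => ?_
      by_cases hx : V x ≤ k
      · rw [indicator_of_mem (by exact hx)]
        refine ENNReal.ofReal_le_ofReal ?_
        unfold profile
        refine Real.rpow_le_rpow (div_nonneg (le_max_right _ _) (by positivity)) ?_
          (one_div_pos.2 (by linarith)).le
        gcongr
      · rw [indicator_of_notMem (by exact hx)]; exact zero_le
    have ht : Tendsto (fun L : ℝ => profile c p L k) atTop atTop := by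
      unfold profile
      refine (tendsto_rpow_atTop (one_div_pos.2 (by linarith))).comp ?_
      refine Tendsto.atTop_div_const (by positivity) ?_
      refine tendsto_atTop_mono (fun L => le_max_left (L - k) 0) ?_
      exact tendsto_atTop_add_const_right _ _ tendsto_id
    have ht2 : Tendsto (fun L : ℝ => ENNReal.ofReal (profile c p L k) * leb Ω {x | V x ≤ k})
        atTop (𝓝 (∞ * leb Ω {x | V x ≤ k})) :=
      ENNReal.Tendsto.mul_const (ENNReal.tendsto_ofReal_atTop.comp ht) (.inl (by simp))
    rw [ENNReal.top_mul hk] at ht2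
    obtain ⟨L, h1, h2⟩ := ((ht2.eventually (lt_mem_nhds ENNReal.one_lt_top)).and
      (eventually_ge_atTop 0)).exists
    exact ⟨L, h2, h1.le.trans (hlow L)⟩
  -- continuity of the mass in `l` by dominated convergence, then the intermediate value theorem
  have hcont : ContinuousOn F (Icc 0 L) := by
    intro l hl
    refine tendsto_lintegral_filter_of_dominated_convergence
      (fun x => ENNReal.ofReal (profile c p L (V x))) (.of_forall hmeas) ?_ (hfin L)
      (ae_of_all _ fun x => ?_)
    · filter_upwards [self_mem_nhdsWithin] with l' hl'
      exact ae_of_all _ fun x => ENNReal.ofReal_le_ofReal (profile_mono hc hp hl'.2)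
    · refine (ENNReal.continuous_ofReal.comp ((continuous_profile hp).comp
        (continuous_id.prodMk continuous_const))).continuousWithinAt
  obtain ⟨l, hl, h1⟩ := intermediate_value_Icc hL0 hcont (show (1 : ℝ≥0∞) ∈ Icc (F 0) (F L) by
    rw [hF0]; exact ⟨zero_le, hL⟩)
  exact ⟨l, hl.1, h1⟩

lemma macroEnergy_eq {Ω : Set (E d)} {s : ℝ} {V : Ω → ℝ} (hV : Continuous V) {ρ : Ω → ℝ≥0∞}
    (hρ : Measurable ρ) : macroEnergy s V ρ =
      ∫⁻ x, (rieszConstant s d * ρ x ^ (1 + s / d) + ENNReal.ofReal (V x) * ρ x) ∂leb Ω := by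
  unfold macroEnergy
  rw [lintegral_add_right _ (by fun_prop), lintegral_const_mul _ (by fun_prop)]

/-- Existence, uniqueness and basic regularity of the minimizer of the macroscopic energy. It is
the profile `((l - V)₊ / (C p))^{1/(p-1)}`, `p = 1 + s/d`, with the multiplier `l` fixed by the
mass; strict convexity gives uniqueness. -/
lemma exists_macroMinimizer (hd : 1 ≤ d) {s : ℝ} (hs : (d : ℝ) < s) {Ω : Set (E d)}
    (hΩ : MeasurableSet Ω) (hΩ_pos : 0 < volume Ω) {V : Ω → ℝ} (hV : Continuous V)
    (hV0 : ∀ x, 0 ≤ V x) (hconf : Confining V) :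
    ∃ ρ : Ω → ℝ≥0∞, IsMacroMinimizer s V ρ ∧
      (∀ ρ' : Ω → ℝ≥0∞, IsMacroMinimizer s V ρ' → ρ' =ᵐ[leb Ω] ρ) ∧ (∀ x, ρ x ≠ ∞) ∧
      (∃ k : ℝ, ∀ x : Ω, k < ‖(x : E d)‖ → ρ x = 0) ∧ macroEnergy s V ρ ≠ ∞ := by
  have hd0 : (0 : ℝ) < d := by exact_mod_cast hd
  have hs0 : 0 < s := hd0.trans hs
  have hp : 1 < 1 + s / d := by have := div_pos hs0 hd0; linarith
  have hCtop := rieszConstant_lt_top hd hs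
  set c := (rieszConstant s d).toReal with hcdef
  have hc : 0 < c := ENNReal.toReal_pos (rieszConstant_pos hd hs0).ne' hCtop.ne
  have hC : rieszConstant s d = ENNReal.ofReal c := (ENNReal.ofReal_toReal hCtop.ne).symm
  obtain ⟨l, hl0, hl⟩ := exists_lintegral_profile_eq_one hΩ hΩ_pos hV hV0 hconf hc hp
  set p := 1 + s / d with hpdef
  set ρ : Ω → ℝ≥0∞ := fun x => ENNReal.ofReal (profile c p l (V x)) with hρ
  have hρm : Measurable ρ :=
    (((continuous_profile hp).comp (continuous_const.prodMk hV)).measurable).ennreal_ofReal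
  -- since all densities have mass `1`, the constant `l` may be added to both sides as `l` times
  -- the mass of the other density, which turns the comparison of energies into a pointwise one
  have hkey : ∀ ρ' : Ω → ℝ≥0∞, IsProbDensity ρ' →
      macroEnergy s V ρ + ENNReal.ofReal l =
        ∫⁻ x, (ENNReal.ofReal c * ρ x ^ p + ENNReal.ofReal (V x) * ρ x +
          ENNReal.ofReal l * ρ' x) ∂leb Ω ∧
      macroEnergy s V ρ' + ENNReal.ofReal l =
        ∫⁻ x, (ENNReal.ofReal c * ρ' x ^ p + ENNReal.ofReal (V x) * ρ' x +
          ENNReal.ofReal l * ρ x) ∂leb Ω := by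
    intro ρ' hρ'
    have hm' := hρ'.1
    constructor
    · rw [lintegral_add_right _ (by fun_prop), lintegral_const_mul _ hm', hρ'.2, mul_one,
        macroEnergy_eq hV hρm, hC]
    · rw [lintegral_add_right _ (by fun_prop), lintegral_const_mul _ hρm, hl, mul_one,
        macroEnergy_eq hV hm', hC]
  have hmin : ∀ ρ' : Ω → ℝ≥0∞, IsProbDensity ρ' → macroEnergy s V ρ ≤ macroEnergy s V ρ' := by
    intro ρ' hρ'
    obtain ⟨e1, e2⟩ := hkey ρ' hρ'
    rw [← ENNReal.add_le_add_iff_right (a := ENNReal.ofReal l) ENNReal.ofReal_ne_top, e1, e2]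
    exact lintegral_mono fun x => (profile_le_ennreal hc hp hl0 (hV0 x) _).1
  obtain ⟨k, hk⟩ := hconf.exists_le l
  have hzero : ∀ x : Ω, k < ‖(x : E d)‖ → ρ x = 0 := fun x hx => by
    simp [hρ, profile_eq_zero hp (hk x hx)]
  have hfin : macroEnergy s V ρ ≠ ∞ := by
    rw [macroEnergy_eq hV hρm, hC]
    set B := ENNReal.ofReal c * ENNReal.ofReal (profile c p l 0) ^ p +
      ENNReal.ofReal l * ENNReal.ofReal (profile c p l 0) with hB
    have hBtop : B < ∞ := by
      refine ENNReal.add_lt_top.2 ⟨ENNReal.mul_lt_top ENNReal.ofReal_lt_top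
        (ENNReal.rpow_lt_top_of_nonneg (by linarith) ENNReal.ofReal_ne_top),
        ENNReal.mul_lt_top ENNReal.ofReal_lt_top ENNReal.ofReal_lt_top⟩
    refine ((lintegral_mono (g := {x : Ω | ‖(x : E d)‖ ≤ k}.indicator fun _ => B)
      fun x => ?_).trans_lt ?_).ne
    · by_cases hx : ‖(x : E d)‖ ≤ k
      · rw [indicator_of_mem (by exact hx), hB]
        rcases le_or_gt l (V x) with hlv | hlv
        · have : ρ x = 0 := by simp [hρ, profile_eq_zero hp hlv]
          rw [this, ENNReal.zero_rpow_of_pos (by linarith)]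
          simp
        · have h1 : ρ x ≤ ENNReal.ofReal (profile c p l 0) := by
            refine ENNReal.ofReal_le_ofReal ?_
            unfold profile
            refine Real.rpow_le_rpow (div_nonneg (le_max_right _ _) (by positivity)) ?_
              (one_div_pos.2 (by linarith)).le
            have := hV0 x
            gcongr
          gcongr
      · rw [hzero x (not_le.1 hx), ENNReal.zero_rpow_of_pos (by linarith)]
        simp
    · rw [lintegral_indicator_const (by
        exact (isClosed_le (by fun_prop) continuous_const).measurableSet)]
      exact ENNReal.mul_lt_top hBtop (leb_norm_le_lt_top hΩ k)
  refine ⟨ρ, ⟨⟨hρm, hl⟩, hmin⟩, fun ρ' hρ' => ?_, fun x => ENNReal.ofReal_ne_top,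
    ⟨k, hzero⟩, hfin⟩
  have hm' := hρ'.1.1
  obtain ⟨e1, e2⟩ := hkey ρ' hρ'.1
  have heq : macroEnergy s V ρ' = macroEnergy s V ρ :=
    le_antisymm (hρ'.2 ρ ⟨hρm, hl⟩) (hmin ρ' hρ'.1)
  -- uniqueness: the pointwise inequality is an equality almost everywhere when the integrals
  -- agree
  set f : Ω → ℝ≥0∞ := fun x => ENNReal.ofReal c * ρ x ^ p + ENNReal.ofReal (V x) * ρ x +
    ENNReal.ofReal l * ρ' x with hf
  set g : Ω → ℝ≥0∞ := fun x => ENNReal.ofReal c * ρ' x ^ p + ENNReal.ofReal (V x) * ρ' x +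
    ENNReal.ofReal l * ρ x with hg
  have hfg : f ≤ᵐ[leb Ω] g :=
    ae_of_all _ fun x => (profile_le_ennreal hc hp hl0 (hV0 x) (ρ' x)).1
  have hgm : AEMeasurable g (leb Ω) := by
    have hVm := hV.measurable
    fun_prop
  have h3 : f =ᵐ[leb Ω] g := ae_eq_of_ae_le_of_lintegral_le hfg
    (by rw [← e1]; exact ENNReal.add_ne_top.2 ⟨hfin, ENNReal.ofReal_ne_top⟩)
    hgm (by rw [← e1, ← e2, heq])
  have h4 : ∀ᵐ x ∂leb Ω, ρ' x < ∞ := ae_lt_top hm' (by rw [hρ'.1.2]; simp)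
  filter_upwards [h3, h4] with x hx1 hx2
  exact (profile_le_ennreal hc hp hl0 (hV0 x) (ρ' x)).2 hx2.ne hx1


/-! ### Geometry of the domain -/

open scoped Pointwise in
/-- A `C¹` boundary is Lebesgue negligible: near each point, its translates in a direction
transverse to the boundary are pairwise disjoint. -/
lemma HasC1Boundary.volume_frontier {Ω : Set (E d)} (h : HasC1Boundary Ω) :
    volume (frontier Ω) = 0 := by
  refine measure_null_of_locally_null _ fun p hp => ?_
  obtain ⟨U, hU, φ, hφ, hφp, hUφ⟩ := h p hp
  obtain ⟨v₀, hv₀⟩ : ∃ v, fderiv ℝ φ p v ≠ 0 := by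
    by_contra hcon
    push Not at hcon
    exact hφp (ContinuousLinearMap.ext hcon)
  obtain ⟨v, hv⟩ : ∃ v, 0 < fderiv ℝ φ p v := by
    rcases lt_or_gt_of_ne hv₀ with h | h
    · exact ⟨-v₀, by simpa using h⟩
    · exact ⟨v₀, h⟩
  -- on a small ball the defining function is strictly increasing in the direction `v`, hence
  -- vanishes at most once on each line of this direction
  have hcont : Continuous fun x => fderiv ℝ φ x v :=
    (hφ.continuous_fderiv one_ne_zero).clm_apply continuous_const
  obtain ⟨r, hr, hball⟩ := Metric.mem_nhds_iff.1
    (inter_mem hU (hcont.continuousAt.eventually (lt_mem_nhds hv)))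
  refine ⟨frontier Ω ∩ Metric.ball p r, inter_mem_nhdsWithin _ (Metric.ball_mem_nhds p hr), ?_⟩
  refine Measure.addHaar_eq_zero_of_disjoint_translates volume (fun n : ℕ => (1 / ((n : ℝ) + 1)) • v)
    ?_ ?_
    (isClosed_frontier.measurableSet.inter measurableSet_ball)
  · refine (Metric.isBounded_closedBall (x := (0 : E d)) (r := ‖v‖)).subset ?_
    rintro _ ⟨n, rfl⟩
    rw [mem_closedBall_zero_iff, norm_smul, Real.norm_of_nonneg (by positivity)]
    exact mul_le_of_le_one_left (norm_nonneg _) (by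
      rw [div_le_one (by positivity)]; linarith [Nat.cast_nonneg (α := ℝ) n])
  -- Rolle: two zeros on the same line would give a zero of the derivative between them
  · have key : ∀ z ∈ frontier Ω ∩ Metric.ball p r, ∀ a : ℝ, 0 < a →
        z + a • v ∉ frontier Ω ∩ Metric.ball p r := by
      rintro z ⟨hz1, hz2⟩ a ha ⟨hw1, hw2⟩
      have hzero : ∀ x ∈ frontier Ω, x ∈ Metric.ball p r → φ x = 0 := fun x hx1 hx2 =>
        ((hUφ ▸ (⟨hx1, (hball hx2).1⟩ : x ∈ frontier Ω ∩ U) : x ∈ {x | φ x = 0} ∩ U)).1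
      have hd : ∀ t : ℝ, HasDerivAt (fun t : ℝ => φ (z + t • v)) (fderiv ℝ φ (z + t • v) v) t := by
        intro t
        have h1 : HasDerivAt (fun t : ℝ => z + t • v) v t := by
          simpa using ((hasDerivAt_id t).smul_const v).const_add z
        exact (hφ.differentiable one_ne_zero _).hasFDerivAt.comp_hasDerivAt t h1
      obtain ⟨t, ht, hder⟩ := exists_hasDerivAt_eq_zero ha
        (fun t _ => (hd t).continuousAt.continuousWithinAt)
        (by simp only [zero_smul, add_zero]; rw [hzero _ hz1 hz2, hzero _ hw1 hw2])
        (fun t _ => hd t)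
      have hmem : z + t • v ∈ Metric.ball p r := by
        have := (convex_ball p r).add_smul_sub_mem hz2 hw2
          (t := t / a) ⟨(div_pos ht.1 ha).le, (div_le_one ha).2 ht.2.le⟩
        simpa [smul_smul, div_mul_cancel₀ _ ha.ne'] using this
      exact absurd hder (hball hmem).2.ne'
    have hlt : ∀ m n : ℕ, m < n →
        Disjoint ({(1 / ((m : ℝ) + 1)) • v} + (frontier Ω ∩ Metric.ball p r))
          ({(1 / ((n : ℝ) + 1)) • v} + (frontier Ω ∩ Metric.ball p r)) := by
      intro m n hmn
      rw [Set.disjoint_left]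
      rintro x hx hx'
      simp only [singleton_add, image_add_left, mem_preimage] at hx hx'
      refine key _ hx (1 / ((m : ℝ) + 1) - 1 / ((n : ℝ) + 1)) (sub_pos.2 ?_) ?_
      · exact one_div_lt_one_div_of_lt (by positivity) (by exact_mod_cast Nat.succ_lt_succ hmn)
      · convert hx' using 1
        rw [sub_smul]; abel
    intro m n hmn
    rcases lt_or_gt_of_ne hmn with h | h
    · exact hlt m n h
    · exact (hlt n m h).symm

lemma volume_box (a b : Fin d → ℝ) :
    volume {x : E d | ∀ j, x j ∈ Icc (a j) (b j)} = ∏ j, ENNReal.ofReal (b j - a j) := by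
  have h := (EuclideanSpace.volume_preserving_symm_measurableEquiv_toLp (Fin d)).symm
  rw [← Real.volume_Icc_pi, ← h.measure_preimage_equiv]
  congr 1
  ext x
  simp [Set.mem_Icc, Pi.le_def, forall_and]

lemma volume_cube {R : ℝ} (hR : 0 ≤ R) : volume (cube d R) = ENNReal.ofReal (R ^ d) := by
  have : cube d R = {x : E d | ∀ j, x j ∈ Icc (-(R / 2)) (R / 2)} := by
    ext x; simp [cube, abs_le]
  rw [this, volume_box]
  simp [ENNReal.ofReal_pow hR]

/-- Hölder's inequality between a function and a constant. -/
lemma rpow_lintegral_le {α : Type*} [MeasurableSpace α] (μ : Measure α) {p : ℝ} (hp : 1 < p)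
    {f : α → ℝ≥0∞} (hf : AEMeasurable f μ) :
    (∫⁻ x, f x ∂μ) ^ p ≤ (∫⁻ x, f x ^ p ∂μ) * μ univ ^ (p - 1) := by
  have hpq := Real.HolderConjugate.conjExponent hp
  have h := ENNReal.lintegral_mul_le_Lp_mul_Lq μ hpq hf (aemeasurable_const (b := (1 : ℝ≥0∞)))
  simp only [Pi.mul_apply, mul_one, ENNReal.one_rpow, lintegral_const, one_mul] at h
  have hp0 : 0 < p := by linarith
  refine (ENNReal.rpow_le_rpow h hp0.le).trans_eq ?_
  rw [ENNReal.mul_rpow_of_nonneg _ _ hp0.le, ← ENNReal.rpow_mul, ← ENNReal.rpow_mul,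
    one_div_mul_cancel hp0.ne', ENNReal.rpow_one]
  congr 2
  rw [Real.conjExponent]
  have : p - 1 ≠ 0 := by linarith
  field_simp

/-! ### Competitors -/

/-- A system with prescribed numbers of points `≈ N αq` in the cells `q` of a fixed grid. As `N`
tends to infinity the interaction between cells is of order `N ^ 2`, which is negligible since
`s > d`. -/
lemma eventually_exists_hamiltonian_le_of_cells (hd : 1 ≤ d) {s : ℝ} (hs : (d : ℝ) < s)
    {Ω : Set (E d)} {V : Ω → ℝ} (hV0 : ∀ x, 0 ≤ V x) {k δ θ c c' : ℝ} (hk : 0 < k) (hδ0 : 0 < δ)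
    (hδ : δ < 1) (hθ : 1 < θ) (hc0 : 0 < c) (hc : rieszConstant s d < ENNReal.ofReal c)
    (F : Finset (Fin d → ℤ)) (α v : F → ℝ) (hα : ∀ q, 0 < α q) (hα1 : 1 ≤ ∑ q, θ * α q)
    (hF : ∀ (q : F) (z : E d), z ∈ cube d 1 →
      ∃ h : gridPoint k δ q.1 z ∈ Ω, V ⟨gridPoint k δ q.1 z, h⟩ ≤ v q)
    (hc' : ∑ q, ((1 - δ) / k) ^ (-s) * (c * (θ ^ 2 * α q) ^ (1 + s / d)) +
      ∑ q, θ ^ 2 * α q * v q < c') :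
    ∀ᶠ N : ℕ in atTop, ∃ Y : Fin N → Ω,
      hamiltonian s V Y ≤ ENNReal.ofReal (c' * (N : ℝ) ^ (1 + s / d)) := by
  classical
  have hd0 : (0 : ℝ) < d := by exact_mod_cast hd
  have hs0 : 0 < s := hd0.trans hs
  set p := 1 + s / d with hp
  have hp2 : 2 < p := by
    have : 1 < s / d := (one_lt_div hd0).2 hs
    linarith
  -- the energy is at most `A₁ N ^ p + A₂ N ^ 2 + A₃ N ^ p`: self energies of the cells,
  -- interactions between cells, potential
  set A₁ := ∑ q, ((1 - δ) / k) ^ (-s) * (c * (θ ^ 2 * α q) ^ p) with hA₁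
  set A₃ := ∑ q, θ ^ 2 * α q * v q with hA₃
  set A₂ := ∑ q, ∑ q', (θ ^ 2 * α q) * (θ ^ 2 * α q') * (δ / k) ^ (-s) with hA₂
  obtain ⟨c₁, hc₁, hc₁c⟩ : ∃ c₁, rieszConstant s d < ENNReal.ofReal c₁ ∧ c₁ < c := by
    obtain ⟨c₁, h1, h2⟩ := exists_between hc
    lift c₁ to ℝ≥0 using h2.ne_top
    refine ⟨c₁, by simpa using h1, ?_⟩
    have h3 : ENNReal.ofReal (c₁ : ℝ) < ENNReal.ofReal c := by simpa using h2
    exact (ENNReal.ofReal_lt_ofReal_iff_of_nonneg c₁.2).1 h3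
  have hv0 : ∀ q, 0 ≤ v q := fun q => by
    obtain ⟨h, hle⟩ := hF q 0 (fun j => by simp)
    exact (hV0 _).trans hle
  have hθ0 : 0 < θ := by linarith
  have hδk : 0 < (1 - δ) / k := div_pos (by linarith) hk
  have hA1 : 0 ≤ A₁ := Finset.sum_nonneg fun q _ => by
    have h5 := (hα q).le
    positivity
  have hA2 : 0 ≤ A₂ := Finset.sum_nonneg fun q _ => Finset.sum_nonneg fun q' _ => by
    have h5 := (hα q).le
    have h6 := (hα q').le
    positivity
  have hA3 : 0 ≤ A₃ := Finset.sum_nonneg fun q _ => by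
    have h5 := (hα q).le
    have h6 := hv0 q
    positivity
  -- one factor `θ > 1` guarantees that there are at least `N` points in total, the other one
  -- absorbs the rounding
  let n : ℕ → F → ℕ := fun N q => ⌈(N : ℝ) * (θ * α q)⌉₊
  have htend : ∀ q, Tendsto (fun N : ℕ => (N : ℝ) * (θ * α q)) atTop atTop := fun q =>
    tendsto_natCast_atTop_atTop.atTop_mul_const (mul_pos hθ0 (hα q))
  have hn : ∀ q, Tendsto (fun N => n N q) atTop atTop := fun q =>
    tendsto_nat_ceil_atTop.comp (htend q)
  have ev1 : ∀ᶠ N in atTop, ∀ q, minRieszEnergy s (cube d 1) (n N q) <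
      ENNReal.ofReal (c * (n N q : ℝ) ^ p) := by
    rw [eventually_all]
    intro q
    filter_upwards [(hn q).eventually (eventually_minRieszEnergy_le hd hs hc₁),
      (hn q).eventually_ge_atTop 1] with N h1 h2
    refine h1.trans_lt ?_
    have h3 : (0 : ℝ) < n N q := by exact_mod_cast h2
    have h4 : 0 < (n N q : ℝ) ^ p := by positivity
    exact (ENNReal.ofReal_lt_ofReal_iff (mul_pos hc0 h4)).2 (by gcongr)
  have ev2 : ∀ᶠ N : ℕ in atTop, ∀ q, (n N q : ℝ) ≤ θ ^ 2 * α q * N := by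
    rw [eventually_all]
    intro q
    have h1 : Tendsto (fun N : ℕ => (θ - 1) * ((N : ℝ) * (θ * α q))) atTop atTop :=
      (htend q).const_mul_atTop (by linarith)
    filter_upwards [h1.eventually_ge_atTop 1] with N h2
    have h3 : (n N q : ℝ) < (N : ℝ) * (θ * α q) + 1 :=
      Nat.ceil_lt_add_one (by have := hα q; positivity)
    nlinarith
  have ev3 : ∀ᶠ N : ℕ in atTop, A₂ * (N : ℝ) ^ (-(p - 2)) ≤ c' - (A₁ + A₃) := by
    have h2 : Tendsto (fun m : ℕ => A₂ * (m : ℝ) ^ (-(p - 2))) atTop (𝓝 (A₂ * 0)) :=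
      ((tendsto_rpow_neg_atTop (by linarith)).comp tendsto_natCast_atTop_atTop).const_mul _
    rw [mul_zero] at h2
    exact (h2.eventually (gt_mem_nhds (sub_pos.2 hc'))).mono fun _ h => h.le
  filter_upwards [ev1, ev2, ev3, eventually_ge_atTop 1] with N h1 h2 h3 h4
  have hN0 : (0 : ℝ) < N := by exact_mod_cast h4
  choose z hz hzE using fun q => exists_rieszEnergy_lt (h1 q)
  let x : (Σ q : F, Fin (n N q)) → E d := fun a => gridPoint k δ a.1.1 (z a.1 a.2)
  have hxΩ : ∀ a, ∃ h : x a ∈ Ω, V ⟨x a, h⟩ ≤ v a.1 := fun a => hF a.1 _ (hz a.1 a.2)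
  choose hx hxV using hxΩ
  have hcard : N ≤ Fintype.card (Σ q : F, Fin (n N q)) := by
    rw [Fintype.card_sigma]
    simp only [Fintype.card_fin]
    have : (N : ℝ) ≤ ∑ q, (n N q : ℝ) := by
      calc (N : ℝ) ≤ N * ∑ q, θ * α q := le_mul_of_one_le_right hN0.le hα1
        _ = ∑ q, (N : ℝ) * (θ * α q) := Finset.mul_sum _ _ _
        _ ≤ _ := Finset.sum_le_sum fun q _ => Nat.le_ceil _
    exact_mod_cast this
  -- superfluous points are dropped, which does not increase the energy
  let e : Fin N → (Σ q : F, Fin (n N q)) :=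
    (Fintype.equivFin _).symm ∘ Fin.castLE hcard
  have he : Function.Injective e := (Equiv.injective _).comp (Fin.castLE_injective hcard)
  refine ⟨fun i => ⟨x (e i), hx _⟩, ?_⟩
  have hR : rieszEnergy s (fun i => x (e i)) ≤
      ENNReal.ofReal ((N : ℝ) ^ p * A₁ + (N : ℝ) ^ 2 * A₂) := by
    rw [rieszEnergy_eq_pairEnergy]
    refine (pairEnergy_comp_le s x he).trans ((pairEnergy_gridPoint_le hs0.le hk hδ F (n N) z
      hz).trans ?_)
    rw [ENNReal.ofReal_add (by positivity) (by positivity)]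
    refine add_le_add ?_ ?_
    · rw [hA₁, Finset.mul_sum, ENNReal.ofReal_sum_of_nonneg (by
        intro q _; have := (hα q).le; positivity)]
      refine Finset.sum_le_sum fun q _ => ?_
      rw [ENNReal.ofReal_rpow_of_pos hδk]
      refine (mul_le_mul' le_rfl (hzE q).le).trans ?_
      rw [← ENNReal.ofReal_mul (by positivity)]
      refine ENNReal.ofReal_le_ofReal ?_
      calc ((1 - δ) / k) ^ (-s) * (c * (n N q : ℝ) ^ p)
          ≤ ((1 - δ) / k) ^ (-s) * (c * (θ ^ 2 * α q * N) ^ p) := by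
            gcongr
            exact h2 q
        _ = _ := by
            rw [Real.mul_rpow (by have := (hα q).le; positivity) hN0.le]; ring
    · rw [hA₂, Finset.mul_sum, ENNReal.ofReal_sum_of_nonneg (by
        intro q _
        refine mul_nonneg (by positivity) (Finset.sum_nonneg fun q' _ => ?_)
        have h5 := (hα q).le
        have h6 := (hα q').le
        positivity)]
      refine Finset.sum_le_sum fun q _ => ?_
      rw [Finset.mul_sum, ENNReal.ofReal_sum_of_nonneg (by
        intro q' _
        have h5 := (hα q).le
        have h6 := (hα q').le
        positivity)]
      refine Finset.sum_le_sum fun q' _ => ?_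
      split_ifs with hqq
      · exact zero_le
      -- points of different cells are at distance at least `δ / k`
      · have hnorm : 1 ≤ ‖(q : Fin d → ℤ) - q'‖ := by
          have hne : (q : Fin d → ℤ) - q' ≠ 0 := sub_ne_zero.2 fun h => hqq (Subtype.ext h)
          obtain ⟨j, hj⟩ := Function.ne_iff.1 hne
          refine le_trans ?_ (norm_le_pi_norm _ j)
          rw [Int.norm_eq_abs]
          have : (1 : ℤ) ≤ |((q : Fin d → ℤ) - q') j| := Int.one_le_abs hj
          exact_mod_cast this
        have hpos : 0 < δ / k := by positivity
        rw [ENNReal.ofReal_rpow_of_pos (by positivity), ← ENNReal.ofReal_natCast,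
          ← ENNReal.ofReal_natCast, ← ENNReal.ofReal_mul (by positivity),
          ← ENNReal.ofReal_mul (by positivity)]
        refine ENNReal.ofReal_le_ofReal ?_
        have e1 : (δ / k * ‖(q : Fin d → ℤ) - q'‖) ^ (-s) ≤ (δ / k) ^ (-s) :=
          Real.rpow_le_rpow_of_nonpos hpos (le_mul_of_one_le_right hpos.le hnorm) (by linarith)
        have e2 := h2 q
        have e3 := h2 q'
        have e4 := (hα q).le
        have e5 := (hα q').le
        calc _ ≤ (θ ^ 2 * α q * N) * (θ ^ 2 * α q' * N) * (δ / k) ^ (-s) := by gcongr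
          _ = _ := by ring
  have hP : ∑ i : Fin N, V ⟨x (e i), hx _⟩ ≤ N * A₃ := by
    calc ∑ i : Fin N, V ⟨x (e i), hx _⟩ ≤ ∑ a, V ⟨x a, hx a⟩ := by
          rw [← Finset.sum_image (f := fun a => V ⟨x a, hx a⟩) (g := e) he.injOn]
          exact Finset.sum_le_univ_sum_of_nonneg fun a => hV0 _
      _ ≤ ∑ a : Σ q : F, Fin (n N q), v a.1 := Finset.sum_le_sum fun a _ => hxV a
      _ = ∑ q, (n N q : ℝ) * v q := by rw [Fintype.sum_sigma]; simp
      _ ≤ ∑ q, θ ^ 2 * α q * N * v q := by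
          refine Finset.sum_le_sum fun q _ => ?_
          exact mul_le_mul_of_nonneg_right (h2 q) (hv0 q)
      _ = N * A₃ := by
          rw [hA₃, Finset.mul_sum]
          exact Finset.sum_congr rfl fun q _ => by ring
  unfold hamiltonian
  refine (add_le_add hR (ENNReal.ofReal_le_ofReal (mul_le_mul_of_nonneg_left hP
    (by positivity)))).trans ?_
  rw [← ENNReal.ofReal_add (by positivity) (by positivity)]
  refine ENNReal.ofReal_le_ofReal ?_
  have e1 : (N : ℝ) ^ (s / d) * (N * A₃) = A₃ * (N : ℝ) ^ p := by
    rw [hp, Real.rpow_add hN0, Real.rpow_one]; ring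
  have e2 : (N : ℝ) ^ 2 = (N : ℝ) ^ (-(p - 2)) * (N : ℝ) ^ p := by
    rw [← Real.rpow_add hN0, ← Real.rpow_natCast]; congr 1; push_cast; ring
  have e3 : 0 < (N : ℝ) ^ p := by positivity
  rw [e1, e2]
  nlinarith


/-- The closed cell `q` of the grid of mesh `1 / k`. -/
def gridCell (k : ℝ) (q : Fin d → ℤ) : Set (E d) :=
  {x | ∀ j, x j ∈ Icc ((q j : ℝ) / k) (((q j : ℝ) + 1) / k)}

/-- The index of the cell containing a point. -/
def cellIndex (k : ℝ) (x : E d) : Fin d → ℤ := fun j => ⌊k * x j⌋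

lemma measurable_cellIndex (k : ℝ) : Measurable (cellIndex k : E d → Fin d → ℤ) := by
  refine measurable_pi_iff.2 fun j => Int.measurable_floor.comp ?_
  fun_prop

lemma mem_gridCell_cellIndex {k : ℝ} (hk : 0 < k) (x : E d) : x ∈ gridCell k (cellIndex k x) := by
  intro j
  rw [mem_Icc, div_le_iff₀' hk, le_div_iff₀' hk]
  exact ⟨Int.floor_le _, (Int.lt_floor_add_one _).le⟩

lemma gridPoint_mem_gridCell {k δ : ℝ} (hk : 0 < k) (hδ0 : 0 < δ) (hδ : δ < 1) (q : Fin d → ℤ)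
    {z : E d} (hz : z ∈ cube d 1) : gridPoint k δ q z ∈ gridCell k q := by
  intro j
  rw [gridPoint_apply, mem_Icc]
  have h := hz j
  rw [abs_le] at h
  constructor
  · exact div_le_div_of_nonneg_right (by nlinarith) hk.le
  · exact div_le_div_of_nonneg_right (by nlinarith) hk.le

lemma dist_le_of_mem_gridCell {k : ℝ} (hk : 0 < k) {q : Fin d → ℤ} {x y : E d}
    (hx : x ∈ gridCell k q) (hy : y ∈ gridCell k q) : dist x y ≤ √d / k := by
  have h := edist_le_of_coord (x := x) (y := y) (r := 1 / k) (by positivity) fun j => by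
    have h1 := hx j
    have h2 := hy j
    rw [mem_Icc, add_div] at h1 h2
    rw [abs_le]; constructor <;> linarith
  rw [edist_dist, ENNReal.ofReal_le_ofReal_iff (by positivity)] at h
  simpa [div_eq_mul_inv] using h

lemma volume_gridCell {k : ℝ} (hk : 0 < k) (q : Fin d → ℤ) :
    volume (gridCell k q) = ENNReal.ofReal ((k ^ d)⁻¹) := by
  unfold gridCell
  rw [volume_box]
  have : ∀ j, ((q j : ℝ) + 1) / k - (q j : ℝ) / k = k⁻¹ := fun j => by rw [← sub_div]; simp
  simp only [this, Finset.prod_const, Finset.card_univ, Fintype.card_fin]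
  rw [← ENNReal.ofReal_pow (by positivity), inv_pow]

/-- Every density of finite energy and bounded support is approximated in energy by systems of
points: fill the cells of a fine grid contained in the domain with near-minimizers, in numbers
proportional to the mass of the cells. -/
lemma eventually_exists_hamiltonian_le (hd : 1 ≤ d) {s : ℝ} (hs : (d : ℝ) < s)
    {Ω : Set (E d)} (hΩ : IsClosed Ω) (hfr : volume (frontier Ω) = 0) {V : Ω → ℝ}
    (hV : Continuous V) (hV0 : ∀ x, 0 ≤ V x) {ρ : Ω → ℝ≥0∞} (hρ : IsProbDensity ρ) {k₀ : ℝ}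
    (hk₀ : ∀ x : Ω, k₀ < ‖(x : E d)‖ → ρ x = 0) {c' : ℝ}
    (hc' : macroEnergy s V ρ < ENNReal.ofReal c') :
    ∀ᶠ N : ℕ in atTop, ∃ Y : Fin N → Ω,
      hamiltonian s V Y ≤ ENNReal.ofReal (c' * (N : ℝ) ^ (1 + s / d)) := by
  classical
  have hd0 : (0 : ℝ) < d := by exact_mod_cast hd
  have hs0 : 0 < s := hd0.trans hs
  have hΩm := hΩ.measurableSet
  set p := 1 + s / d with hp
  have hp1 : 1 < p := by have := div_pos hs0 hd0; linarith
  have hCtop := rieszConstant_lt_top hd hs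
  have hCpos := rieszConstant_pos hd hs0
  set c₀ := (rieszConstant s d).toReal with hc₀
  have hc₀pos : 0 < c₀ := ENNReal.toReal_pos hCpos.ne' hCtop.ne
  have hC : rieszConstant s d = ENNReal.ofReal c₀ := (ENNReal.ofReal_toReal hCtop.ne).symm
  have hρm := hρ.1
  have hVm := hV.measurable
  set I' := ∫⁻ x, ρ x ^ p ∂leb Ω with hI'
  set J' := ∫⁻ x, ENNReal.ofReal (V x) * ρ x ∂leb Ω with hJ'
  have henergy : macroEnergy s V ρ = ENNReal.ofReal c₀ * I' + J' := by
    rw [← hC]; rfl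
  have hfin : ENNReal.ofReal c₀ * I' + J' ≠ ∞ := henergy ▸ hc'.ne_top
  have hI'fin : I' ≠ ∞ := by
    intro h
    rw [h, ENNReal.mul_top (ENNReal.ofReal_pos.2 hc₀pos).ne'] at hfin
    simp at hfin
  have hJ'fin : J' ≠ ∞ := (ENNReal.add_ne_top.1 hfin).2
  set I := I'.toReal with hI
  set J := J'.toReal with hJ
  have hI0 : 0 ≤ I := ENNReal.toReal_nonneg
  have hJ0 : 0 ≤ J := ENNReal.toReal_nonneg
  have hlt : c₀ * I + J < c' := by
    rw [henergy, ← ENNReal.ofReal_toReal hI'fin, ← ENNReal.ofReal_toReal hJ'fin, ← hI, ← hJ,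
      ← ENNReal.ofReal_mul hc₀pos.le, ← ENNReal.ofReal_add (by positivity) hJ0] at hc'
    exact (ENNReal.ofReal_lt_ofReal_iff_of_nonneg (by positivity)).1 hc'
  -- a single parameter `τ > 1` measures all the losses: the shrinking of the cells, through `(1 -
  -- δ) ^ (-s) = τ`, the error on the constant, the excess of points, and the variation `τ - 1` of
  -- the potential in a cell
  obtain ⟨τ, hτ, hτ1⟩ : ∃ τ : ℝ, τ * (τ * c₀ * ((τ ^ 2) ^ p * I)) + τ ^ 2 * (J + 2 * (τ - 1)) < c' ∧
      1 < τ := by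
    have hcont : ContinuousAt (fun τ : ℝ => τ * (τ * c₀ * ((τ ^ 2) ^ p * I)) +
        τ ^ 2 * (J + 2 * (τ - 1))) 1 := by
      have h1 : ContinuousAt (fun τ : ℝ => (τ ^ 2) ^ p) 1 :=
        ContinuousAt.rpow_const (by fun_prop) (by simp)
      fun_prop
    have h1 : ∀ᶠ τ : ℝ in 𝓝 1, τ * (τ * c₀ * ((τ ^ 2) ^ p * I)) +
        τ ^ 2 * (J + 2 * (τ - 1)) < c' :=
      hcont.tendsto.eventually (gt_mem_nhds (by simp; linarith))
    have h2 := h1.filter_mono (nhdsWithin_le_nhds (s := Ioi 1))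
    obtain ⟨τ, h⟩ := (h2.and self_mem_nhdsWithin).exists
    exact ⟨τ, h⟩
  have hτ0 : 0 < τ := by linarith
  set δ := 1 - τ ^ (-(1 / s)) with hδ
  have hδτ : (1 - δ) ^ (-s) = τ := by
    rw [hδ, sub_sub_cancel, ← Real.rpow_mul hτ0.le]
    rw [show -(1 / s) * -s = 1 by field_simp, Real.rpow_one]
  have hδ1 : δ < 1 := by rw [hδ]; have : 0 < τ ^ (-(1 / s)) := by positivity
                         linarith
  have hδ0 : 0 < δ := by
    rw [hδ, sub_pos]
    exact Real.rpow_lt_one_of_one_lt_of_neg hτ1 (by have := one_div_pos.2 hs0; linarith)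
  set ε := τ - 1 with hε
  have hε0 : 0 < ε := by linarith
  -- scale of uniform continuity of `V` on a bounded part of the domain
  obtain ⟨η, hη0, hη⟩ : ∃ η > 0, ∀ x y : Ω, ‖(x : E d)‖ ≤ k₀ + √d → ‖(y : E d)‖ ≤ k₀ + √d →
      dist (x : E d) y < η → |V x - V y| < ε := by
    have hK : IsCompact {x : Ω | ‖(x : E d)‖ ≤ k₀ + √d} := by
      have := hΩ.isClosedEmbedding_subtypeVal.isCompact_preimage
        (isCompact_closedBall (0 : E d) (k₀ + √d))
      convert this using 1
      ext x; simp
    have huc := hK.uniformContinuousOn_of_continuous hV.continuousOn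
    rw [Metric.uniformContinuousOn_iff] at huc
    obtain ⟨η, hη, h⟩ := huc ε hε0
    exact ⟨η, hη, fun x y hx hy hxy => by simpa [Real.dist_eq] using h x hx y hy hxy⟩
  -- choice of the mesh
  -- `G m` is the set of points whose cell of mesh `1 / m` is contained in `Ω`; as `m → ∞` these
  -- sets fill the interior of `Ω`, that is, almost all of `Ω`
  let G : ℕ → Set Ω := fun m => {x | gridCell (m : ℝ) (cellIndex m (x : E d)) ⊆ Ω}
  have hφm : ∀ m : ℕ, Measurable fun x : Ω => cellIndex (m : ℝ) (x : E d) := fun m =>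
    (measurable_cellIndex _).comp measurable_subtype_coe
  have hGm : ∀ m, MeasurableSet (G m) := fun m =>
    (hφm m) (MeasurableSet.of_discrete (s := {q | gridCell (m : ℝ) q ⊆ Ω}))
  have hae : ∀ᵐ x : Ω ∂leb Ω, (x : E d) ∈ interior Ω := by
    rw [ae_iff, leb_apply hΩm]
    refine measure_mono_null ?_ hfr
    rintro _ ⟨x, hx, rfl⟩
    exact ⟨subset_closure x.2, hx⟩
  have hlim : Tendsto (fun m : ℕ => ∫⁻ x in G m, ρ x ∂leb Ω) atTop (𝓝 1) := by
    rw [← hρ.2]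
    simp_rw [← lintegral_indicator (hGm _)]
    refine tendsto_lintegral_of_dominated_convergence ρ (fun m => hρm.indicator (hGm m))
      (fun m => ae_of_all _ fun x => indicator_le_self _ _ x) (by rw [hρ.2]; simp) ?_
    filter_upwards [hae] with x hx
    obtain ⟨r, hr, hball⟩ := Metric.mem_nhds_iff.1 (mem_interior_iff_mem_nhds.1 hx)
    have h1 : Tendsto (fun m : ℕ => √d / (m : ℝ)) atTop (𝓝 0) :=
      tendsto_const_nhds.div_atTop tendsto_natCast_atTop_atTop
    refine tendsto_const_nhds.congr' ?_
    filter_upwards [h1.eventually (gt_mem_nhds hr), eventually_ge_atTop 1] with m hm hm1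
    have hm0 : (0 : ℝ) < m := by exact_mod_cast hm1
    rw [indicator_of_mem]
    intro y hy
    refine hball ?_
    rw [Metric.mem_ball]
    exact (dist_le_of_mem_gridCell hm0 hy (mem_gridCell_cellIndex hm0 _)).trans_lt hm
  obtain ⟨m, hm1, hmG, hmη⟩ : ∃ m : ℕ, 1 ≤ m ∧ ENNReal.ofReal τ⁻¹ < ∫⁻ x in G m, ρ x ∂leb Ω ∧
      √d / m < η := by
    have h1 : Tendsto (fun m : ℕ => √d / (m : ℝ)) atTop (𝓝 0) :=
      tendsto_const_nhds.div_atTop tendsto_natCast_atTop_atTop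
    have h2 : ENNReal.ofReal τ⁻¹ < 1 := by
      rw [ENNReal.ofReal_lt_one]; exact inv_lt_one_of_one_lt₀ hτ1
    obtain ⟨m, h3, h4, h5⟩ := ((eventually_ge_atTop 1).and ((hlim.eventually (lt_mem_nhds h2)).and
      (h1.eventually (gt_mem_nhds hη0)))).exists
    exact ⟨m, h3, h4, h5⟩
  have hm0 : (0 : ℝ) < m := by exact_mod_cast hm1
  let A : (Fin d → ℤ) → Set Ω := fun q => {x | cellIndex (m : ℝ) (x : E d) = q}
  have hAm : ∀ q, MeasurableSet (A q) := fun q => hφm m (measurableSet_singleton q)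
  have hAdisj : Pairwise (Function.onFun Disjoint A) := fun q q' hqq => by
    rw [Function.onFun, Set.disjoint_left]
    rintro x rfl hx
    exact hqq hx
  let a : (Fin d → ℤ) → ℝ≥0∞ := fun q => ∫⁻ x in A q, ρ x ∂leb Ω
  have ha1 : ∀ q, a q ≤ 1 := fun q => by
    rw [← hρ.2]; exact setLIntegral_le_lintegral _ _
  -- integrals over distinct cells add up to at most the integral over `Ω`
  have hsumle : ∀ (T : Finset (Fin d → ℤ)) (b : (Fin d → ℤ) → ℝ≥0∞) (f : Ω → ℝ≥0∞),
      (∀ q ∈ T, b q ≤ ∫⁻ x in A q, f x ∂leb Ω) → ∑ q ∈ T, b q ≤ ∫⁻ x, f x ∂leb Ω := by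
    intro T b f h
    refine (Finset.sum_le_sum h).trans ?_
    rw [← lintegral_biUnion_finset (fun q _ q' _ hqq => hAdisj hqq) fun q _ => hAm q]
    exact setLIntegral_le_lintegral _ _
  -- finitely many cells meet the ball of radius `k₀`, outside of which `ρ` vanishes
  let M : ℤ := ⌈(m : ℝ) * k₀⌉ + 1
  let F' : Finset (Fin d → ℤ) := (Fintype.piFinset fun _ => Finset.Icc (-M) M).filter
    fun q => gridCell (m : ℝ) q ⊆ Ω
  let F : Finset (Fin d → ℤ) := F'.filter fun q => a q ≠ 0
  have hFsum : ENNReal.ofReal τ⁻¹ ≤ ∑ q ∈ F, a q := by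
    rw [Finset.sum_filter_ne_zero, ← lintegral_biUnion_finset (fun q _ q' _ hqq => hAdisj hqq)
      fun q _ => hAm q]
    refine hmG.le.trans ?_
    rw [← lintegral_indicator (hGm m),
      ← lintegral_indicator (Finset.measurableSet_biUnion _ fun q _ => hAm q)]
    refine lintegral_mono fun x => ?_
    by_cases hxG : x ∈ G m
    · by_cases hxk : k₀ < ‖(x : E d)‖
      · rw [indicator_of_mem hxG, hk₀ x hxk]; exact zero_le
      · rw [indicator_of_mem hxG, indicator_of_mem]
        refine mem_iUnion₂.2 ⟨cellIndex (m : ℝ) (x : E d), ?_, rfl⟩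
        refine Finset.mem_filter.2 ⟨Fintype.mem_piFinset.2 fun j => ?_, hxG⟩
        have h1 : |(x : E d) j| ≤ k₀ := by
          have := PiLp.norm_apply_le (x : E d) j
          rw [Real.norm_eq_abs] at this
          exact this.trans (not_lt.1 hxk)
        rw [abs_le] at h1
        have h2 : (m : ℝ) * k₀ ≤ ⌈(m : ℝ) * k₀⌉ := Int.le_ceil _
        have h3 : (m : ℝ) * (x : E d) j ≤ m * k₀ := by gcongr; exact h1.2
        have h4 : (m : ℝ) * (-k₀) ≤ m * (x : E d) j := by gcongr; exact h1.1
        rw [Finset.mem_Icc]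
        constructor
        · refine Int.le_floor.2 ?_
          simp only [M]; push_cast; linarith
        · rw [← Int.cast_le (R := ℝ)]
          refine (Int.floor_le _).trans ?_
          simp only [M]; push_cast; linarith
    · rw [indicator_of_notMem hxG]; exact zero_le
  have hFΩ : ∀ q ∈ F, gridCell (m : ℝ) q ⊆ Ω := fun q hq =>
    (Finset.mem_filter.1 (Finset.mem_filter.1 hq).1).2
  have hx : ∀ q : F, ∃ x : Ω, cellIndex (m : ℝ) (x : E d) = q ∧ ‖(x : E d)‖ ≤ k₀ := by
    intro q
    by_contra hcon
    push Not at hcon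
    refine (Finset.mem_filter.1 q.2).2 ?_
    refine (setLIntegral_congr_fun (hAm q) fun x hx => hk₀ x (hcon x hx)).trans ?_
    simp
  choose x₀ hx₀ hx₀k using hx
  have hVclose : ∀ (q : F) (y : Ω), (y : E d) ∈ gridCell (m : ℝ) q → |V y - V (x₀ q)| < ε := by
    intro q y hy
    have h1 : (x₀ q : E d) ∈ gridCell (m : ℝ) q := by
      have := mem_gridCell_cellIndex hm0 (x₀ q : E d)
      rwa [hx₀] at this
    have h2 := dist_le_of_mem_gridCell hm0 hy h1
    have h3 : √(d : ℝ) / m ≤ √d := div_le_self (Real.sqrt_nonneg _) (by exact_mod_cast hm1)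
    refine hη y (x₀ q) ?_ ((hx₀k q).trans (by have := Real.sqrt_nonneg (d : ℝ); linarith))
      (h2.trans_lt hmη)
    have h4 := norm_le_norm_add_norm_sub' (y : E d) (x₀ q)
    rw [dist_eq_norm] at h2
    linarith [hx₀k q]
  set α : F → ℝ := fun q => (a q).toReal with hα
  set v : F → ℝ := fun q => V (x₀ q) + ε with hv
  have hatop : ∀ q, a q ≠ ∞ := fun q => ((ha1 q).trans_lt ENNReal.one_lt_top).ne
  have hα0 : ∀ q, 0 < α q := fun q =>
    ENNReal.toReal_pos (Finset.mem_filter.1 q.2).2 (hatop q)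
  -- the cell `q` receives a proportion `α q`, its mass under `ρ`, of the points
  refine eventually_exists_hamiltonian_le_of_cells hd hs hV0 (k := m) (δ := δ) (θ := τ)
    (c := τ * c₀) hm0 hδ0 hδ1 hτ1 (by positivity) ?_ F α v hα0 ?_ ?_ ?_
  · rw [hC]
    exact (ENNReal.ofReal_lt_ofReal_iff (by positivity)).2 (by nlinarith)
  · rw [← Finset.mul_sum, ← inv_le_iff_one_le_mul₀' hτ0, hα]
    rw [Finset.sum_coe_sort F fun q => (a q).toReal, ← ENNReal.toReal_sum fun q _ => hatop q]
    exact (ENNReal.ofReal_le_iff_le_toReal (ENNReal.sum_ne_top.2 fun q _ => hatop q)).1 hFsum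
  · intro q z hz
    have h1 := gridPoint_mem_gridCell hm0 hδ0 hδ1 (q : Fin d → ℤ) hz
    refine ⟨hFΩ q q.2 h1, ?_⟩
    have h2 := hVclose q ⟨_, hFΩ q q.2 h1⟩ h1
    rw [abs_lt] at h2
    simp only [hv]; linarith
  -- Jensen: `m ^ s (∫_q ρ) ^ p ≤ ∫_q ρ ^ p`, as the cell has volume `m ^ (-d)` and `d (p - 1) =
  -- s`
  · have hS1 : ∑ q, (m : ℝ) ^ s * α q ^ p ≤ I := by
      have h1 : ∑ q ∈ F, ENNReal.ofReal ((m : ℝ) ^ s) * a q ^ p ≤ I' := by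
        refine hsumle F _ _ fun q _ => ?_
        have h2 := rpow_lintegral_le ((leb Ω).restrict (A q)) hp1 hρm.aemeasurable
        have h3 : (leb Ω).restrict (A q) univ ≤ ENNReal.ofReal (((m : ℝ) ^ d)⁻¹) := by
          rw [Measure.restrict_apply_univ, leb_apply hΩm, ← volume_gridCell hm0 q]
          refine measure_mono ?_
          rintro _ ⟨x, rfl, rfl⟩
          exact mem_gridCell_cellIndex hm0 _
        have h4 : ENNReal.ofReal (((m : ℝ) ^ d)⁻¹) ^ (p - 1) = ENNReal.ofReal (((m : ℝ) ^ s)⁻¹) := by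
          rw [ENNReal.ofReal_rpow_of_pos (by positivity), Real.inv_rpow (by positivity),
            ← Real.rpow_natCast, ← Real.rpow_mul hm0.le]
          congr 3
          rw [hp]; field_simp; ring
        calc ENNReal.ofReal ((m : ℝ) ^ s) * a q ^ p
            ≤ ENNReal.ofReal ((m : ℝ) ^ s) * ((∫⁻ x in A q, ρ x ^ p ∂leb Ω) *
              ENNReal.ofReal (((m : ℝ) ^ s)⁻¹)) := by
              gcongr
              refine h2.trans ?_
              rw [← h4]
              gcongr
          _ = _ := by
              rw [mul_comm, mul_assoc, ← ENNReal.ofReal_mul (by positivity),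
                inv_mul_cancel₀ (by positivity), ENNReal.ofReal_one, mul_one]
      have h5 := ENNReal.toReal_mono hI'fin h1
      rw [ENNReal.toReal_sum (fun q _ => ENNReal.mul_ne_top ENNReal.ofReal_ne_top
        (ENNReal.rpow_ne_top_of_nonneg (by linarith) (hatop q)))] at h5
      rw [← Finset.sum_coe_sort] at h5
      refine le_trans (le_of_eq (Finset.sum_congr rfl fun q _ => ?_)) h5
      rw [ENNReal.toReal_mul, ENNReal.toReal_ofReal (by positivity), ← ENNReal.toReal_rpow]
    have hS2 : ∑ q, α q * v q ≤ J + 2 * ε := by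
      have h1 : ∑ q : F, ENNReal.ofReal (v q) * a q ≤ J' + ENNReal.ofReal (2 * ε) := by
        have h2 : J' + ENNReal.ofReal (2 * ε) =
            ∫⁻ x, (ENNReal.ofReal (V x) * ρ x + ENNReal.ofReal (2 * ε) * ρ x) ∂leb Ω := by
          rw [lintegral_add_right _ (by fun_prop), lintegral_const_mul _ hρm, hρ.2, mul_one]
        rw [h2]
        have h3 := hsumle F (fun q => if h : q ∈ F then ENNReal.ofReal (v ⟨q, h⟩) * a q else 0)
          (fun x => ENNReal.ofReal (V x) * ρ x + ENNReal.ofReal (2 * ε) * ρ x) (fun q hq => by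
            rw [dif_pos hq, ← lintegral_const_mul _ hρm]
            refine setLIntegral_mono (by fun_prop) fun x hx => ?_
            rw [← add_mul, ← ENNReal.ofReal_add (hV0 _) (by positivity)]
            gcongr
            have h4 := hVclose ⟨q, hq⟩ x (by
              have := mem_gridCell_cellIndex hm0 (x : E d)
              have hx' : cellIndex (m : ℝ) (x : E d) = q := hx
              rwa [hx'] at this)
            rw [abs_lt] at h4
            simp only [hv]; linarith)
        refine le_trans (le_of_eq ?_) h3
        rw [← Finset.sum_coe_sort F]
        exact Finset.sum_congr rfl fun q _ => by rw [dif_pos q.2]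
      have h5 := ENNReal.toReal_mono (ENNReal.add_ne_top.2 ⟨hJ'fin, ENNReal.ofReal_ne_top⟩) h1
      rw [ENNReal.toReal_sum (s := Finset.univ) (f := fun q : F => ENNReal.ofReal (v q) * a q)
          (fun q _ => ENNReal.mul_ne_top ENNReal.ofReal_ne_top (hatop q)),
        ENNReal.toReal_add hJ'fin ENNReal.ofReal_ne_top, ENNReal.toReal_ofReal (by positivity)] at h5
      refine le_trans (le_of_eq (Finset.sum_congr rfl fun q _ => ?_)) h5
      rw [ENNReal.toReal_mul, ENNReal.toReal_ofReal (by
        simp only [hv]; linarith [hV0 (x₀ q)]), mul_comm]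
    have e1 : ∑ q, ((1 - δ) / (m : ℝ)) ^ (-s) * (τ * c₀ * (τ ^ 2 * α q) ^ p) =
        τ * (τ * c₀ * ((τ ^ 2) ^ p * ∑ q, (m : ℝ) ^ s * α q ^ p)) := by
      simp_rw [Finset.mul_sum]
      refine Finset.sum_congr rfl fun q _ => ?_
      rw [Real.div_rpow (by linarith) hm0.le, hδτ, Real.rpow_neg hm0.le, div_inv_eq_mul,
        Real.mul_rpow (by positivity) (hα0 q).le]
      ring
    have e2 : ∑ q, τ ^ 2 * α q * v q = τ ^ 2 * ∑ q, α q * v q := by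
      rw [Finset.mul_sum]
      exact Finset.sum_congr rfl fun q _ => by ring
    rw [e1, e2]
    refine lt_of_le_of_lt ?_ hτ
    gcongr


/-! ### Energy and density of random configurations -/

/-- For monotone `f`, the lower limit of `f R / Rᵈ` may be taken along the integers. -/
lemma liminf_div_pow_eq {f : ℝ → ℝ≥0∞} (hf : Monotone f) :
    liminf (fun R : ℝ => f R / ENNReal.ofReal (R ^ d)) atTop =
      liminf (fun n : ℕ => f n / ENNReal.ofReal ((n : ℝ) ^ d)) atTop := by
  apply le_antisymm
  · exact liminf_le_liminf_of_le (u := fun R : ℝ => f R / ENNReal.ofReal (R ^ d))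
      (tendsto_natCast_atTop_atTop (R := ℝ))
  · refine le_of_forall_lt_imp_le_of_dense fun a ha => ?_
    obtain ⟨b, hab, hb⟩ := exists_between ha
    have hev := eventually_lt_of_lt_liminf hb
    have hv : Tendsto (fun R : ℝ => b * ENNReal.ofReal ((⌊R⌋₊ / R) ^ d)) atTop (𝓝 b) := by
      have h1 := ENNReal.tendsto_ofReal ((tendsto_nat_floor_div_atTop (R := ℝ)).pow d)
      have h2 := ENNReal.Tendsto.const_mul (a := b) h1 (Or.inr hb.ne_top)
      simpa using h2
    refine le_liminf_of_le (by isBoundedDefault) ?_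
    filter_upwards [hv.eventually (lt_mem_nhds hab),
      (tendsto_nat_floor_atTop (α := ℝ)).eventually hev, eventually_ge_atTop 1] with R h1 h2 h3
    have hn : (1 : ℝ) ≤ ⌊R⌋₊ := by exact_mod_cast (Nat.one_le_floor_iff R).2 h3
    have hR : 0 < R := by linarith
    calc a ≤ b * ENNReal.ofReal ((⌊R⌋₊ / R) ^ d) := h1.le
      _ ≤ f ⌊R⌋₊ / ENNReal.ofReal ((⌊R⌋₊ : ℝ) ^ d) * ENNReal.ofReal ((⌊R⌋₊ / R) ^ d) := by
        gcongr
      _ = f ⌊R⌋₊ / ENNReal.ofReal (R ^ d) := by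
        rw [div_pow, ENNReal.ofReal_div_of_pos (by positivity), div_eq_mul_inv, div_eq_mul_inv,
          mul_assoc, ← mul_assoc _ (ENNReal.ofReal _), ENNReal.inv_mul_cancel (by
            rw [Ne, ENNReal.ofReal_eq_zero, not_le]; positivity) ENNReal.ofReal_ne_top, one_mul,
          div_eq_mul_inv]
      _ ≤ f R / ENNReal.ofReal (R ^ d) := by
        gcongr
        exact hf (Nat.floor_le hR.le)

lemma cube_mono {R R' : ℝ} (h : R ≤ R') : cube d R ⊆ cube d R' :=
  fun x hx i => (hx i).trans (by linarith)

lemma isClosed_cube (R : ℝ) : IsClosed (cube d R) := by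
  simp only [cube, ofPred_forall]
  exact isClosed_iInter fun i => isClosed_le (by fun_prop) continuous_const

lemma measurableSet_cube (R : ℝ) : MeasurableSet (cube d R) := (isClosed_cube R).measurableSet

lemma cube_subset_closedBall {R : ℝ} (hR : 0 ≤ R) :
    cube d R ⊆ Metric.closedBall 0 (√d * (R / 2)) := fun x hx => by
  have h := edist_le_of_coord (x := x) (y := 0) (r := R / 2) (by positivity) fun j => by
    simpa using hx j
  rw [edist_dist, ENNReal.ofReal_le_ofReal_iff (by positivity)] at h
  exact h

lemma closedBall_subset_cube {r R : ℝ} (h : r ≤ R / 2) :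
    Metric.closedBall 0 r ⊆ cube d R := fun x hx i => by
  rw [mem_closedBall_zero_iff] at hx
  rw [← Real.norm_eq_abs]
  exact (PiLp.norm_apply_le x i).trans (hx.trans h)

lemma cutKernel_mono (s : ℝ) {A B : Set (E d)} (h : A ⊆ B) (p q : E d) :
    cutKernel s A p q ≤ cutKernel s B p q :=
  indicator_le_indicator_of_subset (prod_mono h h) (fun _ => zero_le) _

namespace Config

lemma interaction_mono (s : ℝ) (C : Config d) {A B : Set (E d)} (h : A ⊆ B) :
    C.interaction s A ≤ C.interaction s B := by
  rw [interaction_eq_tsum, interaction_eq_tsum]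
  gcongr
  exact cutKernel_mono s h _ _

lemma dens_eq (C : Config d) : C.dens =
    liminf (fun n : ℕ => C.toMeasure (cube d n) / ENNReal.ofReal ((n : ℝ) ^ d)) atTop :=
  liminf_div_pow_eq fun _ _ h => measure_mono (cube_mono h)

lemma energy_eq (s : ℝ) (C : Config d) : C.energy s =
    liminf (fun n : ℕ => C.interaction s (cube d n) / ENNReal.ofReal ((n : ℝ) ^ d)) atTop :=
  liminf_div_pow_eq (f := fun R => C.interaction s (cube d R))
    fun _ _ h => C.interaction_mono s (cube_mono h)

lemma measurable_dens (hd : 1 ≤ d) : Measurable (dens : Config d → ℝ≥0∞) := by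
  simp_rw [funext dens_eq]
  exact Measurable.liminf fun n =>
    (measurable_toMeasure_apply hd (measurableSet_cube _)).div_const _

lemma measurable_energy (hd : 1 ≤ d) (s : ℝ) : Measurable (energy s : Config d → ℝ≥0∞) := by
  simp_rw [funext (energy_eq s)]
  exact Measurable.liminf fun n =>
    (measurable_interaction hd s (measurableSet_cube _)).div_const _

/-- The points of a configuration in a cube have at least the minimal Riesz energy. -/
lemma mul_minRieszEnergy_le_interaction (hd : 1 ≤ d) {s R : ℝ} (hR : 0 < R) (C : Config d) {n : ℕ}
    (hn : (n : ℝ≥0∞) ≤ C.toMeasure (cube d R)) :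
    ENNReal.ofReal R ^ (-s) * minRieszEnergy s (cube d 1) n ≤ C.interaction s (cube d R) := by
  classical
  obtain ⟨u, rfl⟩ := Enum.surjective_toConfig hd C
  have hmeas : (Enum.toConfig u).toMeasure (cube d R) =
      ∫⁻ p, (cube d R).indicator 1 p ∂(Enum.toConfig u).toMeasure :=
    (lintegral_indicator_one (measurableSet_cube R)).symm
  -- a sequence that is not locally finite enumerates the empty configuration
  by_cases hu : u ∈ Enum.LocFin
  swap
  · rw [hmeas, Enum.lintegral_toConfig_of_notMem hu] at hn
    have hn0 : n = 0 := by simpa using hn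
    subst hn0
    have h0 : minRieszEnergy s (cube d 1) 0 = 0 :=
      le_antisymm ((minRieszEnergy_le s (fun i : Fin 0 => i.elim0) fun i => i.elim0).trans
        (by simp [rieszEnergy])) zero_le
    simp [h0]
  -- `F` indexes the points in the cube, repeated according to their multiplicity
  have hfin : {i | u i ∈ site '' cube d R}.Finite :=
    (Enum.finite_of_mem_locFin hu _).subset fun i hi =>
      image_mono (cube_subset_closedBall hR.le) hi
  set F := hfin.toFinset with hF
  have hFx : ∀ i : F, ∃ x ∈ cube d R, site x = u i := fun i => by
    exact hfin.mem_toFinset.1 i.2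
  choose x hx hxu using hFx
  have hcard : (Enum.toConfig u).toMeasure (cube d R) = Fintype.card F := by
    rw [hmeas, Enum.lintegral_toConfig hu, tsum_eq_sum (s := F)]
    · rw [← Finset.sum_coe_sort]
      have : ∀ i : F, ext₁ ((cube d R).indicator (1 : E d → ℝ≥0∞)) (u i) = 1 := fun i => by
        rw [← hxu i, ext₁_site, indicator_of_mem (hx i), Pi.one_apply]
      simp [this]
    · intro i hi
      by_cases hr : u i ∈ range site
      · obtain ⟨y, hy⟩ := hr
        rw [← hy, ext₁_site, indicator_of_notMem]
        intro hyc
        exact hi (by rw [hF, hfin.mem_toFinset]; exact ⟨y, hyc, hy⟩)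
      · exact ext₁_of_notMem _ hr
  rw [hcard] at hn
  have hn' : n ≤ Fintype.card F := by exact_mod_cast hn
  calc ENNReal.ofReal R ^ (-s) * minRieszEnergy s (cube d 1) n
      ≤ ENNReal.ofReal R ^ (-s) * minRieszEnergy s (cube d 1) (Fintype.card F) := by
        gcongr; exact minRieszEnergy_mono s _ hn'
    _ ≤ pairEnergy s x := mul_minRieszEnergy_le hR x hx
    _ = ∑ i ∈ F, ∑ j ∈ F, if i = j then 0 else ext₂ (cutKernel s (cube d R)) (u i, u j) := by
      rw [← Finset.sum_coe_sort F]
      refine Finset.sum_congr rfl fun i _ => ?_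
      rw [← Finset.sum_coe_sort F]
      refine Finset.sum_congr rfl fun j _ => ?_
      simp only [Subtype.ext_iff]
      rw [← hxu i, ← hxu j, ext₂_site, cutKernel,
        indicator_of_mem (mk_mem_prod (hx i) (hx j))]
      rfl
    _ ≤ _ := by
      rw [Enum.interaction_toConfig hu]
      exact (Finset.sum_le_sum fun i _ => ENNReal.sum_le_tsum F).trans (ENNReal.sum_le_tsum F)

end Config

lemma processEnergy_eq (s : ℝ) (P : Measure (Config d)) : processEnergy s P =
    liminf (fun n : ℕ => (∫⁻ C, C.interaction s (cube d n) ∂P) / ENNReal.ofReal ((n : ℝ) ^ d))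
      atTop :=
  liminf_div_pow_eq (f := fun R => ∫⁻ C, C.interaction s (cube d R) ∂P)
    fun _ _ h => lintegral_mono fun C => C.interaction_mono s (cube_mono h)

/-- The superlinear lower bound for the interaction in a cube of size `n`, at the scale of the
volume, with a defect `k / nᵈ` that vanishes as `n → ∞`. -/
lemma exists_mul_sub_rpow_le_interaction (hd : 1 ≤ d) {s : ℝ} (hs : 0 < s) {c : ℝ≥0∞}
    (hc : c < rieszConstant s d) : ∃ k : ℕ, ∀ n : ℕ, 1 ≤ n → ∀ C : Config d,
      c * (C.toMeasure (cube d n) / ENNReal.ofReal ((n : ℝ) ^ d) -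
        (k : ℝ≥0∞) / ENNReal.ofReal ((n : ℝ) ^ d)) ^ (1 + s / d) ≤
      C.interaction s (cube d n) / ENNReal.ofReal ((n : ℝ) ^ d) := by
  obtain ⟨k, hk⟩ := exists_mul_sub_rpow_le hd hs hc
  refine ⟨k, fun n hn C => ?_⟩
  have hn0 : (0 : ℝ) < n := by exact_mod_cast hn
  have hd0 : (0 : ℝ) < d := by exact_mod_cast hd
  have hp : (0 : ℝ) ≤ 1 + s / d := by positivity
  set D := ENNReal.ofReal ((n : ℝ) ^ d) with hD
  have hD0 : D ≠ 0 := by rw [hD, Ne, ENNReal.ofReal_eq_zero, not_le]; positivity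
  have hDt : D ≠ ∞ := ENNReal.ofReal_ne_top
  have hcount : ∃ N : ℕ, C.toMeasure (cube d n) = N := by
    have hmeas := lintegral_indicator_one (μ := C.toMeasure)
      (measurableSet_cube (d := d) (n : ℝ))
    have h2 : ∀ p : E d, ((C.mult p : ℝ≥0∞) * (cube d n).indicator 1 p) =
        (((cube d n).indicator C.mult p : ℕ) : ℝ≥0∞) := fun p => by
      by_cases hp : p ∈ cube d (n : ℝ) <;> simp [hp]
    have hfin : (Function.support ((cube d n).indicator C.mult)).Finite := by
      refine (C.locallyFinite (√d * (n / 2))).subset ?_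
      rw [support_indicator]
      exact inter_subset_inter_left _ (cube_subset_closedBall hn0.le)
    refine ⟨∑ p ∈ hfin.toFinset, (cube d n).indicator C.mult p, ?_⟩
    rw [← hmeas, Config.lintegral_toMeasure, tsum_congr h2, tsum_eq_sum (s := hfin.toFinset),
      Nat.cast_sum]
    intro p hp
    simpa using hp
  obtain ⟨N, hN⟩ := hcount
  have h1 := C.mul_minRieszEnergy_le_interaction hd (s := s) hn0 (n := N) hN.ge
  -- scaling: dividing by the volume `D = n ^ d`, the factor `n ^ (-s)` of the energy in a cube of
  -- side `n` becomes `D ^ (-(1 + s / d))`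
  have h2 : D⁻¹ * (ENNReal.ofReal (n : ℝ) ^ (-s)) = (D⁻¹) ^ (1 + s / d) := by
    rw [ENNReal.rpow_add _ _ (by simpa using hDt) (by simpa using hD0), ENNReal.rpow_one,
      hD, ENNReal.inv_rpow, ENNReal.ofReal_pow hn0.le, ← ENNReal.rpow_natCast,
      ← ENNReal.rpow_mul, ← ENNReal.rpow_neg, mul_div_cancel₀ _ hd0.ne', ENNReal.rpow_neg _ s]
  rw [hN, div_eq_mul_inv, div_eq_mul_inv, ← ENNReal.sub_mul (by simp [hD0]),
    ENNReal.mul_rpow_of_nonneg _ _ hp, ← h2, div_eq_mul_inv (Config.interaction _ _ _)]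
  calc c * (((N : ℝ≥0∞) - k) ^ (1 + s / d) * (D⁻¹ * ENNReal.ofReal (n : ℝ) ^ (-s)))
      = (c * ((N - k : ℕ) : ℝ≥0∞) ^ (1 + s / d)) * ENNReal.ofReal (n : ℝ) ^ (-s) * D⁻¹ := by
        rw [ENNReal.natCast_sub]; ring
    _ ≤ _ := by
        gcongr
        refine le_trans ?_ h1
        rw [mul_comm]
        gcongr
        exact hk N

/-- Passage to the limit in the lower bound, the defect being negligible. -/
lemma mul_rpow_liminf_le (hd : 1 ≤ d) {p : ℝ} (hp : 0 < p) {Λ : ℝ≥0∞} {z i : ℕ → ℝ≥0∞}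
    (h : ∀ c < Λ, ∃ k : ℕ, ∀ n : ℕ, 1 ≤ n →
      c * (z n - (k : ℝ≥0∞) / ENNReal.ofReal ((n : ℝ) ^ d)) ^ p ≤ i n) :
    Λ * liminf z atTop ^ p ≤ liminf i atTop := by
  refine ENNReal.mul_le_of_forall_lt fun c hc y hy => ?_
  obtain ⟨k, hk⟩ := h c hc
  have hy2 : y ^ (1 / p) < liminf z atTop := by
    rw [one_div, ENNReal.rpow_inv_lt_iff hp]; exact hy
  -- the room between `y ^ (1 / p)` and the lower limit of `z` absorbs the defect
  obtain ⟨b, hyb, hb⟩ := exists_between hy2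
  have hlim : Tendsto (fun n : ℕ => (k : ℝ≥0∞) / ENNReal.ofReal ((n : ℝ) ^ d)) atTop (𝓝 0) := by
    have h1 : Tendsto (fun n : ℕ => ENNReal.ofReal ((n : ℝ) ^ d)) atTop (𝓝 ∞) :=
      ENNReal.tendsto_ofReal_nhds_top.2
        ((tendsto_pow_atTop (by omega)).comp tendsto_natCast_atTop_atTop)
    simpa using ENNReal.Tendsto.const_div h1 (Or.inr (ENNReal.natCast_ne_top k))
  have hpos : 0 < b - y ^ (1 / p) := tsub_pos_of_lt hyb
  refine le_liminf_of_le (by isBoundedDefault) ?_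
  filter_upwards [eventually_lt_of_lt_liminf hb, hlim.eventually (gt_mem_nhds hpos),
    eventually_ge_atTop 1] with n h1 h2 h3
  refine le_trans ?_ (hk n h3)
  gcongr
  have h4 : y ^ (1 / p) ≤ z n - (k : ℝ≥0∞) / ENNReal.ofReal ((n : ℝ) ^ d) := by
    refine ENNReal.le_sub_of_add_le_right (h2.ne_top) ?_
    calc _ ≤ y ^ (1 / p) + (b - y ^ (1 / p)) := by gcongr
      _ = b := add_tsub_cancel_of_le hyb.le
      _ ≤ z n := h1.le
  calc y = (y ^ (1 / p)) ^ p := by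
        rw [← ENNReal.rpow_mul, one_div, inv_mul_cancel₀ hp.ne', ENNReal.rpow_one]
    _ ≤ _ := by gcongr

/-- A configuration of density `m` has energy at least `C_{s,d} m^{1 + s/d}`. -/
lemma Config.mul_dens_rpow_le_energy (hd : 1 ≤ d) {s : ℝ} (hs : 0 < s) (C : Config d) :
    rieszConstant s d * C.dens ^ (1 + s / d) ≤ C.energy s := by
  rw [C.dens_eq, C.energy_eq]
  refine mul_rpow_liminf_le hd (by positivity) fun c hc => ?_
  obtain ⟨k, hk⟩ := exists_mul_sub_rpow_le_interaction hd hs hc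
  exact ⟨k, fun n hn => hk n hn C⟩

/-- The mean form of the lower bound on the interaction. -/
lemma exists_mul_sub_rpow_le_lintegral_interaction (hd : 1 ≤ d) {s : ℝ} (hs : 0 < s) {c : ℝ≥0∞}
    (hc : c < rieszConstant s d) : ∃ k : ℕ, ∀ (P : Measure (Config d)) [IsProbabilityMeasure P]
      (n : ℕ), 1 ≤ n →
      c * ∫⁻ C, (C.toMeasure (cube d n) / ENNReal.ofReal ((n : ℝ) ^ d) -
        (k : ℝ≥0∞) / ENNReal.ofReal ((n : ℝ) ^ d)) ^ (1 + s / d) ∂P ≤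
      (∫⁻ C, C.interaction s (cube d n) ∂P) / ENNReal.ofReal ((n : ℝ) ^ d) := by
  obtain ⟨k, hk⟩ := exists_mul_sub_rpow_le_interaction hd hs hc
  refine ⟨k, fun P _ n hn => ?_⟩
  have hm := Config.measurable_toMeasure_apply hd (measurableSet_cube (d := d) (n : ℝ))
  rw [← lintegral_const_mul _ (by fun_prop), div_eq_mul_inv (lintegral _ _),
    ← lintegral_mul_const _ (Config.measurable_interaction hd s (measurableSet_cube _))]
  exact lintegral_mono fun C => by simpa only [div_eq_mul_inv] using hk n hn C

/-- The energy of a random configuration of mean density `m` is at least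
`C_{s,d} m^{1 + s/d}`. -/
lemma mul_intensity_rpow_le_processEnergy (hd : 1 ≤ d) {s : ℝ} (hs : 0 < s)
    (P : Measure (Config d)) [IsProbabilityMeasure P] :
    rieszConstant s d * (liminf (fun n : ℕ =>
      (∫⁻ C, C.toMeasure (cube d n) ∂P) / ENNReal.ofReal ((n : ℝ) ^ d)) atTop) ^ (1 + s / d) ≤
      processEnergy s P := by
  rw [processEnergy_eq]
  have hd0 : (0 : ℝ) < d := by exact_mod_cast hd
  have hp : 1 < 1 + s / d := by have : 0 < s / d := by positivity
                                linarith
  refine mul_rpow_liminf_le hd (by linarith) fun c hc => ?_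
  obtain ⟨k, hk⟩ := exists_mul_sub_rpow_le_lintegral_interaction hd hs hc
  refine ⟨k, fun n hn => le_trans ?_ (hk P n hn)⟩
  have hm := Config.measurable_toMeasure_apply hd (measurableSet_cube (d := d) (n : ℝ))
  gcongr
  have h1 := rpow_lintegral_le P hp (f := fun C =>
    C.toMeasure (cube d n) / ENNReal.ofReal ((n : ℝ) ^ d) -
        (k : ℝ≥0∞) / ENNReal.ofReal ((n : ℝ) ^ d)) (by fun_prop)
  rw [measure_univ, ENNReal.one_rpow, mul_one] at h1
  refine le_trans ?_ h1
  gcongr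
  refine le_trans ?_ (lintegral_sub_le _ _ measurable_const)
  rw [lintegral_const, measure_univ, mul_one]
  simp_rw [div_eq_mul_inv]
  rw [lintegral_mul_const _ hm]

/-- Fatou's lemma for the density. -/
lemma intensity_le_liminf (hd : 1 ≤ d) (P : Measure (Config d)) :
    intensity P ≤ liminf (fun n : ℕ =>
      (∫⁻ C, C.toMeasure (cube d n) ∂P) / ENNReal.ofReal ((n : ℝ) ^ d)) atTop := by
  unfold intensity
  simp_rw [Config.dens_eq]
  have hm := fun n : ℕ => Config.measurable_toMeasure_apply hd (measurableSet_cube (d := d) (n : ℝ))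
  refine (lintegral_liminf_le fun n => (hm n).div_const _).trans (le_of_eq ?_)
  simp_rw [div_eq_mul_inv]
  congr 1; ext n
  rw [lintegral_mul_const _ (hm n)]


/-! ### Stationary laws: the mean measure -/

lemma measurable_toMeasure (hd : 1 ≤ d) : Measurable (Config.toMeasure : Config d → Measure (E d)) :=
  Measure.measurable_of_measurable_coe _ fun _ hA => Config.measurable_toMeasure_apply hd hA

/-- The mean measure of a stationary law is a multiple of Lebesgue measure. -/
lemma IsStationary.exists_lintegral_eq (hd : 1 ≤ d) {P : Measure (Config d)}
    (hP : IsStationary P) (hfin : ∀ n : ℕ, ∫⁻ C, C.toMeasure (cube d n) ∂P < ∞) :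
    ∃ m : ℝ≥0∞, m ≠ ∞ ∧ ∀ f : E d → ℝ≥0∞, Measurable f →
      ∫⁻ C, ∫⁻ p, f p ∂C.toMeasure ∂P = m * ∫⁻ p, f p := by
  set Λ := P.bind Config.toMeasure with hΛ
  have hΛ1 : ∀ f : E d → ℝ≥0∞, Measurable f →
      ∫⁻ p, f p ∂Λ = ∫⁻ C, ∫⁻ p, f p ∂C.toMeasure ∂P := fun f hf =>
    Measure.lintegral_bind (measurable_toMeasure hd).aemeasurable hf.aemeasurable
  have hcpt : IsFiniteMeasureOnCompacts Λ := ⟨fun K hK => by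
    obtain ⟨r, hr⟩ := hK.isBounded.subset_closedBall 0
    obtain ⟨n, hn⟩ := exists_nat_ge (2 * r)
    refine (measure_mono (hr.trans (closedBall_subset_cube (R := n) (by linarith)))).trans_lt ?_
    rw [hΛ, Measure.bind_apply (measurableSet_cube _) (measurable_toMeasure hd).aemeasurable]
    exact hfin n⟩
  have hinv : Λ.IsAddLeftInvariant := ⟨fun x => by
    refine Measure.ext_of_lintegral _ fun f hf => ?_
    rw [lintegral_map hf (measurable_const_add x),
      hΛ1 (fun p => f (x + p)) (hf.comp (measurable_const_add x)), hΛ1 _ hf]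
    conv_rhs => rw [← hP (-x)]
    rw [lintegral_map (Config.measurable_lintegral hd hf) (Config.continuous_translate _).measurable]
    simp_rw [Config.lintegral_translate, sub_neg_eq_add, add_comm x]⟩
  -- uniqueness of the Haar measure
  have h := Measure.isAddLeftInvariant_eq_smul Λ (volume : Measure (E d))
  refine ⟨(Measure.addHaarScalarFactor Λ volume : ℝ≥0∞), ENNReal.coe_ne_top, fun f hf => ?_⟩
  rw [← hΛ1 f hf]
  exact (congrArg (fun ν : Measure (E d) => ∫⁻ p, f p ∂ν) h).trans (lintegral_smul_measure _ _)

/-! ### Laws that minimize the energy at given density -/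

/-- The tangent inequality for `t ↦ tᵖ` at `m`, with a gain away from `m`. -/
lemma exists_sub_add_mul_le {p : ℝ} (hp : 1 < p) (m δ : ℝ≥0) (hδ : 0 < δ) :
    ∃ K : ℝ≥0, 0 < K ∧ ∀ t : ℝ≥0∞,
      ((m : ℝ≥0∞) - t) + K * (ENNReal.ofReal p * (m : ℝ≥0∞) ^ (p - 1) * t) ≤
        δ + K * (t ^ p + ENNReal.ofReal (p - 1) * (m : ℝ≥0∞) ^ p) := by
  let h : ℝ → ℝ := fun t => t ^ p + (p - 1) * (m : ℝ) ^ p - p * (m : ℝ) ^ (p - 1) * t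
  have hcont : ContinuousOn h (Icc 0 (m - δ)) := by
    have : Continuous h := by
      have := Real.continuous_rpow_const (q := p) (by linarith)
      fun_prop
    exact this.continuousOn
  -- strict convexity and compactness: the gap `h` in the tangent inequality is bounded below on
  -- `[0, m - δ]`
  obtain ⟨γ, hγ, hγle⟩ : ∃ γ : ℝ, 0 < γ ∧ ∀ t ∈ Icc (0 : ℝ) (m - δ), γ ≤ h t := by
    rcases (Icc (0 : ℝ) (m - δ)).eq_empty_or_nonempty with he | hne
    · exact ⟨1, one_pos, fun t ht => by rw [he] at ht; exact ht.elim⟩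
    · obtain ⟨t₀, ht₀, hmin⟩ := isCompact_Icc.exists_isMinOn hne hcont
      refine ⟨h t₀, ?_, fun t ht => hmin ht⟩
      have h1 := tangent_lt_rpow hp ht₀.1 m.2 (by
        intro h2
        have h3 := ht₀.2
        have : (0 : ℝ) < δ := hδ
        change t₀ = (m : ℝ) at h2
        linarith)
      simp only [h]
      change p * (m : ℝ) ^ (p - 1) * t₀ < t₀ ^ p + (p - 1) * (m : ℝ) ^ p at h1
      linarith
  set K : ℝ≥0 := Real.toNNReal ((m + 1) / γ) with hK
  have hKr : (K : ℝ) = (m + 1) / γ := Real.coe_toNNReal _ (by positivity)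
  refine ⟨K, by rw [hK, Real.toNNReal_pos]; positivity, fun t => ?_⟩
  have hK0 : 0 < K := by rw [hK, Real.toNNReal_pos]; positivity
  rcases eq_or_ne t ∞ with rfl | ht
  · have hKt : (K : ℝ≥0∞) * ∞ = ∞ := ENNReal.mul_top (by exact_mod_cast hK0.ne')
    rw [ENNReal.top_rpow_of_pos (by linarith), top_add, hKt, add_top]
    exact le_top
  lift t to ℝ≥0 using ht
  have key : max ((m : ℝ) - t) 0 + K * (p * (m : ℝ) ^ (p - 1) * t) ≤
      δ + K * ((t : ℝ) ^ p + (p - 1) * (m : ℝ) ^ p) := by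
    have h0 := tangent_le_rpow hp t.2 m.2
    change p * (m : ℝ) ^ (p - 1) * t ≤ (t : ℝ) ^ p + (p - 1) * (m : ℝ) ^ p at h0
    have hKn : (0 : ℝ) ≤ K := K.2
    have h2 : max ((m : ℝ) - t) 0 ≤ δ + K * h t := by
      have hh : 0 ≤ h t := by simp only [h]; linarith
      -- if `t ≥ m - δ` then the defect is at most `δ`; otherwise `K * h t ≥ m + 1` exceeds it
      rcases le_or_gt ((m : ℝ) - t) δ with h1 | h1
      · exact (max_le h1 δ.2).trans (by have := mul_nonneg hKn hh; linarith)
      · have h3 := hγle t ⟨t.2, by linarith⟩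
        have h4 : (m : ℝ) + 1 ≤ K * h t := by
          rw [hKr, div_mul_eq_mul_div, le_div_iff₀ hγ]
          gcongr
        have : (0 : ℝ) ≤ t := t.2
        have : (0 : ℝ) ≤ m := m.2
        have : (0 : ℝ) ≤ δ := δ.2
        exact max_le (by linarith) (by linarith)
    have h3 : K * h t = K * ((t : ℝ) ^ p + (p - 1) * (m : ℝ) ^ p) - K * (p * (m : ℝ) ^ (p - 1) * t) := by
      simp only [h]; ring
    linarith
  have e := ENNReal.ofReal_le_ofReal key
  have hp1 : 0 ≤ p - 1 := by linarith
  have hp0 : 0 ≤ p := by linarith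
  have hm0 : (0 : ℝ) ≤ m := m.2
  have ht0 : (0 : ℝ) ≤ t := t.2
  rw [ENNReal.ofReal_add (le_max_right _ _) (by positivity),
    ENNReal.ofReal_add (by positivity) (by positivity), ENNReal.ofReal_mul (by positivity),
    ENNReal.ofReal_mul (by positivity), ENNReal.ofReal_mul (by positivity),
    ENNReal.ofReal_mul (by positivity), ENNReal.ofReal_add (by positivity) (by positivity),
    ENNReal.ofReal_mul (by positivity), ← ENNReal.ofReal_rpow_of_nonneg hm0 hp1,
    ← ENNReal.ofReal_rpow_of_nonneg hm0 hp0, ← ENNReal.ofReal_rpow_of_nonneg ht0 hp0] at e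
  simp only [ENNReal.ofReal_coe_nnreal] at e
  refine le_trans ?_ e
  gcongr
  rw [← ENNReal.ofReal_coe_nnreal, ← ENNReal.ofReal_coe_nnreal (p := t),
    ← ENNReal.ofReal_sub _ ht0]
  exact ENNReal.ofReal_le_ofReal (le_max_left _ _)

/-- If the mean interaction of a law of mean density `m` is asymptotically minimal along a
sequence of cubes, then the density in some large cube falls below `m` only by little on average. -/
lemma exists_lintegral_sub_le (hd : 1 ≤ d) {s : ℝ} (hs : (d : ℝ) < s) {P : Measure (Config d)}
    [IsProbabilityMeasure P] {m : ℝ≥0}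
    (hN : ∀ n : ℕ, ∫⁻ C, C.toMeasure (cube d n) ∂P = m * ENNReal.ofReal ((n : ℝ) ^ d))
    (hE : processEnergy s P ≤ rieszConstant s d * (m : ℝ≥0∞) ^ (1 + s / d)) {ε : ℝ≥0} (hε : 0 < ε) :
    ∃ n : ℕ, 1 ≤ n ∧
      ∫⁻ C, ((m : ℝ≥0∞) - C.toMeasure (cube d n) / ENNReal.ofReal ((n : ℝ) ^ d)) ∂P ≤ ε := by
  have hd0 : (0 : ℝ) < d := by exact_mod_cast hd
  have hs0 : 0 < s := hd0.trans hs
  set p := 1 + s / d with hpdef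
  have hp : 1 < p := by have : 0 < s / d := by positivity
                        linarith
  set Λ := rieszConstant s d with hΛ
  have hΛ0 : Λ ≠ 0 := (rieszConstant_pos hd hs0).ne'
  have hΛt : Λ ≠ ∞ := (rieszConstant_lt_top hd hs).ne
  obtain ⟨K, hK0, hK⟩ := exists_sub_add_mul_le hp m (ε / 2) (by positivity)
  set M : ℝ≥0∞ := (m : ℝ≥0∞) ^ p with hM
  have hMt : M ≠ ∞ := ENNReal.rpow_ne_top_of_nonneg (by linarith) ENNReal.coe_ne_top
  -- the error in the mean of `Zᵖ` that can be afforded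
  set η : ℝ≥0∞ := (ε : ℝ≥0∞) / (4 * K) with hη
  have hKne : (K : ℝ≥0∞) ≠ 0 := by exact_mod_cast hK0.ne'
  have hη0 : η ≠ 0 := by
    rw [hη]; exact ENNReal.div_ne_zero.2 ⟨by exact_mod_cast hε.ne', by finiteness⟩
  have hηt : η ≠ ∞ := by rw [hη]; finiteness
  have hlt : Λ * M / (M + η) < Λ := by
    refine ENNReal.div_lt_of_lt_mul ?_
    rw [mul_add]
    exact ENNReal.lt_add_right (by finiteness) (mul_ne_zero hΛ0 hη0)
  obtain ⟨c, hc1, hc2⟩ := exists_between hlt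
  have hc0 : c ≠ 0 := (bot_le.trans_lt hc1).ne'
  have hct : c ≠ ∞ := hc2.ne_top
  obtain ⟨k, hk⟩ := exists_mul_sub_rpow_le_lintegral_interaction hd hs0 hc2
  have hcM : Λ * M < c * (M + η) := by
    rwa [ENNReal.div_lt_iff (Or.inl (by simp [hη0])) (Or.inl (by finiteness))] at hc1
  have hfreq : ∃ᶠ n : ℕ in atTop,
      (∫⁻ C, C.interaction s (cube d n) ∂P) / ENNReal.ofReal ((n : ℝ) ^ d) < c * (M + η) := by
    refine frequently_lt_of_liminf_lt (by isBoundedDefault) ?_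
    rw [← processEnergy_eq]
    exact hE.trans_lt hcM
  set A : ℝ≥0∞ := K * (ENNReal.ofReal p * (m : ℝ≥0∞) ^ (p - 1)) with hA
  have hAt : A ≠ ∞ := by
    have : (m : ℝ≥0∞) ^ (p - 1) ≠ ∞ :=
      ENNReal.rpow_ne_top_of_nonneg (by linarith) ENNReal.coe_ne_top
    rw [hA]; finiteness
  have hlim : Tendsto (fun n : ℕ => A * ((k : ℝ≥0∞) / ENNReal.ofReal ((n : ℝ) ^ d))) atTop (𝓝 0) := by
    have h1 : Tendsto (fun n : ℕ => ENNReal.ofReal ((n : ℝ) ^ d)) atTop (𝓝 ∞) :=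
      ENNReal.tendsto_ofReal_nhds_top.2
        ((tendsto_pow_atTop (by omega)).comp tendsto_natCast_atTop_atTop)
    have h2 := ENNReal.Tendsto.const_mul (a := A)
      (ENNReal.Tendsto.const_div h1 (Or.inr (ENNReal.natCast_ne_top k))) (Or.inr hAt)
    simpa using h2
  have hε4 : (0 : ℝ≥0∞) < ε / 4 := ENNReal.div_pos (by exact_mod_cast hε.ne') (by norm_num)
  obtain ⟨n, hn1, hn2, hn3⟩ := (hfreq.and_eventually
    ((hlim.eventually (gt_mem_nhds hε4)).and (eventually_ge_atTop 1))).exists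
  refine ⟨n, hn3, ?_⟩
  have hn0 : (0 : ℝ) < n := by exact_mod_cast hn3
  set D := ENNReal.ofReal ((n : ℝ) ^ d) with hD
  have hD0 : D ≠ 0 := by rw [hD, Ne, ENNReal.ofReal_eq_zero, not_le]; positivity
  have hDt : D ≠ ∞ := ENNReal.ofReal_ne_top
  have hm := Config.measurable_toMeasure_apply hd (measurableSet_cube (d := d) (n : ℝ))
  -- `Z` is the density in the cube up to the small defect `k / D`: its mean is almost `m`, while
  -- the mean of `Z ^ p` is almost at most `m ^ p`
  set Z : Config d → ℝ≥0∞ := fun C => C.toMeasure (cube d n) / D - k / D with hZ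
  have hZm : Measurable Z := by fun_prop
  have hZp : ∫⁻ C, Z C ^ p ∂P ≤ M + η := by
    have h1 := (hk P n hn3).trans hn1.le
    exact (ENNReal.mul_le_mul_iff_right hc0 hct).1 h1
  have hZ1 : (m : ℝ≥0∞) ≤ ∫⁻ C, Z C ∂P + k / D := by
    rw [← tsub_le_iff_right]
    refine le_trans ?_ (lintegral_sub_le _ _ measurable_const)
    rw [lintegral_const, measure_univ, mul_one]
    simp_rw [div_eq_mul_inv]
    rw [lintegral_mul_const _ hm, hN, mul_assoc, ENNReal.mul_inv_cancel hD0 hDt, mul_one]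
  -- integrate the tangent inequality with gain
  have hint : ∫⁻ C, ((m : ℝ≥0∞) - Z C) ∂P + A * ∫⁻ C, Z C ∂P ≤
      ((ε / 2 : ℝ≥0) : ℝ≥0∞) + K * (M + η + ENNReal.ofReal (p - 1) * M) := by
    calc _ = ∫⁻ C, (((m : ℝ≥0∞) - Z C) + K * (ENNReal.ofReal p * (m : ℝ≥0∞) ^ (p - 1) * Z C)) ∂P := by
          rw [lintegral_add_left (by fun_prop), ← lintegral_const_mul _ hZm]
          simp only [hA, mul_assoc]
      _ ≤ ∫⁻ C, (((ε / 2 : ℝ≥0) : ℝ≥0∞) + K * (Z C ^ p + ENNReal.ofReal (p - 1) * M)) ∂P :=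
          lintegral_mono fun C => hK (Z C)
      _ = ((ε / 2 : ℝ≥0) : ℝ≥0∞) + K * (∫⁻ C, Z C ^ p ∂P + ENNReal.ofReal (p - 1) * M) := by
          rw [lintegral_add_left measurable_const, lintegral_const_mul _ (by fun_prop),
            lintegral_add_right _ measurable_const]
          simp
      _ ≤ _ := by gcongr
  -- the tangent of `t ↦ t ^ p` at `m` agrees with the function at `m`, so the main terms cancel
  have hAm : A * m = K * M + K * (ENNReal.ofReal (p - 1) * M) := by
    have h1 : (m : ℝ≥0∞) ^ (p - 1) * m = M := by
      rcases eq_or_ne m 0 with rfl | hm0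
      · simp [hM, ENNReal.zero_rpow_of_pos (show 0 < p by linarith)]
      · rw [hM]
        conv_lhs => rw [← ENNReal.rpow_one (m : ℝ≥0∞), ← ENNReal.rpow_mul, one_mul]
        rw [← ENNReal.rpow_add _ _ (by exact_mod_cast hm0) ENNReal.coe_ne_top]
        congr 1; ring
    rw [hA, mul_assoc, mul_assoc, h1, ← mul_add]
    congr 1
    rw [show ENNReal.ofReal p = 1 + ENNReal.ofReal (p - 1) by
      rw [← ENNReal.ofReal_one, ← ENNReal.ofReal_add zero_le_one (by linarith)]; congr 1; ring]
    ring
  have hfin : A * m ≠ ∞ := by finiteness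
  have hKη : K * η = ε / 4 := by
    rw [hη, ← mul_div_assoc, mul_comm (K : ℝ≥0∞), ENNReal.mul_div_mul_right _ _ hKne (by finiteness)]
  have hfinal : ∫⁻ C, ((m : ℝ≥0∞) - Z C) ∂P + A * m ≤ ε + A * m := by
    calc _ ≤ ∫⁻ C, ((m : ℝ≥0∞) - Z C) ∂P + A * (∫⁻ C, Z C ∂P + k / D) := by gcongr
      _ = ∫⁻ C, ((m : ℝ≥0∞) - Z C) ∂P + A * ∫⁻ C, Z C ∂P + A * (k / D) := by ring
      _ ≤ ((ε / 2 : ℝ≥0) : ℝ≥0∞) + K * (M + η + ENNReal.ofReal (p - 1) * M) + ε / 4 := by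
        gcongr
      _ = ((ε / 2 : ℝ≥0) : ℝ≥0∞) + K * η + ε / 4 + A * m := by rw [hAm]; ring
      _ = ε + A * m := by
        congr 1
        have h4 : (ε : ℝ≥0∞) / 4 = ((ε / 4 : ℝ≥0) : ℝ≥0∞) := by
          rw [ENNReal.coe_div (by norm_num)]; rfl
        rw [hKη, h4, ← ENNReal.coe_add, ← ENNReal.coe_add, ENNReal.coe_inj]
        ext; push_cast; ring
  refine le_trans ?_ ((ENNReal.add_le_add_iff_right hfin).1 hfinal)
  gcongr
  exact tsub_le_self


/-! ### The density of energy minimizing stationary laws -/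

namespace Config

lemma measurable_uncurry_translate : Measurable fun a : E d × Config d => a.2.translate a.1 :=
  measurable_uncurry_of_continuous_of_measurable (u := fun (x : E d) (C : Config d) => C.translate x)
    continuous_translate_left fun x => (continuous_translate x).measurable

/-- The number of points in a cube controls the average number of points in smaller cubes. -/
lemma setLIntegral_toMeasure_translate_le (C : Config d) {r R : ℝ} (hr : 0 ≤ r) :
    ∫⁻ y in cube d R, (C.translate y).toMeasure (cube d r) ≤
      ENNReal.ofReal (r ^ d) * C.toMeasure (cube d (R + r)) := by
  have hm := measurableSet_cube (d := d) r
  have h1 : ∀ y, (C.translate y).toMeasure (cube d r) =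
      ∫⁻ p, (cube d r).indicator 1 (p - y) ∂C.toMeasure := fun y => by
    rw [← lintegral_indicator_one hm, lintegral_translate]
  have hmi : Measurable ((cube d r).indicator (1 : E d → ℝ≥0∞)) := measurable_one.indicator hm
  simp_rw [h1]
  rw [lintegral_lintegral_swap (by fun_prop)]
  rw [← lintegral_indicator_one (measurableSet_cube _), ← lintegral_const_mul _
    (measurable_one.indicator (measurableSet_cube _))]
  refine lintegral_mono fun p => ?_
  by_cases hp : p ∈ cube d (R + r)
  · rw [indicator_of_mem hp, Pi.one_apply, mul_one]
    refine (setLIntegral_le_lintegral _ _).trans ?_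
    rw [lintegral_sub_left_eq_self (fun y => (cube d r).indicator (1 : E d → ℝ≥0∞) y) p,
      lintegral_indicator_one hm, volume_cube hr]
  · rw [setLIntegral_congr_fun (g := 0) (measurableSet_cube _)]
    · simp
    · intro y hy
      refine indicator_of_notMem (fun h => hp fun i => ?_) _
      have h1 := hy i
      have h2 := h i
      rw [PiLp.sub_apply] at h2
      rw [abs_le] at *
      constructor <;> linarith

end Config

/-- The configurations around which the average of `g` over some cube of integer size at most `T`
exceeds `l`. -/
def maximalSet (g : Config d → ℝ≥0∞) (l : ℝ≥0∞) (T : ℕ) : Set (Config d) :=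
  {C | ∃ n : ℕ, 1 ≤ n ∧ n ≤ T ∧
    l * ENNReal.ofReal ((n : ℝ) ^ d) < ∫⁻ y in cube d n, g (C.translate y)}

lemma measurableSet_maximalSet {g : Config d → ℝ≥0∞} (hg : Measurable g) (l : ℝ≥0∞) (T : ℕ) :
    MeasurableSet (maximalSet g l T) := by
  have : maximalSet g l T = ⋃ n : ℕ, ⋃ _ : 1 ≤ n ∧ n ≤ T,
      {C | l * ENNReal.ofReal ((n : ℝ) ^ d) < ∫⁻ y in cube d n, g (C.translate y)} := by
    ext C; simp [maximalSet, and_assoc]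
  rw [this]
  refine MeasurableSet.iUnion fun n => MeasurableSet.iUnion fun _ =>
    measurableSet_lt measurable_const ?_
  have h : Measurable fun a : Config d × E d => g (a.1.translate a.2) :=
    hg.comp (Config.measurable_uncurry_translate.comp measurable_swap)
  exact h.lintegral_prod_right'

/-- The covering argument behind the maximal inequality, for a single configuration. -/
lemma mul_volume_maximalSet_le {g : Config d → ℝ≥0∞} (l : ℝ≥0∞)
    (T : ℕ) (C : Config d) :
    l * volume {y ∈ cube d T | C.translate y ∈ maximalSet g l T} ≤
      3 ^ d * ∫⁻ z in cube d (2 * T), g (C.translate z) := by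
  classical
  set A := {y ∈ cube d T | C.translate y ∈ maximalSet g l T} with hA
  have hch : ∀ y : E d, ∃ n : ℕ, y ∈ A → 1 ≤ n ∧ n ≤ T ∧
      l * ENNReal.ofReal ((n : ℝ) ^ d) < ∫⁻ z in cube d n, g ((C.translate y).translate z) :=
    fun y => by
      by_cases hy : y ∈ A
      · obtain ⟨n, hn⟩ := hy.2
        exact ⟨n, fun _ => hn⟩
      · exact ⟨0, fun h => (hy h).elim⟩
  choose n hn using hch
  let B : E d → Set (E d) := fun y => {z | z - y ∈ cube d (n y)}
  have hBself : ∀ y, y ∈ B y := fun y i => by simp; positivity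
  -- Vitali covering: with enlargement parameter `2`, a disjoint subfamily of cubes `B y` whose
  -- concentric triples cover `A`
  obtain ⟨u, huA, hdisj, hcov⟩ := Vitali.exists_disjoint_subfamily_covering_enlargement B A
    (fun y => (n y : ℝ)) 2 one_lt_two (fun _ _ => Nat.cast_nonneg _) T
    (fun y hy => by exact_mod_cast (hn y hy).2.1) fun y _ => ⟨y, hBself y⟩
  have hBm : ∀ y, MeasurableSet (B y) := fun y =>
    (measurable_id.sub_const y) (measurableSet_cube _)
  have hpos : ∀ y ∈ A, (0 : ℝ) < n y := fun y hy => by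
    have := (hn y hy).1
    exact_mod_cast this
  have hcount : u.Countable := by
    refine hdisj.countable_of_nonempty_interior fun y hy => ⟨y, ?_⟩
    rw [mem_interior_iff_mem_nhds]
    refine mem_of_superset (Metric.ball_mem_nhds y (half_pos (hpos y (huA hy)))) fun z hz => ?_
    refine closedBall_subset_cube le_rfl ?_
    rw [mem_closedBall_zero_iff, ← dist_eq_norm]
    exact (Metric.mem_ball.1 hz).le
  have hvol : ∀ y ∈ A, l * ENNReal.ofReal ((n y : ℝ) ^ d) ≤ ∫⁻ z in B y, g (C.translate z) :=
    fun y hy => by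
      refine (hn y hy).2.2.le.trans (le_of_eq ?_)
      simp_rw [Config.translate_translate]
      rw [← lintegral_indicator (measurableSet_cube _), ← lintegral_indicator (hBm y),
        ← lintegral_add_left_eq_self (fun z => (B y).indicator (fun z => g (C.translate z)) z) y]
      refine lintegral_congr fun z => ?_
      by_cases hz : z ∈ cube d (n y)
      · rw [indicator_of_mem hz, indicator_of_mem (show y + z ∈ B y by simpa [B] using hz)]
      · rw [indicator_of_notMem hz, indicator_of_notMem (show y + z ∉ B y by simpa [B] using hz)]
  have hAsub : A ⊆ ⋃ y ∈ u, {z | z - y ∈ cube d (3 * n y)} := fun a ha => by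
    obtain ⟨b, hb, ⟨z, hza, hzb⟩, hab⟩ := hcov a ha
    refine mem_iUnion₂.2 ⟨b, hb, fun i => ?_⟩
    have h1 := hza i
    have h2 := hzb i
    simp only [PiLp.sub_apply, abs_le] at h1 h2 ⊢
    constructor <;> linarith
  -- the cubes have side at most `T` and centre in a cube of side `T`
  have hBsub : ⋃ y ∈ u, B y ⊆ cube d (2 * T) := iUnion₂_subset fun y hy z hz i => by
    have h1 := hz i
    have h2 := (huA hy).1 i
    have h3 : (n y : ℝ) ≤ T := by exact_mod_cast (hn y (huA hy)).2.1
    simp only [PiLp.sub_apply, abs_le] at h1 h2 ⊢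
    constructor <;> linarith
  have := hcount.to_subtype
  calc l * volume A ≤ l * ∑' y : u, volume {z | z - (y : E d) ∈ cube d (3 * n y)} := by
        gcongr
        exact (measure_mono hAsub).trans (measure_biUnion_le _ hcount _)
    _ = l * ∑' y : u, 3 ^ d * ENNReal.ofReal ((n y : ℝ) ^ d) := by
        congr 2
        ext y
        have e : {z | z - (y : E d) ∈ cube d (3 * n y)} =
            (fun z => z + -(y : E d)) ⁻¹' cube d (3 * n y) := by
          simp only [← sub_eq_add_neg]; rfl
        rw [e, measure_preimage_add_right, volume_cube (by positivity), mul_pow,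
          ENNReal.ofReal_mul (by positivity)]
        congr 1
        rw [ENNReal.ofReal_pow (by norm_num)]; norm_num
    _ = 3 ^ d * ∑' y : u, l * ENNReal.ofReal ((n y : ℝ) ^ d) := by
        rw [ENNReal.tsum_mul_left, ENNReal.tsum_mul_left]; ring
    _ ≤ 3 ^ d * ∑' y : u, ∫⁻ z in B y, g (C.translate z) := by
        gcongr with y
        exact hvol y (huA y.2)
    _ = 3 ^ d * ∫⁻ z in ⋃ y ∈ u, B y, g (C.translate z) := by
        rw [lintegral_biUnion hcount (fun y _ => hBm y) hdisj]
    _ ≤ _ := by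
        gcongr

/-- The maximal inequality for stationary laws. -/
lemma IsStationary.mul_maximalSet_le {P : Measure (Config d)}
    [IsProbabilityMeasure P] (hP : IsStationary P) {g : Config d → ℝ≥0∞} (hg : Measurable g)
    (l : ℝ≥0∞) {T : ℕ} (hT : 1 ≤ T) : l * P (maximalSet g l T) ≤ 6 ^ d * ∫⁻ C, g C ∂P := by
  have hT0 : (0 : ℝ) < T := by exact_mod_cast hT
  have hB := measurableSet_maximalSet hg l T
  -- by stationarity, averages over translations have the same mean as the function
  have key : ∀ (h : Config d → ℝ≥0∞) (_ : Measurable h) (R : ℝ) (_ : 0 ≤ R),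
      ∫⁻ C, (∫⁻ y in cube d R, h (C.translate y)) ∂P = ENNReal.ofReal (R ^ d) * ∫⁻ C, h C ∂P := by
    intro h hh R hR
    have hm : Measurable fun a : Config d × E d => h (a.1.translate a.2) :=
      hh.comp (Config.measurable_uncurry_translate.comp measurable_swap)
    rw [lintegral_lintegral_swap hm.aemeasurable]
    have : ∀ y, ∫⁻ C, h (C.translate y) ∂P = ∫⁻ C, h C ∂P := fun y => by
      conv_rhs => rw [← hP y]
      rw [lintegral_map hh (Config.continuous_translate y).measurable]
    simp_rw [this]
    rw [setLIntegral_const, volume_cube hR, mul_comm]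
  have h1 := key ((maximalSet g l T).indicator 1) (measurable_one.indicator hB) T hT0.le
  have h2 := key g hg (2 * T) (by positivity)
  -- integrate the covering inequality; the constant is `3 ^ d` times the ratio `2 ^ d` of the
  -- volumes of the two cubes
  have h3 : ∫⁻ C, (l * ∫⁻ y in cube d T, (maximalSet g l T).indicator 1 (C.translate y)) ∂P ≤
      ∫⁻ C, (3 ^ d * ∫⁻ z in cube d (2 * T), g (C.translate z)) ∂P := by
    refine lintegral_mono fun C => ?_
    refine le_trans (le_of_eq ?_) (mul_volume_maximalSet_le l T C)
    congr 1
    have hm : MeasurableSet {y | C.translate y ∈ maximalSet g l T} :=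
      (Config.continuous_translate_left C).measurable hB
    rw [ofPred_and, inter_comm, ← Measure.restrict_apply hm, ← lintegral_indicator_one hm]
    rfl
  have hm1 : Measurable fun C : Config d =>
      ∫⁻ y in cube d T, (maximalSet g l T).indicator (1 : Config d → ℝ≥0∞) (C.translate y) := by
    have h : Measurable fun a : Config d × E d =>
        (maximalSet g l T).indicator (1 : Config d → ℝ≥0∞) (a.1.translate a.2) :=
      (measurable_one.indicator hB).comp (Config.measurable_uncurry_translate.comp measurable_swap)
    exact h.lintegral_prod_right'
  have hm2 : Measurable fun C : Config d => ∫⁻ z in cube d (2 * T), g (C.translate z) := by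
    have h : Measurable fun a : Config d × E d => g (a.1.translate a.2) :=
      hg.comp (Config.measurable_uncurry_translate.comp measurable_swap)
    exact h.lintegral_prod_right'
  rw [lintegral_const_mul _ hm1, lintegral_const_mul _ hm2, h1, h2, lintegral_indicator_one hB] at h3
  have hTd : ENNReal.ofReal ((T : ℝ) ^ d) ≠ 0 := by
    rw [Ne, ENNReal.ofReal_eq_zero, not_le]; positivity
  rw [← ENNReal.mul_le_mul_iff_right hTd ENNReal.ofReal_ne_top]
  refine le_trans (le_of_eq (by ring)) (h3.trans (le_of_eq ?_))
  rw [mul_pow, ENNReal.ofReal_mul (by positivity), ENNReal.ofReal_pow (by norm_num),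
    show (6 : ℝ≥0∞) = 3 * 2 by norm_num, mul_pow, show ENNReal.ofReal 2 = 2 by norm_num]
  ring

/-- If the averages of the density defect over all cubes are small, then so is the defect of the
asymptotic density. -/
lemma Config.le_dens_add (hd : 1 ≤ d) (C : Config d) {m : ℝ≥0} {l : ℝ≥0} {k : ℕ} (hk : 1 ≤ k)
    (h : ∀ n : ℕ, 1 ≤ n → ∫⁻ y in cube d n, ((m : ℝ≥0∞) -
      (C.translate y).toMeasure (cube d k) / ENNReal.ofReal ((k : ℝ) ^ d)) ≤
        l * ENNReal.ofReal ((n : ℝ) ^ d)) : (m : ℝ≥0∞) ≤ C.dens + l := by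
  have hk0 : (0 : ℝ) < k := by exact_mod_cast hk
  rw [C.dens_eq, ← tsub_le_iff_right, ← liminf_nat_add _ k]
  -- the points of a cube of side `n + k` are compared with the volume of the cube of side `n`
  have hlim : Tendsto (fun n : ℕ => ((m : ℝ≥0∞) - l) * ENNReal.ofReal (((n : ℝ) / (n + k)) ^ d))
      atTop (𝓝 (m - l)) := by
    have h1 := ENNReal.Tendsto.const_mul (a := (m : ℝ≥0∞) - l) (ENNReal.tendsto_ofReal
      ((tendsto_natCast_div_add_atTop (k : ℝ)).pow d)) (Or.inr (by finiteness))
    simpa using h1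
  rw [← hlim.liminf_eq]
  refine liminf_le_liminf ?_
  filter_upwards [eventually_ge_atTop 1] with n hn
  have hn0 : (0 : ℝ) < n := by exact_mod_cast hn
  set Dk := ENNReal.ofReal ((k : ℝ) ^ d) with hDk
  set Dn := ENNReal.ofReal ((n : ℝ) ^ d) with hDn
  have hDk0 : Dk ≠ 0 := by rw [hDk, Ne, ENNReal.ofReal_eq_zero, not_le]; positivity
  -- average over `y` the inequality between `m` and the local density plus its defect
  have h0 : m * Dn ≤ C.toMeasure (cube d ((n : ℝ) + k)) + l * Dn := by
    have h2 := C.setLIntegral_toMeasure_translate_le (r := k) (R := n) hk0.le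
    have hmt : Measurable fun y => (C.translate y).toMeasure (cube d k) :=
      (measurable_toMeasure_apply hd (measurableSet_cube _)).comp
        (continuous_translate_left C).measurable
    calc m * Dn = ∫⁻ _ in cube d n, (m : ℝ≥0∞) := by
          rw [setLIntegral_const, volume_cube hn0.le]
      _ ≤ ∫⁻ y in cube d n, ((C.translate y).toMeasure (cube d k) * Dk⁻¹ +
          ((m : ℝ≥0∞) - (C.translate y).toMeasure (cube d k) / Dk)) := by
          refine lintegral_mono fun y => ?_
          rw [← div_eq_mul_inv]
          exact le_add_tsub
      _ ≤ Dk * C.toMeasure (cube d ((n : ℝ) + k)) * Dk⁻¹ + l * Dn := by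
          rw [lintegral_add_left (by fun_prop), lintegral_mul_const _ hmt]
          gcongr
          exact h n hn
      _ = _ := by
          rw [mul_comm Dk, mul_assoc, ENNReal.mul_inv_cancel hDk0 ENNReal.ofReal_ne_top, mul_one]
  rw [div_pow, ENNReal.ofReal_div_of_pos (by positivity), ← mul_div_assoc]
  push_cast
  gcongr
  rw [ENNReal.sub_mul (by simp), tsub_le_iff_right]
  exact h0

/-- A stationary law whose energy is the least possible for its mean density `m` is carried by
configurations of density `m` and of minimal energy. -/
theorem IsStationary.ae_dens_eq_and_energy_eq (hd : 1 ≤ d) {s : ℝ} (hs : (d : ℝ) < s)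
    {P : Measure (Config d)} [IsProbabilityMeasure P] (hP : IsStationary P) {m : ℝ≥0}
    (hN : ∀ n : ℕ, ∫⁻ C, C.toMeasure (cube d n) ∂P = m * ENNReal.ofReal ((n : ℝ) ^ d))
    (hE : processEnergy s P ≤ rieszConstant s d * (m : ℝ≥0∞) ^ (1 + s / d)) :
    ∀ᵐ C : Config d ∂P, C.dens = m ∧ C.energy s = rieszConstant s d * (m : ℝ≥0∞) ^ (1 + s / d) := by
  have hd0 : (0 : ℝ) < d := by exact_mod_cast hd
  have hs0 : 0 < s := hd0.trans hs
  have hmeas := fun n : ℕ => Config.measurable_toMeasure_apply hd (measurableSet_cube (d := d) (n : ℝ))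
  -- the maximal inequality, applied to the defect of density in a large cube, whose mean is
  -- small, bounds the probability that the asymptotic density is less than `m - l`
  have hle : ∀ l : ℝ≥0, 0 < l → ∀ᵐ C ∂P, (m : ℝ≥0∞) ≤ C.dens + l := fun l hl => by
    rw [ae_iff]
    refine le_antisymm (le_of_forall_pos_le_add fun ε hε => ?_) zero_le
    rw [zero_add]
    rcases eq_or_ne ε ∞ with rfl | hεt
    · exact le_top
    lift ε to ℝ≥0 using hεt
    have hε0 : 0 < ε := by exact_mod_cast hε
    obtain ⟨k, hk, hkε⟩ := exists_lintegral_sub_le hd hs hN hE (ε := ε * l / 6 ^ d) (by positivity)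
    set g : Config d → ℝ≥0∞ := fun C =>
      (m : ℝ≥0∞) - C.toMeasure (cube d k) / ENNReal.ofReal ((k : ℝ) ^ d) with hg
    have hgm : Measurable g := by have := hmeas k; fun_prop
    have hsub : {C : Config d | ¬ (m : ℝ≥0∞) ≤ C.dens + l} ⊆ ⋃ T : ℕ, maximalSet g l T := by
      intro C hC
      by_contra hnot
      refine hC (C.le_dens_add hd hk fun n hn => ?_)
      by_contra hlt
      exact hnot (mem_iUnion.2 ⟨n, n, hn, le_rfl, not_le.1 hlt⟩)
    have hmono : Monotone (maximalSet g l) := fun T T' h C ⟨n, h1, h2, h3⟩ => ⟨n, h1, h2.trans h, h3⟩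
    refine (measure_mono hsub).trans ?_
    rw [hmono.measure_iUnion]
    refine iSup_le fun T => (measure_mono (hmono (Nat.le_succ T))).trans ?_
    have h1 := (hP.mul_maximalSet_le hgm l (Nat.le_add_left 1 T)).trans (mul_le_mul_right hkε _)
    rw [← ENNReal.mul_le_mul_iff_right (a := (l : ℝ≥0∞)) (by exact_mod_cast hl.ne')
      ENNReal.coe_ne_top]
    refine h1.trans (le_of_eq ?_)
    have : (6 : ℝ≥0∞) ^ d = ((6 ^ d : ℝ≥0) : ℝ≥0∞) := by push_cast; rfl
    rw [this, ← ENNReal.coe_mul, ← ENNReal.coe_mul, mul_div_cancel₀ _ (by positivity), mul_comm]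
  have hge : ∀ᵐ C ∂P, (m : ℝ≥0∞) ≤ C.dens := by
    have := ae_all_iff.2 fun j : ℕ => hle (1 / ((j : ℝ≥0) + 1)) (by positivity)
    filter_upwards [this] with C hC
    refine ENNReal.le_of_forall_pos_le_add fun ε hε _ => ?_
    obtain ⟨j, hj⟩ := exists_nat_one_div_lt (show (0 : ℝ) < ε from hε)
    refine (hC j).trans ?_
    gcongr
    exact_mod_cast hj.le
  -- conversely the mean of the density is at most `m`, so the density equals `m` almost surely
  have hint : ∫⁻ C, C.dens ∂P ≤ m := by
    refine (intensity_le_liminf hd P).trans (le_of_eq ?_)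
    refine Tendsto.liminf_eq (tendsto_const_nhds.congr' ?_)
    filter_upwards [eventually_ge_atTop 1] with n hn
    have hn0 : (0 : ℝ) < n := by exact_mod_cast hn
    rw [hN, mul_div_assoc, ENNReal.div_self _ ENNReal.ofReal_ne_top, mul_one]
    rw [Ne, ENNReal.ofReal_eq_zero, not_le]; positivity
  have hdens : ∀ᵐ C : Config d ∂P, C.dens = m := by
    have := ae_eq_of_ae_le_of_lintegral_le hge (by simp) (Config.measurable_dens hd).aemeasurable
      (by simpa using hint)
    filter_upwards [this] with C hC using hC.symm
  -- the same argument for the energy: it is at least the minimum, with mean at most the minimum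
  have hgeE : ∀ᵐ C ∂P, rieszConstant s d * (m : ℝ≥0∞) ^ (1 + s / d) ≤ C.energy s := by
    filter_upwards [hdens] with C hC
    rw [← hC]
    exact C.mul_dens_rpow_le_energy hd hs0
  have hintE : ∫⁻ C, C.energy s ∂P ≤ rieszConstant s d * (m : ℝ≥0∞) ^ (1 + s / d) := by
    refine le_trans ?_ hE
    simp_rw [Config.energy_eq, processEnergy_eq]
    have hm := fun n : ℕ => Config.measurable_interaction hd s (measurableSet_cube (d := d) (n : ℝ))
    refine (lintegral_liminf_le fun n => (hm n).div_const _).trans (le_of_eq ?_)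
    simp_rw [div_eq_mul_inv]
    congr 1; ext n
    rw [lintegral_mul_const _ (hm n)]
  have hfin : rieszConstant s d * (m : ℝ≥0∞) ^ (1 + s / d) ≠ ∞ :=
    ENNReal.mul_ne_top (rieszConstant_lt_top hd hs).ne
      (ENNReal.rpow_ne_top_of_nonneg (by positivity) ENNReal.coe_ne_top)
  have hen := ae_eq_of_ae_le_of_lintegral_le hgeE (by simpa using hfin)
    (Config.measurable_energy hd s).aemeasurable (by simpa using hintE)
  filter_upwards [hdens, hen] with C h1 h2 using ⟨h1, h2.symm⟩


/-! ### Enumeration of finite configurations by increasing norm -/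

/-- The points of a tuple enumerated by increasing norm; the remaining indices are sent to `z`,
which is meant to lie outside the image of `ℝᵈ`. -/
def enumTuple (z : Site d) {N : ℕ} (y : Fin N → E d) : Enum d := fun k =>
  if h : k < N then site (y (Tuple.sort (fun i => ‖y i‖) ⟨k, h⟩)) else z

lemma measurable_enumTuple (z : Site d) (N : ℕ) :
    Measurable (enumTuple z : (Fin N → E d) → Enum d) := by
  refine measurable_pi_iff.2 fun k => ?_
  by_cases hk : k < N
  · simp only [enumTuple, hk, dif_pos]
    intro S hS
    have h : (fun y : Fin N → E d => site (y (Tuple.sort (fun i => ‖y i‖) ⟨k, hk⟩))) ⁻¹' S =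
        ⋃ σ : Equiv.Perm (Fin N), {y | σ = Tuple.sort fun i => ‖y i‖} ∩
          (fun y : Fin N → E d => site (y (σ ⟨k, hk⟩))) ⁻¹' S := by
      ext y; simp
    rw [h]
    have h3 : ∀ i : Fin N, Measurable fun y : Fin N → E d => site (y i) := fun i =>
      isOpenEmbedding_site.continuous.measurable.comp (measurable_pi_apply i)
    refine MeasurableSet.iUnion fun σ => MeasurableSet.inter ?_ (h3 _ hS)
    have h2 : {y : Fin N → E d | σ = Tuple.sort fun i => ‖y i‖} =
        (⋂ i, ⋂ j, ⋂ _ : i ≤ j, {y | ‖y (σ i)‖ ≤ ‖y (σ j)‖}) ∩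
        ⋂ i, ⋂ j, ⋂ _ : i < j, {y | ‖y (σ i)‖ = ‖y (σ j)‖ → σ i < σ j} := by
      ext y
      simp only [mem_ofPred_eq, Tuple.eq_sort_iff, mem_inter_iff, mem_iInter, Monotone,
        Function.comp]
    rw [h2]
    refine MeasurableSet.inter ?_ ?_
    · refine MeasurableSet.iInter fun i => MeasurableSet.iInter fun j => MeasurableSet.iInter
        fun _ => measurableSet_le (by fun_prop) (by fun_prop)
    · refine MeasurableSet.iInter fun i => MeasurableSet.iInter fun j => MeasurableSet.iInter
        fun _ => ?_
      by_cases hij : σ i < σ j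
      · simp [hij]
      · simp only [hij, imp_false]
        exact (measurableSet_eq_fun (by fun_prop) (by fun_prop)).compl
  · simp only [enumTuple, hk, dif_neg, not_false_eq_true]
    exact measurable_const

section

variable {z : Site d} (hz : z ∉ range (site : E d → Site d)) {N : ℕ} (y : Fin N → E d)
include hz

lemma tsum_enumTuple (f : E d → ℝ≥0∞) : ∑' k, ext₁ f (enumTuple z y k) = ∑ i, f (y i) := by
  rw [tsum_eq_sum (s := Finset.range N), Finset.sum_range]
  · rw [← Equiv.sum_comp (Tuple.sort fun i => ‖y i‖) fun i => f (y i)]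
    refine Finset.sum_congr rfl fun i _ => ?_
    simp [enumTuple, ext₁_site]
  · intro k hk
    have : ¬ k < N := by simpa using hk
    simp only [enumTuple, this, dif_neg, not_false_eq_true]
    exact ext₁_of_notMem f hz

open Classical in
lemma tsum_tsum_enumTuple (g : E d → E d → ℝ≥0∞) :
    (∑' k, ∑' l, if k = l then 0 else ext₂ g (enumTuple z y k, enumTuple z y l)) =
      ∑ i, ∑ j, if i = j then 0 else g (y i) (y j) := by
  have h0 : ∀ k, k ∉ Finset.range N → enumTuple z y k = z := fun k hk => by
    have : ¬ k < N := by simpa using hk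
    simp only [enumTuple, this, dif_neg, not_false_eq_true]
  rw [tsum_eq_sum (s := Finset.range N), Finset.sum_range]
  · rw [← Equiv.sum_comp (Tuple.sort fun i => ‖y i‖) fun i =>
      ∑ j, if i = j then 0 else g (y i) (y j)]
    refine Finset.sum_congr rfl fun i _ => ?_
    rw [tsum_eq_sum (s := Finset.range N), Finset.sum_range]
    · rw [← Equiv.sum_comp (Tuple.sort fun i => ‖y i‖) fun j => if _ = j then 0 else g (y _) (y j)]
      refine Finset.sum_congr rfl fun j _ => ?_
      simp [enumTuple, ext₂_site, Fin.val_inj]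
    · intro l hl
      rw [h0 l hl, ext₂_of_notMem g (Or.inr hz), ite_self]
  · intro k hk
    rw [ENNReal.tsum_eq_zero]
    intro l
    rw [h0 k hk, ext₂_of_notMem g (Or.inl hz), ite_self]

lemma enumTuple_mem_locFin : enumTuple z y ∈ Enum.LocFin := fun k =>
  (Set.finite_Iio N).subset fun i hi => by
    by_contra h
    simp only [mem_Iio] at h
    simp only [mem_ofPred_eq, enumTuple, h, dif_neg, not_false_eq_true] at hi
    obtain ⟨x, -, hx⟩ := hi
    exact hz ⟨x, hx⟩

/-- The points in a ball come first in the enumeration by increasing norm. -/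
lemma enumTuple_sorted {r : ℝ} {k l : ℕ} (hkl : k ≤ l)
    (hl : enumTuple z y l ∈ site '' Metric.closedBall (0 : E d) r) :
    enumTuple z y k ∈ site '' Metric.closedBall (0 : E d) r := by
  obtain ⟨x, hx, hxl⟩ := hl
  by_cases h : l < N
  · simp only [enumTuple, h, dif_pos] at hxl
    have hxl := site_injective hxl
    have hk : k < N := hkl.trans_lt h
    simp only [enumTuple, hk, dif_pos]
    refine mem_image_of_mem _ ?_
    have := Tuple.monotone_sort (fun i => ‖y i‖) (show (⟨k, hk⟩ : Fin N) ≤ ⟨l, h⟩ from hkl)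
    simp only [Function.comp] at this
    rw [mem_closedBall_zero_iff] at hx ⊢
    rw [hxl] at hx
    exact this.trans hx
  · simp only [enumTuple, h, dif_neg, not_false_eq_true] at hxl
    exact absurd ⟨x, hxl⟩ hz

lemma toConfig_enumTuple : Enum.toConfig (enumTuple z y) = Config.ofTuple y := by
  classical
  ext p
  have h1 := Config.toMeasure_singleton (Enum.toConfig (enumTuple z y)) p
  rw [← lintegral_indicator_one (measurableSet_singleton p),
    Enum.lintegral_toConfig (enumTuple_mem_locFin hz y), tsum_enumTuple hz] at h1
  have h2 : ∑ i, ({p} : Set (E d)).indicator (1 : E d → ℝ≥0∞) (y i) =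
      ((Config.ofTuple y).mult p : ℝ≥0∞) := by
    simp only [Config.ofTuple, indicator_apply, mem_singleton_iff, Pi.one_apply, Finset.sum_boole]
  rw [h2] at h1
  exact_mod_cast h1.symm

end

lemma translate_ofTuple {N : ℕ} (y : Fin N → E d) (x : E d) :
    (Config.ofTuple y).translate x = Config.ofTuple fun i => y i - x := by
  ext q
  simp only [Config.translate, Config.ofTuple]
  simp only [sub_eq_iff_eq_add]

/-! ### Excess of points beyond a given index -/

/-- The number of points of index at least `T` in the ball of radius `r`. -/
def excess (r : ℝ) (T : ℕ) (u : Enum d) : ℝ≥0∞ :=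
  ∑' k, ext₁ ((Metric.closedBall (0 : E d) r).indicator 1) (u (k + T))

lemma measurable_excess (r : ℝ) (T : ℕ) : Measurable (excess r T : Enum d → ℝ≥0∞) :=
  Measurable.tsum fun _ => (measurable_ext₁
    (measurable_one.indicator Metric.isClosed_closedBall.measurableSet)).comp (measurable_pi_apply _)

open Classical in
/-- In an enumeration by increasing norm, every point of index at least `T` interacts with the
first `T` points. -/
lemma mul_excess_le {z : Site d} (hz : z ∉ range (site : E d → Site d)) {N : ℕ}
    (y : Fin N → E d) {s r : ℝ} (hs : 0 ≤ s) (hr : 0 < r) (T : ℕ) :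
    T * excess r T (enumTuple z y) ≤ ENNReal.ofReal (2 * r) ^ s *
      ∑ i, ∑ j, if i = j then 0 else cutKernel s (Metric.closedBall 0 r) (y i) (y j) := by
  set u := enumTuple z y with hu
  set B := Metric.closedBall (0 : E d) r with hB
  rw [← tsum_tsum_enumTuple hz, ← ENNReal.tsum_mul_left, excess, ← ENNReal.tsum_mul_left]
  have hinj : Function.Injective fun k : ℕ => k + T := add_left_injective T
  refine le_trans ?_ (ENNReal.tsum_comp_le_tsum_of_injective hinj _)
  refine ENNReal.tsum_le_tsum fun k => ?_
  by_cases hk : u (k + T) ∈ site '' B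
  swap
  · have : ext₁ (B.indicator (1 : E d → ℝ≥0∞)) (u (k + T)) = 0 := by
      by_cases hr : u (k + T) ∈ range site
      · obtain ⟨x, hx⟩ := hr
        rw [← hx, ext₁_site, indicator_of_notMem]
        exact fun h => hk ⟨x, h, hx⟩
      · exact ext₁_of_notMem _ hr
    rw [this, mul_zero]
    exact zero_le
  have h1 : ext₁ (B.indicator (1 : E d → ℝ≥0∞)) (u (k + T)) = 1 := by
    obtain ⟨x, hx, hxu⟩ := hk
    rw [← hxu, ext₁_site, indicator_of_mem hx, Pi.one_apply]
  -- the points of smaller index are also in the ball, hence within distance `2 * r`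
  have h2 : ∀ l ∈ Finset.range T, ENNReal.ofReal (2 * r) ^ (-s) ≤
      if k + T = l then 0 else ext₂ (cutKernel s B) (u (k + T), u l) := fun l hl => by
    have hl' : l < T := by simpa using hl
    rw [if_neg (by omega)]
    obtain ⟨x', hx', hxu'⟩ := enumTuple_sorted hz y (show l ≤ k + T by omega) hk
    obtain ⟨x, hx, hxu⟩ := hk
    rw [← hxu, hu, ← hxu', ext₂_site, cutKernel, indicator_of_mem (mk_mem_prod hx hx')]
    refine le_rieszKernel hs ?_
    rw [edist_dist]
    refine ENNReal.ofReal_le_ofReal ((dist_triangle_right x x' 0).trans ?_)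
    rw [two_mul]
    exact add_le_add hx hx'
  have hpos : ENNReal.ofReal (2 * r) ≠ 0 := by rw [Ne, ENNReal.ofReal_eq_zero, not_le]; positivity
  calc (T : ℝ≥0∞) * ext₁ (B.indicator (1 : E d → ℝ≥0∞)) (u (k + T))
      = ENNReal.ofReal (2 * r) ^ s * ∑ _l ∈ Finset.range T, ENNReal.ofReal (2 * r) ^ (-s) := by
        rw [h1, mul_one, Finset.sum_const, Finset.card_range, nsmul_eq_mul, mul_left_comm,
          ← ENNReal.rpow_add _ _ hpos ENNReal.ofReal_ne_top, add_neg_cancel, ENNReal.rpow_zero,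
          mul_one]
    _ ≤ ENNReal.ofReal (2 * r) ^ s * ∑' l, _ := by
        gcongr
        exact (Finset.sum_le_sum h2).trans (ENNReal.sum_le_tsum _)

lemma one_le_excess {r : ℝ} {T k : ℕ} {u : Enum d} (hk : T ≤ k)
    (h : u k ∈ site '' Metric.closedBall (0 : E d) r) : 1 ≤ excess r T u := by
  obtain ⟨x, hx, hxu⟩ := h
  have : ext₁ ((Metric.closedBall (0 : E d) r).indicator (1 : E d → ℝ≥0∞)) (u (k - T + T)) = 1 := by
    rw [Nat.sub_add_cancel hk, ← hxu, ext₁_site, indicator_of_mem hx, Pi.one_apply]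
  rw [← this]
  exact ENNReal.le_tsum (k - T)

/-- A function below the indicator of a ball is integrated by the first `T` points up to the
excess. -/
lemma tsum_le_sum_add_excess {f : E d → ℝ≥0∞} {r : ℝ}
    (hf : ∀ p, f p ≤ (Metric.closedBall 0 r).indicator 1 p) (T : ℕ) (u : Enum d) :
    ∑' k, ext₁ f (u k) ≤ ∑ k ∈ Finset.range T, ext₁ f (u k) + excess r T u := by
  rw [← Summable.sum_add_tsum_nat_add' (k := T) ENNReal.summable]
  unfold excess
  gcongr with k
  by_cases h : u (k + T) ∈ range site
  · obtain ⟨x, hx⟩ := h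
    rw [← hx, ext₁_site, ext₁_site]
    exact hf x
  · rw [ext₁_of_notMem _ h]; exact zero_le


/-! ### Compactness of graphs of maps into a compact space -/

/-- Lower semicontinuity of the integral of a lower semicontinuous function under weak
convergence. -/
lemma lintegral_le_liminf_of_lowerSemicontinuous {Z : Type*} [TopologicalSpace Z]
    [MeasurableSpace Z] [BorelSpace Z] [HasOuterApproxClosed Z] {μ : ProbabilityMeasure Z}
    {μs : ℕ → ProbabilityMeasure Z} (h : Tendsto μs atTop (𝓝 μ)) {f : Z → ℝ≥0∞}
    (hf : LowerSemicontinuous f) :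
    ∫⁻ z, f z ∂(μ : Measure Z) ≤ liminf (fun n => ∫⁻ z, f z ∂(μs n : Measure Z)) atTop := by
  have hfm : Measurable f := hf.measurable
  have hsup : ∀ z, ⨆ M : ℕ, min (f z) M = f z := fun z => by
    refine le_antisymm (iSup_le fun M => min_le_left _ _) (le_of_forall_lt fun c hc => ?_)
    obtain ⟨M, hM⟩ := ENNReal.exists_nat_gt hc.ne_top
    exact (lt_min hc hM).trans_le (le_iSup (fun M : ℕ => min (f z) M) M)
  have hI : ∫⁻ z, f z ∂(μ : Measure Z) = ⨆ M : ℕ, ∫⁻ z, min (f z) M ∂(μ : Measure Z) := by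
    rw [← lintegral_iSup (fun M => hfm.min measurable_const)]
    · simp_rw [hsup]
    · intro M M' hM z
      exact min_le_min_left _ (by exact_mod_cast hM)
  rw [hI]
  refine iSup_le fun M => ?_
  -- the layer cake formula for the truncation
  have hcake : ∀ π : ProbabilityMeasure Z, ∫⁻ z, min (f z) M ∂(π : Measure Z) =
      ∫⁻ t in Ioi (0 : ℝ), (π : Measure Z) {z | ENNReal.ofReal t < min (f z) M} := fun π => by
    have hfin : ∀ z, min (f z) M ≠ ∞ := fun z =>
      ((min_le_right _ _).trans_lt (ENNReal.natCast_lt_top M)).ne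
    have h1 := lintegral_eq_lintegral_meas_lt (π : Measure Z)
      (f := fun z => (min (f z) M).toReal) (ae_of_all _ fun _ => ENNReal.toReal_nonneg)
      (hfm.min measurable_const).ennreal_toReal.aemeasurable
    simp_rw [ENNReal.ofReal_toReal (hfin _)] at h1
    rw [h1]
    refine setLIntegral_congr_fun measurableSet_Ioi fun t ht => ?_
    simp_rw [ENNReal.ofReal_lt_iff_lt_toReal (le_of_lt ht) (hfin _)]
  have hopen : ∀ t : ℝ, IsOpen {z | ENNReal.ofReal t < min (f z) M} := fun t => by
    by_cases ht : ENNReal.ofReal t < M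
    · have : {z | ENNReal.ofReal t < min (f z) M} = f ⁻¹' Ioi (ENNReal.ofReal t) := by
        ext z; simp [ht]
      rw [this]
      exact hf.isOpen_preimage _
    · simp [ht]
  calc ∫⁻ z, min (f z) M ∂(μ : Measure Z)
      = ∫⁻ t in Ioi (0 : ℝ), (μ : Measure Z) {z | ENNReal.ofReal t < min (f z) M} := hcake μ
    _ ≤ ∫⁻ t in Ioi (0 : ℝ), liminf (fun n =>
        (μs n : Measure Z) {z | ENNReal.ofReal t < min (f z) M}) atTop :=
        lintegral_mono fun t => ProbabilityMeasure.le_liminf_measure_open_of_tendsto h (hopen t)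
    _ ≤ liminf (fun n => ∫⁻ t in Ioi (0 : ℝ),
        (μs n : Measure Z) {z | ENNReal.ofReal t < min (f z) M}) atTop :=
        lintegral_liminf_le fun n => Antitone.measurable fun t t' htt =>
          measure_mono fun z hz => (ENNReal.ofReal_le_ofReal htt).trans_lt hz
    _ ≤ _ := by
        refine liminf_le_liminf (Eventually.of_forall fun n => ?_)
        rw [← hcake]
        exact lintegral_mono fun z => min_le_left _ _

lemma lowerSemicontinuous_mul {Z : Type*} [TopologicalSpace Z] {a f : Z → ℝ≥0∞}
    (ha : Continuous a) (hat : ∀ z, a z ≠ ∞) (hf : LowerSemicontinuous f) :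
    LowerSemicontinuous fun z => a z * f z := by
  intro z t ht
  have ha0 : a z ≠ 0 := fun h => by simp [h] at ht
  obtain ⟨q, hq1, hq2⟩ := exists_between (ENNReal.div_lt_of_lt_mul' ht)
  rw [ENNReal.div_lt_iff (Or.inl ha0) (Or.inl (hat z))] at hq1
  have h1 : Continuous fun z => q * a z := (ENNReal.continuous_const_mul hq2.ne_top).comp ha
  filter_upwards [h1.continuousAt.eventually (lt_mem_nhds hq1), hf z q hq2] with z' h2 h3
  refine h2.trans_le ?_
  rw [mul_comm]
  gcongr

/-- A positive continuous probability density with respect to Lebesgue measure on `Ω`. -/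
lemma exists_weight {Ω : Set (E d)} (hΩ : IsClosed Ω) (hΩ_pos : 0 < volume Ω) :
    ∃ a : Ω → ℝ≥0∞, Continuous a ∧ (∀ x, a x ≠ 0) ∧ (∀ x, a x ≠ ∞) ∧ ∫⁻ x, a x ∂leb Ω = 1 := by
  -- an integrable function on the whole space
  let w : E d → ℝ := fun x => (1 + ‖x‖) ^ (-((d : ℝ) + 1))
  have hwc : Continuous w := by
    refine Continuous.rpow_const (by fun_prop) fun x => Or.inl ?_
    positivity
  have hw : Integrable w := integrable_one_add_norm (by simp)
  have hw0 : ∀ x, 0 < w x := fun x => by positivity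
  set W := ∫⁻ x : Ω, ENNReal.ofReal (w x) ∂leb Ω with hW
  have hWt : W ≠ ∞ := by
    rw [hW, lintegral_leb hΩ.measurableSet (fun x => ENNReal.ofReal (w x))]
    refine ((setLIntegral_le_lintegral _ _).trans_lt ?_).ne
    exact hw.lintegral_lt_top
  have hW0 : W ≠ 0 := by
    rw [hW, lintegral_leb hΩ.measurableSet (fun x => ENNReal.ofReal (w x)), ← pos_iff_ne_zero,
      setLIntegral_pos_iff (by fun_prop)]
    have : Function.support (fun x => ENNReal.ofReal (w x)) = univ := by
      ext x; simpa using hw0 x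
    rwa [this, univ_inter]
  refine ⟨fun x => ENNReal.ofReal (w x) * W⁻¹, ?_, fun x => ?_, fun x => ?_, ?_⟩
  · exact ENNReal.continuous_mul_const (by simpa using hW0) |>.comp
      (ENNReal.continuous_ofReal.comp (hwc.comp continuous_subtype_val))
  · refine mul_ne_zero ?_ (by simpa using hWt)
    rw [Ne, ENNReal.ofReal_eq_zero, not_le]; exact hw0 x
  · exact ENNReal.mul_ne_top ENNReal.ofReal_ne_top (by simpa using hW0)
  · rw [lintegral_mul_const _ (by fun_prop), ENNReal.mul_inv_cancel hW0 hWt]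

/-- Any sequence of measurable maps from `Ω` to a compact space has a subsequence whose graphs
converge, in the sense of lower semicontinuous integrands, to a measurable family of probability
measures (a Young measure). -/
theorem exists_youngMeasure {Ω : Set (E d)} (hΩ : IsClosed Ω) (hΩ_pos : 0 < volume Ω)
    {K : Type*} [TopologicalSpace K] [CompactSpace K] [PolishSpace K] [MeasurableSpace K]
    [BorelSpace K] [Nonempty K] {U : ℕ → Ω → K} (hU : ∀ n, Measurable (U n)) :
    ∃ φ : ℕ → ℕ, StrictMono φ ∧ ∃ κ : Kernel Ω K, IsMarkovKernel κ ∧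
      ∀ G : Ω × K → ℝ≥0∞, LowerSemicontinuous G →
        ∫⁻ x, ∫⁻ u, G (x, u) ∂κ x ∂leb Ω ≤
          liminf (fun n => ∫⁻ x, G (x, U (φ n) x) ∂leb Ω) atTop := by
  have : PolishSpace Ω := hΩ.polishSpace
  -- Lebesgue measure on `Ω` may be infinite; a continuous weight reduces to probability measures
  obtain ⟨a, ha, ha0, hat, ha1⟩ := exists_weight hΩ hΩ_pos
  set ν := (leb Ω).withDensity a with hν
  have hνp : IsProbabilityMeasure ν := ⟨by rw [hν, withDensity_apply _ MeasurableSet.univ,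
    Measure.restrict_univ, ha1]⟩
  have hgraph : ∀ n, Measurable fun x => (x, U n x) := fun n => measurable_id.prodMk (hU n)
  let μs : ℕ → ProbabilityMeasure (Ω × K) := fun n =>
    ⟨ν.map fun x => (x, U n x), Measure.isProbabilityMeasure_map (hgraph n).aemeasurable⟩
  have hfst : ∀ n, ((μs n : Measure (Ω × K))).fst = ν := fun n => by
    change (ν.map fun x => (x, U n x)).map Prod.fst = ν
    rw [Measure.map_map measurable_fst (hgraph n)]
    exact Measure.map_id
  -- Prokhorov: all the graphs have the same first marginal, and the second factor is compact
  have htight : IsTightMeasureSet {((π : ProbabilityMeasure (Ω × K)) : Measure (Ω × K)) |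
      π ∈ range μs} := by
    refine IsTightMeasureSet.prodMk ?_ IsTightMeasureSet.of_compactSpace
    refine (isTightMeasureSet_singleton (μ := ν)).subset ?_
    rintro _ ⟨_, ⟨_, ⟨n, rfl⟩, rfl⟩, rfl⟩
    exact hfst n
  obtain ⟨μ, -, φ, hφ, hlim⟩ := (isCompact_closure_of_isTightMeasureSet htight).tendsto_subseq
    fun n => subset_closure (mem_range_self n)
  -- the limit has the same first marginal, and is disintegrated with respect to it
  have hμfst : (μ : Measure (Ω × K)).fst = ν := by
    have h1 := ProbabilityMeasure.tendsto_map_of_tendsto_of_continuous _ _ hlim continuous_fst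
    have h2 : ∀ n, (μs (φ n)).map continuous_fst.measurable.aemeasurable =
        (⟨ν, hνp⟩ : ProbabilityMeasure Ω) := fun n => Subtype.ext (hfst (φ n))
    simp only [Function.comp, h2] at h1
    exact congrArg (fun π : ProbabilityMeasure Ω => (π : Measure Ω))
      (tendsto_nhds_unique h1 tendsto_const_nhds)
  refine ⟨φ, hφ, (μ : Measure (Ω × K)).condKernel, inferInstance, fun G hG => ?_⟩
  have hGm : Measurable G := hG.measurable
  have hinv : Continuous fun z : Ω × K => (a z.1)⁻¹ := (ha.comp continuous_fst).inv
  have hH := lowerSemicontinuous_mul hinv (fun z => by simpa using ha0 z.1) hG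
  have hweight : ∀ g : Ω → ℝ≥0∞, Measurable g → ∫⁻ x, (a x)⁻¹ * g x ∂ν = ∫⁻ x, g x ∂leb Ω :=
    fun g hg => by
      rw [hν, lintegral_withDensity_eq_lintegral_mul _ ha.measurable
        (show Measurable fun x => (a x)⁻¹ * g x from ha.measurable.inv.mul hg)]
      refine lintegral_congr fun x => ?_
      simp only [Pi.mul_apply]
      rw [← mul_assoc, ENNReal.mul_inv_cancel (ha0 x) (hat x), one_mul]
  have hlsc := lintegral_le_liminf_of_lowerSemicontinuous hlim hH
  have e1 : ∫⁻ z, (a z.1)⁻¹ * G z ∂(μ : Measure (Ω × K)) =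
      ∫⁻ x, ∫⁻ u, G (x, u) ∂(μ : Measure (Ω × K)).condKernel x ∂leb Ω := by
    conv_lhs => rw [← (μ : Measure (Ω × K)).disintegrate (μ : Measure (Ω × K)).condKernel]
    rw [Measure.lintegral_compProd hH.measurable, hμfst, ← hweight _ hGm.lintegral_kernel_prod_right']
    refine lintegral_congr fun x => ?_
    exact lintegral_const_mul (a x)⁻¹ (show Measurable fun u => G (x, u) from
      hGm.comp measurable_prodMk_left)
  have e2 : ∀ n, ∫⁻ z, (a z.1)⁻¹ * G z ∂(μs n : Measure (Ω × K)) = ∫⁻ x, G (x, U n x) ∂leb Ω :=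
    fun n => by
      rw [← hweight (fun x => G (x, U n x)) (hGm.comp (hgraph n))]
      exact lintegral_map hH.measurable (hgraph n)
  rw [e1] at hlsc
  refine hlsc.trans (le_of_eq ?_)
  simp only [Function.comp, e2]


/-! ### Averages of blown-up point systems -/

/-- The points of a system of `N` points seen from `x`, at the scale `N^{-1/d}`. -/
def blowUp {N : ℕ} (X : Fin N → E d) (x : E d) (i : Fin N) : E d :=
  ((N : ℝ) ^ (1 / d : ℝ)) • X i - ((N : ℝ) ^ (1 / d : ℝ)) • x

lemma measurable_blowUp {N : ℕ} (X : Fin N → E d) : Measurable (blowUp X) :=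
  measurable_pi_iff.2 fun i => by unfold blowUp; fun_prop

lemma lintegral_comp_sub_smul {c : ℝ} (hc : 0 < c) {f : E d → ℝ≥0∞} (hf : Measurable f) (p : E d) :
    ∫⁻ x, f (p - c • x) = (ENNReal.ofReal (c ^ d))⁻¹ * ∫⁻ x, f x := by
  have h1 := lintegral_map (μ := (volume : Measure (E d))) (f := fun y => f (p - y))
    (g := fun x : E d => c • x) (by fun_prop) (by fun_prop)
  rw [← h1, Measure.map_addHaar_smul _ hc.ne', lintegral_smul_measure,
    lintegral_sub_left_eq_self f p, smul_eq_mul, finrank_euclideanSpace_fin,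
    abs_of_pos (by positivity), ENNReal.ofReal_inv_of_pos (by positivity)]

lemma scale_pow (hd : 1 ≤ d) (N : ℕ) : ((N : ℝ) ^ (1 / d : ℝ)) ^ d = N := by
  rw [← Real.rpow_natCast, ← Real.rpow_mul (by positivity), one_div,
    inv_mul_cancel₀ (by positivity), Real.rpow_one]

lemma scale_pos {N : ℕ} (hN : 1 ≤ N) : 0 < (N : ℝ) ^ (1 / d : ℝ) := by
  have : (0 : ℝ) < N := by exact_mod_cast hN
  positivity

lemma lintegral_blowUp (hd : 1 ≤ d) {N : ℕ} (hN : 1 ≤ N) (X : Fin N → E d) {f : E d → ℝ≥0∞}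
    (hf : Measurable f) (i : Fin N) : ∫⁻ x, f (blowUp X x i) = (N : ℝ≥0∞)⁻¹ * ∫⁻ x, f x := by
  unfold blowUp
  rw [lintegral_comp_sub_smul (scale_pos hN) hf, scale_pow hd, ENNReal.ofReal_natCast]

lemma lintegral_sum_blowUp (hd : 1 ≤ d) {N : ℕ} (hN : 1 ≤ N) (X : Fin N → E d) {f : E d → ℝ≥0∞}
    (hf : Measurable f) : ∫⁻ x, ∑ i, f (blowUp X x i) = ∫⁻ x, f x := by
  have hm : ∀ i, Measurable fun x => f (blowUp X x i) := fun i =>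
    hf.comp (measurable_pi_iff.1 (measurable_blowUp X) i)
  rw [lintegral_finsetSum _ fun i _ => hm i]
  simp_rw [lintegral_blowUp hd hN X hf]
  rw [Finset.sum_const, Finset.card_univ, Fintype.card_fin, nsmul_eq_mul, ← mul_assoc,
    ENNReal.mul_inv_cancel (by exact_mod_cast (by omega : N ≠ 0)) (ENNReal.natCast_ne_top N), one_mul]

/-- The average over the centre of the interaction seen in a window `A` is at most the total
energy, per unit volume of `A`. -/
lemma lintegral_interaction_blowUp_le (hd : 1 ≤ d) {s : ℝ} {N : ℕ} (hN : 1 ≤ N)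
    (X : Fin N → E d) {A : Set (E d)} (hA : MeasurableSet A) :
    ∫⁻ x, ∑ i, ∑ j, (if i = j then 0 else cutKernel s A (blowUp X x i) (blowUp X x j)) ≤
      volume A * ((N : ℝ≥0∞) ^ (1 + s / d))⁻¹ * rieszEnergy s X := by
  have hd0 : (0 : ℝ) < d := by exact_mod_cast hd
  have hN0 : (N : ℝ≥0∞) ≠ 0 := by exact_mod_cast (by omega : N ≠ 0)
  have hNt : (N : ℝ≥0∞) ≠ ∞ := ENNReal.natCast_ne_top N
  have hmi := fun i => measurable_pi_iff.1 (measurable_blowUp X) i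
  have hmA : Measurable (A.indicator (1 : E d → ℝ≥0∞)) := measurable_one.indicator hA
  have hmAi : ∀ i, Measurable fun x => A.indicator (1 : E d → ℝ≥0∞) (blowUp X x i) :=
    fun i => hmA.comp (hmi i)
  have hker : ∀ i j x, rieszKernel s (blowUp X x i) (blowUp X x j) =
      (N : ℝ≥0∞) ^ (-(s / d)) * rieszKernel s (X i) (X j) := fun i j x => by
    have h := rieszKernel_smul_add (s := s) (scale_pos (d := d) hN)
      (-(((N : ℝ) ^ (1 / d : ℝ)) • x)) (X i) (X j)
    simp only [neg_add_eq_sub] at h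
    unfold blowUp
    rw [h]
    congr 1
    rw [← ENNReal.ofReal_rpow_of_pos (by exact_mod_cast hN), ENNReal.ofReal_natCast,
      ← ENNReal.rpow_mul]
    congr 1; field_simp
  -- dropping the condition that the second point lies in `A`, each pair is counted for a set of
  -- centres whose volume is that of `A` divided by `N`
  have hle : ∀ i j x, cutKernel s A (blowUp X x i) (blowUp X x j) ≤
      A.indicator 1 (blowUp X x i) * ((N : ℝ≥0∞) ^ (-(s / d)) * rieszKernel s (X i) (X j)) :=
    fun i j x => by
      rw [← hker i j x, cutKernel]
      by_cases h : blowUp X x i ∈ A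
      · rw [indicator_of_mem h, Pi.one_apply, one_mul]
        exact indicator_le_self _ _ _
      · rw [indicator_of_notMem fun h' => h h'.1]
        exact zero_le
  calc ∫⁻ x, ∑ i, ∑ j, (if i = j then 0 else cutKernel s A (blowUp X x i) (blowUp X x j))
      ≤ ∫⁻ x, ∑ i, ∑ j, (A.indicator 1 (blowUp X x i) *
          (if i = j then 0 else (N : ℝ≥0∞) ^ (-(s / d)) * rieszKernel s (X i) (X j))) := by
        refine lintegral_mono fun x => Finset.sum_le_sum fun i _ => Finset.sum_le_sum fun j _ => ?_
        split_ifs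
        · exact zero_le
        · exact hle i j x
    _ = ∑ i, ∑ j, (N : ℝ≥0∞)⁻¹ * volume A *
          (if i = j then 0 else (N : ℝ≥0∞) ^ (-(s / d)) * rieszKernel s (X i) (X j)) := by
        rw [lintegral_finsetSum _ fun i _ => Finset.measurable_sum _ fun j _ =>
          (hmAi i).mul_const _]
        refine Finset.sum_congr rfl fun i _ => ?_
        rw [lintegral_finsetSum _ fun j _ => (hmAi i).mul_const _]
        refine Finset.sum_congr rfl fun j _ => ?_
        rw [lintegral_mul_const _ (hmAi i), lintegral_blowUp hd hN X hmA i, lintegral_indicator_one hA]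
    _ = volume A * ((N : ℝ≥0∞)⁻¹ * (N : ℝ≥0∞) ^ (-(s / d))) * rieszEnergy s X := by
        rw [rieszEnergy_eq_pairEnergy, pairEnergy, Finset.mul_sum]
        refine Finset.sum_congr rfl fun i _ => ?_
        rw [Finset.mul_sum]
        refine Finset.sum_congr rfl fun j _ => ?_
        split_ifs <;> ring
    _ = _ := by
        rw [← ENNReal.rpow_neg_one, ← ENNReal.rpow_add _ _ hN0 hNt, ← ENNReal.rpow_neg]
        congr 3; ring

/-- The enumerated blown-up configuration is the translated blown-up configuration. -/
lemma toConfig_enumTuple_blowUp {z : Site d} (hz : z ∉ range (site : E d → Site d)) {N : ℕ}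
    (X : Fin N → E d) (x : E d) : Enum.toConfig (enumTuple z (blowUp X x)) =
      Config.translate (((N : ℝ) ^ (1 / d : ℝ)) • x)
        (Config.ofTuple fun i => ((N : ℝ) ^ (1 / d : ℝ)) • X i) := by
  rw [toConfig_enumTuple hz, translate_ofTuple]
  rfl

lemma measurable_enumTuple_blowUp (z : Site d) {N : ℕ} (X : Fin N → E d) :
    Measurable fun x => enumTuple z (blowUp X x) :=
  (measurable_enumTuple z N).comp (measurable_blowUp X)

open Classical in
/-- Few points have a large index in a fixed window: the mean excess is controlled by the energy. -/
lemma mul_lintegral_excess_le (hd : 1 ≤ d) {z : Site d} (hz : z ∉ range (site : E d → Site d))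
    {s : ℝ} (hs : 0 ≤ s) {N : ℕ} (hN : 1 ≤ N) (X : Fin N → E d) {r : ℝ} (hr : 0 < r) (T : ℕ) :
    T * ∫⁻ x, excess r T (enumTuple z (blowUp X x)) ≤
      ENNReal.ofReal (2 * r) ^ s * volume (Metric.closedBall (0 : E d) r) *
        (((N : ℝ≥0∞) ^ (1 + s / d))⁻¹ * rieszEnergy s X) := by
  rw [← lintegral_const_mul' _ _ (ENNReal.natCast_ne_top T), mul_assoc, ← mul_assoc (volume _)]
  calc _ ≤ ∫⁻ x, ENNReal.ofReal (2 * r) ^ s * ∑ i, ∑ j, (if i = j then 0 else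
        cutKernel s (Metric.closedBall 0 r) (blowUp X x i) (blowUp X x j)) := by
        refine lintegral_mono fun x => ?_
        convert! mul_excess_le hz (blowUp X x) hs hr T
    _ ≤ _ := by
        rw [lintegral_const_mul']
        · gcongr
          convert! lintegral_interaction_blowUp_le hd hN X Metric.isClosed_closedBall.measurableSet
        · exact ENNReal.rpow_ne_top_of_nonneg hs ENNReal.ofReal_ne_top


/-! ### Weak convergence of empirical processes -/

namespace Enum

/-- The enumerations whose points of index at least `T k` avoid the ball of radius `k`, for
every `k`. -/
def Tame (T : ℕ → ℕ) : Set (Enum d) :=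
  {u | ∀ k i : ℕ, T k ≤ i → u i ∉ site '' Metric.ball (0 : E d) k}

lemma isClosed_tame (T : ℕ → ℕ) : IsClosed (Tame T : Set (Enum d)) := by
  simp only [Tame, ofPred_forall]
  refine isClosed_iInter fun k => isClosed_iInter fun i => isClosed_iInter fun _ => ?_
  have h : IsOpen (site '' Metric.ball (0 : E d) k) :=
    isOpenEmbedding_site.isOpenMap _ Metric.isOpen_ball
  exact isClosed_compl_iff.2 (h.preimage (continuous_apply (A := fun _ : ℕ => Site d) i))

lemma tame_subset_locFin (T : ℕ → ℕ) : (Tame T : Set (Enum d)) ⊆ LocFin := fun u hu k =>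
  (Set.finite_Iio (T (k + 1))).subset fun i hi => by
    by_contra h
    refine hu (k + 1) i (not_lt.1 h) (image_mono ?_ hi)
    exact Metric.closedBall_subset_ball (by push_cast; linarith)

/-- On tame enumerations, the enumerated configuration depends continuously on the enumeration. -/
lemma continuousOn_toConfig (T : ℕ → ℕ) : ContinuousOn (toConfig : Enum d → Config d) (Tame T) := by
  rw [continuousOn_iff_continuous_domRestrict]
  refine Config.continuous_of_integral fun f hf hfc => ?_
  obtain ⟨r, hr⟩ := hfc.isCompact.isBounded.subset_ball 0
  obtain ⟨k, hk⟩ := exists_nat_ge r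
  -- the integral is a finite sum of continuous functions of the sites
  have key : ∀ g : E d → ℝ, Continuous g → (∀ p, f p = 0 → g p = 0) →
      Continuous fun u : (Tame T : Set (Enum d)) =>
        (∫⁻ p, ENNReal.ofReal (g p) ∂(toConfig u.1).toMeasure).toReal := fun g hg hgf => by
    have hgc : HasCompactSupport fun p => ENNReal.ofReal (g p) :=
      hfc.mono fun p hp hfp => hp (by simp [hgf p hfp])
    have hgcont : Continuous (ext₁ fun p => ENNReal.ofReal (g p)) :=
      continuous_ext₁ (ENNReal.continuous_ofReal.comp hg) hgc
    have hsum : ∀ u ∈ (Tame T : Set (Enum d)),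
        ∫⁻ p, ENNReal.ofReal (g p) ∂(toConfig u).toMeasure =
          ∑ i ∈ Finset.range (T k), ext₁ (fun p => ENNReal.ofReal (g p)) (u i) := fun u hu => by
      rw [lintegral_toConfig (tame_subset_locFin T hu), tsum_eq_sum]
      intro i hi
      have hi' : T k ≤ i := by simpa using hi
      have h1 := hu k i hi'
      by_cases h2 : u i ∈ range site
      · obtain ⟨p, hp⟩ := h2
        rw [← hp] at h1 ⊢
        rw [ext₁_site, hgf p, ENNReal.ofReal_zero]
        by_contra h3
        exact h1 ⟨p, Metric.ball_subset_ball hk (hr (subset_tsupport _ h3)), rfl⟩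
      · exact ext₁_of_notMem _ h2
    have hfin : ∀ v, ext₁ (fun p => ENNReal.ofReal (g p)) v ≠ ∞ := fun v => by
      by_cases h2 : v ∈ range (site (d := d))
      · obtain ⟨p, rfl⟩ := h2
        rw [ext₁_site]; exact ENNReal.ofReal_ne_top
      · rw [ext₁_of_notMem _ h2]; exact ENNReal.zero_ne_top
    have e : (fun u : (Tame T : Set (Enum d)) =>
        (∫⁻ p, ENNReal.ofReal (g p) ∂(toConfig u.1).toMeasure).toReal) = fun u =>
        ∑ i ∈ Finset.range (T k), (ext₁ (fun p => ENNReal.ofReal (g p)) (u.1 i)).toReal := by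
      ext u
      rw [hsum u.1 u.2, ENNReal.toReal_sum fun i _ => hfin _]
    rw [e]
    refine continuous_finsetSum _ fun i _ => ?_
    have h1 : Continuous fun v => (ext₁ (fun p => ENNReal.ofReal (g p)) v).toReal :=
      continuous_iff_continuousAt.2 fun v =>
        (ENNReal.tendsto_toReal (hfin v)).comp hgcont.continuousAt
    exact h1.comp ((continuous_apply i).comp continuous_subtype_val)
  have h := (key f hf fun _ h => h).sub (key (fun p => -f p) hf.neg fun p h => by simp [h])
  refine h.congr fun u => ?_
  rw [domRestrict_apply, integral_eq_lintegral_pos_part_sub_lintegral_neg_part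
    (hf.integrable_of_hasCompactSupport hfc)]
  rfl

end Enum

/-- The kernel `κ` is a limit of the graphs of the maps `U n`. -/
def IsYoungLimit {Ω : Set (E d)} (U : ℕ → Ω → Enum d) (κ : Kernel Ω (Enum d)) : Prop :=
  ∀ G : Ω × Enum d → ℝ≥0∞, LowerSemicontinuous G →
    ∫⁻ x, ∫⁻ u, G (x, u) ∂κ x ∂leb Ω ≤ liminf (fun n => ∫⁻ x, G (x, U n x) ∂leb Ω) atTop

lemma lintegral_leb_le {Ω : Set (E d)} (hΩ : MeasurableSet Ω) (f : E d → ℝ≥0∞) :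
    ∫⁻ x : Ω, f x ∂leb Ω ≤ ∫⁻ x, f x :=
  (lintegral_leb hΩ f).trans_le (setLIntegral_le_lintegral _ _)

/-- Systems of bounded energy per particle have uniformly tame enumerations. -/
lemma exists_tame (hd : 1 ≤ d) {z : Site d} (hz : z ∉ range (site : E d → Site d))
    {s : ℝ} (hs : 0 ≤ s) {B : ℝ≥0∞} (hB : B ≠ ∞) {ε : ℝ≥0∞} (hε : ε ≠ 0) :
    ∃ T : ℕ → ℕ, ∀ (Ω : Set (E d)) (_ : MeasurableSet Ω) (N : ℕ) (_ : 1 ≤ N) (X : Fin N → E d),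
      ((N : ℝ≥0∞) ^ (1 + s / d))⁻¹ * rieszEnergy s X ≤ B →
      leb Ω {x | enumTuple z (blowUp X x) ∉ Enum.Tame T} ≤ ε := by
  -- Markov for each window, with probabilities of failure that add up to less than `ε`
  obtain ⟨ε', hε', hsum⟩ := ENNReal.exists_pos_sum_of_countable' hε ℕ
  let c : ℕ → ℝ≥0∞ := fun k => ENNReal.ofReal (2 * ((k : ℝ) + 1)) ^ s *
    volume (Metric.closedBall (0 : E d) (k + 1)) * B
  have hc : ∀ k, c k ≠ ∞ := fun k => ENNReal.mul_ne_top (ENNReal.mul_ne_top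
    (ENNReal.rpow_ne_top_of_nonneg hs ENNReal.ofReal_ne_top)
    (isCompact_closedBall _ _).measure_lt_top.ne) hB
  have hT : ∀ k, ∃ T : ℕ, 0 < T ∧ c k ≤ ε' k * T := fun k => by
    obtain ⟨T, hT⟩ := ENNReal.exists_nat_gt (ENNReal.div_ne_top (hc k) (hε' k).ne')
    rcases eq_or_ne (ε' k) ∞ with h | h
    · exact ⟨1, one_pos, by simp [h]⟩
    · refine ⟨T + 1, by omega, ?_⟩
      rw [ENNReal.div_lt_iff (Or.inl (hε' k).ne') (Or.inl h)] at hT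
      rw [mul_comm]
      refine hT.le.trans ?_
      gcongr; exact le_self_add
  choose T hT0 hT using hT
  refine ⟨T, fun Ω hΩ N hN X hX => ?_⟩
  have hsub : {x : Ω | enumTuple z (blowUp X x) ∉ Enum.Tame T} ⊆
      ⋃ k : ℕ, {x : Ω | 1 ≤ excess ((k : ℝ) + 1) (T k) (enumTuple z (blowUp X x))} := by
    intro x hx
    simp only [Enum.Tame, mem_ofPred_eq, not_forall, not_not] at hx
    obtain ⟨k, i, hi, h⟩ := hx
    refine mem_iUnion.2 ⟨k, one_le_excess hi (image_mono ?_ h)⟩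
    exact Metric.ball_subset_closedBall.trans (Metric.closedBall_subset_closedBall (by linarith))
  refine (measure_mono hsub).trans ((measure_iUnion_le _).trans ((ENNReal.tsum_le_tsum fun k => ?_).trans
    hsum.le))
  have h1 := mul_lintegral_excess_le hd hz hs hN X (r := (k : ℝ) + 1) (by positivity) (T k)
  have hm := (measurable_excess ((k : ℝ) + 1) (T k)).comp (measurable_enumTuple_blowUp z X)
  have h2 := mul_meas_ge_le_lintegral (μ := leb Ω) (hm.comp measurable_subtype_coe) 1
  rw [one_mul] at h2
  have hTk : (T k : ℝ≥0∞) ≠ 0 := by exact_mod_cast (hT0 k).ne'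
  rw [← ENNReal.mul_le_mul_iff_right hTk (ENNReal.natCast_ne_top _)]
  calc (T k : ℝ≥0∞) * leb Ω {x : Ω | 1 ≤ excess ((k : ℝ) + 1) (T k) (enumTuple z (blowUp X x))}
      ≤ T k * ∫⁻ x, excess ((k : ℝ) + 1) (T k) (enumTuple z (blowUp X x)) := by
        gcongr
        exact h2.trans (lintegral_leb_le hΩ _)
    _ ≤ c k := h1.trans (by simp only [c]; gcongr)
    _ ≤ T k * ε' k := by rw [mul_comm]; exact hT k


open Classical in
/-- Raising a function outside of a closed set of continuity, to a continuous upper bound, makes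
it lower semicontinuous. -/
lemma lowerSemicontinuous_ite {Z : Type*} [TopologicalSpace Z] {S : Set Z} (hS : IsClosed S)
    {f g : Z → ℝ≥0∞} (hf : ContinuousOn f S) (hg : Continuous g) (hfg : ∀ z ∈ S, f z ≤ g z) :
    LowerSemicontinuous fun z => if z ∈ S then f z else g z := by
  intro z t ht
  by_cases hz : z ∈ S
  · simp only [hz, if_true] at ht
    have h1 := eventually_nhdsWithin_iff.1 ((hf z hz).eventually (lt_mem_nhds ht))
    have h2 := hg.continuousAt.eventually (lt_mem_nhds (ht.trans_le (hfg z hz)))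
    filter_upwards [h1, h2] with w h3 h4
    split_ifs with hw
    exacts [h3 hw, h4]
  · simp only [hz, if_false] at ht
    filter_upwards [hS.isOpen_compl.mem_nhds hz, hg.continuousAt.eventually (lt_mem_nhds ht)]
      with w h3 h4
    rwa [if_neg h3]

lemma integrable_leb {Ω : Set (E d)} (hΩ : MeasurableSet Ω) {g : E d → ℝ} (hg : Integrable g) :
    Integrable (fun x : Ω => g x) (leb Ω) := by
  have h : Integrable g ((leb Ω).map Subtype.val) := by
    rw [map_leb hΩ]; exact hg.integrableOn
  exact h.comp_measurable measurable_subtype_coe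

section

variable {Ω : Set (E d)} {z : Site d}

lemma taggedEmpirical_eq (hz : z ∉ range (site : E d → Site d)) {N : ℕ} (X : Fin N → Ω) :
    taggedEmpirical X = (leb Ω).map fun x : Ω =>
      (x, Enum.toConfig (enumTuple z (blowUp (fun i => (X i : E d)) x))) := by
  simp_rw [toConfig_enumTuple_blowUp hz]
  rfl

lemma measurable_tagged {N : ℕ} (X : Fin N → Ω) : Measurable fun x : Ω =>
    (x, Enum.toConfig (enumTuple z (blowUp (fun i => (X i : E d)) x))) :=
  measurable_id.prodMk (Enum.measurable_toConfig.comp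
    ((measurable_enumTuple_blowUp z _).comp measurable_subtype_coe))

/-- Shifting a test function by an integrable function of the tag makes it nonnegative. -/
lemma lintegral_ofReal_add_eq {π : Measure (Ω × Config d)} (hπ : π.map Prod.fst = leb Ω)
    {F : Ω × Config d → ℝ} (hF : Measurable F) {b : Ω → ℝ} (hb : Measurable b)
    (hbi : Integrable b (leb Ω)) (hFb : ∀ w, |F w| ≤ b w.1) :
    ∫⁻ w, ENNReal.ofReal (F w + b w.1) ∂π = ENNReal.ofReal (∫ w, F w ∂π + ∫ x, b x ∂leb Ω) := by
  have h1 : Integrable (fun w : Ω × Config d => b w.1) π := by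
    rw [← hπ] at hbi
    exact hbi.comp_measurable measurable_fst
  have h2 : Integrable F π := h1.mono' hF.aestronglyMeasurable (ae_of_all _ fun w => by
    simpa using hFb w)
  rw [← hπ, integral_map measurable_fst.aemeasurable hb.aestronglyMeasurable,
    ← integral_add h2 h1]
  refine (ofReal_integral_eq_lintegral_ofReal (h2.add h1) (ae_of_all _ fun w => ?_)).symm
  have := neg_le_of_abs_le (hFb w)
  simp only [Pi.zero_apply, Pi.add_apply]
  linarith

/-- A Young limit of enumerations of systems of bounded energy per particle is a weak limit of the
tagged empirical processes. -/
theorem IsYoungLimit.tendstoWeakly (hd : 1 ≤ d) (hΩ : IsClosed Ω)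
    (hz : z ∉ range (site : E d → Site d)) {s : ℝ} (hs : 0 ≤ s) {M : ℕ → ℕ} (hM : ∀ n, 1 ≤ M n)
    (X : ∀ n, Fin (M n) → Ω) {B : ℝ≥0∞} (hB : B ≠ ∞)
    (hXB : ∀ n, ((M n : ℝ≥0∞) ^ (1 + s / d))⁻¹ * rieszEnergy s (fun i => (X n i : E d)) ≤ B)
    {κ : Kernel Ω (Enum d)} [IsMarkovKernel κ]
    (hκ : IsYoungLimit (fun n (x : Ω) => enumTuple z (blowUp (fun i => (X n i : E d)) x)) κ) :
    TendstoWeakly (fun n => taggedEmpirical (X n)) (leb Ω ⊗ₘ κ.map Enum.toConfig) := by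
  classical
  have := sigmaFinite_leb hΩ.measurableSet
  have hκ' : IsMarkovKernel (κ.map Enum.toConfig) := Kernel.IsMarkovKernel.map κ Enum.measurable_toConfig
  intro F₀ ⟨R, hR⟩
  -- an integrable function of the tag alone that dominates the test function
  set b₀ : E d → ℝ := fun x => ‖F₀‖ * Config.bump R x with hb₀
  have hb₀c : Continuous b₀ := continuous_const.mul (Config.continuous_bump R)
  have hb₀i : Integrable b₀ :=
    hb₀c.integrable_of_hasCompactSupport (Config.hasCompactSupport_bump R).mul_left
  set b : Ω → ℝ := fun x => b₀ x with hb
  have hbc : Continuous b := hb₀c.comp continuous_subtype_val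
  have hbi : Integrable b (leb Ω) := integrable_leb hΩ.measurableSet hb₀i
  have hb0 : ∀ x, 0 ≤ b x := fun x => mul_nonneg (norm_nonneg _) (Config.bump_nonneg _ _)
  have hbF : ∀ x, b x ≤ ‖F₀‖ := fun x =>
    mul_le_of_le_one_right (norm_nonneg _) (Config.bump_le_one _ _)
  have hFb : ∀ w, |F₀ w| ≤ b w.1 := fun w => by
    rcases le_or_gt ‖(w.1 : E d)‖ R with h | h
    · simp only [hb, hb₀]
      rw [Config.bump_eq_one h, mul_one]
      exact F₀.norm_coe_le_norm w
    · rw [hR w.1 w.2 h, abs_zero]; exact hb0 _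
  set π := leb Ω ⊗ₘ κ.map Enum.toConfig with hπ
  have hπ1 : π.map Prod.fst = leb Ω := Measure.fst_compProd _ _
  have hπn : ∀ n, (taggedEmpirical (X n)).map Prod.fst = leb Ω := fun n => by
    rw [taggedEmpirical_eq hz, Measure.map_map measurable_fst (measurable_tagged _)]
    exact Measure.map_id
  -- one-sided estimate
  have key : ∀ F : Ω × Config d → ℝ, Continuous F → (∀ w, |F w| ≤ b w.1) → ∀ δ : ℝ, 0 < δ →
      ∀ᶠ n in atTop, ∫ w, F w ∂π ≤ ∫ w, F w ∂taggedEmpirical (X n) + δ := by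
    intro F hF hFb δ hδ
    have hFm : Measurable F := hF.measurable
    set L : Measure (Ω × Config d) → ℝ≥0∞ := fun π => ∫⁻ w, ENNReal.ofReal (F w + b w.1) ∂π with hL
    have hLeq : ∀ π : Measure (Ω × Config d), π.map Prod.fst = leb Ω →
        L π = ENNReal.ofReal (∫ w, F w ∂π + ∫ x, b x ∂leb Ω) := fun π hπ =>
      lintegral_ofReal_add_eq hπ hFm hbc.measurable hbi hFb
    have hIb : ∀ π : Measure (Ω × Config d), π.map Prod.fst = leb Ω →
        0 ≤ ∫ w, F w ∂π + ∫ x, b x ∂leb Ω := fun π hπ => by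
      have h1 : Integrable (fun w : Ω × Config d => b w.1) π := by
        have := hbi
        rw [← hπ] at this
        exact this.comp_measurable measurable_fst
      have h2 : Integrable F π := h1.mono' hFm.aestronglyMeasurable (ae_of_all _ fun w => by
        simpa using hFb w)
      rw [← hπ, integral_map measurable_fst.aemeasurable hbc.measurable.aestronglyMeasurable,
        ← integral_add h2 h1]
      exact integral_nonneg fun w => by
        have := neg_le_of_abs_le (hFb w)
        simp only [Pi.zero_apply]
        linarith
    set δ' : ℝ≥0∞ := ENNReal.ofReal (δ / 2) with hδ'
    have hδ'0 : δ' ≠ 0 := by rw [hδ', Ne, ENNReal.ofReal_eq_zero, not_le]; positivity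
    obtain ⟨T, hT⟩ := exists_tame hd hz hs hB (ε := δ' / (ENNReal.ofReal (2 * ‖F₀‖) + 1))
      (ENNReal.div_ne_zero.2 ⟨hδ'0, by finiteness⟩)
    -- the map `toConfig` is continuous on tame enumerations only: on the others, which are rare,
    -- the nonnegative function `f` is replaced by its upper bound `g`, and the result is lower
    -- semicontinuous
    let S : Set (Ω × Enum d) := Prod.snd ⁻¹' Enum.Tame T
    have hS : IsClosed S := (Enum.isClosed_tame T).preimage continuous_snd
    let f : Ω × Enum d → ℝ≥0∞ := fun w => ENNReal.ofReal (F (w.1, Enum.toConfig w.2) + b w.1)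
    let g : Ω × Enum d → ℝ≥0∞ := fun w => ENNReal.ofReal (2 * b w.1)
    have hf : ContinuousOn f S := by
      refine ENNReal.continuous_ofReal.comp_continuousOn (ContinuousOn.add ?_ ?_)
      · refine hF.comp_continuousOn (continuous_fst.continuousOn.prodMk ?_)
        exact (Enum.continuousOn_toConfig T).comp continuous_snd.continuousOn fun w hw => hw
      · exact (hbc.comp continuous_fst).continuousOn
    have hg : Continuous g := ENNReal.continuous_ofReal.comp
      (continuous_const.mul (hbc.comp continuous_fst))
    have hfg : ∀ w, f w ≤ g w := fun w => ENNReal.ofReal_le_ofReal (by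
      have := le_of_abs_le (hFb (w.1, Enum.toConfig w.2))
      simp only at this ⊢
      linarith)
    have hlsc := hκ _ (lowerSemicontinuous_ite hS hf hg fun w _ => hfg w)
    have h1 : L π ≤ ∫⁻ x, ∫⁻ u, (if (x, u) ∈ S then f (x, u) else g (x, u)) ∂κ x ∂leb Ω := by
      have hm : Measurable fun w : Ω × Config d => ENNReal.ofReal (F w + b w.1) :=
        (hFm.add (hbc.measurable.comp measurable_fst)).ennreal_ofReal
      simp only [hL, hπ]
      rw [Measure.lintegral_compProd hm]
      refine lintegral_mono fun x => ?_
      rw [Kernel.map_apply _ Enum.measurable_toConfig]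
      refine (lintegral_map (f := fun C => ENNReal.ofReal (F (x, C) + b x))
        (hm.comp measurable_prodMk_left) Enum.measurable_toConfig).le.trans ?_
      refine lintegral_mono fun u => ?_
      split_ifs
      exacts [le_rfl, hfg (x, u)]
    have h2 : ∀ n, ∫⁻ x, (if (x, enumTuple z (blowUp (fun i => (X n i : E d)) x)) ∈ S then
        f (x, enumTuple z (blowUp (fun i => (X n i : E d)) x)) else
        g (x, enumTuple z (blowUp (fun i => (X n i : E d)) x))) ∂leb Ω ≤
        L (taggedEmpirical (X n)) + δ' := fun n => by
      have hm : Measurable fun w : Ω × Config d => ENNReal.ofReal (F w + b w.1) :=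
        (hFm.add (hbc.measurable.comp measurable_fst)).ennreal_ofReal
      simp only [hL]
      rw [taggedEmpirical_eq hz, lintegral_map hm (measurable_tagged _)]
      set A : Set Ω := {x | enumTuple z (blowUp (fun i => (X n i : E d)) x) ∉ Enum.Tame T} with hA
      have hAm : MeasurableSet A := (((measurable_enumTuple_blowUp z _).comp
        measurable_subtype_coe) (Enum.isClosed_tame T).measurableSet).compl
      have hAle := hT Ω hΩ.measurableSet (M n) (hM n) _ (hXB n)
      calc _ ≤ ∫⁻ x, (f (x, enumTuple z (blowUp (fun i => (X n i : E d)) x)) +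
            A.indicator (fun _ => ENNReal.ofReal (2 * ‖F₀‖)) x) ∂leb Ω := by
            refine lintegral_mono fun x => ?_
            split_ifs with h
            · exact le_self_add
            · rw [indicator_of_mem (show x ∈ A from h)]
              refine le_add_left (ENNReal.ofReal_le_ofReal ?_)
              have := hbF x
              simp only
              linarith
        _ = _ + ENNReal.ofReal (2 * ‖F₀‖) * leb Ω A := by
            rw [lintegral_add_right _ (measurable_const.indicator hAm),
              lintegral_indicator_const hAm]
        _ ≤ _ := by
            gcongr
            calc _ ≤ (ENNReal.ofReal (2 * ‖F₀‖) + 1) * (δ' / (ENNReal.ofReal (2 * ‖F₀‖) + 1)) := by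
                  gcongr
                  exact le_self_add
              _ = δ' := ENNReal.mul_div_cancel (by simp) (by finiteness)
    have h3 : L π ≤ liminf (fun n => L (taggedEmpirical (X n)) + δ') atTop :=
      h1.trans (hlsc.trans (liminf_le_liminf (Eventually.of_forall h2)))
    have h4 : ∀ᶠ n in atTop, L π ≤ L (taggedEmpirical (X n)) + δ' + δ' := by
      rcases eq_or_ne (L π) 0 with h0 | h0
      · exact Eventually.of_forall fun n => by rw [h0]; exact zero_le
      · have h5 : L π - δ' < L π := ENNReal.sub_lt_self (by rw [hLeq π hπ1]; finiteness) h0 hδ'0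
        filter_upwards [eventually_lt_of_lt_liminf (h5.trans_le h3)] with n hn
        exact tsub_le_iff_right.1 hn.le
    filter_upwards [h4] with n hn
    have h6 := hIb _ (hπn n)
    rw [hLeq π hπ1, hLeq _ (hπn n), add_assoc, ← ENNReal.ofReal_add (by positivity) (by positivity),
      ← ENNReal.ofReal_add h6 (by positivity), ENNReal.ofReal_le_ofReal_iff (by positivity)] at hn
    linarith
  -- the one-sided estimate for `F₀` and `-F₀`
  rw [Metric.tendsto_atTop']
  intro δ hδ
  have h1 := key F₀ F₀.continuous hFb (δ / 2) (by positivity)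
  have h2 := key (fun w => -F₀ w) F₀.continuous.neg (fun w => by rw [abs_neg]; exact hFb w) (δ / 2)
    (by positivity)
  obtain ⟨n₀, hn₀⟩ := eventually_atTop.1 (h1.and h2)
  refine ⟨n₀, fun n hn => ?_⟩
  obtain ⟨h3, h4⟩ := hn₀ n hn.le
  rw [integral_neg, integral_neg] at h4
  rw [Real.dist_eq, abs_lt]
  constructor <;> linarith

end


/-! ### Stationarity of the limit -/

section

variable {Ω : Set (E d)}

lemma integral_leb_eq (hΩ : MeasurableSet Ω) (g : Ω → ℝ) (H : E d → ℝ) :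
    ∫ x : Ω, g x * H x ∂leb Ω = ∫ x, Function.extend Subtype.val g 0 x * H x := by
  have h1 : ∫ x : Ω, g x * H x ∂leb Ω =
      ∫ x : Ω, (fun y => Function.extend Subtype.val g 0 y * H y) x ∂leb Ω := by
    refine integral_congr_ae (ae_of_all _ fun x => ?_)
    simp only [Subtype.val_injective.extend_apply]
  have h2 := (MeasurableEmbedding.subtype_coe hΩ).integral_map (μ := leb Ω)
    fun y => Function.extend Subtype.val g 0 y * H y
  rw [h1, ← h2, map_leb hΩ]
  refine setIntegral_eq_integral_of_forall_compl_eq_zero fun x hx => ?_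
  rw [Function.extend_apply' _ _ _ (by simpa using hx)]
  simp

lemma continuousAt_extend_zero (hΩ : IsClosed Ω) {g : Ω → ℝ} (hg : Continuous g) {x : E d}
    (hx : x ∉ frontier Ω) : ContinuousAt (Function.extend Subtype.val g 0) x := by
  by_cases h : x ∈ Ω
  · have h1 : x ∈ interior Ω := by
      by_contra h2
      exact hx ⟨subset_closure h, h2⟩
    have h2 : ContinuousAt (fun y : Ω => Function.extend Subtype.val g 0 (y : E d)) ⟨x, h⟩ := by
      simp only [Subtype.val_injective.extend_apply]
      exact hg.continuousAt
    have h3 : ContinuousOn (Function.extend Subtype.val g (0 : E d → ℝ)) Ω := by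
      rw [continuousOn_iff_continuous_domRestrict]
      refine hg.congr fun y => ?_
      rw [domRestrict_apply, Subtype.val_injective.extend_apply]
    exact h3.continuousAt (mem_interior_iff_mem_nhds.1 h1)
  · have h1 : Function.extend Subtype.val g (0 : E d → ℝ) =ᶠ[𝓝 x] fun _ => 0 := by
      filter_upwards [hΩ.isOpen_compl.mem_nhds h] with y hy
      rw [Function.extend_apply' _ _ _ (by simpa using hy)]
      rfl
    exact (continuousAt_const (y := (0 : ℝ))).congr h1.symm

/-- Small shifts of bounded functions are not seen by test functions, because the boundary of `Ω`
has zero volume. -/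
lemma tendsto_integral_sub_shift (hΩ : IsClosed Ω) (hfr : volume (frontier Ω) = 0)
    {g : Ω → ℝ} (hg : Continuous g) {b R : ℝ} (hb : ∀ x, |g x| ≤ b)
    (hR : ∀ x : Ω, R < ‖(x : E d)‖ → g x = 0) {H : ℕ → E d → ℝ} (hH : ∀ n, Measurable (H n))
    {c : ℝ} (hc : ∀ n x, |H n x| ≤ c) {t : ℕ → E d} (ht : Tendsto t atTop (𝓝 0)) :
    Tendsto (fun n => ∫ x : Ω, g x * H n x ∂leb Ω - ∫ x : Ω, g x * H n (x + t n) ∂leb Ω)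
      atTop (𝓝 0) := by
  set G : E d → ℝ := Function.extend Subtype.val g 0 with hG
  have hGm : Measurable G :=
    (MeasurableEmbedding.subtype_coe hΩ.measurableSet).measurable_extend hg.measurable
      measurable_const
  have hGcases : ∀ x, (∃ y : Ω, (y : E d) = x ∧ G x = g y) ∨ G x = 0 := fun x => by
    by_cases h : x ∈ Ω
    · exact Or.inl ⟨⟨x, h⟩, rfl, Subtype.val_injective.extend_apply g 0 ⟨x, h⟩⟩
    · right
      rw [hG, Function.extend_apply' _ _ _ (by simpa using h)]
      rfl
  have hb' : ∀ x, |G x| ≤ |b| := fun x => by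
    rcases hGcases x with ⟨y, -, h⟩ | h
    · rw [h]; exact (hb y).trans (le_abs_self b)
    · rw [h, abs_zero]; exact abs_nonneg b
  have hG0 : ∀ x, R < ‖x‖ → G x = 0 := fun x hx => by
    rcases hGcases x with ⟨y, rfl, h⟩ | h
    · rw [h, hR y hx]
    · exact h
  have hc0 : 0 ≤ c := (abs_nonneg _).trans (hc 0 0)
  have hbd : ∀ r : ℝ, Integrable ((Metric.closedBall (0 : E d) r).indicator fun _ => |b| * c) :=
    fun r => (integrableOn_const (isCompact_closedBall _ _).measure_lt_top.ne).integrable_indicator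
      measurableSet_closedBall
  have hle : ∀ x x' r a, (R < ‖x‖ → G x = 0) → (‖x‖ ≤ R → ‖x'‖ ≤ r) → |a| ≤ c →
      ‖G x * a‖ ≤ (Metric.closedBall (0 : E d) r).indicator (fun _ => |b| * c) x' := by
    intro x x' r a h1 h2 h3
    rw [Real.norm_eq_abs, abs_mul]
    rcases le_or_gt ‖x‖ R with h | h
    · rw [indicator_of_mem (by simpa using h2 h)]
      exact mul_le_mul (hb' x) h3 (abs_nonneg _) (abs_nonneg _)
    · rw [h1 h, abs_zero, zero_mul]
      exact indicator_nonneg (fun _ _ => by positivity) _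
  have hi1 : ∀ n, Integrable fun x => G x * H n x := fun n =>
    (hbd R).mono' (hGm.mul (hH n)).aestronglyMeasurable (ae_of_all _ fun x =>
      hle x x R _ (hG0 x) (fun h => h) (hc n x))
  have hi2 : ∀ n, Integrable fun x => G (x - t n) * H n x := fun n => by
    refine (hbd (R + ‖t n‖)).mono' (((hGm.comp (measurable_id.sub_const (t n)))).mul
      (hH n)).aestronglyMeasurable (ae_of_all _ fun x =>
        hle (x - t n) x _ _ (hG0 _) (fun h => ?_) (hc n x))
    have := norm_add_le (x - t n) (t n)
    rw [sub_add_cancel] at this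
    linarith
  -- by a change of variables the shift is moved to the extension of `g` by zero, which is
  -- continuous almost everywhere
  have e : ∀ n, ∫ x : Ω, g x * H n x ∂leb Ω - ∫ x : Ω, g x * H n (x + t n) ∂leb Ω =
      ∫ x, (G x * H n x - G (x - t n) * H n x) := fun n => by
    rw [integral_sub (hi1 n) (hi2 n), integral_leb_eq hΩ.measurableSet,
      integral_leb_eq hΩ.measurableSet g fun x => H n (x + t n),
      ← integral_add_right_eq_self (fun x => G (x - t n) * H n x) (t n)]
    simp only [add_sub_cancel_right, hG]
  simp only [e]
  rw [← integral_zero (E d) ℝ]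
  have ht1 : ∀ᶠ n in atTop, ‖t n‖ ≤ 1 := by
    have := ht.norm
    rw [norm_zero] at this
    exact this.eventually (Iic_mem_nhds one_pos)
  refine tendsto_integral_filter_of_dominated_convergence
    (fun x => (Metric.closedBall (0 : E d) R).indicator (fun _ => |b| * c) x +
      (Metric.closedBall (0 : E d) (R + 1)).indicator (fun _ => |b| * c) x)
    (Eventually.of_forall fun n => ((hi1 n).sub (hi2 n)).aestronglyMeasurable) ?_
    ((hbd R).add (hbd (R + 1))) ?_
  · filter_upwards [ht1] with n hn
    refine ae_of_all _ fun x => (norm_sub_le _ _).trans (add_le_add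
      (hle x x R _ (hG0 x) (fun h => h) (hc n x)) (hle (x - t n) x _ _ (hG0 _) (fun h => ?_) (hc n x)))
    have := norm_add_le (x - t n) (t n)
    rw [sub_add_cancel] at this
    linarith
  · have h : ∀ᵐ x : E d, x ∉ frontier Ω := by
      rw [ae_iff]; simpa using hfr
    filter_upwards [h] with x hx
    have h1 : Tendsto (fun n => G (x - t n)) atTop (𝓝 (G x)) := by
      refine (continuousAt_extend_zero hΩ hg hx).tendsto.comp ?_
      simpa using tendsto_const_nhds.sub ht
    have h2 : Tendsto (fun n => c * ‖G x - G (x - t n)‖) atTop (𝓝 0) := by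
      have := (tendsto_const_nhds (x := G x)).sub h1
      rw [sub_self] at this
      simpa using this.norm.const_mul c
    refine squeeze_zero_norm (fun n => ?_) h2
    rw [← sub_mul, norm_mul, mul_comm]
    exact mul_le_mul_of_nonneg_right (hc n x) (norm_nonneg _)

lemma integral_taggedEmpirical {N : ℕ} (X : Fin N → Ω) {F : Ω × Config d → ℝ} (hF : Continuous F) :
    ∫ w, F w ∂taggedEmpirical X = ∫ x : Ω, F (x, (Config.ofTuple fun i =>
      ((N : ℝ) ^ (1 / d : ℝ)) • (X i : E d)).translate (((N : ℝ) ^ (1 / d : ℝ)) • (x : E d))) ∂leb Ω := by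
  rw [taggedEmpirical, integral_map _ hF.measurable.aestronglyMeasurable]
  have h : Continuous fun x : Ω => ((N : ℝ) ^ (1 / d : ℝ)) • (x : E d) := by fun_prop
  exact (measurable_id.prodMk ((Config.continuous_translate_left _).comp h).measurable).aemeasurable

/-- The weak limit of tagged empirical processes does not distinguish a test function from its
translates. -/
lemma TendstoWeakly.integral_translate_eq (hd : 1 ≤ d) (hΩ : IsClosed Ω)
    (hfr : volume (frontier Ω) = 0) {M : ℕ → ℕ}
    (hM : Tendsto M atTop atTop) {X : ∀ n, Fin (M n) → Ω} {π : Measure (Ω × Config d)}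
    (h : TendstoWeakly (fun n => taggedEmpirical (X n)) π) {g : Ω → ℝ} (hg : Continuous g) {b R : ℝ}
    (hb : ∀ x, |g x| ≤ b) (hR : ∀ x : Ω, R < ‖(x : E d)‖ → g x = 0) (f : Config d →ᵇ ℝ) (y : E d) :
    ∫ w, g w.1 * f w.2 ∂π = ∫ w, g w.1 * f (w.2.translate y) ∂π := by
  have hb' : ∀ x, |g x| ≤ |b| := fun x => (hb x).trans (le_abs_self b)
  have hc1 : Continuous fun w : Ω × Config d => g w.1 * f w.2 :=
    (hg.comp continuous_fst).mul (f.continuous.comp continuous_snd)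
  have hc2 : Continuous fun w : Ω × Config d => g w.1 * f (w.2.translate y) :=
    (hg.comp continuous_fst).mul
      (f.continuous.comp ((Config.continuous_translate y).comp continuous_snd))
  have hn : ∀ x C, ‖g x * f C‖ ≤ |b| * ‖f‖ := fun x C => by
    rw [norm_mul]
    exact mul_le_mul (hb' x) (f.norm_coe_le_norm C) (norm_nonneg _) (abs_nonneg _)
  have h1 := h (BoundedContinuousFunction.ofNormedAddCommGroup _ hc1 _ fun w => hn w.1 w.2)
    ⟨R, fun x C hx => by simp [hR x hx]⟩
  have h2 := h (BoundedContinuousFunction.ofNormedAddCommGroup _ hc2 _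
    fun w => hn w.1 (w.2.translate y)) ⟨R, fun x C hx => by simp [hR x hx]⟩
  simp only [BoundedContinuousFunction.coe_ofNormedAddCommGroup] at h1 h2
  set H : ℕ → E d → ℝ := fun n x => f ((Config.ofTuple fun i =>
      ((M n : ℝ) ^ (1 / d : ℝ)) • (X n i : E d)).translate (((M n : ℝ) ^ (1 / d : ℝ)) • x)) with hH
  -- translating the blown-up configuration by `y` amounts to moving the tag by `t n`, which is
  -- infinitesimal
  set t : ℕ → E d := fun n => ((M n : ℝ) ^ (1 / d : ℝ))⁻¹ • y with ht
  have ht0 : Tendsto t atTop (𝓝 0) := by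
    have h3 : Tendsto (fun n => ((M n : ℝ) ^ (1 / d : ℝ))⁻¹) atTop (𝓝 0) :=
      ((tendsto_rpow_atTop (by positivity)).comp
        (tendsto_natCast_atTop_atTop.comp hM)).inv_tendsto_atTop
    have h4 := h3.smul_const y
    rwa [zero_smul] at h4
  have hHm : ∀ n, Measurable (H n) := fun n => by
    have h3 : Continuous fun x : E d => ((M n : ℝ) ^ (1 / d : ℝ)) • x := by fun_prop
    exact (f.continuous.comp ((Config.continuous_translate_left _).comp h3)).measurable
  have hHb : ∀ n x, |H n x| ≤ ‖f‖ := fun n x => f.norm_coe_le_norm _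
  have h3 := tendsto_integral_sub_shift hΩ hfr hg hb hR hHm hHb ht0
  have h4 : Tendsto (fun n => ∫ w, g w.1 * f w.2 ∂taggedEmpirical (X n) -
      ∫ w, g w.1 * f (w.2.translate y) ∂taggedEmpirical (X n)) atTop (𝓝 0) := by
    refine h3.congr' ?_
    filter_upwards [hM.eventually_ge_atTop 1] with n hn
    rw [integral_taggedEmpirical _ hc1, integral_taggedEmpirical _ hc2]
    have e : ∀ x : E d, H n (x + t n) = f (((Config.ofTuple fun i =>
        ((M n : ℝ) ^ (1 / d : ℝ)) • (X n i : E d)).translate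
          (((M n : ℝ) ^ (1 / d : ℝ)) • x)).translate y) := fun x => by
      simp only [hH, ht]
      rw [Config.translate_translate, smul_add, smul_inv_smul₀ (scale_pos hn).ne']
    simp only [hH] at e ⊢
    simp only [e]
  have h5 := tendsto_nhds_unique h4 (h1.sub h2)
  linarith

/-- A weak limit of tagged empirical processes is stationary. -/
theorem TendstoWeakly.ae_isStationary (hd : 1 ≤ d) (hΩ : IsClosed Ω)
    (hfr : volume (frontier Ω) = 0) {M : ℕ → ℕ} (hM : Tendsto M atTop atTop)
    {X : ∀ n, Fin (M n) → Ω} {η : Kernel Ω (Config d)} [IsMarkovKernel η]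
    (h : TendstoWeakly (fun n => taggedEmpirical (X n)) (leb Ω ⊗ₘ η)) :
    ∀ᵐ x ∂leb Ω, IsStationary (η x) := by
  have := sigmaFinite_leb hΩ.measurableSet
  have hbc : ∀ k : ℕ, Continuous fun x : Ω => Config.bump k (x : E d) := fun k =>
    (Config.continuous_bump k).comp continuous_subtype_val
  have hbi : ∀ k : ℕ, Integrable (fun x : Ω => Config.bump k (x : E d)) (leb Ω) := fun k =>
    integrable_leb hΩ.measurableSet
      ((Config.continuous_bump k).integrable_of_hasCompactSupport (Config.hasCompactSupport_bump k))
  have hmt : ∀ y : E d, Measurable (Config.translate y : Config d → Config d) := fun y =>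
    (Config.continuous_translate y).measurable
  -- invariance under a fixed translation, for almost all tags in a ball: the tags are weighted by
  -- a cutoff, so that the two compared measures are finite
  have h1 : ∀ (y : E d) (k : ℕ), ∀ᵐ x : Ω ∂leb Ω, ‖(x : E d)‖ ≤ k →
      (η x).map (Config.translate y) = η x := by
    intro y k
    set ν := (leb Ω).withDensity fun x : Ω => ENNReal.ofReal (Config.bump k (x : E d)) with hν
    have hνfin : IsFiniteMeasure ν := isFiniteMeasure_withDensity_ofReal (hbi k).2
    have hηy : IsMarkovKernel (η.map (Config.translate y)) := Kernel.IsMarkovKernel.map η (hmt y)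
    have key : ∀ (f : Ω →ᵇ ℝ) (g : Config d →ᵇ ℝ) (ζ : Kernel Ω (Config d)) [IsMarkovKernel ζ],
        ∫ w, f w.1 * g w.2 ∂(ν ⊗ₘ ζ) =
          ∫ w, (Config.bump k (w.1 : E d) * f w.1) * g w.2 ∂(leb Ω ⊗ₘ ζ) := by
      intro f g ζ _
      have hm : Measurable fun w : Ω × Config d => f w.1 * g w.2 :=
        (f.continuous.measurable.comp measurable_fst).mul
          (g.continuous.measurable.comp measurable_snd)
      have hi1 : Integrable (fun w : Ω × Config d => f w.1 * g w.2) (ν ⊗ₘ ζ) :=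
        Integrable.of_bound hm.aestronglyMeasurable (‖f‖ * ‖g‖) (ae_of_all _ fun w => by
          rw [norm_mul]
          exact mul_le_mul (f.norm_coe_le_norm _) (g.norm_coe_le_norm _) (norm_nonneg _)
            (norm_nonneg _))
      have hi0 : Integrable (fun w : Ω × Config d => Config.bump k (w.1 : E d)) (leb Ω ⊗ₘ ζ) := by
        have h3 := hbi k
        rw [← Measure.fst_compProd (leb Ω) ζ] at h3
        exact h3.comp_measurable measurable_fst
      have hi2 : Integrable (fun w : Ω × Config d => (Config.bump k (w.1 : E d) * f w.1) * g w.2)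
          (leb Ω ⊗ₘ ζ) := by
        simp_rw [mul_assoc]
        refine (hi0.mul_bdd (c := ‖f‖ * ‖g‖) hm.aestronglyMeasurable (ae_of_all _ fun w => ?_))
        rw [norm_mul]
        exact mul_le_mul (f.norm_coe_le_norm _) (g.norm_coe_le_norm _) (norm_nonneg _)
          (norm_nonneg _)
      rw [Measure.integral_compProd hi1, Measure.integral_compProd hi2, hν,
        integral_withDensity_eq_integral_toReal_smul
          (hbc k).measurable.ennreal_ofReal (ae_of_all _ fun _ => ENNReal.ofReal_lt_top)]
      refine integral_congr_ae (ae_of_all _ fun x => ?_)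
      simp only [ENNReal.toReal_ofReal (Config.bump_nonneg _ _), smul_eq_mul, integral_const_mul,
        mul_assoc]
    have h2 : ν ⊗ₘ η.map (Config.translate y) = ν ⊗ₘ η := by
      refine Measure.ext_of_integral_mul_boundedContinuousFunction fun f g => ?_
      rw [key, key]
      have h3 := h.integral_translate_eq hd hΩ hfr hM
        (g := fun x : Ω => Config.bump k (x : E d) * f x) ((hbc k).mul f.continuous)
        (b := ‖f‖) (R := k + 1) (fun x => ?_) (fun x hx => ?_) g y
      · rw [h3]
        have hm : Measurable fun w : Ω × Config d => (Config.bump k (w.1 : E d) * f w.1) * g w.2 :=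
          (((hbc k).mul f.continuous).measurable.comp measurable_fst).mul
            (g.continuous.measurable.comp measurable_snd)
        have e : leb Ω ⊗ₘ η.map (Config.translate y) =
            (leb Ω ⊗ₘ η).map (Prod.map id (Config.translate y)) := Measure.compProd_map (hmt y)
        rw [e, integral_map (measurable_id.prodMap (hmt y)).aemeasurable hm.aestronglyMeasurable]
        rfl
      · rw [abs_mul, abs_of_nonneg (Config.bump_nonneg _ _)]
        exact (mul_le_of_le_one_left (abs_nonneg _) (Config.bump_le_one _ _)).trans (f.norm_coe_le_norm x)
      · rw [Config.bump_eq_zero hx.le, zero_mul]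
    have h3 := Kernel.ae_eq_of_compProd_eq h2
    rw [hν, EventuallyEq, ae_withDensity_iff (hbc k).measurable.ennreal_ofReal] at h3
    filter_upwards [h3] with x hx hxk
    rw [← Kernel.map_apply _ (hmt y)]
    exact hx (by rw [Config.bump_eq_one hxk]; simp)
  -- countably many translations at once; the others follow by continuity
  have h2 : ∀ᵐ x : Ω ∂leb Ω, ∀ i : ℕ,
      (η x).map (Config.translate (TopologicalSpace.denseSeq (E d) i)) = η x := by
    rw [ae_all_iff]
    intro i
    filter_upwards [ae_all_iff.2 (h1 (TopologicalSpace.denseSeq (E d) i))] with x hx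
    obtain ⟨k, hk⟩ := exists_nat_ge ‖(x : E d)‖
    exact hx k hk
  filter_upwards [h2] with x hx y
  have := Measure.isProbabilityMeasure_map (μ := η x) (hmt y).aemeasurable
  refine ext_of_forall_integral_eq_of_IsFiniteMeasure fun f => ?_
  rw [integral_map (hmt y).aemeasurable f.continuous.aestronglyMeasurable]
  have hc : Continuous fun y : E d => ∫ C, f (C.translate y) ∂η x :=
    continuous_of_dominated (bound := fun _ => ‖f‖)
      (fun y => (f.continuous.comp (Config.continuous_translate y)).aestronglyMeasurable)
      (fun y => ae_of_all _ fun C => f.norm_coe_le_norm _) (integrable_const _)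
      (ae_of_all _ fun C => f.continuous.comp (Config.continuous_translate_left C))
  refine congrFun (hc.ext_on (TopologicalSpace.denseRange_denseSeq (E d)) continuous_const ?_) y
  rintro _ ⟨i, rfl⟩
  have h3 := congrArg (fun P => ∫ C, f C ∂P) (hx i)
  rwa [integral_map (hmt _).aemeasurable f.continuous.aestronglyMeasurable] at h3

end


/-! ### Mass, energy and potential of the limit -/

/-- The mean number of points, weighted by `f`, of the random enumeration `κ x`. -/
def meanCount {Ω : Set (E d)} (κ : Kernel Ω (Enum d)) (f : E d → ℝ≥0∞) (x : Ω) : ℝ≥0∞ :=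
  ∫⁻ u, ∑' i, ext₁ f (u i) ∂κ x

lemma measurable_tsum_ext₁ {f : E d → ℝ≥0∞} (hf : Measurable f) :
    Measurable fun u : Enum d => ∑' i, ext₁ f (u i) :=
  Measurable.tsum fun i => (measurable_ext₁ hf).comp (measurable_pi_apply i)

lemma lowerSemicontinuous_tsum_ext₁ {f : E d → ℝ≥0∞} (hf : LowerSemicontinuous f) :
    LowerSemicontinuous fun u : Enum d => ∑' i, ext₁ f (u i) :=
  lowerSemicontinuous_tsum fun i => (lowerSemicontinuous_ext₁ hf).comp (continuous_apply i)

lemma lowerSemicontinuous_indicator_ball (r : ℝ) :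
    LowerSemicontinuous ((Metric.ball (0 : E d) r).indicator fun _ => (1 : ℝ≥0∞)) :=
  Metric.isOpen_ball.lowerSemicontinuous_indicator zero_le_one

lemma mem_locFin_of_tsum_ne_top {u : Enum d}
    (h : ∀ k : ℕ, ∑' i, ext₁ ((Metric.ball (0 : E d) ((k : ℝ) + 1)).indicator fun _ => (1 : ℝ≥0∞))
      (u i) ≠ ∞) : u ∈ Enum.LocFin := fun k => by
  refine (ENNReal.finite_const_le_of_tsum_ne_top (h k) one_ne_zero).subset ?_
  rintro i ⟨p, hp, hpi⟩
  rw [mem_ofPred_eq, ← hpi, ext₁_site, indicator_of_mem]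
  exact Metric.closedBall_subset_ball (by linarith) hp

section

variable {Ω : Set (E d)} {z : Site d} {M : ℕ → ℕ} {X : ∀ n, Fin (M n) → Ω}
  {κ : Kernel Ω (Enum d)}

lemma measurable_meanCount [IsMarkovKernel κ] {f : E d → ℝ≥0∞} (hf : Measurable f) :
    Measurable (meanCount κ f) :=
  (measurable_tsum_ext₁ hf).lintegral_kernel

variable (hd : 1 ≤ d) (hz : z ∉ range (site : E d → Site d)) (hM : ∀ n, 1 ≤ M n)
  (hκ : IsYoungLimit (fun n (x : Ω) => enumTuple z (blowUp (fun i => (X n i : E d)) x)) κ)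

include hd hz hM hκ

/-- No mass is created in the limit: summing over the points of a system, the mean number of
points seen in a window is at most the volume of the window. -/
lemma lintegral_meanCount_le (hΩ : MeasurableSet Ω) {f : E d → ℝ≥0∞}
    (hf : LowerSemicontinuous f) : ∫⁻ x, meanCount κ f x ∂leb Ω ≤ ∫⁻ x, f x := by
  refine (hκ (fun w => ∑' i, ext₁ f (w.2 i))
    ((lowerSemicontinuous_tsum_ext₁ hf).comp continuous_snd)).trans ?_
  refine liminf_le_of_frequently_le' (Frequently.of_forall fun n => ?_)
  simp_rw [tsum_enumTuple hz]
  refine (lintegral_leb_le hΩ fun x => ∑ i, f (blowUp (fun i => (X n i : E d)) x i)).trans ?_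
  rw [lintegral_sum_blowUp hd (hM n) _ hf.measurable]

/-- The random enumerations obtained in the limit are locally finite, as they have finitely many
points in each ball on average. -/
lemma ae_mem_locFin (hΩ : MeasurableSet Ω) [IsMarkovKernel κ] :
    ∀ᵐ x ∂leb Ω, (∀ r : ℝ, meanCount κ ((Metric.ball (0 : E d) r).indicator fun _ => 1) x < ∞) ∧
      ∀ᵐ u ∂κ x, u ∈ Enum.LocFin := by
  have hm : ∀ r : ℝ, Measurable ((Metric.ball (0 : E d) r).indicator fun _ => (1 : ℝ≥0∞)) :=
    fun r => measurable_const.indicator measurableSet_ball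
  have h1 : ∀ k : ℕ, ∀ᵐ x ∂leb Ω,
      meanCount κ ((Metric.ball (0 : E d) ((k : ℝ) + 1)).indicator fun _ => 1) x < ∞ := fun k => by
    refine ae_lt_top (measurable_meanCount (hm _)) (ne_of_lt ?_)
    refine (lintegral_meanCount_le hd hz hM hκ hΩ (lowerSemicontinuous_indicator_ball _)).trans_lt ?_
    rw [lintegral_indicator_const measurableSet_ball, one_mul]
    exact measure_ball_lt_top
  filter_upwards [ae_all_iff.2 h1] with x hx
  refine ⟨fun r => ?_, ?_⟩
  · obtain ⟨k, hk⟩ := exists_nat_ge r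
    refine lt_of_le_of_lt ?_ (hx k)
    refine lintegral_mono fun u => ENNReal.tsum_le_tsum fun i => ?_
    by_cases h : u i ∈ range (site (d := d))
    · obtain ⟨p, hp⟩ := h
      rw [← hp, ext₁_site, ext₁_site]
      exact indicator_le_indicator_of_subset (Metric.ball_subset_ball (by linarith))
        (fun _ => zero_le) p
    · rw [ext₁_of_notMem _ h, ext₁_of_notMem _ h]
  · have h2 : ∀ k : ℕ, ∀ᵐ u ∂κ x, ∑' i, ext₁ ((Metric.ball (0 : E d) ((k : ℝ) + 1)).indicator
        fun _ => (1 : ℝ≥0∞)) (u i) < ∞ := fun k =>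
      ae_lt_top (measurable_tsum_ext₁ (hm _)) (hx k).ne
    filter_upwards [ae_all_iff.2 h2] with u hu
    exact mem_locFin_of_tsum_ne_top fun k => (hu k).ne

omit hz hM hκ in
lemma lintegral_map_toConfig {x : Ω} (hx : ∀ᵐ u ∂κ x, u ∈ Enum.LocFin)
    {f : E d → ℝ≥0∞} (hf : Measurable f) :
    ∫⁻ C, (∫⁻ p, f p ∂C.toMeasure) ∂(κ.map Enum.toConfig x) = meanCount κ f x := by
  rw [Kernel.map_apply _ Enum.measurable_toConfig,
    lintegral_map (Config.measurable_lintegral hd hf) Enum.measurable_toConfig]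
  refine lintegral_congr_ae ?_
  filter_upwards [hx] with u hu
  exact Enum.lintegral_toConfig hu f

omit hd hz hM hκ in
lemma isOpen_openCube (R : ℝ) : IsOpen {x : E d | ∀ i, |x i| < R / 2} := by
  simp only [ofPred_forall]
  exact isOpen_iInter_of_finite fun i => isOpen_lt (by fun_prop) continuous_const

/-- The mean interaction of the limit in a cube is at most the energy per particle. -/
lemma lintegral_interaction_le (hΩ : MeasurableSet Ω) [IsMarkovKernel κ] {L : ℝ≥0∞} {s : ℝ}
    (hL : L ≠ ∞)
    (hLe : liminf (fun n => ((M n : ℝ≥0∞) ^ (1 + s / d))⁻¹ *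
      rieszEnergy s (fun i => (X n i : E d))) atTop ≤ L) {R : ℝ} (hR : 0 ≤ R) :
    ∫⁻ x, (∫⁻ C, C.interaction s (cube d R) ∂(κ.map Enum.toConfig x)) ∂leb Ω ≤
      ENNReal.ofReal (R ^ d) * L := by
  classical
  have h1 : ∀ R' : ℝ, R < R' →
      ∫⁻ x, (∫⁻ C, C.interaction s (cube d R) ∂(κ.map Enum.toConfig x)) ∂leb Ω ≤
      ENNReal.ofReal (R' ^ d) * L := fun R' hR' => by
    -- lower semicontinuity requires an open window: a slightly larger open cube
    set A : Set (E d) := {x | ∀ i, |x i| < R' / 2} with hA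
    have hAo : IsOpen A := isOpen_openCube R'
    have hAsub : cube d R ⊆ A := fun x hx i => (hx i).trans_lt (by linarith)
    have hAcube : A ⊆ cube d R' := fun x hx i => (hx i).le
    let G : Ω × Enum d → ℝ≥0∞ := fun w =>
      ∑' i, ∑' j, if i = j then 0 else ext₂ (cutKernel s A) (w.2 i, w.2 j)
    have hG : LowerSemicontinuous G := by
      refine lowerSemicontinuous_tsum fun i => lowerSemicontinuous_tsum fun j => ?_
      split_ifs
      · exact lowerSemicontinuous_const
      · refine (lowerSemicontinuous_ext₂ (lowerSemicontinuous_cutKernel s hAo)).comp ?_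
        fun_prop
    have h2 : ∀ x : Ω, ∫⁻ C, C.interaction s (cube d R) ∂(κ.map Enum.toConfig x) ≤
        ∫⁻ u, G (x, u) ∂κ x := fun x => by
      rw [Kernel.map_apply _ Enum.measurable_toConfig, lintegral_map
        (Config.measurable_interaction hd s (measurableSet_cube R)) Enum.measurable_toConfig]
      exact lintegral_mono fun u =>
        (Config.interaction_mono s _ hAsub).trans (Enum.interaction_toConfig_le u s A)
    have h3 : ∀ n, ∫⁻ x : Ω, G (x, enumTuple z (blowUp (fun i => (X n i : E d)) x)) ∂leb Ω ≤
        ENNReal.ofReal (R' ^ d) * (((M n : ℝ≥0∞) ^ (1 + s / d))⁻¹ *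
          rieszEnergy s (fun i => (X n i : E d))) := fun n => by
      simp only [G, tsum_tsum_enumTuple hz]
      refine (lintegral_leb_le hΩ fun x => ∑ i, ∑ j, if i = j then 0 else
        cutKernel s A (blowUp (fun i => (X n i : E d)) x i)
          (blowUp (fun i => (X n i : E d)) x j)).trans ?_
      refine (lintegral_interaction_blowUp_le hd (hM n) _ hAo.measurableSet).trans ?_
      rw [mul_assoc, ← volume_cube (d := d) (hR.trans hR'.le)]
      gcongr
    refine (lintegral_mono h2).trans ((hκ G hG).trans ?_)
    refine (liminf_le_liminf (Eventually.of_forall h3)).trans ?_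
    rw [ENNReal.liminf_const_mul_of_ne_top ENNReal.ofReal_ne_top]
    gcongr
  have h2 : Tendsto (fun R' : ℝ => ENNReal.ofReal (R' ^ d) * L) (𝓝[>] R)
      (𝓝 (ENNReal.ofReal (R ^ d) * L)) := by
    have h3 : Continuous fun R' : ℝ => ENNReal.ofReal (R' ^ d) :=
      ENNReal.continuous_ofReal.comp (continuous_pow d)
    exact ENNReal.Tendsto.mul_const ((h3.tendsto R).mono_left nhdsWithin_le_nhds) (Or.inr hL)
  exact ge_of_tendsto h2 (eventually_nhdsWithin_of_forall h1)

/-- The energy of the limit is at most the energy per particle. -/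
lemma lintegral_processEnergy_le (hΩ : MeasurableSet Ω) [IsMarkovKernel κ] {L : ℝ≥0∞} {s : ℝ}
    (hL : L ≠ ∞)
    (hLe : liminf (fun n => ((M n : ℝ≥0∞) ^ (1 + s / d))⁻¹ *
      rieszEnergy s (fun i => (X n i : E d))) atTop ≤ L) :
    ∫⁻ x, processEnergy s (κ.map Enum.toConfig x) ∂leb Ω ≤ L := by
  have hm : ∀ n : ℕ, Measurable fun x => (∫⁻ C, C.interaction s (cube d n) ∂(κ.map Enum.toConfig x)) :=
    fun n => (Config.measurable_interaction hd s (measurableSet_cube n)).lintegral_kernel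
  simp_rw [processEnergy_eq]
  -- Fatou
  refine (lintegral_liminf_le fun n => (hm n).div_const _).trans ?_
  refine liminf_le_of_frequently_le' (Eventually.frequently ?_)
  filter_upwards [eventually_ge_atTop 1] with n hn
  have hn0 : 0 < (n : ℝ) ^ d := by
    have : (0 : ℝ) < n := by exact_mod_cast hn
    positivity
  simp_rw [div_eq_mul_inv]
  rw [lintegral_mul_const _ (hm n), ← div_eq_mul_inv]
  refine ENNReal.div_le_of_le_mul ?_
  rw [mul_comm]
  exact lintegral_interaction_le hd hz hM hκ hΩ hL hLe (Nat.cast_nonneg n)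

end


section

variable {Ω : Set (E d)}

/-- The largest `k`-Lipschitz function on the whole space that lies below `V` on `Ω`. -/
def lipschitzMinorant (V : Ω → ℝ) (k : ℕ) (x : E d) : ℝ≥0∞ :=
  ⨅ y : Ω, (ENNReal.ofReal (V y) + k * edist x y)

lemma lipschitzMinorant_le (V : Ω → ℝ) (k : ℕ) (x : Ω) :
    lipschitzMinorant V k x ≤ ENNReal.ofReal (V x) :=
  (iInf_le _ x).trans (by simp)

lemma lipschitzMinorant_le_add (V : Ω → ℝ) (k : ℕ) (x x' : E d) :
    lipschitzMinorant V k x ≤ lipschitzMinorant V k x' + k * edist x x' := by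
  unfold lipschitzMinorant
  rw [ENNReal.iInf_add]
  refine le_iInf fun y => (iInf_le _ y).trans ?_
  rw [add_assoc, ← mul_add]
  gcongr
  rw [add_comm]
  exact edist_triangle _ _ _

lemma continuous_lipschitzMinorant (V : Ω → ℝ) (k : ℕ) : Continuous (lipschitzMinorant V k) :=
  continuous_of_le_add_edist k (ENNReal.natCast_ne_top k) (lipschitzMinorant_le_add V k)

lemma lipschitzMinorant_mono (V : Ω → ℝ) (x : E d) : Monotone fun k => lipschitzMinorant V k x :=
  fun k l h => iInf_mono fun y => by gcongr

/-- A nonnegative continuous function is the supremum of its Lipschitz minorants. -/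
lemma iSup_lipschitzMinorant {V : Ω → ℝ} (hV : Continuous V) (x : Ω) :
    ⨆ k, lipschitzMinorant V k x = ENNReal.ofReal (V x) := by
  refine le_antisymm (iSup_le fun k => lipschitzMinorant_le V k x) (le_of_forall_lt fun c hc => ?_)
  obtain ⟨c', hcc', hc'⟩ := exists_between hc
  refine hcc'.trans_le ?_
  have h1 := (ENNReal.continuous_ofReal.comp hV).continuousAt.eventually (lt_mem_nhds hc')
  obtain ⟨δ, hδ, hball⟩ := EMetric.mem_nhds_iff.1 h1
  obtain ⟨k, hk⟩ := ENNReal.exists_nat_gt (r := c' / δ)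
    (ENNReal.div_ne_top (hc'.trans ENNReal.ofReal_lt_top).ne hδ.ne')
  refine le_iSup_of_le k (le_iInf fun y => ?_)
  rcases lt_or_ge (edist y x) δ with h | h
  · exact (hball h).le.trans le_self_add
  · refine le_add_left ?_
    calc c' ≤ (c' / δ) * δ := by
          rcases eq_or_ne δ ∞ with hδt | hδt
          · rw [hδt, top_le_iff] at h
            exact absurd h (edist_ne_top _ _)
          · rw [ENNReal.div_mul_cancel hδ.ne' hδt]
      _ ≤ k * edist (x : E d) y := by
          rw [edist_comm]
          exact mul_le_mul' hk.le h

variable {z : Site d} {M : ℕ → ℕ} {X : ∀ n, Fin (M n) → Ω} {κ : Kernel Ω (Enum d)}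

lemma dist_le_of_norm_blowUp_le {N : ℕ} (hN : 1 ≤ N) {X : Fin N → E d} {x : E d} {i : Fin N} {r : ℝ}
    (h : ‖blowUp X x i‖ ≤ r) : dist x (X i) ≤ r / (N : ℝ) ^ (1 / d : ℝ) := by
  rw [le_div_iff₀ (scale_pos hN), dist_comm, dist_eq_norm]
  rwa [blowUp, ← smul_sub, norm_smul, Real.norm_of_nonneg (scale_pos hN).le, mul_comm] at h

/-- The points seen from `x` in a bounded window are at distance `O(N^{-1/d})` from `x`, so a
Lipschitz function has almost the same value there as at `x`. -/
lemma lintegral_lipschitzMinorant_mul_sum_le (hd : 1 ≤ d) {N : ℕ} (hN : 1 ≤ N) (X : Fin N → Ω)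
    (V : Ω → ℝ) (k : ℕ) {f : E d → ℝ≥0∞} (hf : Measurable f) {r : ℝ}
    (hr : ∀ p, f p ≠ 0 → ‖p‖ ≤ r) :
    ∫⁻ x, lipschitzMinorant V k x * ∑ i, f (blowUp (fun i => (X i : E d)) x i) ≤
      ((N : ℝ≥0∞)⁻¹ * ∑ i, ENNReal.ofReal (V (X i)) +
        k * ENNReal.ofReal (r / (N : ℝ) ^ (1 / d : ℝ))) * ∫⁻ p, f p := by
  set δ : ℝ≥0∞ := ENNReal.ofReal (r / (N : ℝ) ^ (1 / d : ℝ)) with hδ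
  set Y : Fin N → E d := fun i => X i with hY
  have hm : ∀ i, Measurable fun x => f (blowUp Y x i) := fun i =>
    hf.comp (measurable_pi_iff.1 (measurable_blowUp _) i)
  have hN0 : (N : ℝ≥0∞) ≠ 0 := by exact_mod_cast (by omega : N ≠ 0)
  calc _ ≤ ∫⁻ x, ∑ i, (ENNReal.ofReal (V (X i)) + k * δ) * f (blowUp Y x i) := by
        refine lintegral_mono fun x => ?_
        rw [Finset.mul_sum]
        refine Finset.sum_le_sum fun i _ => ?_
        rcases eq_or_ne (f (blowUp Y x i)) 0 with h | h
        · rw [h, mul_zero]; exact zero_le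
        · refine mul_le_mul_left ?_ _
          refine (lipschitzMinorant_le_add V k x (X i)).trans ?_
          refine add_le_add (lipschitzMinorant_le V k _) ?_
          rw [edist_dist]
          exact mul_le_mul_right
            (ENNReal.ofReal_le_ofReal (dist_le_of_norm_blowUp_le hN (hr _ h))) _
    _ = ∑ i, (ENNReal.ofReal (V (X i)) + k * δ) * ((N : ℝ≥0∞)⁻¹ * ∫⁻ p, f p) := by
        rw [lintegral_finsetSum _ fun i _ => (hm i).const_mul _]
        refine Finset.sum_congr rfl fun i _ => ?_
        rw [lintegral_const_mul _ (hm i), lintegral_blowUp hd hN _ hf i]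
    _ = ((∑ i, ENNReal.ofReal (V (X i))) + N * (k * δ)) * ((N : ℝ≥0∞)⁻¹ * ∫⁻ p, f p) := by
        rw [← Finset.sum_mul, Finset.sum_add_distrib, Finset.sum_const, Finset.card_univ,
          Fintype.card_fin, nsmul_eq_mul]
    _ = _ := by
        rw [← mul_assoc]
        congr 1
        rw [add_mul, mul_comm (N : ℝ≥0∞), mul_assoc (k * δ),
          ENNReal.mul_inv_cancel hN0 (ENNReal.natCast_ne_top _), mul_one, mul_comm (N : ℝ≥0∞)⁻¹]

variable (hd : 1 ≤ d) (hz : z ∉ range (site : E d → Site d)) (hM : ∀ n, 1 ≤ M n)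
  (hκ : IsYoungLimit (fun n (x : Ω) => enumTuple z (blowUp (fun i => (X n i : E d)) x)) κ)

include hd hz hM hκ

/-- The potential energy of the limit is at most the potential energy per particle. -/
lemma lintegral_mul_meanCount_le (hΩ : MeasurableSet Ω) (hΩ0 : Nonempty Ω) [IsMarkovKernel κ]
    (hMt : Tendsto M atTop atTop)
    {V : Ω → ℝ} (hV : Continuous V) {L : ℝ≥0∞}
    (hL : liminf (fun n => (M n : ℝ≥0∞)⁻¹ * ∑ i, ENNReal.ofReal (V (X n i))) atTop ≤ L)
    {f : E d → ℝ≥0∞} (hf : LowerSemicontinuous f) {r : ℝ}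
    (hr : ∀ p, f p ≠ 0 → ‖p‖ ≤ r) (hf0 : ∫⁻ p, f p ≠ 0) (hft : ∫⁻ p, f p ≠ ∞) :
    ∫⁻ x, ENNReal.ofReal (V x) * meanCount κ f x ∂leb Ω ≤ L * ∫⁻ p, f p := by
  have hmc : Measurable (meanCount κ f) := measurable_meanCount hf.measurable
  have hlm : ∀ k, Measurable fun x : Ω => lipschitzMinorant V k x := fun k =>
    ((continuous_lipschitzMinorant V k).comp continuous_subtype_val).measurable
  -- the claim for Lipschitz minorants of `V`, which are defined on the whole space; then monotone
  -- convergence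
  have key : ∀ k, ∫⁻ x : Ω, lipschitzMinorant V k x * meanCount κ f x ∂leb Ω ≤ L * ∫⁻ p, f p := by
    intro k
    have hne : ∀ x : E d, lipschitzMinorant V k x ≠ ∞ := fun x =>
      ne_top_of_le_ne_top (b := ENNReal.ofReal (V hΩ0.some) + k * edist x hΩ0.some)
        (by finiteness [edist_ne_top x (hΩ0.some : E d)]) (iInf_le _ hΩ0.some)
    let G : Ω × Enum d → ℝ≥0∞ := fun w =>
      lipschitzMinorant V k w.1 * ∑' i, ext₁ f (w.2 i)
    have hG : LowerSemicontinuous G := lowerSemicontinuous_mul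
      ((continuous_lipschitzMinorant V k).comp (continuous_subtype_val.comp continuous_fst))
      (fun w => hne _) ((lowerSemicontinuous_tsum_ext₁ hf).comp continuous_snd)
    have h1 : ∫⁻ x : Ω, lipschitzMinorant V k x * meanCount κ f x ∂leb Ω =
        ∫⁻ x, ∫⁻ u, G (x, u) ∂κ x ∂leb Ω := lintegral_congr fun x =>
      (lintegral_const_mul _ (measurable_tsum_ext₁ hf.measurable)).symm
    set δ : ℕ → ℝ≥0∞ := fun n => ENNReal.ofReal (r / (M n : ℝ) ^ (1 / d : ℝ)) with hδ
    have h2 : ∀ n, ∫⁻ x : Ω, G (x, enumTuple z (blowUp (fun i => (X n i : E d)) x)) ∂leb Ω ≤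
        ((M n : ℝ≥0∞)⁻¹ * ∑ i, ENNReal.ofReal (V (X n i)) + k * δ n) * ∫⁻ p, f p := fun n => by
      simp only [G, tsum_enumTuple hz]
      refine (lintegral_leb_le hΩ fun x => lipschitzMinorant V k x *
        ∑ i, f (blowUp (fun i => (X n i : E d)) x i)).trans ?_
      exact lintegral_lipschitzMinorant_mul_sum_le hd (hM n) (X n) V k hf.measurable hr
    have hδ0 : Tendsto (fun n => k * δ n) atTop (𝓝 0) := by
      have h3 : Tendsto (fun n => r / (M n : ℝ) ^ (1 / d : ℝ)) atTop (𝓝 0) :=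
        tendsto_const_nhds.div_atTop ((tendsto_rpow_atTop (by positivity)).comp
          (tendsto_natCast_atTop_atTop.comp hMt))
      have h4 := ENNReal.tendsto_ofReal h3
      rw [ENNReal.ofReal_zero] at h4
      have h5 := ENNReal.Tendsto.const_mul (a := (k : ℝ≥0∞)) h4 (Or.inr (ENNReal.natCast_ne_top k))
      rwa [mul_zero] at h5
    rw [h1]
    refine (hκ G hG).trans ?_
    rw [← ENNReal.div_le_iff hf0 hft]
    refine le_of_forall_gt fun c hc => ?_
    obtain ⟨c₁, hc₁, hc₁'⟩ := exists_between hc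
    obtain ⟨c₂, hc₂, hc₂'⟩ := exists_between hc₁'
    refine lt_of_le_of_lt ?_ hc₂'
    rw [ENNReal.div_le_iff hf0 hft]
    have h3 : ∃ᶠ n in atTop, (M n : ℝ≥0∞)⁻¹ * ∑ i, ENNReal.ofReal (V (X n i)) < c₁ :=
      frequently_lt_of_liminf_lt (by isBoundedDefault) (hL.trans_lt hc₁)
    have h4 : ∀ᶠ n in atTop, k * δ n < c₂ - c₁ :=
      hδ0.eventually (gt_mem_nhds (tsub_pos_of_lt hc₂))
    refine liminf_le_of_frequently_le' ((h3.and_eventually h4).mono fun n hn => (h2 n).trans ?_)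
    gcongr
    calc _ ≤ c₁ + (c₂ - c₁) := add_le_add hn.1.le hn.2.le
      _ = c₂ := add_tsub_cancel_of_le hc₂.le
  have h : ∀ x : Ω, ENNReal.ofReal (V x) * meanCount κ f x =
      ⨆ k, lipschitzMinorant V k x * meanCount κ f x := fun x => by
    rw [← ENNReal.iSup_mul, iSup_lipschitzMinorant hV]
  simp_rw [h]
  have hmk : ∀ k : ℕ, Measurable fun x : Ω => lipschitzMinorant V k x * meanCount κ f x :=
    fun k => (hlm k).mul hmc
  rw [lintegral_iSup hmk fun k l hkl x => by
    dsimp only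
    gcongr
    exact lipschitzMinorant_mono V _ hkl]
  exact iSup_le key

end


section

variable {Ω : Set (E d)}

open Classical in
/-- Count of the points seen near `x`: up to the excess beyond the index `T`, all the points are
among the first `T` ones, unless `x` lies outside of `Ω` but close to it, or far away, where the
points have a large potential. -/
lemma sum_blowUp_le {z : Site d} (hz : z ∉ range (site : E d → Site d)) {N : ℕ} (hN : 1 ≤ N)
    (X : Fin N → Ω) {V : Ω → ℝ} {A k r : ℝ} (hr0 : 0 ≤ r)
    (hA : ∀ x : Ω, k < ‖(x : E d)‖ → A ≤ V x) {f : E d → ℝ≥0∞}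
    (hf : ∀ p, f p ≤ (Metric.closedBall 0 r).indicator 1 p) (T : ℕ) (x : E d) :
    ∑ i, f (blowUp (fun i => (X i : E d)) x i) ≤
      (Ω.indicator (fun x => ENNReal.ofReal (Config.bump (k + r) x) *
        ∑ i ∈ Finset.range T, ext₁ f (enumTuple z (blowUp (fun i => (X i : E d)) x) i)) x +
      T * ((Metric.closedBall (0 : E d) (k + r) \ Ω) ∩
        Metric.cthickening (r / (N : ℝ) ^ (1 / d : ℝ)) Ω).indicator 1 x) +
      excess r T (enumTuple z (blowUp (fun i => (X i : E d)) x)) +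
      ∑ i, (if A ≤ V (X i) then 1 else 0) * f (blowUp (fun i => (X i : E d)) x i) := by
  have hf1 : ∀ p, f p ≠ 0 → ‖p‖ ≤ r := fun p hp => by
    by_contra h
    have := hf p
    rw [indicator_of_notMem (by simpa using h)] at this
    exact hp (le_antisymm this zero_le)
  have hfle : ∀ v, ext₁ f v ≤ 1 := fun v => by
    by_cases h : v ∈ range (site (d := d))
    · obtain ⟨p, rfl⟩ := h
      rw [ext₁_site]
      refine (hf p).trans (indicator_le_self' (fun _ _ => zero_le) p)
    · rw [ext₁_of_notMem _ h]; exact zero_le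
  have hS : ∑ i, f (blowUp (fun i => (X i : E d)) x i) ≤
      ∑ i ∈ Finset.range T, ext₁ f (enumTuple z (blowUp (fun i => (X i : E d)) x) i) +
        excess r T (enumTuple z (blowUp (fun i => (X i : E d)) x)) := by
    rw [← tsum_enumTuple hz]
    exact tsum_le_sum_add_excess hf T _
  -- far away, the points seen from `x` are themselves far away
  rcases lt_or_ge (k + r) ‖x‖ with hx | hx
  · refine le_add_left (Finset.sum_le_sum fun i _ => ?_)
    rcases eq_or_ne (f (blowUp (fun i => (X i : E d)) x i)) 0 with h | h
    · rw [h]; exact zero_le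
    · have h1 := dist_le_of_norm_blowUp_le hN (hf1 _ h)
      have h2 : (1 : ℝ) ≤ (N : ℝ) ^ (1 / d : ℝ) :=
        Real.one_le_rpow (by exact_mod_cast hN) (by positivity)
      have h3 : dist x (X i) ≤ r := h1.trans (div_le_self hr0 h2)
      have h4 : k < ‖(X i : E d)‖ := by
        rw [dist_eq_norm] at h3
        have := norm_add_le (x - X i) (X i : E d)
        rw [sub_add_cancel] at this
        linarith
      rw [if_pos (hA _ h4), one_mul]
  · refine le_add_right ?_
    by_cases hxΩ : x ∈ Ω
    · rw [indicator_of_mem hxΩ, Config.bump_eq_one hx, ENNReal.ofReal_one, one_mul]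
      refine hS.trans ?_
      gcongr
      exact le_self_add
    · by_cases hxt : x ∈ Metric.cthickening (r / (N : ℝ) ^ (1 / d : ℝ)) Ω
      · have h1 : x ∈ (Metric.closedBall (0 : E d) (k + r) \ Ω) ∩
            Metric.cthickening (r / (N : ℝ) ^ (1 / d : ℝ)) Ω := ⟨⟨by simpa using hx, hxΩ⟩, hxt⟩
        rw [indicator_of_mem h1]
        refine hS.trans ?_
        gcongr
        refine le_add_left ?_
        refine (Finset.sum_le_sum fun i _ => hfle _).trans ?_
        simp
      · refine (Finset.sum_eq_zero fun i _ => ?_).trans_le zero_le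
        by_contra h
        have h1 := dist_le_of_norm_blowUp_le hN (hf1 _ h)
        exact hxt (Metric.mem_cthickening_of_dist_le x (X i) _ _ (X i).2 h1)

/-- The points outside of `Ω` from which some point of the system can be seen occupy a vanishing
volume in each ball. -/
lemma tendsto_volume_inter_cthickening (hΩ : IsClosed Ω) (K r : ℝ) (hd : 1 ≤ d) {M : ℕ → ℕ}
    (hMt : Tendsto M atTop atTop) :
    Tendsto (fun n => volume ((Metric.closedBall (0 : E d) K \ Ω) ∩
      Metric.cthickening (r / (M n : ℝ) ^ (1 / d : ℝ)) Ω)) atTop (𝓝 0) := by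
  set μ : Measure (E d) := volume.restrict (Metric.closedBall (0 : E d) K \ Ω) with hμ
  have hfin : μ univ < ∞ := by
    rw [hμ, Measure.restrict_apply_univ]
    exact (measure_mono sdiff_subset).trans_lt (isCompact_closedBall _ _).measure_lt_top
  have h0 : μ Ω = 0 := by
    rw [hμ, Measure.restrict_apply hΩ.measurableSet, inter_sdiff_self, measure_empty]
  have h1 := tendsto_measure_cthickening_of_isClosed (μ := μ) (s := Ω)
    ⟨1, one_pos, ((measure_mono (subset_univ _)).trans_lt hfin).ne⟩ hΩ
  have h2 : Tendsto (fun n => r / (M n : ℝ) ^ (1 / d : ℝ)) atTop (𝓝 0) :=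
    tendsto_const_nhds.div_atTop ((tendsto_rpow_atTop (by positivity)).comp
      (tendsto_natCast_atTop_atTop.comp hMt))
  rw [h0] at h1
  refine (h1.comp h2).congr fun n => ?_
  simp only [Function.comp, hμ]
  rw [Measure.restrict_apply Metric.isClosed_cthickening.measurableSet, inter_comm]

variable {z : Site d} {M : ℕ → ℕ} {X : ∀ n, Fin (M n) → Ω} {κ : Kernel Ω (Enum d)}

/-- No mass is lost in the limit: points neither accumulate in a window (this would cost energy),
nor escape to infinity (this would cost potential), nor leave `Ω`. -/
lemma le_lintegral_meanCount (hd : 1 ≤ d) (hz : z ∉ range (site : E d → Site d))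
    (hM : ∀ n, 1 ≤ M n)
    (hκ : IsYoungLimit (fun n (x : Ω) => enumTuple z (blowUp (fun i => (X n i : E d)) x)) κ)
    (hΩ : IsClosed Ω) [IsMarkovKernel κ] (hMt : Tendsto M atTop atTop)
    {V : Ω → ℝ} (hconf : Confining V) {s : ℝ} (hs : 0 ≤ s) {B : ℝ≥0∞}
    (hB : B ≠ ∞)
    (hXB : ∀ n, ((M n : ℝ≥0∞) ^ (1 + s / d))⁻¹ * rieszEnergy s (fun i => (X n i : E d)) ≤ B)
    (hVB : ∀ n, (M n : ℝ≥0∞)⁻¹ * ∑ i, ENNReal.ofReal (V (X n i)) ≤ B)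
    {f : E d → ℝ≥0∞} (hf : Continuous f) (hfc : HasCompactSupport f) {r : ℝ} (hr : 0 < r)
    (hf1 : ∀ p, f p ≤ (Metric.closedBall 0 r).indicator 1 p) :
    ∫⁻ p, f p ≤ ∫⁻ x, meanCount κ f x ∂leb Ω := by
  classical
  have hfm := hf.measurable
  set I := ∫⁻ p, f p with hI
  have hIt : I ≠ ∞ := by
    refine ((lintegral_mono hf1).trans_lt ?_).ne
    rw [show ((Metric.closedBall (0 : E d) r).indicator 1 : E d → ℝ≥0∞) =
      (Metric.closedBall (0 : E d) r).indicator (fun _ => 1) from rfl,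
      lintegral_indicator_const measurableSet_closedBall, one_mul]
    exact (isCompact_closedBall _ _).measure_lt_top
  refine ENNReal.le_of_forall_pos_le_add fun ε hε _ => ?_
  set ε' : ℝ≥0∞ := ε / 3 with hε'
  have hε'0 : ε' ≠ 0 := by
    rw [hε']; exact (ENNReal.div_pos (by exact_mod_cast hε.ne') (by norm_num)).ne'
  have hε3 : ε' + ε' + ε' = ε := ENNReal.add_thirds _
  -- points far away
  obtain ⟨A, hA⟩ := ENNReal.exists_nat_gt (r := B * I / ε')
    (ENNReal.div_ne_top (ENNReal.mul_ne_top hB hIt) hε'0)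
  have hA0 : (A : ℝ≥0∞) ≠ 0 := (zero_le.trans_lt hA).ne'
  obtain ⟨k, hk⟩ := hconf.exists_le A
  -- points of large index
  set c : ℝ≥0∞ := ENNReal.ofReal (2 * r) ^ s * volume (Metric.closedBall (0 : E d) r) * B with hc
  have hct : c ≠ ∞ := ENNReal.mul_ne_top (ENNReal.mul_ne_top
    (ENNReal.rpow_ne_top_of_nonneg hs ENNReal.ofReal_ne_top)
    (isCompact_closedBall _ _).measure_lt_top.ne) hB
  obtain ⟨T, hT⟩ := ENNReal.exists_nat_gt (r := c / ε') (ENNReal.div_ne_top hct hε'0)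
  have hT0 : (T : ℝ≥0∞) ≠ 0 := (zero_le.trans_lt hT).ne'
  have hε't : ε' ≠ ∞ := by rw [hε']; exact ENNReal.div_ne_top ENNReal.coe_ne_top (by norm_num)
  -- `S` counts the first `T` points only: it is continuous and at most `T`
  set S : Enum d → ℝ≥0∞ := fun u => ∑ i ∈ Finset.range T, ext₁ f (u i) with hS
  have hScont : Continuous S := continuous_finsetSum _ fun i _ =>
    (continuous_ext₁ hf hfc).comp (continuous_apply i)
  have hST : ∀ u, S u ≤ T := fun u => by
    have : ∀ v, ext₁ f v ≤ 1 := fun v => by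
      by_cases h : v ∈ range (site (d := d))
      · obtain ⟨p, rfl⟩ := h
        rw [ext₁_site]
        exact (hf1 p).trans (indicator_le_self' (fun _ _ => zero_le) p)
      · rw [ext₁_of_notMem _ h]; exact zero_le
    exact (Finset.sum_le_sum fun i _ => this _).trans (by simp)
  set g : Ω → ℝ≥0∞ := fun x => ENNReal.ofReal (Config.bump (k + r) (x : E d)) with hg
  have hgc : Continuous g := ENNReal.continuous_ofReal.comp
    ((Config.continuous_bump _).comp continuous_subtype_val)
  have hg1 : ∀ x, g x ≤ 1 := fun x => by
    rw [hg]
    exact ENNReal.ofReal_le_one.2 (Config.bump_le_one _ _)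
  have hgt : ∫⁻ x, g x ∂leb Ω ≠ ∞ := by
    have h := integrable_leb hΩ.measurableSet
      ((Config.continuous_bump (k + r)).integrable_of_hasCompactSupport
        (Config.hasCompactSupport_bump (k + r)))
    have h2 := h.lintegral_lt_top
    exact h2.ne
  have hUm : ∀ n, Measurable fun x : Ω => enumTuple z (blowUp (fun i => (X n i : E d)) x) :=
    fun n => (measurable_enumTuple_blowUp z _).comp measurable_subtype_coe
  -- the mass of the approximations
  have hlow : ∀ᶠ n in atTop, I ≤ ∫⁻ x : Ω, g x *
      S (enumTuple z (blowUp (fun i => (X n i : E d)) x)) ∂leb Ω + ε := by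
    have h1 : ∀ᶠ n in atTop, (T : ℝ≥0∞) * volume ((Metric.closedBall (0 : E d) (k + r) \ Ω) ∩
        Metric.cthickening (r / (M n : ℝ) ^ (1 / d : ℝ)) Ω) ≤ ε' := by
      have h2 := ENNReal.Tendsto.const_mul (a := (T : ℝ≥0∞))
        (tendsto_volume_inter_cthickening hΩ (k + r) r hd hMt) (Or.inr (ENNReal.natCast_ne_top T))
      rw [mul_zero] at h2
      exact (h2.eventually (gt_mem_nhds (pos_iff_ne_zero.2 hε'0))).mono fun _ h => h.le
    filter_upwards [h1] with n hn
    have hm : ∀ i, Measurable fun x => f (blowUp (fun i => (X n i : E d)) x i) := fun i =>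
      hfm.comp (measurable_pi_iff.1 (measurable_blowUp _) i)
    set F₁ : E d → ℝ≥0∞ := fun x => Ω.indicator (fun x =>
        ENNReal.ofReal (Config.bump (k + r) x) *
          S (enumTuple z (blowUp (fun i => (X n i : E d)) x))) x with hF₁
    set D : Set (E d) := (Metric.closedBall (0 : E d) (k + r) \ Ω) ∩
        Metric.cthickening (r / (M n : ℝ) ^ (1 / d : ℝ)) Ω with hD
    set F₂ : E d → ℝ≥0∞ := fun x => (T : ℝ≥0∞) * D.indicator 1 x with hF₂
    set F₃ : E d → ℝ≥0∞ := fun x =>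
        excess r T (enumTuple z (blowUp (fun i => (X n i : E d)) x)) with hF₃
    set F₄ : E d → ℝ≥0∞ := fun x => ∑ i, (if (A : ℝ) ≤ V (X n i) then 1 else 0) *
        f (blowUp (fun i => (X n i : E d)) x i) with hF₄
    have hm1 : Measurable F₁ :=
      (((Config.continuous_bump _).measurable.ennreal_ofReal).mul
        (hScont.measurable.comp (measurable_enumTuple_blowUp z _))).indicator hΩ.measurableSet
    have hDm : MeasurableSet D :=
      (measurableSet_closedBall.diff hΩ.measurableSet).inter
        Metric.isClosed_cthickening.measurableSet
    have hm2 : Measurable F₂ :=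
      (measurable_one.indicator hDm).const_mul _
    have hm3 : Measurable F₃ :=
      (measurable_excess r T).comp (measurable_enumTuple_blowUp z _)
    have e1 : ∫⁻ x, F₁ x =
        ∫⁻ x : Ω, g x * S (enumTuple z (blowUp (fun i => (X n i : E d)) x)) ∂leb Ω := by
      rw [hF₁, lintegral_indicator hΩ.measurableSet]
      exact (lintegral_leb hΩ.measurableSet fun x => ENNReal.ofReal (Config.bump (k + r) x) *
          S (enumTuple z (blowUp (fun i => (X n i : E d)) x))).symm
    have e2 : ∫⁻ x, F₃ x ≤ ε' := by
      have h2 := mul_lintegral_excess_le hd hz hs (hM n) (fun i => (X n i : E d)) hr T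
      have h3 : (T : ℝ≥0∞) * ∫⁻ x, excess r T (enumTuple z (blowUp (fun i => (X n i : E d)) x)) ≤
          T * ε' := by
        refine h2.trans (le_trans (b := c) ?_ ?_)
        · rw [hc]
          exact mul_le_mul_right (hXB n) _
        · exact ((ENNReal.div_lt_iff (Or.inl hε'0) (Or.inl hε't)).1 hT).le
      exact (ENNReal.mul_le_mul_iff_right hT0 (ENNReal.natCast_ne_top T)).1 h3
    have e3 : ∫⁻ x, F₄ x ≤ ε' := by
      rw [hF₄, lintegral_finsetSum _ fun i _ => (hm i).const_mul _]
      have h2 : ∀ i, ∫⁻ x : E d, (if (A : ℝ) ≤ V (X n i) then 1 else 0) *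
          f (blowUp (fun i => (X n i : E d)) x i) ≤
          (A : ℝ≥0∞)⁻¹ * I * ((M n : ℝ≥0∞)⁻¹ * ENNReal.ofReal (V (X n i))) := fun i => by
        rw [lintegral_const_mul _ (hm i), lintegral_blowUp hd (hM n) _ hfm]
        split_ifs with h
        · rw [one_mul]
          have h3 : (1 : ℝ≥0∞) ≤ (A : ℝ≥0∞)⁻¹ * ENNReal.ofReal (V (X n i)) := by
            rw [← ENNReal.inv_mul_cancel hA0 (ENNReal.natCast_ne_top A)]
            gcongr
            rw [← ENNReal.ofReal_natCast]
            exact ENNReal.ofReal_le_ofReal h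
          calc (M n : ℝ≥0∞)⁻¹ * I ≤ (M n : ℝ≥0∞)⁻¹ * I *
                ((A : ℝ≥0∞)⁻¹ * ENNReal.ofReal (V (X n i))) := le_mul_of_one_le_right' h3
            _ = _ := by ring
        · rw [zero_mul]; exact zero_le
      refine (Finset.sum_le_sum fun i _ => h2 i).trans ?_
      rw [← Finset.mul_sum, ← Finset.mul_sum]
      refine (mul_le_mul_right (hVB n) _).trans ?_
      rw [mul_assoc, mul_comm, mul_comm I, ← div_eq_mul_inv]
      refine ENNReal.div_le_of_le_mul ?_
      rw [mul_comm ε']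
      exact ((ENNReal.div_lt_iff (Or.inl hε'0) (Or.inl hε't)).1 hA).le
    calc I = ∫⁻ x, ∑ i, f (blowUp (fun i => (X n i : E d)) x i) :=
          (lintegral_sum_blowUp hd (hM n) _ hfm).symm
      _ ≤ ∫⁻ x, (F₁ x + F₂ x + F₃ x + F₄ x) :=
          lintegral_mono fun x => sum_blowUp_le hz (hM n) (X n) hr.le hk hf1 T x
      _ = (∫⁻ x, F₁ x) + T * volume D + (∫⁻ x, F₃ x) + ∫⁻ x, F₄ x := by
          have h2 := lintegral_add_left (μ := volume) ((hm1.add hm2).add hm3) F₄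
          have h3 := lintegral_add_left (μ := volume) (hm1.add hm2) F₃
          have h4 := lintegral_add_left (μ := volume) hm1 F₂
          have h5 : ∫⁻ x, F₂ x = T * volume D := by
            rw [hF₂, lintegral_const_mul _ (measurable_one.indicator hDm),
              lintegral_indicator_one hDm]
          simp only [Pi.add_apply] at h2 h3 h4
          rw [h2, h3, h4, h5]
      _ ≤ ∫⁻ x : Ω, g x * S (enumTuple z (blowUp (fun i => (X n i : E d)) x)) ∂leb Ω +
          ε' + ε' + ε' := by
          rw [e1]
          exact add_le_add (add_le_add (add_le_add le_rfl hn) e2) e3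
      _ = _ := by rw [add_assoc, add_assoc, ← add_assoc ε', hε3]
  -- passing to the limit in `g (T - S)`, which is continuous and nonnegative
  let G : Ω × Enum d → ℝ≥0∞ := fun w => g w.1 * (T - S w.2)
  have hG : Continuous fun u : Enum d => (T : ℝ≥0∞) - S u :=
    (ENNReal.continuous_sub_left (ENNReal.natCast_ne_top T)).comp hScont
  have hGl : LowerSemicontinuous G := lowerSemicontinuous_mul (hgc.comp continuous_fst)
    (fun w => ((hg1 _).trans_lt ENNReal.one_lt_top).ne) (hG.comp continuous_snd).lowerSemicontinuous
  have hlsc := hκ G hGl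
  set Γ : ℝ≥0∞ := T * ∫⁻ x, g x ∂leb Ω with hΓ
  have hΓt : Γ ≠ ∞ := ENNReal.mul_ne_top (ENNReal.natCast_ne_top T) hgt
  have hgm := hgc.measurable
  have hsum : ∀ (b : Ω → ℝ≥0∞) (a : Ω → ℝ≥0∞), Measurable b → (∀ x, a x + b x = T) →
      ∫⁻ x, g x * a x ∂leb Ω + ∫⁻ x, g x * b x ∂leb Ω = Γ := fun b a hb hab => by
    have hgb : Measurable fun x => g x * b x := hgm.mul hb
    rw [← lintegral_add_right _ hgb, hΓ, ← lintegral_const_mul _ hgm]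
    refine lintegral_congr fun x => ?_
    rw [← mul_add, hab, mul_comm]
  have hlim : ∫⁻ x, ∫⁻ u, G (x, u) ∂κ x ∂leb Ω + ∫⁻ x, g x * (∫⁻ u, S u ∂κ x) ∂leb Ω = Γ := by
    have h1 : ∀ x, ∫⁻ u, G (x, u) ∂κ x = g x * ∫⁻ u, (T - S u) ∂κ x := fun x =>
      lintegral_const_mul (g x) hG.measurable
    simp_rw [h1]
    refine hsum _ _ hScont.measurable.lintegral_kernel fun x => ?_
    rw [← lintegral_add_right _ hScont.measurable]
    simp_rw [tsub_add_cancel_of_le (hST _)]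
    simp
  have hSle : ∫⁻ x, g x * (∫⁻ u, S u ∂κ x) ∂leb Ω ≤ ∫⁻ x, meanCount κ f x ∂leb Ω := by
    refine lintegral_mono fun x => (mul_le_of_le_one_left' (hg1 x)).trans ?_
    exact lintegral_mono fun u => ENNReal.sum_le_tsum _
  refine le_trans ?_ (add_le_add_left hSle _)
  have hR : ∫⁻ x, ∫⁻ u, G (x, u) ∂κ x ∂leb Ω ≤ Γ - (I - ε) := by
    refine hlsc.trans (liminf_le_of_frequently_le' (hlow.mono fun n hn => ?_).frequently)
    have h1 := hsum (fun x => S (enumTuple z (blowUp (fun i => (X n i : E d)) x)))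
      (fun x => T - S (enumTuple z (blowUp (fun i => (X n i : E d)) x)))
      (hScont.measurable.comp (hUm n)) fun x => tsub_add_cancel_of_le (hST _)
    refine ENNReal.le_sub_of_add_le_right (ne_top_of_le_ne_top hIt tsub_le_self) ?_
    rw [← h1]
    exact add_le_add le_rfl (tsub_le_iff_right.2 hn)
  have hΓI : I - ε ≤ Γ := by
    obtain ⟨n, hn⟩ := hlow.exists
    have h1 := hsum (fun x => S (enumTuple z (blowUp (fun i => (X n i : E d)) x)))
      (fun x => T - S (enumTuple z (blowUp (fun i => (X n i : E d)) x)))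
      (hScont.measurable.comp (hUm n)) fun x => tsub_add_cancel_of_le (hST _)
    rw [← h1]
    exact (tsub_le_iff_right.2 hn).trans le_add_self
  rw [← tsub_le_iff_right]
  have h2 : Γ ≤ (Γ - (I - ε)) + ∫⁻ x, g x * (∫⁻ u, S u ∂κ x) ∂leb Ω := by
    rw [← hlim] at hR ⊢
    exact add_le_add_left hR _
  have h3 : Γ - (I - ε) + (I - ε) ≤ (Γ - (I - ε)) + ∫⁻ x, g x * (∫⁻ u, S u ∂κ x) ∂leb Ω := by
    rwa [tsub_add_cancel_of_le hΓI]
  exact (ENNReal.add_le_add_iff_left (ne_top_of_le_ne_top hΓt tsub_le_self)).1 h3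

end


section

variable {Ω : Set (E d)}

/-- The limit is stationary, and its intensity is a probability density whose potential energy is
at most the potential energy per particle. -/
theorem IsYoungLimit.exists_intensity (hd : 1 ≤ d) (hΩ : IsClosed Ω) (hΩ0 : Nonempty Ω)
    (hfr : volume (frontier Ω) = 0) {z : Site d} (hz : z ∉ range (site : E d → Site d))
    {M : ℕ → ℕ} (hM : ∀ n, 1 ≤ M n) (hMt : Tendsto M atTop atTop) {X : ∀ n, Fin (M n) → Ω}
    {κ : Kernel Ω (Enum d)} [IsMarkovKernel κ]
    (hκ : IsYoungLimit (fun n (x : Ω) => enumTuple z (blowUp (fun i => (X n i : E d)) x)) κ)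
    {V : Ω → ℝ} (hV : Continuous V) (hconf : Confining V) {s : ℝ} (hs : 0 ≤ s) {B : ℝ≥0∞}
    (hB : B ≠ ∞)
    (hXB : ∀ n, ((M n : ℝ≥0∞) ^ (1 + s / d))⁻¹ * rieszEnergy s (fun i => (X n i : E d)) ≤ B)
    (hVB : ∀ n, (M n : ℝ≥0∞)⁻¹ * ∑ i, ENNReal.ofReal (V (X n i)) ≤ B) :
    ∃ m : Ω → ℝ≥0∞, Measurable m ∧ ∫⁻ x, m x ∂leb Ω = 1 ∧
      (∀ᵐ x ∂leb Ω, m x ≠ ∞ ∧ IsStationary (κ.map Enum.toConfig x) ∧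
        ∀ f : E d → ℝ≥0∞, Measurable f →
          ∫⁻ C, (∫⁻ p, f p ∂C.toMeasure) ∂(κ.map Enum.toConfig x) = m x * ∫⁻ p, f p) ∧
      ∫⁻ x, ENNReal.ofReal (V x) * m x ∂leb Ω ≤
        liminf (fun n => (M n : ℝ≥0∞)⁻¹ * ∑ i, ENNReal.ofReal (V (X n i))) atTop := by
  have hMarkov : IsMarkovKernel (κ.map Enum.toConfig) :=
    Kernel.IsMarkovKernel.map κ Enum.measurable_toConfig
  have hstat := (hκ.tendstoWeakly hd hΩ hz hs hM X hB hXB).ae_isStationary hd hΩ hfr hMt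
  -- the intensity is the mean number of points in the unit ball divided by its volume
  set o : E d → ℝ≥0∞ := (Metric.ball (0 : E d) 1).indicator fun _ => 1 with ho
  have hom : Measurable o := measurable_const.indicator measurableSet_ball
  have hoint : ∫⁻ p, o p = volume (Metric.ball (0 : E d) 1) := by
    rw [ho, lintegral_indicator_const measurableSet_ball, one_mul]
  have ho0 : volume (Metric.ball (0 : E d) 1) ≠ 0 := (Metric.measure_ball_pos _ _ one_pos).ne'
  have hot : volume (Metric.ball (0 : E d) 1) ≠ ∞ := measure_ball_lt_top.ne
  set m : Ω → ℝ≥0∞ := fun x => meanCount κ o x / volume (Metric.ball (0 : E d) 1) with hm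
  have hmm : Measurable m := (measurable_meanCount hom).div_const _
  have hmo : ∀ x, meanCount κ o x = m x * volume (Metric.ball (0 : E d) 1) := fun x => by
    rw [hm, ENNReal.div_mul_cancel ho0 hot]
  have hae : ∀ᵐ x ∂leb Ω, (∀ᵐ u ∂κ x, u ∈ Enum.LocFin) ∧
      m x ≠ ∞ ∧ IsStationary (κ.map Enum.toConfig x) ∧
        ∀ f : E d → ℝ≥0∞, Measurable f →
          ∫⁻ C, (∫⁻ p, f p ∂C.toMeasure) ∂(κ.map Enum.toConfig x) = m x * ∫⁻ p, f p := by
    filter_upwards [hstat, ae_mem_locFin hd hz hM hκ hΩ.measurableSet] with x hx ⟨hfin, hloc⟩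
    have hN : ∀ n : ℕ, ∫⁻ C, C.toMeasure (cube d n) ∂(κ.map Enum.toConfig x) < ∞ := fun n => by
      refine lt_of_le_of_lt ?_ (hfin (√d * (n / 2) + 1))
      rw [← lintegral_map_toConfig hd hloc (measurable_const.indicator measurableSet_ball)]
      refine lintegral_mono fun C => ?_
      rw [lintegral_indicator_const measurableSet_ball, one_mul]
      exact measure_mono ((cube_subset_closedBall n.cast_nonneg).trans
        (Metric.closedBall_subset_ball (lt_add_one _)))
    obtain ⟨m', hm't, hm'⟩ := hx.exists_lintegral_eq hd hN
    have h1 : m x = m' := by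
      rw [hm]
      dsimp only
      rw [← lintegral_map_toConfig hd hloc hom, hm' o hom, hoint, ENNReal.mul_div_cancel_right ho0 hot]
    exact ⟨hloc, h1 ▸ hm't, hx, fun f hf => by rw [hm' f hf, h1]⟩
  refine ⟨m, hmm, ?_, hae.mono fun x hx => hx.2, ?_⟩
  · -- the mass is tested with a continuous function
    set b : E d → ℝ≥0∞ := fun p => ENNReal.ofReal (Config.bump 0 p) with hb
    have hbc : Continuous b := ENNReal.continuous_ofReal.comp (Config.continuous_bump 0)
    have hb1 : ∀ p, b p ≤ (Metric.closedBall 0 1).indicator 1 p := fun p => by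
      by_cases h : p ∈ Metric.closedBall (0 : E d) 1
      · rw [indicator_of_mem h]
        exact ENNReal.ofReal_le_one.2 (Config.bump_le_one _ _)
      · rw [indicator_of_notMem h, hb]
        simp only [mem_closedBall_zero_iff, not_le] at h
        simp only
        rw [Config.bump_eq_zero (by linarith), ENNReal.ofReal_zero]
    have hbs : HasCompactSupport b := (Config.hasCompactSupport_bump 0).mono fun p hp hp' =>
      hp (by simp [hb, hp'])
    have hbt : ∫⁻ p, b p ≠ ∞ := ((Config.continuous_bump 0).integrable_of_hasCompactSupport
      (Config.hasCompactSupport_bump (d := d) 0)).lintegral_lt_top.ne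
    have hb0 : ∫⁻ p, b p ≠ 0 := by
      rw [← pos_iff_ne_zero, lintegral_pos_iff_support hbc.measurable]
      refine (hbc.isOpen_support).measure_pos _ ⟨0, ?_⟩
      simp [hb, Config.bump_eq_one (d := d) (R := 0) (x := 0) (by simp)]
    have h1 : ∫⁻ x, meanCount κ b x ∂leb Ω = ∫⁻ p, b p := le_antisymm
      (lintegral_meanCount_le hd hz hM hκ hΩ.measurableSet hbc.lowerSemicontinuous)
      (le_lintegral_meanCount hd hz hM hκ hΩ hMt hconf hs hB hXB hVB hbc hbs one_pos hb1)
    have h2 : ∫⁻ x, meanCount κ b x ∂leb Ω = (∫⁻ x, m x ∂leb Ω) * ∫⁻ p, b p := by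
      rw [← lintegral_mul_const _ hmm]
      refine lintegral_congr_ae (hae.mono fun x hx => ?_)
      simp only
      rw [← hx.2.2.2 b hbc.measurable, lintegral_map_toConfig hd hx.1 hbc.measurable]
    rw [h1] at h2
    exact (ENNReal.mul_left_inj hb0 hbt).1 (by rw [← h2, one_mul])
  · have h1 := lintegral_mul_meanCount_le hd hz hM hκ hΩ.measurableSet hΩ0 hMt hV le_rfl
      (lowerSemicontinuous_indicator_ball 1) (r := 1) (fun p hp => by
        by_contra h
        exact hp (indicator_of_notMem (fun h' => h (mem_ball_zero_iff.1 h').le) _))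
      (hoint.trans_ne ho0) (hoint.trans_ne hot)
    rw [show ∫⁻ p, (Metric.ball (0 : E d) 1).indicator (fun _ => (1 : ℝ≥0∞)) p =
      volume (Metric.ball (0 : E d) 1) from hoint] at h1
    simp_rw [← ho, hmo, ← mul_assoc] at h1
    have hVm : Measurable fun x => ENNReal.ofReal (V x) * m x :=
      hV.measurable.ennreal_ofReal.mul hmm
    rw [lintegral_mul_const _ hVm] at h1
    exact (ENNReal.mul_le_mul_iff_left ho0 hot).1 h1

end

/-! ### Comparison with the macroscopic energy -/

section

variable {Ω : Set (E d)}

lemma liminf_add_liminf_le (u v : ℕ → ℝ≥0∞) :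
    liminf u atTop + liminf v atTop ≤ liminf (fun n => u n + v n) atTop := by
  have h : ∀ w : ℕ → ℝ≥0∞, Monotone fun n => ⨅ i, ⨅ _ : i ≥ n, w i := fun w n k hnk =>
    le_iInf₂ fun i hi => iInf₂_le i (hnk.trans hi)
  simp only [liminf_eq_iSup_iInf_of_nat]
  rw [ENNReal.iSup_add_iSup_of_monotone (h u) (h v)]
  exact iSup_mono fun n => le_iInf₂ fun i hi => add_le_add (iInf₂_le i hi) (iInf₂_le i hi)

lemma measurable_processEnergy_kernel (hd : 1 ≤ d) (s : ℝ) (η : Kernel Ω (Config d)) :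
    Measurable fun x => processEnergy s (η x) := by
  simp_rw [processEnergy_eq]
  exact Measurable.liminf fun n =>
    ((Config.measurable_interaction hd s (measurableSet_cube n)).lintegral_kernel).div_const _

lemma measurable_intensity_kernel (hd : 1 ≤ d) (η : Kernel Ω (Config d)) :
    Measurable fun x => intensity (η x) :=
  (Config.measurable_dens hd).lintegral_kernel

lemma TaggedProcess.potentialEnergy_eq (hd : 1 ≤ d) {V : Ω → ℝ} (hV : Continuous V)
    (P : TaggedProcess Ω) : P.potentialEnergy V =
      ∫⁻ x, ENNReal.ofReal (V x) * intensity (P.fiber x) ∂leb Ω := by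
  rw [TaggedProcess.potentialEnergy, TaggedProcess.intensityMeasure,
    lintegral_withDensity_eq_lintegral_mul _ (measurable_intensity_kernel hd _)
      hV.measurable.ennreal_ofReal]
  exact lintegral_congr fun x => mul_comm _ _

/-- The energy of a tagged process is at least the macroscopic energy of its intensity. -/
lemma TaggedProcess.macroEnergy_intensity_le (hd : 1 ≤ d) {s : ℝ} (hs : 0 < s) {V : Ω → ℝ}
    (hV : Continuous V) (P : TaggedProcess Ω) :
    macroEnergy s V (fun x => intensity (P.fiber x)) ≤ P.energy s + P.potentialEnergy V := by
  have := P.isMarkov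
  rw [macroEnergy, P.potentialEnergy_eq hd hV,
    ← lintegral_const_mul _ ((measurable_intensity_kernel hd _).pow_const _)]
  gcongr
  refine lintegral_mono fun x => le_trans ?_ (mul_intensity_rpow_le_processEnergy hd hs (P.fiber x))
  gcongr
  exact intensity_le_liminf hd _

lemma lintegral_toMeasure_cube {P : Measure (Config d)} {m : ℝ≥0∞}
    (h : ∀ f : E d → ℝ≥0∞, Measurable f →
      ∫⁻ C, (∫⁻ p, f p ∂C.toMeasure) ∂P = m * ∫⁻ p, f p) (n : ℕ) :
    ∫⁻ C, C.toMeasure (cube d n) ∂P = m * ENNReal.ofReal ((n : ℝ) ^ d) := by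
  have h1 := h ((cube d n).indicator 1) (measurable_one.indicator (measurableSet_cube _))
  simp_rw [lintegral_indicator_one (measurableSet_cube (d := d) (n : ℝ))] at h1
  rw [h1, volume_cube n.cast_nonneg]

lemma mul_rpow_le_processEnergy (hd : 1 ≤ d) {s : ℝ} (hs : 0 < s) {P : Measure (Config d)}
    [IsProbabilityMeasure P] {m : ℝ≥0∞}
    (h : ∀ n : ℕ, ∫⁻ C, C.toMeasure (cube d n) ∂P = m * ENNReal.ofReal ((n : ℝ) ^ d)) :
    rieszConstant s d * m ^ (1 + s / d) ≤ processEnergy s P := by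
  refine le_trans (le_of_eq ?_) (mul_intensity_rpow_le_processEnergy hd hs P)
  congr 2
  refine (Tendsto.liminf_eq (tendsto_const_nhds.congr' ?_)).symm
  filter_upwards [eventually_ge_atTop 1] with n hn
  have hn0 : 0 < (n : ℝ) ^ d := by
    have : (0 : ℝ) < n := by exact_mod_cast hn
    positivity
  rw [h, ENNReal.mul_div_cancel_right (ENNReal.ofReal_pos.2 hn0).ne' ENNReal.ofReal_ne_top]

/-- The Hamiltonian per particle is the sum of the energy and of the potential per particle. -/
lemma inv_mul_hamiltonian_eq {s : ℝ} {V : Ω → ℝ} (hV0 : ∀ x, 0 ≤ V x) {N : ℕ}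
    (hN : 1 ≤ N) (X : Fin N → Ω) : ((N : ℝ≥0∞) ^ (1 + s / d))⁻¹ * hamiltonian s V X =
      ((N : ℝ≥0∞) ^ (1 + s / d))⁻¹ * rieszEnergy s (fun i => (X i : E d)) +
        (N : ℝ≥0∞)⁻¹ * ∑ i, ENNReal.ofReal (V (X i)) := by
  have hN0 : (N : ℝ≥0∞) ≠ 0 := by exact_mod_cast (by omega : N ≠ 0)
  have hNt : (N : ℝ≥0∞) ≠ ∞ := ENNReal.natCast_ne_top N
  have hNpos : (0 : ℝ) < N := by exact_mod_cast hN
  rw [hamiltonian, mul_add]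
  congr 1
  rw [ENNReal.ofReal_mul (by positivity), ENNReal.ofReal_sum_of_nonneg fun i _ => hV0 _,
    ← ENNReal.ofReal_rpow_of_pos hNpos, ENNReal.ofReal_natCast, ← mul_assoc]
  congr 1
  rw [← ENNReal.rpow_neg, ← ENNReal.rpow_add _ _ hN0 hNt, ← ENNReal.rpow_neg_one]
  congr 1
  ring

end

end HyperRiesz

end

theorem mainTheorem4 (d : ℕ) (hd : 1 ≤ d) (s : ℝ) (hs : (d : ℝ) < s)
    (Ω : Set (E d)) (hΩ_closed : IsClosed Ω) (hΩ_pos : 0 < volume Ω)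
    (hΩ_bdry : HasC1Boundary Ω)
    (V : Ω → ℝ) (hV_cont : Continuous V) (hV_nonneg : ∀ x, 0 ≤ V x) (hV_conf : Confining V)
    (X : ∀ N : ℕ, Fin N → Ω)
    (hX : ∀ N : ℕ, 1 ≤ N → ∀ Y : Fin N → Ω, hamiltonian s V (X N) ≤ hamiltonian s V Y) :
    ∃ ρ : Ω → ℝ≥0∞,
      -- `ρ` is (the density of) `μ_{V,∞}`, the unique minimizer of the macroscopic energy
      IsMacroMinimizer s V ρ ∧
      (∀ ρ' : Ω → ℝ≥0∞, IsMacroMinimizer s V ρ' → ρ' =ᵐ[leb Ω] ρ) ∧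
      ∃ (φ : ℕ → ℕ) (P : TaggedProcess Ω),
        StrictMono φ ∧
        -- convergence along a subsequence to a minimizer of the energy
        TendstoWeakly (fun n => taggedEmpirical (X (φ n))) P.toMeasure ∧
        P.StationaryUnit ∧
        (∀ Q : TaggedProcess Ω, Q.StationaryUnit →
          P.energy s + P.potentialEnergy V ≤ Q.energy s + Q.potentialEnergy V) ∧
        -- the intensity measure is `μ_{V,∞}`
        P.intensityMeasure = (leb Ω).withDensity ρ ∧
        -- almost every configuration minimizes the energy at its own density
        (∀ᵐ z ∂P.toMeasure, z.2.dens = ρ z.1 ∧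
          ∀ C : Config d, C.dens = ρ z.1 → z.2.energy s ≤ C.energy s) := by
  have hd0 : (0 : ℝ) < d := by exact_mod_cast hd
  have hs0 : 0 < s := hd0.trans hs
  have hfr := hΩ_bdry.volume_frontier
  have hΩm := hΩ_closed.measurableSet
  have hΩ0 : Nonempty Ω := by
    obtain ⟨x, hx⟩ := nonempty_of_measure_ne_zero hΩ_pos.ne'
    exact ⟨⟨x, hx⟩⟩
  have hσ := sigmaFinite_leb hΩm
  obtain ⟨ρ, hρ, hρ_unique, -, ⟨k₀, hk₀⟩, hρ_fin⟩ :=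
    exists_macroMinimizer hd hs hΩm hΩ_pos hV_cont hV_nonneg hV_conf
  refine ⟨ρ, hρ, hρ_unique, ?_⟩
  set e : ℕ → ℝ≥0∞ := fun N =>
    ((N : ℝ≥0∞) ^ (1 + s / d))⁻¹ * rieszEnergy s (fun i => (X N i : E d)) with he
  set v : ℕ → ℝ≥0∞ := fun N => (N : ℝ≥0∞)⁻¹ * ∑ i, ENNReal.ofReal (V (X N i)) with hv
  -- the trial configurations bound the energy per particle of the minimizers
  have hupper : ∀ c : ℝ, macroEnergy s V ρ < ENNReal.ofReal c →
      ∀ᶠ N in atTop, e N + v N ≤ ENNReal.ofReal c := fun c hc => by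
    filter_upwards [eventually_exists_hamiltonian_le hd hs hΩ_closed hfr hV_cont hV_nonneg hρ.1
      hk₀ hc, eventually_ge_atTop 1] with N ⟨Y, hY⟩ hN
    have hNpos : (0 : ℝ) < N := by exact_mod_cast hN
    have hN0 : (N : ℝ≥0∞) ^ (1 + s / d) ≠ 0 :=
      (ENNReal.rpow_pos (by exact_mod_cast hN) (ENNReal.natCast_ne_top N)).ne'
    have hNt : (N : ℝ≥0∞) ^ (1 + s / d) ≠ ∞ :=
      ENNReal.rpow_ne_top_of_nonneg (by positivity) (ENNReal.natCast_ne_top N)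
    rw [he, hv]
    dsimp only
    rw [← inv_mul_hamiltonian_eq hV_nonneg hN]
    refine (mul_le_mul_right ((hX N hN Y).trans hY) _).trans (le_of_eq ?_)
    rw [ENNReal.ofReal_mul' (by positivity), ← ENNReal.ofReal_rpow_of_pos hNpos,
      ENNReal.ofReal_natCast, mul_comm, mul_assoc, ENNReal.mul_inv_cancel hN0 hNt, mul_one]
  obtain ⟨c₀, hc₀⟩ : ∃ c : ℝ, macroEnergy s V ρ < ENNReal.ofReal c :=
    ⟨(macroEnergy s V ρ).toReal + 1, (ENNReal.lt_ofReal_iff_toReal_lt hρ_fin).2 (lt_add_one _)⟩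
  obtain ⟨N₀, hN₀⟩ := eventually_atTop.1 ((hupper c₀ hc₀).and (eventually_ge_atTop 1))
  obtain ⟨z, hz⟩ := exists_notMem_range_site hd
  obtain ⟨φ₀, hφ₀, κ, hκ_markov, hκ⟩ := exists_youngMeasure hΩ_closed hΩ_pos
    (U := fun n (x : Ω) => enumTuple z (blowUp (fun i => (X (n + N₀) i : E d)) x))
    fun n => (measurable_enumTuple_blowUp z _).comp measurable_subtype_coe
  set M : ℕ → ℕ := fun n => φ₀ n + N₀ with hM
  have hM_mono : StrictMono M := hφ₀.add_const N₀
  have hMt : Tendsto M atTop atTop := hM_mono.tendsto_atTop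
  have hM1 : ∀ n, 1 ≤ M n := fun n => (hN₀ (M n) (Nat.le_add_left _ _)).2
  have hevB : ∀ n, e (M n) + v (M n) ≤ ENNReal.ofReal c₀ := fun n =>
    (hN₀ (M n) (Nat.le_add_left _ _)).1
  have heB : ∀ n, e (M n) ≤ ENNReal.ofReal c₀ := fun n => le_self_add.trans (hevB n)
  have hvB : ∀ n, v (M n) ≤ ENNReal.ofReal c₀ := fun n => le_add_self.trans (hevB n)
  have hYoung : IsYoungLimit
      (fun n (x : Ω) => enumTuple z (blowUp (fun i => (X (M n) i : E d)) x)) κ := hκ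
  have hη_markov : IsMarkovKernel (κ.map Enum.toConfig) :=
    Kernel.IsMarkovKernel.map κ Enum.measurable_toConfig
  set η : Kernel Ω (Config d) := κ.map Enum.toConfig with hη
  have hweak := hYoung.tendstoWeakly hd hΩ_closed hz hs0.le hM1 (fun n => X (M n))
    ENNReal.ofReal_ne_top heB
  obtain ⟨m, hm, hm1, hm_ae, hm_pot⟩ := hYoung.exists_intensity hd hΩ_closed hΩ0 hfr hz hM1 hMt
    hV_cont hV_conf hs0.le ENNReal.ofReal_ne_top heB hvB
  have hLe : liminf (fun n => e (M n)) atTop ≠ ∞ := ne_top_of_le_ne_top ENNReal.ofReal_ne_top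
    (liminf_le_of_frequently_le' (Frequently.of_forall heB))
  have hm_energy : ∫⁻ x, processEnergy s (η x) ∂leb Ω ≤ liminf (fun n => e (M n)) atTop :=
    lintegral_processEnergy_le hd hz hM1 hYoung hΩm hLe le_rfl
  have hliminf : liminf (fun n => e (M n)) atTop + liminf (fun n => v (M n)) atTop ≤
      macroEnergy s V ρ := by
    refine (liminf_add_liminf_le _ _).trans (le_of_forall_gt fun c hc => ?_)
    obtain ⟨c', hc', hc'c⟩ := exists_between hc
    have hc't : c' ≠ ∞ := (hc'c.trans_le le_top).ne
    have h := hupper c'.toReal (by rwa [ENNReal.ofReal_toReal hc't])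
    rw [ENNReal.ofReal_toReal hc't] at h
    exact (liminf_le_of_frequently_le' (hMt.eventually h).frequently).trans_lt hc'c
  -- lower bound of the energy of the limit by the macroscopic energy of its intensity
  have hcube : ∀ᵐ x ∂leb Ω, ∀ n : ℕ, ∫⁻ C, C.toMeasure (cube d n) ∂η x =
      m x * ENNReal.ofReal ((n : ℝ) ^ d) :=
    hm_ae.mono fun x hx n => lintegral_toMeasure_cube hx.2.2 n
  have hpoint : ∀ᵐ x ∂leb Ω, rieszConstant s d * m x ^ (1 + s / d) ≤ processEnergy s (η x) :=
    hcube.mono fun x hx => mul_rpow_le_processEnergy hd hs0 hx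
  have hm_prob : IsProbDensity m := ⟨hm, hm1⟩
  have hmp : Measurable fun x => m x ^ (1 + s / d) := hm.pow_const _
  have hmacro_le : macroEnergy s V m ≤ ∫⁻ x, processEnergy s (η x) ∂leb Ω +
      ∫⁻ x, ENNReal.ofReal (V x) * m x ∂leb Ω := by
    rw [macroEnergy, ← lintegral_const_mul _ hmp]
    gcongr ?_ + _
    exact lintegral_mono_ae hpoint
  have hle_rho : ∫⁻ x, processEnergy s (η x) ∂leb Ω +
      ∫⁻ x, ENNReal.ofReal (V x) * m x ∂leb Ω ≤ macroEnergy s V ρ :=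
    (add_le_add hm_energy hm_pot).trans hliminf
  -- all the inequalities above are equalities
  have hm_min : IsMacroMinimizer s V m :=
    ⟨hm_prob, fun ρ' hρ' => (hmacro_le.trans hle_rho).trans (hρ.2 ρ' hρ')⟩
  have hmρ := hρ_unique m hm_min
  have hmacro_eq : macroEnergy s V m = macroEnergy s V ρ :=
    le_antisymm (hm_min.2 ρ hρ.1) (hρ.2 m hm_prob)
  have hpot_fin : ∫⁻ x, ENNReal.ofReal (V x) * m x ∂leb Ω ≠ ∞ :=
    ne_top_of_le_ne_top (hmacro_eq ▸ hρ_fin) le_add_self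
  have hint_fin : rieszConstant s d * ∫⁻ x, m x ^ (1 + s / d) ∂leb Ω ≠ ∞ :=
    ne_top_of_le_ne_top (hmacro_eq ▸ hρ_fin) le_self_add
  have hint_le : ∫⁻ x, processEnergy s (η x) ∂leb Ω ≤
      rieszConstant s d * ∫⁻ x, m x ^ (1 + s / d) ∂leb Ω := by
    have h := hle_rho.trans hmacro_eq.ge
    rw [macroEnergy] at h
    exact (ENNReal.add_le_add_iff_right hpot_fin).1 h
  rw [← lintegral_const_mul _ hmp] at hint_fin hint_le
  have hpe := ae_eq_of_ae_le_of_lintegral_le hpoint hint_fin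
    (measurable_processEnergy_kernel hd s η).aemeasurable hint_le
  have hconfig : ∀ᵐ x ∂leb Ω, ∀ᵐ C : Config d ∂η x, C.dens = m x ∧
      C.energy s = rieszConstant s d * m x ^ (1 + s / d) := by
    filter_upwards [hm_ae, hcube, hpe] with x hx hxc hxe
    lift m x to ℝ≥0 using hx.1 with t ht
    exact hx.2.1.ae_dens_eq_and_energy_eq hd hs hxc hxe.ge
  have hintensity : ∀ᵐ x ∂leb Ω, intensity (η x) = m x := by
    filter_upwards [hconfig] with x hx
    rw [intensity, lintegral_congr_ae (hx.mono fun C hC => hC.1), lintegral_const, measure_univ,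
      mul_one]
  refine ⟨M, ⟨η, hη_markov⟩, hM_mono, hweak, ⟨hm_ae.mono fun x hx => hx.2.1, ?_⟩,
    fun Q hQ => ?_, ?_, ?_⟩
  · exact (lintegral_congr_ae hintensity).trans hm1
  · have h1 : ∫⁻ x, ENNReal.ofReal (V x) * intensity (η x) ∂leb Ω =
        ∫⁻ x, ENNReal.ofReal (V x) * m x ∂leb Ω :=
      lintegral_congr_ae (hintensity.mono fun x hx => by simp only [hx])
    rw [TaggedProcess.potentialEnergy_eq hd hV_cont ⟨η, hη_markov⟩, TaggedProcess.energy, h1]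
    refine (hle_rho.trans (hρ.2 (fun x => intensity (Q.fiber x))
      ⟨measurable_intensity_kernel hd _, hQ.2⟩)).trans ?_
    exact Q.macroEnergy_intensity_le hd hs0 hV_cont
  · exact withDensity_congr_ae (EventuallyEq.trans hintensity hmρ)
  · have h1 : ∀ᵐ w ∂(leb Ω ⊗ₘ η), w.2.dens = ρ w.1 ∧
        w.2.energy s = rieszConstant s d * ρ w.1 ^ (1 + s / d) := by
      refine Measure.ae_compProd_of_ae_ae ?_ ?_
      · exact (measurableSet_eq_fun ((Config.measurable_dens hd).comp measurable_snd)
          (hρ.1.1.comp measurable_fst)).inter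
          (measurableSet_eq_fun ((Config.measurable_energy hd s).comp measurable_snd)
            (((hρ.1.1.pow_const _).const_mul _).comp measurable_fst))
      · filter_upwards [hconfig, hmρ] with x hx hxρ
        rw [← hxρ]
        exact hx
    filter_upwards [show ∀ᵐ w ∂(leb Ω ⊗ₘ η), _ from h1] with w hw
    refine ⟨hw.1, fun C hC => ?_⟩
    rw [hw.2, ← hC]
    exact C.mul_dens_rpow_le_energy hd hs0
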